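/- **Setting.** A plane link diagram, considered up to plane isotopy, is presented in sliced form: it is cut by horizontal lines into slices, each of which contains, besides vertical strands, nothing, one cup $\cup$, one cap $\cap$ or one crossing $\sigma_i^{\pm}$ of the strands in positions $i,i+1$ (counted from the left; slices are read upwards; the over-strand runs from bottom left to top right in $\sigma_i^+$ and from bottom right to top left in $\sigma_i^-$). The $0$-resolution of $\sigma_i^+$ and the $1$-resolution of $\sigma_i^-$ are vertical, the other ones consist of a cap below a cup. For a vertex $v\in\{0,1\}^k$ of the cube of resolutions of a diagram $L$ with $k$ crossings, $D_v$ denotes the resulting union of circles and $|v|$ the number of $1$'s. *Lee's complex.* Let $V=\mathbf Q v_+\oplus\mathbf Q v_-$, and let $CKh'(L)=\bigoplus_v V^{\otimes\{\text{circles of }D_v\}}$ with the differential $d'=\sum_e\pm\mathcal A'(S_e)$, where $\mathcal A'(S_e)$ merges two circles by $m'(v_\pm\otimes v_\pm)=v_+$, $m'(v_\pm\otimes v_\mp)=v_-$ or splits a circle by $\Delta'(v_+)=v_+\otimes v_-+v_-\otimes v_+$, $\Delta'(v_-)=v_-\otimes v_-+v_+\otimes v_+$. The sign of an edge that changes the crossing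 $l$ is $(-1)^m$, where $m$ is the number of $1$-resolved crossings that precede $l$ in a chosen enumeration of the crossings; the crossings that are not involved in a move are enumerated in the same order before and after it, and, except in the case of $\rho_1'$ itself, come after those that are involved. The homology is $Kh'(L)$. For a link oriented by $w$, $\mathrm{gr}=|v|-n_-$ with $n_-$ the number of negative crossings. *Canonical generators.* Put $\mathbf a=v_-+v_+$, $\mathbf b=v_--v_+$. For an orientation $o$ of $L$ (an orientation of every component), let $D_o$ be the oriented resolution. Label a circle $C$ of $D_o$ by $\mathbf a$ if the number of circles of $D_o$ separating $C$ from infinity (the number of intersections of a ray from $C$ to infinity with the other circles), plus $1$ if $C$ is oriented counterclockwise, is even, and by $\mathbf b$ otherwise. The tensor product of the labels is $\mathfrak s_o\in CKh'(L)$. *Moves and maps.* Let $L$ and $\tilde L$ agree except in the following consecutive slices (written from bottom to top; $1$ is an empty slice). Coordinates of vertices that belong to other crossings are denoted by $*$. A map $\iota$ adds the label $v_+$ on a new small circle. 1. *Left-hand curl:* $(1,\cap_i)\to(\sigma_i^-,\cap_i)$. The $0$-resolution of the new crossing splits off a small circle, and $\rho_1':CKh'(L)\to CKh'(\tilde L(*0))$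 is given by $v_-\mapsto v_-\otimes v_--v_+\otimes v_+$, $v_+\mapsto v_+\otimes v_--v_-\otimes v_+$, where the first factor labels the circle through the strand on which the curl is added and the second factor the small circle. 2. *Second move:* $(1,1)\to(\sigma_i^{\pm},\sigma_i^{\mp})$. Number the crossing $\sigma_i^+$ first and $\sigma_i^-$ second; then $\tilde L(*01)=L$, and $\rho_2'(z)=(-1)^{\mathrm{gr}(z)}(z+\iota(d'_{01\to11}(z)))$ with $\iota:CKh'(\tilde L(*11))\to CKh'(\tilde L(*10))$ and $d'_{01\to11}$ the sum of the maps $\mathcal A'(S_e)$ without signs. 3. *Third move:* $L=(\sigma_i^-,\sigma_{i+1}^-,\sigma_i^-)\to\tilde L=(\sigma_{i+1}^-,\sigma_i^-,\sigma_{i+1}^-)$. The crossings on the lowest strand are numbered $1$, $2$ in the order from bottom left to top right, and the crossing of the two upper strands is number $3$; the corresponding crossings have the same places in the enumerations for $L$ and $\tilde L$. Then $L(*100)=\tilde L(*010)$ and $L(*1)=\tilde L(*1)$. With $\beta'=\iota\circ d'_{100\to110}:CKh'(L(*100))\to CKh'(L(*010))$ and $\tilde\beta'=\iota\circ d'_{010\to110}:CKh'(\tilde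 L(*010))\to CKh'(\tilde L(*100))$ (again without signs), let $X_1=\{x+\beta'(x)+y\mid x\in CKh'(L(*100)),\,y\in CKh'(L(*1))\}$ and $\rho_3'(x+\beta'(x)+y)=x+\tilde\beta'(x)+y$ on $X_1$. 4. *Right-hand curl:* $L=(1,1,\cap_i)\to\tilde L=(\sigma_i^+,1,\cap_i)$. Let $M=(\sigma_i^+,\sigma_i^-,\cap_i)$, which is obtained from $L$ by a second move and from $\tilde L$ by adding a left-hand curl. **Proposition.** The maps $\rho_1'$ and $\rho_2'$ are chain maps. In case 4 the map $\rho_{1*}':Kh'(\tilde L)\to Kh'(M)$ is bijective, and one defines $\rho_{1'*}'=(\rho_{1*}')^{-1}\circ\rho_{2*}':Kh'(L)\to Kh'(\tilde L)$. In case 3, $X_1$ is a subcomplex whose inclusion into $CKh'(L)$ induces a bijection $H(X_1)\to Kh'(L)$ and $\rho_3'$ is a chain map on $X_1$; the composition of the inverse of this bijection with the map induced by $\rho_3'$ is denoted by $\rho_{3*}':Kh'(L)\to Kh'(\tilde L)$. Let $L$ and $\tilde L$ be related by one of these Reidemeister moves and let $\rho_*:Kh'(L)\to Kh'(\tilde L)$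 be the corresponding map $\rho_{1*}'$, $\rho_{1'*}'$, $\rho_{2*}'$ or $\rho_{3*}'$. Then every orientation $o$ on $L$ induces a unique orientation $\tilde o$ on $\tilde L$ that agrees with $o$ outside of the move; $\mathfrak s_o$ and $\mathfrak s_{\tilde o}$ are cycles; and $\rho_*([\mathfrak s_o])=c\,[\mathfrak s_{\tilde o}]$ for some nonzero $c\in\mathbf Q$. -/

import Mathlib

/-!
# Lee homology of link diagrams in sliced form

A link diagram in the plane is cut by horizontal lines into elementary slices, each of which
contains a single cup, cap or crossing (or nothing) besides vertical strands.  Slices are read from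
bottom to top, the strands at each level are numbered `0, 1, 2, ...` from left to right.
-/

namespace LeeKh

/-! ## Slices -/

/-- Elementary slices.
* `id`: vertical strands only;
* `cup i`: a new arc `∪` is born, its two ends have positions `i`, `i + 1` on the upper level;
* `cap i`: the strands at positions `i`, `i + 1` of the lower level are closed off by an arc `∩`;
* `cross i pos`: the strands at positions `i`, `i + 1` cross.  The over-strand is the one running
  from bottom left to top right if `pos = true`, and the one running from bottom right to top left
  if `pos = false`. -/
inductive Slice
  | id
  | cup (i : ℕ)
  | cap (i : ℕ)
  | cross (i : ℕ) (pos : Bool)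

/-- `σ.Fits m n`: the slice `σ` can be inserted between a level with `m` strands (below) and a
level with `n` strands (above). -/
def Slice.Fits : Slice → ℕ → ℕ → Prop
  | .id, m, n => n = m
  | .cup i, m, n => i ≤ m ∧ n = m + 2
  | .cap i, m, n => i + 2 ≤ m ∧ m = n + 2
  | .cross i _, m, n => i + 2 ≤ m ∧ n = m

def Slice.IsCross (σ : Slice) : Prop := ∃ i pos, σ = .cross i pos

/-- The left position of a crossing (`0` by convention for other slices). -/
def Slice.pos : Slice → ℕ
  | .cross i _ => i
  | _ => 0

/-- `true` iff the slice is a crossing whose over-strand runs from bottom left to top right. -/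
def Slice.isPos : Slice → Bool
  | .cross _ p => p
  | _ => false

theorem Slice.IsCross.lt {σ : Slice} (h : σ.IsCross) {m n : ℕ} (hf : σ.Fits m n) :
    σ.pos + 1 < m ∧ σ.pos + 1 < n := by
  obtain ⟨i, p, rfl⟩ := h
  obtain ⟨h1, h2⟩ : i + 2 ≤ m ∧ n = m := hf
  simp only [Slice.pos]
  omega

/-- The plane curves (without over/under information) in a slice: as before, where `swap i` is the
projection of a crossing and `turn i` consists of a cap `∩` joining the strands `i`, `i + 1` of the
lower level and of a cup `∪` joining the strands `i`, `i + 1` of the upper level. -/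
inductive Shape
  | id
  | cup (i : ℕ)
  | cap (i : ℕ)
  | swap (i : ℕ)
  | turn (i : ℕ)

/-- The ends of the arcs in a slice: `bot j`, the `j`-th point of the level below the slice, and
`top j`, the `j`-th point of the level above it. -/
inductive SliceEnd
  | bot (j : ℕ)
  | top (j : ℕ)

open SliceEnd in
/-- `S.Joins e f`: there is an arc in the slice of shape `S` with ends `e` and `f`. -/
inductive Shape.Joins : Shape → SliceEnd → SliceEnd → Prop
  | id (j : ℕ) : Joins .id (bot j) (top j)
  | cup_left (i j : ℕ) (h : j < i) : Joins (.cup i) (bot j) (top j)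
  | cup_right (i j : ℕ) (h : i ≤ j) : Joins (.cup i) (bot j) (top (j + 2))
  | cup_arc (i : ℕ) : Joins (.cup i) (top i) (top (i + 1))
  | cap_left (i j : ℕ) (h : j < i) : Joins (.cap i) (bot j) (top j)
  | cap_right (i j : ℕ) (h : i ≤ j) : Joins (.cap i) (bot (j + 2)) (top j)
  | cap_arc (i : ℕ) : Joins (.cap i) (bot i) (bot (i + 1))
  | swap_off (i j : ℕ) (h : j ≠ i) (h' : j ≠ i + 1) : Joins (.swap i) (bot j) (top j)
  | swap_right (i : ℕ) : Joins (.swap i) (bot i) (top (i + 1))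
  | swap_left (i : ℕ) : Joins (.swap i) (bot (i + 1)) (top i)
  | turn_off (i j : ℕ) (h : j ≠ i) (h' : j ≠ i + 1) : Joins (.turn i) (bot j) (top j)
  | turn_cap (i : ℕ) : Joins (.turn i) (bot i) (bot (i + 1))
  | turn_cup (i : ℕ) : Joins (.turn i) (top i) (top (i + 1))

/-- The projection of a slice. -/
def Slice.shape : Slice → Shape
  | .id => .id
  | .cup i => .cup i
  | .cap i => .cap i
  | .cross i _ => .swap i

/-- The `0`-resolution (`one = false`) or `1`-resolution (`one = true`) of a slice.  The
`0`-resolution of a crossing connects the two regions swept out when the over-strand is turned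
counterclockwise; for `cross i true` it is vertical, for `cross i false` it is `turn i`, and
the `1`-resolution is the other one of the two. -/
def Slice.resolve : Slice → (one : Bool) → Shape
  | .id, _ => .id
  | .cup i, _ => .cup i
  | .cap i, _ => .cap i
  | .cross _ true, false => .id
  | .cross i true, true => .turn i
  | .cross i false, false => .turn i
  | .cross _ false, true => .id

/-! ## Diagrams, resolutions and orientations -/

/-- A link diagram made of `N` slices.  Slice `t` lies between the levels `t` and `t + 1`, and
`width n` is the number of strands at level `n`. -/
structure Diagram (N : ℕ) where
  slice : Fin N → Slice
  width : Fin (N + 1) → ℕ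
  width_first : width 0 = 0
  width_last : width (Fin.last N) = 0
  fits : ∀ t : Fin N, (slice t).Fits (width t.castSucc) (width t.succ)

namespace Diagram

variable {N : ℕ}

/-- The intersection points of the diagram with the levels: `⟨n, j⟩` is the `j`-th point from the
left at level `n`. -/
abbrev Point (L : Diagram N) : Type := Σ n : Fin (N + 1), Fin (L.width n)

/-- `L.IsEnd t e p`: the end `e` of an arc in slice `t` is the point `p`. -/
def IsEnd (L : Diagram N) (t : Fin N) : SliceEnd → L.Point → Prop
  | .bot j, p => p.1 = t.castSucc ∧ (p.2 : ℕ) = j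
  | .top j, p => p.1 = t.succ ∧ (p.2 : ℕ) = j

/-- Two points are adjacent if they are the ends of an arc in some slice, where slice `t` is filled
with the curves `S t`. -/
def Adj (L : Diagram N) (S : Fin N → Shape) (p q : L.Point) : Prop :=
  ∃ t e f, (S t).Joins e f ∧ L.IsEnd t e p ∧ L.IsEnd t f q

/-- The vertices of the cube of resolutions; a vertex is given by the set of those crossings that
have a `1`-resolution. -/
abbrev Vertex (L : Diagram N) : Type := {v : Finset (Fin N) // ∀ t ∈ v, (L.slice t).IsCross}

/-- The circles of the complete resolution `D_v`. -/
def Circle (L : Diagram N) (v : L.Vertex) : Type :=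
  Quot (L.Adj fun t => (L.slice t).resolve (decide (t ∈ v.1)))

/-- The circle of `D_v` through a point. -/
def circle (L : Diagram N) (v : L.Vertex) (p : L.Point) : L.Circle v := Quot.mk _ p

instance (L : Diagram N) (v : L.Vertex) : Finite (L.Circle v) := by
  unfold Circle; infer_instance

noncomputable instance (L : Diagram N) (v : L.Vertex) : Fintype (L.Circle v) := Fintype.ofFinite _

/-- The bottom left end of the crossing in slice `t`. -/
def bl (L : Diagram N) (t : Fin N) (h : (L.slice t).IsCross) : L.Point :=
  ⟨t.castSucc, ⟨(L.slice t).pos, by have := (h.lt (L.fits t)).1; omega⟩⟩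

/-- The bottom right end of the crossing in slice `t`. -/
def br (L : Diagram N) (t : Fin N) (h : (L.slice t).IsCross) : L.Point :=
  ⟨t.castSucc, ⟨(L.slice t).pos + 1, (h.lt (L.fits t)).1⟩⟩

/-- The top right end of the crossing in slice `t`. -/
def tr (L : Diagram N) (t : Fin N) (h : (L.slice t).IsCross) : L.Point :=
  ⟨t.succ, ⟨(L.slice t).pos + 1, (h.lt (L.fits t)).2⟩⟩

/-- An orientation of (all components of) the link: every point is marked by the direction, up or
down, in which the strand passes through it.  Along an arc, the direction changes if and only if
the two ends of the arc are at the same level. -/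
@[ext]
structure Orientation (L : Diagram N) where
  up : L.Point → Bool
  coherent : ∀ p q, L.Adj (fun t => (L.slice t).shape) p q → (up p = up q ↔ p.1 ≠ q.1)

/-- The crossing in slice `t` is negative with respect to the orientation `o`: either the
over-strand runs from bottom left to top right and the strands point in different vertical
directions, or it runs from bottom right to top left and both point up or both point down. -/
def Orientation.IsNegative {L : Diagram N} (o : L.Orientation) (t : Fin N)
    (h : (L.slice t).IsCross) : Prop :=
  (L.slice t).isPos = true ↔ o.up (L.bl t h) ≠ o.up (L.br t h)

open scoped Classical in
/-- The vertex of the oriented resolution `D_o`, in which every crossing is resolved coherently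
with the orientation: positive crossings have `0`-resolutions, negative ones `1`-resolutions. -/
noncomputable def Orientation.vertex {L : Diagram N} (o : L.Orientation) : L.Vertex :=
  ⟨Finset.univ.filter fun t => ∃ h, o.IsNegative t h, by
    intro t ht
    obtain ⟨h, -⟩ := (Finset.mem_filter.1 ht).2
    exact h⟩

/-- The number `n₋` of negative crossings. -/
noncomputable def Orientation.numNeg {L : Diagram N} (o : L.Orientation) : ℕ := o.vertex.1.card

/-! ## The complex `CKh'` -/

/-- The states: a complete resolution with a labelling of its circles by `v₊` (`true`) and
`v₋` (`false`). -/
abbrev State (L : Diagram N) : Type := Σ v : L.Vertex, (L.Circle v → Bool)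

open scoped Classical in
noncomputable instance (L : Diagram N) : Fintype L.State := Fintype.ofFinite _

/-- The label of the point `p` in the state `s`. -/
def State.label {L : Diagram N} (s : L.State) (p : L.Point) : Bool := s.2 (L.circle s.1 p)

/-- The rational vector space spanned by the states. -/
abbrev CKh (L : Diagram N) : Type := L.State →₀ ℚ

/-- The linear map with matrix coefficients `c s s'`. -/
noncomputable def ofCoeff {L L' : Diagram N} (c : L.State → L'.State → ℚ) :
    L.CKh →ₗ[ℚ] L'.CKh :=
  Finsupp.linearCombination ℚ fun s => ∑ s' : L'.State, Finsupp.single s' (c s s')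

/-- The coefficient of `v_z` in `m'(v_x ⊗ v_y)`. -/
def mulCoeff : (x y z : Bool) → ℚ
  | true, true, true => 1
  | false, false, true => 1
  | true, false, false => 1
  | false, true, false => 1
  | _, _, _ => 0

/-- The coefficient of `v_y ⊗ v_z` in `Δ'(v_x)`. -/
def comulCoeff : (x y z : Bool) → ℚ
  | true, true, false => 1
  | true, false, true => 1
  | false, false, false => 1
  | false, true, true => 1
  | _, _, _ => 0

open scoped Classical in
/-- The sum of the maps `A'(S_e)` (without signs) over all edges `e` of the cube in the direction
of the crossing `t`.  On `A'(D_v)` it is zero if `t` has a `1`-resolution in `v`.  The two arcs of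
a resolution at the crossing pass through the points `bl` and `tr`; if these lie on different
circles of `D_v`, then the circles are merged by `m'`, and otherwise their common circle is split
by `Δ'`.  The labels of the other circles do not change. -/
noncomputable def saddle (L : Diagram N) (t : Fin N) (h : (L.slice t).IsCross) :
    L.CKh →ₗ[ℚ] L.CKh :=
  ofCoeff fun s s' =>
    if t ∉ s.1.1 ∧ s'.1.1 = insert t s.1.1 ∧
        ∀ p, L.circle s.1 p ≠ L.circle s.1 (L.bl t h) → L.circle s.1 p ≠ L.circle s.1 (L.tr t h) →
          s'.label p = s.label p then
      if L.circle s.1 (L.bl t h) ≠ L.circle s.1 (L.tr t h) then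
        mulCoeff (s.label (L.bl t h)) (s.label (L.tr t h)) (s'.label (L.bl t h))
      else
        comulCoeff (s.label (L.bl t h)) (s'.label (L.bl t h)) (s'.label (L.tr t h))
    else 0

/-- The linear map that multiplies each state `s` by the scalar `c s`. -/
noncomputable def scale {L : Diagram N} (c : L.State → ℚ) : L.CKh →ₗ[ℚ] L.CKh :=
  Finsupp.linearCombination ℚ fun s => Finsupp.single s (c s)

/-- The sign of the edge in direction `t` that starts at the vertex of `s`, where the crossings are
enumerated in the order of increasing `r`: `-1` to the number of `1`-resolutions before `t`. -/
def edgeSign {L : Diagram N} (r : Fin N → ℕ) (t : Fin N) (s : L.State) : ℚ :=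
  (-1) ^ (s.1.1.filter fun k => r k < r t).card

open scoped Classical in
/-- Lee's differential `d'`, for the sign convention given by the enumeration `r` of the
crossings. -/
noncomputable def dLee (L : Diagram N) (r : Fin N → ℕ) : L.CKh →ₗ[ℚ] L.CKh :=
  ∑ t : Fin N, if h : (L.slice t).IsCross then L.saddle t h ∘ₗ scale (edgeSign r t) else 0

/-- The homological grading `|v| - n₋` of a state in the diagram oriented by `w`. -/
noncomputable def gr {L : Diagram N} (w : L.Orientation) (s : L.State) : ℤ :=
  (s.1.1.card : ℤ) - (w.numNeg : ℤ)

end Diagram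

/-! ## Homology of a vector space with a differential -/

section Homology

variable {V W : Type} [AddCommGroup V] [Module ℚ V] [AddCommGroup W] [Module ℚ W]

/-- Kernel modulo image. -/
abbrev Homology (d : V →ₗ[ℚ] V) : Type :=
  LinearMap.ker d ⧸ (LinearMap.range d).comap (LinearMap.ker d).subtype

/-- The homology class of a cycle. -/
def cls (d : V →ₗ[ℚ] V) (x : V) (hx : d x = 0) : Homology d :=
  Submodule.Quotient.mk ⟨x, hx⟩

def IsChainMap (d : V →ₗ[ℚ] V) (d' : W →ₗ[ℚ] W) (f : V →ₗ[ℚ] W) : Prop :=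
  ∀ x, d' (f x) = f (d x)

/-- The map induced on homology by a chain map; it maps the class of `x` to the class of `f x`. -/
def IsChainMap.map {d : V →ₗ[ℚ] V} {d' : W →ₗ[ℚ] W} {f : V →ₗ[ℚ] W} (h : IsChainMap d d' f) :
    Homology d →ₗ[ℚ] Homology d' :=
  Submodule.mapQ _ _
    (f.restrict (p := LinearMap.ker d) (q := LinearMap.ker d') fun x hx => by
      rw [LinearMap.mem_ker] at hx ⊢; rw [h x, hx, map_zero])
    (by
      rintro ⟨x, hx⟩ ⟨y, hy⟩
      exact ⟨f y, by rw [h y, hy]; rfl⟩)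

theorem IsChainMap.map_cls {d : V →ₗ[ℚ] V} {d' : W →ₗ[ℚ] W} {f : V →ₗ[ℚ] W}
    (h : IsChainMap d d' f) (x : V) (hx : d x = 0) :
    h.map (cls d x hx) = cls d' (f x) (by rw [h x, hx, map_zero]) := rfl

end Homology

namespace Diagram

variable {N : ℕ}

/-- Lee's homology `Kh'`. -/
abbrev Kh (L : Diagram N) (r : Fin N → ℕ) : Type := Homology (L.dLee r)

/-! ## Canonical generators -/

open scoped Classical in
/-- The number of intersections of the horizontal ray from `p` to the left with circles of `D_v`
other than the circle of `p`. -/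
noncomputable def rayCount (L : Diagram N) (v : L.Vertex) (p : L.Point) : ℕ :=
  (Finset.univ.filter fun j : Fin (L.width p.1) =>
    j < p.2 ∧ L.circle v ⟨p.1, j⟩ ≠ L.circle v p).card

/-- The circle `C` of the oriented resolution is oriented counterclockwise: it runs downwards at
a point which is its leftmost point at some level. -/
def Orientation.IsCCW {L : Diagram N} (o : L.Orientation) (C : L.Circle o.vertex) : Prop :=
  ∃ p : L.Point, L.circle o.vertex p = C ∧
    (∀ j : Fin (L.width p.1), j < p.2 → L.circle o.vertex ⟨p.1, j⟩ ≠ C) ∧ o.up p = false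

open scoped Classical in
/-- The circle `C` of `D_o` is labelled by `a` in the canonical generator (otherwise by `b`): the
number of circles which separate `C` from infinity, plus `1` if `C` is oriented counterclockwise,
is even.  The former number is computed modulo `2` with a ray from some point of `C`. -/
def Orientation.IsA {L : Diagram N} (o : L.Orientation) (C : L.Circle o.vertex) : Prop :=
  Even (L.rayCount o.vertex (Quot.out C) + if o.IsCCW C then 1 else 0)

/-- The coefficient of `v_x` in `a = v₋ + v₊` (for `isA`) or in `b = v₋ - v₊`. -/
def abCoeff (isA : Prop) [Decidable isA] (x : Bool) : ℚ :=
  if x = true ∧ ¬ isA then -1 else 1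

open scoped Classical in
/-- The canonical generator `s_o`: the tensor product of the labels `a` or `b` over all circles of
the oriented resolution, expanded in terms of states. -/
noncomputable def canonical (L : Diagram N) (o : L.Orientation) : L.CKh :=
  ∑ x : L.Circle o.vertex → Bool,
    Finsupp.single ⟨o.vertex, x⟩ (∏ C, abCoeff (o.IsA C) (x C))

/-! ## Comparison of diagrams that differ in some slices -/

/-- `p` and `p'` are the points at the same level and position. -/
def SamePlace {L L' : Diagram N} (p : L.Point) (p' : L'.Point) : Prop :=
  p.1 = p'.1 ∧ (p.2 : ℕ) = p'.2

/-- The states have the same labels at all levels not in `I`. -/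
def AgreeOff {L L' : Diagram N} (I : Set (Fin (N + 1))) (s : L.State) (s' : L'.State) : Prop :=
  ∀ p p', SamePlace p p' → p.1 ∉ I → s'.label p' = s.label p

/-- The orientation `o'` is induced by `o`: they agree at all levels not in `I`. -/
def Orientation.Induces {L L' : Diagram N} (I : Set (Fin (N + 1))) (o : L.Orientation)
    (o' : L'.Orientation) : Prop :=
  ∀ p p', SamePlace p p' → p.1 ∉ I → o'.up p' = o.up p

open scoped Classical in
/-- The map that sends each state at `v` to the sum of all states at those `v'` with `P v v'` that
satisfy `E` and have the same labels at the levels outside of `I`. -/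
noncomputable def transfer (L L' : Diagram N) (I : Set (Fin (N + 1)))
    (P : Finset (Fin N) → Finset (Fin N) → Prop) (E : L'.State → Prop) : L.CKh →ₗ[ℚ] L'.CKh :=
  ofCoeff fun s s' => if P s.1.1 s'.1.1 ∧ AgreeOff I s s' ∧ E s' then 1 else 0

/-- Every orientation `o` of `L` induces a unique orientation `o'` of `L'`, the canonical
generators `s_o`, `s_{o'}` are cycles, and `f` sends the class of `s_o` to a nonzero multiple of
the class of `s_{o'}`. -/
def PreservesCanonical {L L' : Diagram N} (I : Set (Fin (N + 1))) {r r' : Fin N → ℕ}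
    (f : L.Kh r →ₗ[ℚ] L'.Kh r') : Prop :=
  ∀ o : L.Orientation, ∃ o' : L'.Orientation,
    (o.Induces I o' ∧ ∀ o'' : L'.Orientation, o.Induces I o'' → o'' = o') ∧
    ∃ (h : L.dLee r (L.canonical o) = 0) (h' : L'.dLee r' (L'.canonical o') = 0),
      ∃ c : ℚ, c ≠ 0 ∧ f (cls _ _ h) = c • cls _ _ h'

/-! ## The first Reidemeister move -/

/-- `L'` is obtained from `L` by adding a left-hand curl: the two strands below a cap (in slice
`b`) are crossed (in slice `a`) such that the `0`-resolution of the new crossing is `turn i`, and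
so splits off a circle. -/
structure IsRI (L L' : Diagram N) (a b : Fin N) (i : ℕ) : Prop where
  next : (b : ℕ) = a + 1
  before : L.slice a = .id
  after : L'.slice a = .cross i false
  cap : L.slice b = .cap i
  off : ∀ t, t ≠ a → L'.slice t = L.slice t

theorem IsRI.isCross {L L' : Diagram N} {a b : Fin N} {i : ℕ} (h : IsRI L L' a b i) :
    (L'.slice a).IsCross := ⟨i, false, h.after⟩

theorem IsRI.lt {L L' : Diagram N} {a b : Fin N} {i : ℕ} (h : IsRI L L' a b i) :
    i < L.width a.castSucc := by
  have h1 := L.fits a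
  have h2 := L.fits b
  rw [h.before] at h1
  rw [h.cap] at h2
  have h3 : b.castSucc = a.succ := by ext; simp [h.next]
  rw [h3] at h2
  have h4 : L.width a.succ = L.width a.castSucc := h1
  have h5 : i + 2 ≤ L.width a.succ := h2.1
  omega

/-- The coefficient of `v_y ⊗ v_z` in `ρ₁'(v_x)`, where `ρ₁'(v₋) = v₋ ⊗ v₋ - v₊ ⊗ v₊` and
`ρ₁'(v₊) = v₊ ⊗ v₋ - v₋ ⊗ v₊`. -/
def rhoICoeff : (x y z : Bool) → ℚ
  | false, false, false => 1
  | false, true, true => -1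
  | true, true, false => 1
  | true, false, true => -1
  | _, _, _ => 0

open scoped Classical in
/-- The map `ρ₁' : CKh'(L) → CKh'(L̃)`.  Its image is contained in the part where the new crossing
has a `0`-resolution.  The first factor of `v_y ⊗ v_z` belongs to the circle that contains the
strand on which the curl is added, and the second factor to the new small circle (which contains the
top right end of the crossing). -/
noncomputable def rhoI {L L' : Diagram N} {a b : Fin N} {i : ℕ} (h : IsRI L L' a b i) :
    L.CKh →ₗ[ℚ] L'.CKh :=
  let strand : L.Point := ⟨a.castSucc, ⟨i, h.lt⟩⟩
  ofCoeff fun s s' =>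
    if s'.1.1 = s.1.1 ∧
        ∀ p p', SamePlace p p' → p.1 ≠ a.succ → L.circle s.1 p ≠ L.circle s.1 strand →
          s'.label p' = s.label p then
      rhoICoeff (s.label strand) (s'.label (L'.bl a h.isCross)) (s'.label (L'.tr a h.isCross))
    else 0

/-! ## The second Reidemeister move -/

/-- `L'` is obtained from `L` by crossing two adjacent strands twice.  Here `c₀` is the crossing
whose `0`-resolution is vertical and `c₁` the one whose `1`-resolution is vertical; both orders of
the crossings along the strands are allowed.  In the numbering of vertices, `c₀` comes first, so
that `01` is the vertex at which both crossings are resolved vertically, and at the vertex `10` a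
small circle lies between the crossings. -/
structure IsRII (L L' : Diagram N) (a b : Fin N) (i : ℕ) (c₀ c₁ : Fin N) : Prop where
  next : (b : ℕ) = a + 1
  before_a : L.slice a = .id
  before_b : L.slice b = .id
  order : (c₀ = a ∧ c₁ = b) ∨ (c₀ = b ∧ c₁ = a)
  after₀ : L'.slice c₀ = .cross i true
  after₁ : L'.slice c₁ = .cross i false
  off : ∀ t, t ≠ a → t ≠ b → L'.slice t = L.slice t

theorem IsRII.isCross_a {L L' : Diagram N} {a b c₀ c₁ : Fin N} {i : ℕ}
    (h : IsRII L L' a b i c₀ c₁) : (L'.slice a).IsCross := by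
  rcases h.order with ⟨rfl, -⟩ | ⟨-, rfl⟩
  exacts [⟨i, true, h.after₀⟩, ⟨i, false, h.after₁⟩]

theorem IsRII.isCross₀ {L L' : Diagram N} {a b c₀ c₁ : Fin N} {i : ℕ}
    (h : IsRII L L' a b i c₀ c₁) : (L'.slice c₀).IsCross := ⟨i, true, h.after₀⟩

/-- The identification of `CKh'(L)` with `CKh'(L̃(*01))`. -/
noncomputable def IsRII.incl {L L' : Diagram N} {a b c₀ c₁ : Fin N} {i : ℕ}
    (_h : IsRII L L' a b i c₀ c₁) : L.CKh →ₗ[ℚ] L'.CKh :=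
  transfer L L' {a.succ} (fun v v' => v' = insert c₁ v) fun _ => True

/-- The map `ι : CKh'(L̃(*11)) → CKh'(L̃(*10))` which labels the small circle by `v₊`. -/
noncomputable def IsRII.birth {L L' : Diagram N} {a b c₀ c₁ : Fin N} {i : ℕ}
    (h : IsRII L L' a b i c₀ c₁) : L'.CKh →ₗ[ℚ] L'.CKh :=
  transfer L' L' {a.succ} (fun v v' => c₀ ∈ v ∧ c₁ ∈ v ∧ v' = v.erase c₁)
    fun s => s.label (L'.tr a h.isCross_a) = true

/-- The map `ρ₂'(z) = (-1)^{gr z} (z + ι (d'_{01→11} z))`, where the gradings refer to the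
orientation `w` of the link. -/
noncomputable def rhoII {L L' : Diagram N} {a b c₀ c₁ : Fin N} {i : ℕ}
    (h : IsRII L L' a b i c₀ c₁) (w : L.Orientation) : L.CKh →ₗ[ℚ] L'.CKh :=
  (h.incl + h.birth ∘ₗ L'.saddle c₀ h.isCross₀ ∘ₗ h.incl) ∘ₗ
    scale fun s => (-1 : ℚ) ^ gr w s

/-! ## The third Reidemeister move -/

/-- The strand that enters the three slices `a`, `b`, `c` at the lower left and leaves them at the
upper right is below the other two.  It crosses them after their mutual crossing in `L'` and before
it in `L`.  The crossings on the lowest strand are numbered `1` and `2` in the order from bottom left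
to top right, and the crossing of the other two strands is number `3`.  So these are the slices `a`,
`b`, `c` of `L`, in this order, and the slices `b`, `c`, `a` of `L'`. -/
structure IsRIII (L L' : Diagram N) (a b c : Fin N) (i : ℕ) : Prop where
  next_a : (b : ℕ) = a + 1
  next_b : (c : ℕ) = b + 1
  before_a : L.slice a = .cross i false
  before_b : L.slice b = .cross (i + 1) false
  before_c : L.slice c = .cross i false
  after_a : L'.slice a = .cross (i + 1) false
  after_b : L'.slice b = .cross i false
  after_c : L'.slice c = .cross (i + 1) false
  off : ∀ t, t ≠ a → t ≠ b → t ≠ c → L'.slice t = L.slice t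

namespace IsRIII

variable {L L' : Diagram N} {a b c : Fin N} {i : ℕ}

theorem isCross_a (h : IsRIII L L' a b c i) : (L.slice a).IsCross := ⟨_, _, h.before_a⟩
theorem isCross_b (h : IsRIII L L' a b c i) : (L.slice b).IsCross := ⟨_, _, h.before_b⟩
theorem isCross_a' (h : IsRIII L L' a b c i) : (L'.slice a).IsCross := ⟨_, _, h.after_a⟩
theorem isCross_b' (h : IsRIII L L' a b c i) : (L'.slice b).IsCross := ⟨_, _, h.after_b⟩

/-- The map `β' = ι ∘ d'_{100→110} : CKh'(L(*100)) → CKh'(L(*010))`, extended by zero.  The small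
circle at the vertices `010` contains the top right end of the crossing in slice `a`. -/
noncomputable def beta (h : IsRIII L L' a b c i) : L.CKh →ₗ[ℚ] L.CKh :=
  transfer L L {a.succ, b.succ} (fun v v' => a ∈ v ∧ b ∈ v ∧ c ∉ v ∧ v' = v.erase a)
    (fun s => s.label (L.tr a h.isCross_a) = true) ∘ₗ L.saddle b h.isCross_b

/-- The map `β̃' = ι ∘ d'_{010→110} : CKh'(L̃(*010)) → CKh'(L̃(*100))`, extended by zero.  The small
circle at the vertices `100` contains the top right end of the crossing in slice `a`. -/
noncomputable def beta' (h : IsRIII L L' a b c i) : L'.CKh →ₗ[ℚ] L'.CKh :=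
  transfer L' L' {a.succ, b.succ} (fun v v' => b ∈ v ∧ c ∈ v ∧ a ∉ v ∧ v' = v.erase c)
    (fun s => s.label (L'.tr a h.isCross_a') = true) ∘ₗ L'.saddle b h.isCross_b'

/-- `CKh'(L(*100))`. -/
noncomputable def part100 (_h : IsRIII L L' a b c i) : Submodule ℚ L.CKh :=
  Finsupp.supported ℚ ℚ {s | a ∈ s.1.1 ∧ b ∉ s.1.1 ∧ c ∉ s.1.1}

/-- `CKh'(L(*1))`. -/
noncomputable def part1 (_h : IsRIII L L' a b c i) : Submodule ℚ L.CKh :=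
  Finsupp.supported ℚ ℚ {s | c ∈ s.1.1}

/-- `X₁ = {x + β'(x) + y | x ∈ CKh'(L(*100)), y ∈ CKh'(L(*1))}`. -/
noncomputable def X₁ (h : IsRIII L L' a b c i) : Submodule ℚ L.CKh :=
  h.part100.map (LinearMap.id + h.beta) ⊔ h.part1

/-- The identification of `CKh'(L(*100))` with `CKh'(L̃(*010))`, extended by zero. -/
noncomputable def ident100 (_h : IsRIII L L' a b c i) : L.CKh →ₗ[ℚ] L'.CKh :=
  transfer L L' {a.succ, b.succ}
    (fun v v' => a ∈ v ∧ b ∉ v ∧ c ∉ v ∧ v' = insert c (v.erase a)) fun _ => True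

/-- The identification of `CKh'(L(*1))` with `CKh'(L̃(*1))`, extended by zero.  It sends the vertices
`jk1` to `jk1`. -/
noncomputable def ident1 (_h : IsRIII L L' a b c i) : L.CKh →ₗ[ℚ] L'.CKh :=
  transfer L L' {a.succ, b.succ}
    (fun v v' => c ∈ v ∧ a ∈ v' ∧ (b ∈ v' ↔ a ∈ v) ∧ (c ∈ v' ↔ b ∈ v) ∧
      ∀ t, t ≠ a → t ≠ b → t ≠ c → (t ∈ v' ↔ t ∈ v)) fun _ => True

/-- The map `ρ₃'(x + β'(x) + y) = x + β̃'(x) + y` on `X₁`. -/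
noncomputable def rhoIII (h : IsRIII L L' a b c i) : h.X₁ →ₗ[ℚ] L'.CKh :=
  ((LinearMap.id + h.beta') ∘ₗ h.ident100 + h.ident1) ∘ₗ h.X₁.subtype

/-- The enumeration of the crossings of `L'` in which the crossings number `1`, `2`, `3` have the
same places as in the enumeration `r` of the crossings of `L`. -/
def reorder (_h : IsRIII L L' a b c i) (r : Fin N → ℕ) (t : Fin N) : ℕ :=
  if t = a then r c else if t = b then r a else if t = c then r b else r t

end IsRIII

end Diagram

end LeeKh

namespace LeeKh

/-! ## Permutations and transpositions -/

/-! With `v₊` as unit, Lee's algebra `V` is `ℚ[x]/(x² - 1)` with `x = v₋`. It has two characters,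
`v₋ ↦ 1` and `v₋ ↦ -1`; the first takes the values `2` and `0` at `a` and `b`, the second the values
`0` and `-2`. Hence a resolution `V` together with a colouring `c` of its circles by `a` and `b`
gives a functional `pair V c` on `CKh'`, and these functionals are coordinates: they separate the
elements (`pair_inj`) and take arbitrary values (`exists_pair_eq`).

In these coordinates the differential does not change the colouring (`pair_saddle`, `pair_dLee`).
The edge of the crossing `t` multiplies by a nonzero number `kap` if the corners of `t` have one
colour, and contributes nothing otherwise. Fix a colouring of the points of the diagram. A crossing
that is not monochromatic has its resolution forced by the colours, and a monochromatic one can be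
resolved in both ways. So the part of the complex that belongs to this colouring is a cube in the
directions of the monochromatic crossings, with all edges invertible. It is contractible if there is
such a crossing, and one-dimensional if there is none (`exists_boundary`). That the squares of the
cube commute before signs is obtained by counting circles of each colour (`kap_square`).

The colourings without monochromatic crossings are the orientations: a point has the colour `a` if
and only if its position is even and the strand goes up, or its position is odd and the strand goes
down. The rule with rays and counterclockwise circles gives just these colours
(`Orientation.isA_iff`), so `s_o` spans the line of the coordinate of `o`. Consequently a cycle is
determined up to boundaries by its coordinates at the orientations.

It therefore suffices, for each move, that the map is a chain map, that the orientations of the two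
diagrams correspond to each other, and that the coordinate of the image at `õ` is a nonzero multiple
of the coordinate at `o` (`OrientationCorr.preservesCanonical_map`,
`OrientationCorr.bijective_map`). Resolutions before and after a move are compared through their
colourings only (`Refill`), which also shows that the factors of edges away from the move agree.

The third move needs in addition that `X₁` carries the homology: every `w` with boundary in `X₁` can
be moved into `X₁` by a boundary (`exists_sub_mem_X₁`). Its chain map property is checked vertex by
vertex (`IsRIII.core_dLee`). -/

theorem sameCycle_mul_swap {P : Type*} [Finite P] [DecidableEq P] (f : Equiv.Perm P) {x y : P}
    (hxy : x ≠ y) :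
    (f * Equiv.swap x y).SameCycle x y ↔ ¬ f.SameCycle x y := by
  have hx : (f * Equiv.swap x y) x = f y := by simp
  have hy : (f * Equiv.swap x y) y = f x := by simp
  have ho : ∀ z, z ≠ x → z ≠ y → (f * Equiv.swap x y) z = f z := by
    intro z h1 h2
    simp [Equiv.swap_apply_of_ne_of_ne h1 h2]
  generalize f * Equiv.swap x y = g at hx hy ho
  constructor
  -- If `y = f^k x` with `k` least, then the orbit of `y` under `g` stays among `f x, …, f^k x`,
  -- since from `f^k x = y` it jumps back to `f x`. None of these points is `x`.
  · intro hg hf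
    obtain ⟨k0, hk0⟩ := hf.exists_nat_pow_eq
    classical
    have hex : ∃ k, (f ^ k) x = y := ⟨k0, hk0⟩
    set k := Nat.find hex with hk
    have hky : (f ^ k) x = y := Nat.find_spec hex
    have hmin : ∀ j < k, (f ^ j) x ≠ y := fun j hj => Nat.find_min hex hj
    have hkpos : k ≠ 0 := by
      intro h0
      rw [h0] at hky
      exact hxy (by simpa using hky)
    have hnx : ∀ j, 1 ≤ j → j ≤ k → (f ^ j) x ≠ x := by
      intro j h1 h2 h3
      apply hmin (k - j) (by omega)
      have : (f ^ k) x = (f ^ (k - j)) ((f ^ j) x) := by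
        rw [← Equiv.Perm.mul_apply, ← pow_add]
        congr 2
        omega
      rw [h3] at this
      rw [← this, hky]
    have hinv : ∀ m : ℕ, ∃ j, 1 ≤ j ∧ j ≤ k ∧ (g ^ m) y = (f ^ j) x := by
      intro m
      induction m with
      | zero => exact ⟨k, by omega, le_rfl, by simp [hky]⟩
      | succ m ih =>
        obtain ⟨j, h1, h2, h3⟩ := ih
        rw [pow_succ', Equiv.Perm.mul_apply, h3]
        by_cases hjk : j = k
        · refine ⟨1, le_rfl, by omega, ?_⟩
          rw [hjk, hky, hy, pow_one]
        · refine ⟨j + 1, by omega, by omega, ?_⟩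
          rw [ho _ (hnx j h1 h2) (hmin j (by omega)), pow_succ', Equiv.Perm.mul_apply]
    obtain ⟨m, hm⟩ := hg.symm.exists_nat_pow_eq
    obtain ⟨j, h1, h2, h3⟩ := hinv m
    exact hnx j h1 h2 (by rw [← h3, hm])
  -- Here `k` is the length of the cycle of `x` under `f`. As `y` does not lie on it, `g` leads from
  -- `y` along `f x, f² x, …` until it arrives at `f^k x = x`.
  · intro hf
    classical
    have hex : ∃ k, 0 < k ∧ (f ^ k) x = x :=
      ⟨orderOf f, orderOf_pos f, by rw [pow_orderOf_eq_one]; rfl⟩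
    set k := Nat.find hex with hk
    obtain ⟨hkpos, hkx⟩ := Nat.find_spec hex
    have hmin : ∀ j, 0 < j → j < k → (f ^ j) x ≠ x := fun j h0 hj h =>
      Nat.find_min hex hj ⟨h0, h⟩
    have hpow : ∀ m, 1 ≤ m → m ≤ k → (g ^ m) y = (f ^ m) x := by
      intro m h1
      induction m, h1 using Nat.le_induction with
      | base => intro _; simpa using hy
      | succ m h1 ih =>
        intro h2
        rw [pow_succ', Equiv.Perm.mul_apply, ih (by omega), pow_succ' f, Equiv.Perm.mul_apply]
        apply ho _ (hmin m (by omega) (by omega))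
        intro h3
        exact hf ⟨m, by exact_mod_cast h3⟩
    refine Equiv.Perm.SameCycle.symm ⟨k, ?_⟩
    have := hpow k hkpos le_rfl
    rw [hkx] at this
    exact_mod_cast this

/-! ## Shapes -/

/-- The two ends of an arc are exchanged (for the shapes that occur in resolutions). -/
def Shape.inv : Shape → SliceEnd → SliceEnd
  | .id, .bot j => .top j
  | .id, .top j => .bot j
  | .cup i, .bot j => if j < i then .top j else .top (j + 2)
  | .cup i, .top j =>
    if j < i then .bot j else if j = i then .top (i + 1) else if j = i + 1 then .top i
      else .bot (j - 2)
  | .cap i, .top j => if j < i then .bot j else .bot (j + 2)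
  | .cap i, .bot j =>
    if j < i then .top j else if j = i then .bot (i + 1) else if j = i + 1 then .bot i
      else .top (j - 2)
  | .swap i, .bot j => if j = i then .top (i + 1) else if j = i + 1 then .top i else .top j
  | .swap i, .top j => if j = i then .bot (i + 1) else if j = i + 1 then .bot i else .bot j
  | .turn i, .bot j => if j = i then .bot (i + 1) else if j = i + 1 then .bot i else .top j
  | .turn i, .top j => if j = i then .top (i + 1) else if j = i + 1 then .top i else .bot j

theorem Shape.Joins.inv_eq {S : Shape} {e f : SliceEnd} (h : S.Joins e f) : S.inv e = f := by
  cases h <;> simp only [Shape.inv] <;> (repeat' split) <;>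
    first | rfl | omega | (congr 1; omega) | simp_all

theorem Shape.Joins.inv_eq' {S : Shape} {e f : SliceEnd} (h : S.Joins e f) : S.inv f = e := by
  cases h <;> simp only [Shape.inv] <;> (repeat' split) <;>
    first | rfl | omega | (congr 1; omega) | simp_all

theorem Shape.joins_inv (S : Shape) (e : SliceEnd) :
    S.Joins e (S.inv e) ∨ S.Joins (S.inv e) e := by
  cases S with
  | id =>
    cases e with
    | bot j => exact .inl (.id j)
    | top j => exact .inr (.id j)
  | cup i =>
    cases e with
    | bot j =>
      left
      by_cases h : j < i
      · simpa [Shape.inv, h] using Shape.Joins.cup_left i j h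
      · simpa [Shape.inv, h] using Shape.Joins.cup_right i j (by omega)
    | top j =>
      simp only [Shape.inv]
      split_ifs with h1 h2 h3
      · exact .inr (.cup_left i j h1)
      · subst h2; exact .inl (.cup_arc _)
      · subst h3; exact .inr (.cup_arc _)
      · right
        have := Shape.Joins.cup_right i (j - 2) (by omega)
        rwa [show j - 2 + 2 = j by omega] at this
  | cap i =>
    cases e with
    | top j =>
      right
      by_cases h : j < i
      · simpa [Shape.inv, h] using Shape.Joins.cap_left i j h
      · simpa [Shape.inv, h] using Shape.Joins.cap_right i j (by omega)
    | bot j =>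
      simp only [Shape.inv]
      split_ifs with h1 h2 h3
      · exact .inl (.cap_left i j h1)
      · subst h2; exact .inl (.cap_arc _)
      · subst h3; exact .inr (.cap_arc _)
      · left
        have := Shape.Joins.cap_right i (j - 2) (by omega)
        rwa [show j - 2 + 2 = j by omega] at this
  | swap i =>
    cases e with
    | bot j =>
      left
      simp only [Shape.inv]
      split_ifs with h1 h2
      · subst h1; exact .swap_right _
      · subst h2; exact .swap_left _
      · exact .swap_off i j h1 h2
    | top j =>
      right
      simp only [Shape.inv]
      split_ifs with h1 h2
      · subst h1; exact .swap_left _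
      · subst h2; exact .swap_right _
      · exact .swap_off i j h1 h2
  | turn i =>
    cases e with
    | bot j =>
      simp only [Shape.inv]
      split_ifs with h1 h2
      · subst h1; exact .inl (.turn_cap _)
      · subst h2; exact .inr (.turn_cap _)
      · exact .inl (.turn_off i j h1 h2)
    | top j =>
      simp only [Shape.inv]
      split_ifs with h1 h2
      · subst h1; exact .inl (.turn_cup _)
      · subst h2; exact .inr (.turn_cup _)
      · exact .inr (.turn_off i j h1 h2)

theorem Shape.inv_inv (S : Shape) (e : SliceEnd) : S.inv (S.inv e) = e := by
  rcases S.joins_inv e with h | h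
  · exact h.inv_eq'
  · exact h.inv_eq

/-- The end exists in a slice with `m` strands below and `n` strands above. -/
def SliceEnd.Valid (m n : ℕ) : SliceEnd → Prop
  | .bot j => j < m
  | .top j => j < n

/-- With all strands directed up or down alternatingly, the ends at which strands enter. -/
def SliceEnd.Entry (k : ℕ) : SliceEnd → Prop
  | .bot j => Even (j + k)
  | .top j => ¬ Even (j + k)

/-- The shape can be inserted between levels with `m` and `n` strands. -/
def Shape.Fits : Shape → ℕ → ℕ → Prop
  | .id, m, n => n = m
  | .cup i, m, n => i ≤ m ∧ n = m + 2
  | .cap i, m, n => i + 2 ≤ m ∧ m = n + 2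
  | .swap i, m, n => i + 2 ≤ m ∧ n = m
  | .turn i, m, n => i + 2 ≤ m ∧ n = m

theorem Slice.Fits.resolve {σ : Slice} {m n : ℕ} (hf : σ.Fits m n) (u : Bool) :
    (σ.resolve u).Fits m n := by
  cases σ with
  | cross i p =>
    cases p <;> cases u
    exacts [hf, hf.2, hf.2, hf]
  | _ => exact hf

theorem Shape.inv_valid {S : Shape} {m n : ℕ} (hf : S.Fits m n) {e : SliceEnd}
    (he : e.Valid m n) : (S.inv e).Valid m n := by
  cases S <;> cases e <;> simp only [Shape.Fits, SliceEnd.Valid] at hf he <;>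
    simp only [Shape.inv] <;> (repeat' split) <;> simp only [SliceEnd.Valid] <;> omega

/-- An arc between two levels preserves the parity of the position, and an arc within a level joins
neighbouring positions. So the alternating directions orient every resolution coherently, whichever
crossings are changed. A `swap` moves strands by one position, which is why only resolved slices are
admitted. -/
theorem Shape.inv_entry (σ : Slice) (u : Bool) (k : ℕ) (e : SliceEnd) :
    ((σ.resolve u).inv e).Entry k ↔ ¬ e.Entry k := by
  have key : ∀ S : Shape, (∀ i, S ≠ .swap i) → ((S.inv e).Entry k ↔ ¬ e.Entry k) := by
    intro S h
    cases S with
    | swap i => exact absurd rfl (h i)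
    | id => cases e <;> simp [Shape.inv, SliceEnd.Entry]
    | cup i =>
      cases e <;> simp only [Shape.inv] <;> split_ifs <;>
        simp only [SliceEnd.Entry, Nat.even_iff] <;> omega
    | cap i =>
      cases e <;> simp only [Shape.inv] <;> split_ifs <;>
        simp only [SliceEnd.Entry, Nat.even_iff] <;> omega
    | turn i =>
      cases e <;> simp only [Shape.inv] <;> split_ifs <;>
        simp only [SliceEnd.Entry, Nat.even_iff] <;> omega
  apply key
  intro i
  cases σ with
  | cross j p => cases p <;> cases u <;> simp [Slice.resolve]
  | _ => simp [Slice.resolve]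

end LeeKh

namespace LeeKh

/-! ## Colourings -/

/-- A colouring of the points of a diagram, given by level and position. The colour `true` stands
for the idempotent proportional to `a`, the colour `false` for the one proportional to `b`. -/
abbrev Coloring : Type := ℕ → ℕ → Bool

/-- The colour of an end, if the levels below and above are coloured by `x` and `y`. -/
def SliceEnd.val (x y : ℕ → Bool) : SliceEnd → Bool
  | .bot j => x j
  | .top j => y j

/-- The colours are constant along the arcs. -/
def Shape.Ok (S : Shape) (x y : ℕ → Bool) : Prop := ∀ e f, S.Joins e f → e.val x y = f.val x y

namespace Diagram

variable {N : ℕ}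

/-- The number of strands at level `n`. -/
def wd (L : Diagram N) (n : ℕ) : ℕ := if h : n < N + 1 then L.width ⟨n, h⟩ else 0

theorem wd_fin (L : Diagram N) (n : Fin (N + 1)) : L.wd n = L.width n := by
  simp [wd, n.2]

theorem Point.lt_wd {L : Diagram N} (p : L.Point) : (p.2 : ℕ) < L.wd p.1 := by
  rw [wd_fin]; exact p.2.2

theorem exists_point (L : Diagram N) {n j : ℕ} (h : j < L.wd n) :
    ∃ p : L.Point, (p.1 : ℕ) = n ∧ (p.2 : ℕ) = j := by
  unfold wd at h
  split_ifs at h with h1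
  · exact ⟨⟨⟨n, h1⟩, ⟨j, h⟩⟩, rfl, rfl⟩
  · omega

theorem Point.ext' {L : Diagram N} {p q : L.Point} (h1 : (p.1 : ℕ) = q.1)
    (h2 : (p.2 : ℕ) = q.2) : p = q := by
  obtain ⟨n, j⟩ := p
  obtain ⟨m, k⟩ := q
  obtain rfl : n = m := Fin.ext h1
  obtain rfl : j = k := Fin.ext h2
  rfl

theorem wd_castSucc (L : Diagram N) (t : Fin N) : L.wd t = L.width t.castSucc :=
  L.wd_fin t.castSucc

theorem wd_succ (L : Diagram N) (t : Fin N) : L.wd (t + 1) = L.width t.succ := by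
  have := L.wd_fin t.succ
  rwa [Fin.val_succ] at this

theorem fits' (L : Diagram N) (t : Fin N) : (L.slice t).Fits (L.wd t) (L.wd (t + 1)) := by
  rw [wd_castSucc, wd_succ]; exact L.fits t

/-- The resolution of slice `t` at the vertex `V`. -/
def shapeAt (L : Diagram N) (V : Finset (Fin N)) (t : Fin N) : Shape :=
  (L.slice t).resolve (decide (t ∈ V))

theorem IsEnd.valid {L : Diagram N} {t : Fin N} {e : SliceEnd} {p : L.Point}
    (h : L.IsEnd t e p) : e.Valid (L.wd t) (L.wd (t + 1)) := by
  have := p.lt_wd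
  cases e <;> obtain ⟨h1, h2⟩ := h <;> simpa [SliceEnd.Valid, h1, h2] using this

theorem IsEnd.val {L : Diagram N} {t : Fin N} {e : SliceEnd} {p : L.Point}
    (h : L.IsEnd t e p) (c : Coloring) : e.val (c t) (c (t + 1)) = c p.1 p.2 := by
  cases e <;> obtain ⟨h1, h2⟩ := h <;> simp [SliceEnd.val, h1, h2]

theorem exists_isEnd (L : Diagram N) (t : Fin N) {e : SliceEnd}
    (h : e.Valid (L.wd t) (L.wd (t + 1))) : ∃ p, L.IsEnd t e p := by
  cases e <;> obtain ⟨p, h1, h2⟩ := L.exists_point h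
  · exact ⟨p, Fin.ext h1, h2⟩
  · exact ⟨p, Fin.ext h1, h2⟩

theorem IsEnd.unique {L : Diagram N} {t : Fin N} {e : SliceEnd} {p q : L.Point}
    (h : L.IsEnd t e p) (h' : L.IsEnd t e q) : p = q := by
  cases e <;> obtain ⟨h1, h2⟩ := h <;> obtain ⟨h1', h2'⟩ := h' <;>
    exact Point.ext' (by rw [h1, h1']) (by rw [h2, h2'])

theorem Vertex.adj_iff {L : Diagram N} (v : L.Vertex) {p q : L.Point} :
    L.Adj (fun t => (L.slice t).resolve (decide (t ∈ v.1))) p q ↔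
      ∃ t e f, (L.shapeAt v.1 t).Joins e f ∧ L.IsEnd t e p ∧ L.IsEnd t f q := Iff.rfl

/-- `c` is a colouring of the circles of the resolution `V`. -/
structure Comp (L : Diagram N) (V : Finset (Fin N)) (c : Coloring) : Prop where
  cross : ∀ t ∈ V, (L.slice t).IsCross
  supp : ∀ n j, c n j = true → j < L.wd n
  ok : ∀ t : Fin N, (L.shapeAt V t).Ok (c t) (c (t + 1))

theorem circle_inv (L : Diagram N) (v : L.Vertex) {t : Fin N} {e : SliceEnd} {p q : L.Point}
    (hp : L.IsEnd t e p) (hq : L.IsEnd t ((L.shapeAt v.1 t).inv e) q) :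
    L.circle v p = L.circle v q := by
  rcases (L.shapeAt v.1 t).joins_inv e with h | h
  · exact Quot.sound ⟨t, _, _, h, hp, hq⟩
  · exact (Quot.sound ⟨t, _, _, h, hq, hp⟩).symm

theorem circle_joins (L : Diagram N) (v : L.Vertex) {t : Fin N} {e f : SliceEnd} {p q : L.Point}
    (h : (L.shapeAt v.1 t).Joins e f) (hp : L.IsEnd t e p) (hq : L.IsEnd t f q) :
    L.circle v p = L.circle v q :=
  Quot.sound ⟨t, _, _, h, hp, hq⟩

theorem Comp.circle_eq {L : Diagram N} {v : L.Vertex} {c : Coloring} (hc : L.Comp v.1 c)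
    {p q : L.Point} (h : L.circle v p = L.circle v q) : c p.1 p.2 = c q.1 q.2 := by
  let F : L.Circle v → Bool := Quot.lift (fun p => c p.1 p.2) (by
    rintro p q ⟨t, e, f, h, hp, hq⟩
    rw [← hp.val c, ← hq.val c]
    exact hc.ok t e f h)
  exact congrArg F h

/-- The colour of a circle. -/
noncomputable def colorOf {L : Diagram N} {v : L.Vertex} (c : Coloring) (C : L.Circle v) : Bool :=
  c (Quot.out C).1 (Quot.out C).2

theorem circle_out {L : Diagram N} {v : L.Vertex} (C : L.Circle v) :
    L.circle v (Quot.out C) = C := Quot.out_eq C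

theorem Comp.colorOf_circle {L : Diagram N} {v : L.Vertex} {c : Coloring} (hc : L.Comp v.1 c)
    (p : L.Point) : colorOf c (L.circle v p) = c p.1 p.2 :=
  hc.circle_eq (circle_out _)

open scoped Classical in
/-- The colouring of the points given by a colouring of the circles. -/
noncomputable def ofCircle {L : Diagram N} {v : L.Vertex} (y : L.Circle v → Bool) : Coloring :=
  fun n j => if h : ∃ p : L.Point, (p.1 : ℕ) = n ∧ (p.2 : ℕ) = j then y (L.circle v h.choose)
    else false

theorem ofCircle_point {L : Diagram N} {v : L.Vertex} (y : L.Circle v → Bool) (p : L.Point) :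
    ofCircle y p.1 p.2 = y (L.circle v p) := by
  have h : ∃ q : L.Point, (q.1 : ℕ) = p.1 ∧ (q.2 : ℕ) = p.2 := ⟨p, rfl, rfl⟩
  rw [ofCircle, dif_pos h]
  congr 2
  exact Point.ext' h.choose_spec.1 h.choose_spec.2

theorem ofCircle_of_not {L : Diagram N} {v : L.Vertex} (y : L.Circle v → Bool) {n j : ℕ}
    (h : ¬ j < L.wd n) : ofCircle y n j = false := by
  rw [ofCircle, dif_neg]
  rintro ⟨p, rfl, rfl⟩
  exact h p.lt_wd

theorem comp_ofCircle {L : Diagram N} {v : L.Vertex} (y : L.Circle v → Bool) :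
    L.Comp v.1 (ofCircle y) where
  cross := v.2
  supp n j h := by
    by_contra h'
    rw [ofCircle_of_not y h'] at h
    exact absurd h (by simp)
  ok t e f h := by
    have hfit : (L.shapeAt v.1 t).Fits (L.wd t) (L.wd (t + 1)) := (L.fits' t).resolve _
    by_cases he : e.Valid (L.wd t) (L.wd (t + 1))
    · have hf := Shape.inv_valid hfit he
      rw [h.inv_eq] at hf
      obtain ⟨p, hp⟩ := L.exists_isEnd t he
      obtain ⟨q, hq⟩ := L.exists_isEnd t hf
      rw [hp.val, hq.val, ofCircle_point, ofCircle_point, L.circle_joins v h hp hq]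
    -- The arcs of a shape continue beyond the width of the diagram. There both ends of an arc are
    -- outside together, and both have the default colour `false`.
    · have hf : ¬ f.Valid (L.wd t) (L.wd (t + 1)) := by
        intro hf
        have := Shape.inv_valid hfit hf
        rw [h.inv_eq'] at this
        exact he this
      have key : ∀ e : SliceEnd, ¬ e.Valid (L.wd t) (L.wd (t + 1)) →
          e.val (ofCircle y t) (ofCircle y (t + 1)) = false := by
        intro e he
        cases e <;> exact ofCircle_of_not y he
      rw [key e he, key f hf]

/-- Colourings are functions on all levels and positions, so that those of different diagrams can be
compared as functions. The condition `supp` fixes the default colour off the diagram, so nothing but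
the colours of points matters. -/
theorem Comp.ext_points {L : Diagram N} {V V' : Finset (Fin N)} {c d : Coloring}
    (hc : L.Comp V c) (hd : L.Comp V' d) (h : ∀ p : L.Point, c p.1 p.2 = d p.1 p.2) : c = d := by
  funext n j
  by_cases hj : j < L.wd n
  · obtain ⟨p, rfl, rfl⟩ := L.exists_point hj
    exact h p
  · have h1 : c n j = false := by
      by_contra h'
      exact hj (hc.supp n j (by simpa using h'))
    have h2 : d n j = false := by
      by_contra h'
      exact hj (hd.supp n j (by simpa using h'))
    rw [h1, h2]

theorem Comp.ofCircle_colorOf {L : Diagram N} {v : L.Vertex} {c : Coloring} (hc : L.Comp v.1 c) :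
    ofCircle (fun C : L.Circle v => colorOf c C) = c := by
  apply Comp.ext_points (comp_ofCircle _) hc
  intro p
  rw [ofCircle_point, hc.colorOf_circle]

theorem colorOf_ofCircle {L : Diagram N} {v : L.Vertex} (y : L.Circle v → Bool) (C : L.Circle v) :
    colorOf (ofCircle y) C = y C := by
  rw [colorOf, ofCircle_point, circle_out]

/-- The points `(n, j)` and `(m, k)` lie on the same circle of the resolution `V`. -/
def Same (L : Diagram N) (V : Finset (Fin N)) (n j m k : ℕ) : Prop :=
  ∀ c, L.Comp V c → c n j = c m k

/-- The colouring that is `true` on just one circle separates it from the others. In contrast to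
`circle`, the relation `Same` mentions only levels and positions and can be transported between
diagrams. -/
theorem circle_eq_iff_same {L : Diagram N} (v : L.Vertex) {p q : L.Point} :
    L.circle v p = L.circle v q ↔ L.Same v.1 p.1 p.2 q.1 q.2 := by
  constructor
  · exact fun h c hc => hc.circle_eq h
  · intro h
    classical
    have := h _ (comp_ofCircle fun C : L.Circle v => decide (C = L.circle v p))
    rw [ofCircle_point, ofCircle_point] at this
    simpa [eq_comm] using this

/-! ## Circles of neighbouring resolutions -/

/-- If all strands are directed alternatingly, then `q` follows `p`. -/
def Next (L : Diagram N) (V : Finset (Fin N)) (k : ℕ) (p q : L.Point) : Prop :=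
  ∃ t e, SliceEnd.Entry k e ∧ L.IsEnd t e p ∧ L.IsEnd t ((L.shapeAt V t).inv e) q

theorem isEnd_entry_unique {L : Diagram N} {k : ℕ} {t t' : Fin N} {e e' : SliceEnd} {p : L.Point}
    (h : L.IsEnd t e p) (h' : L.IsEnd t' e' p) (he : e.Entry k ↔ e'.Entry k) :
    t = t' ∧ e = e' := by
  cases e <;> cases e' <;> obtain ⟨h1, h2⟩ := h <;> obtain ⟨h1', h2'⟩ := h' <;>
    simp only [SliceEnd.Entry, ← h2, ← h2'] at he ⊢
  · rw [h1] at h1'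
    exact ⟨by simpa using h1', trivial⟩
  · tauto
  · tauto
  · rw [h1] at h1'
    exact ⟨by simpa using h1', trivial⟩

/-- The first and the last level are empty, so a strand directed upwards always has a slice above it
and one directed downwards has a slice below it. -/
theorem exists_next (L : Diagram N) (V : Finset (Fin N)) (k : ℕ) (p : L.Point) :
    ∃ q, L.Next V k p q := by
  have hp := p.lt_wd
  have key : ∃ t e, SliceEnd.Entry k e ∧ L.IsEnd t e p := by
    by_cases hk : Even ((p.2 : ℕ) + k)
    · have hn : p.1 ≠ Fin.last N := by
        intro h
        rw [wd_fin] at hp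
        have := L.width_last
        rw [← h] at this
        omega
      have hlt : (p.1 : ℕ) < N := by
        have := Fin.val_ne_of_ne hn
        have := p.1.2
        simp only [Fin.val_last] at *
        omega
      exact ⟨⟨p.1, hlt⟩, .bot p.2, hk, Fin.ext rfl, rfl⟩
    · have hn : p.1 ≠ 0 := by
        intro h
        rw [wd_fin] at hp
        have := L.width_first
        rw [← h] at this
        omega
      obtain ⟨t, ht⟩ := Fin.exists_succ_eq.2 hn
      exact ⟨t, .top p.2, hk, ht.symm, rfl⟩
  obtain ⟨t, e, h1, h2⟩ := key
  obtain ⟨q, hq⟩ := L.exists_isEnd t (Shape.inv_valid ((L.fits' t).resolve (decide (t ∈ V))) h2.valid)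
  exact ⟨q, t, e, h1, h2, hq⟩

theorem Next.unique {L : Diagram N} {V : Finset (Fin N)} {k : ℕ} {p q q' : L.Point}
    (h : L.Next V k p q) (h' : L.Next V k p q') : q = q' := by
  obtain ⟨t, e, h1, h2, h3⟩ := h
  obtain ⟨t', e', h1', h2', h3'⟩ := h'
  obtain ⟨rfl, rfl⟩ := isEnd_entry_unique h2 h2' (iff_of_true h1 h1')
  exact h3.unique h3'

theorem Next.unique' {L : Diagram N} {V : Finset (Fin N)} {k : ℕ} {p p' q : L.Point}
    (h : L.Next V k p q) (h' : L.Next V k p' q) : p = p' := by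
  obtain ⟨t, e, h1, h2, h3⟩ := h
  obtain ⟨t', e', h1', h2', h3'⟩ := h'
  have hh : ((L.shapeAt V t).inv e).Entry k ↔ ((L.shapeAt V t').inv e').Entry k := by
    unfold shapeAt
    rw [Shape.inv_entry, Shape.inv_entry]
    tauto
  obtain ⟨rfl, h⟩ := isEnd_entry_unique h3 h3' hh
  have := congrArg (L.shapeAt V t).inv h
  rw [Shape.inv_inv, Shape.inv_inv] at this
  subst this
  exact h2.unique h2'

/-- The permutation that runs along the circles in the alternating directions. -/
noncomputable def nextPerm (L : Diagram N) (V : Finset (Fin N)) (k : ℕ) : Equiv.Perm L.Point :=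
  Equiv.ofBijective (fun p => (L.exists_next V k p).choose) (Finite.injective_iff_bijective.1 (by
    intro p p' h
    have h1 := (L.exists_next V k p).choose_spec
    have h2 := (L.exists_next V k p').choose_spec
    simp only at h
    rw [← h] at h2
    exact h1.unique' h2))

theorem next_nextPerm (L : Diagram N) (V : Finset (Fin N)) (k : ℕ) (p : L.Point) :
    L.Next V k p (L.nextPerm V k p) := (L.exists_next V k p).choose_spec

theorem Next.eq {L : Diagram N} {V : Finset (Fin N)} {k : ℕ} {p q : L.Point}
    (h : L.Next V k p q) : L.nextPerm V k p = q := (L.next_nextPerm V k p).unique h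

/-- Each arc is run through once, from its entry to its exit, so the cycles of the permutation are
the circles of the resolution. This turns statements about circles into statements about
permutations. -/
theorem sameCycle_iff {L : Diagram N} (v : L.Vertex) (k : ℕ) {p q : L.Point} :
    (L.nextPerm v.1 k).SameCycle p q ↔ L.circle v p = L.circle v q := by
  constructor
  · intro h
    obtain ⟨m, rfl⟩ := h.exists_nat_pow_eq
    induction m with
    | zero => rfl
    | succ m ih =>
      rw [ih (by exact ⟨m, by simp⟩), pow_succ', Equiv.Perm.mul_apply]
      obtain ⟨t, e, h1, h2, h3⟩ := L.next_nextPerm v.1 k (((L.nextPerm v.1 k) ^ m) p)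
      exact L.circle_inv v h2 h3
  · intro h
    let F : L.Circle v → Prop := Quot.lift (fun q => (L.nextPerm v.1 k).SameCycle p q) (by
      rintro a b ⟨t, e, f, h, ha, hb⟩
      have hab : L.Next v.1 k a b ∨ L.Next v.1 k b a := by
        by_cases he : e.Entry k
        · left
          refine ⟨t, e, he, ha, ?_⟩
          have := h.inv_eq
          unfold shapeAt
          rwa [this]
        · right
          refine ⟨t, f, ?_, hb, ?_⟩
          · have := Shape.inv_entry (L.slice t) (decide (t ∈ v.1)) k f
            rw [h.inv_eq'] at this
            tauto
          · have := h.inv_eq'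
            unfold shapeAt
            rwa [this]
      have hs : (L.nextPerm v.1 k).SameCycle a b := by
        rcases hab with h | h
        · exact ⟨1, by simpa using h.eq⟩
        · exact Equiv.Perm.SameCycle.symm ⟨1, by simpa using h.eq⟩
      exact propext ⟨fun h => h.trans hs, fun h => h.trans hs.symm⟩)
    have h2 : F (L.circle v p) := Equiv.Perm.SameCycle.refl _ _
    rw [h] at h2
    exact h2

end Diagram

end LeeKh

namespace LeeKh

/-! ## Flipping the resolution of one crossing -/

/-- If two classes of `R` are merged in `R'` and all others remain the same, then the classes of
`R'` correspond to those of `R` except one. -/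
theorem exists_merge {P M : Type*} [CommMonoid M] (R R' : P → P → Prop) (x y : P)
    [Fintype (Quot R)] [Fintype (Quot R')]
    (h1 : ∀ p q, R p q → Quot.mk R' p = Quot.mk R' q)
    (h2 : ∀ p q, R' p q → Quot.mk R p = Quot.mk R q ∨
      (Quot.mk R p = Quot.mk R x ∨ Quot.mk R p = Quot.mk R y) ∧
      (Quot.mk R q = Quot.mk R x ∨ Quot.mk R q = Quot.mk R y))
    (hxy : Quot.mk R' x = Quot.mk R' y) (hne : Quot.mk R x ≠ Quot.mk R y) :
    ∃ h : Quot R' → Quot R,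
      (∀ p, Quot.mk R p ≠ Quot.mk R y → h (Quot.mk R' p) = Quot.mk R p) ∧
      (∀ p, Quot.mk R p = Quot.mk R y → h (Quot.mk R' p) = Quot.mk R x) ∧
      (∀ p q, Quot.mk R p = Quot.mk R q → Quot.mk R' p = Quot.mk R' q) ∧
      ∀ F : Quot R → M, ∏ C, F C = F (Quot.mk R y) * ∏ C', F (h C') := by
  classical
  let g : P → Quot R := fun p => if Quot.mk R p = Quot.mk R y then Quot.mk R x else Quot.mk R p
  have hg : ∀ p q, R' p q → g p = g q := by
    intro p q h
    simp only [g]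
    rcases h2 p q h with h | ⟨h, h'⟩
    · rw [h]
    · rcases h with h | h <;> rcases h' with h' | h' <;> simp [h, h', hne]
  let h : Quot R' → Quot R := Quot.lift g hg
  let π : Quot R → Quot R' := Quot.lift (Quot.mk R') h1
  have hπ : ∀ p, π (Quot.mk R p) = Quot.mk R' p := fun p => rfl
  have hh : ∀ p, h (Quot.mk R' p) = g p := fun p => rfl
  have hπh : ∀ C, π (h C) = C := by
    intro C
    obtain ⟨p, rfl⟩ := Quot.exists_rep C
    rw [hh]
    simp only [g]
    split_ifs with hp
    · rw [hπ, hxy, ← hπ y, ← hp, hπ]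
    · rfl
  have hinj : Function.Injective h := Function.LeftInverse.injective hπh
  have hny : ∀ C, h C ≠ Quot.mk R y := by
    intro C
    obtain ⟨p, rfl⟩ := Quot.exists_rep C
    rw [hh]
    simp only [g]
    split_ifs with hp
    · exact hne
    · exact hp
  have hgne : ∀ p, Quot.mk R p ≠ Quot.mk R y → h (Quot.mk R' p) = Quot.mk R p := by
    intro p hp
    rw [hh]
    simp only [g, if_neg hp]
  refine ⟨h, hgne, ?_, fun p q hpq => congrArg π hpq, ?_⟩
  · intro p hp
    rw [hh]
    simp only [g, if_pos hp]
  · intro F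
    rw [← Finset.mul_prod_erase Finset.univ F (Finset.mem_univ (Quot.mk R y))]
    congr 1
    symm
    refine Finset.prod_bij (fun C _ => h C) ?_ ?_ ?_ ?_
    · intro C _
      simpa using hny C
    · intro C _ D _ hCD
      exact hinj hCD
    · intro D hD
      obtain ⟨p, rfl⟩ := Quot.exists_rep D
      exact ⟨Quot.mk R' p, Finset.mem_univ _, hgne p (by simpa using hD)⟩
    · intro C _
      rfl

namespace Diagram

variable {N : ℕ}

/-- The top left end of the crossing in slice `t`. -/
def tl (L : Diagram N) (t : Fin N) (h : (L.slice t).IsCross) : L.Point :=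
  ⟨t.succ, ⟨(L.slice t).pos, by have := (h.lt (L.fits t)).2; omega⟩⟩

section Corners

variable {L : Diagram N} {t : Fin N} (h : (L.slice t).IsCross)

theorem isEnd_bl : L.IsEnd t (.bot (L.slice t).pos) (L.bl t h) := ⟨rfl, rfl⟩
theorem isEnd_br : L.IsEnd t (.bot ((L.slice t).pos + 1)) (L.br t h) := ⟨rfl, rfl⟩
theorem isEnd_tl : L.IsEnd t (.top (L.slice t).pos) (L.tl t h) := ⟨rfl, rfl⟩
theorem isEnd_tr : L.IsEnd t (.top ((L.slice t).pos + 1)) (L.tr t h) := ⟨rfl, rfl⟩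

theorem bl_ne_tr : L.bl t h ≠ L.tr t h := by
  intro h'
  have := congrArg (fun p : L.Point => (p.1 : ℕ)) h'
  simp [bl, tr] at this

include h in
theorem shapeAt_cases (V : Finset (Fin N)) :
    L.shapeAt V t = .id ∨ L.shapeAt V t = .turn (L.slice t).pos := by
  obtain ⟨i, p, hip⟩ := h
  unfold shapeAt
  rw [hip]
  cases p <;> cases decide (t ∈ V) <;> simp [Slice.resolve, Slice.pos]

include h in
theorem shapeAt_flip {V V' : Finset (Fin N)} (hV : t ∉ V) (hV' : t ∈ V') :
    (L.shapeAt V t = .id ∧ L.shapeAt V' t = .turn (L.slice t).pos) ∨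
      (L.shapeAt V t = .turn (L.slice t).pos ∧ L.shapeAt V' t = .id) := by
  obtain ⟨i, p, hip⟩ := h
  unfold shapeAt
  rw [hip]
  cases p <;> simp [Slice.resolve, Slice.pos, hV, hV']

theorem shapeAt_congr {V V' : Finset (Fin N)} {s : Fin N} (hs : s ∈ V ↔ s ∈ V') :
    L.shapeAt V s = L.shapeAt V' s := by
  unfold shapeAt
  simp only [hs]

/-- Both resolutions separate `bl` from `tr` locally: each of the two arcs at the crossing ends in
exactly one of these corners, whether the arcs are vertical or turned. -/
theorem circle_corner (v : L.Vertex) {e : SliceEnd} {p : L.Point} (hp : L.IsEnd t e p)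
    (he : e = .bot (L.slice t).pos ∨ e = .bot ((L.slice t).pos + 1) ∨ e = .top (L.slice t).pos ∨
      e = .top ((L.slice t).pos + 1)) :
    L.circle v p = L.circle v (L.bl t h) ∨ L.circle v p = L.circle v (L.tr t h) := by
  rcases shapeAt_cases h v.1 with hs | hs
  · rcases he with rfl | rfl | rfl | rfl
    · left; rw [hp.unique (isEnd_bl h)]
    · right
      exact L.circle_joins v (by rw [hs]; exact .id _) hp (isEnd_tr h)
    · left
      exact (L.circle_joins v (by rw [hs]; exact .id _) (isEnd_bl h) hp).symm
    · right; rw [hp.unique (isEnd_tr h)]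
  · rcases he with rfl | rfl | rfl | rfl
    · left; rw [hp.unique (isEnd_bl h)]
    · left
      exact (L.circle_joins v (by rw [hs]; exact .turn_cap _) (isEnd_bl h) hp).symm
    · right
      exact L.circle_joins v (by rw [hs]; exact .turn_cup _) hp (isEnd_tr h)
    · right; rw [hp.unique (isEnd_tr h)]

theorem circle_flip (v v' : L.Vertex) (hoff : ∀ s ≠ t, (s ∈ v.1 ↔ s ∈ v'.1)) {p q : L.Point}
    (hpq : L.Adj (fun t => (L.slice t).resolve (decide (t ∈ v.1))) p q) :
    L.circle v' p = L.circle v' q ∨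
      (L.circle v' p = L.circle v' (L.bl t h) ∨ L.circle v' p = L.circle v' (L.tr t h)) ∧
      (L.circle v' q = L.circle v' (L.bl t h) ∨ L.circle v' q = L.circle v' (L.tr t h)) := by
  obtain ⟨s, e, f, hj, hp, hq⟩ := (Vertex.adj_iff v).1 hpq
  by_cases hst : s = t
  · subst hst
    by_cases hc : ∃ j, j ≠ (L.slice s).pos ∧ j ≠ (L.slice s).pos + 1 ∧ e = .bot j ∧ f = .top j
    · obtain ⟨j, h1, h2, rfl, rfl⟩ := hc
      left
      apply L.circle_joins v' _ hp hq
      rcases shapeAt_cases h v'.1 with hs | hs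
      · rw [hs]; exact .id _
      · rw [hs]; exact .turn_off _ _ h1 h2
    · right
      rcases shapeAt_cases h v.1 with hs | hs <;> rw [hs] at hj <;> cases hj
      · rename_i j
        have : j = (L.slice s).pos ∨ j = (L.slice s).pos + 1 := by
          by_contra hcon
          exact hc ⟨j, by tauto, by tauto, rfl, rfl⟩
        refine ⟨circle_corner h v' hp ?_, circle_corner h v' hq ?_⟩ <;>
          rcases this with rfl | rfl <;> simp
      · rename_i j h1 h2
        exact absurd ⟨j, h1, h2, rfl, rfl⟩ hc
      · exact ⟨circle_corner h v' hp (by simp), circle_corner h v' hq (by simp)⟩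
      · exact ⟨circle_corner h v' hp (by simp), circle_corner h v' hq (by simp)⟩
  · left
    rw [shapeAt_congr (hoff s hst)] at hj
    exact L.circle_joins v' hj hp hq

/-- By `hk` the strands enter the crossing at `bl` and `tr`. Vertical arcs lead `bl` to `tl` and
`tr` to `br`, turned ones lead `bl` to `br` and `tr` to `tl`; so just two values of the permutation
are exchanged. -/
theorem nextPerm_turn {V W : Finset (Fin N)} {k : ℕ} (hk : Even ((L.slice t).pos + k))
    (hV : L.shapeAt V t = .id) (hW : L.shapeAt W t = .turn (L.slice t).pos)
    (hoff : ∀ s ≠ t, (s ∈ V ↔ s ∈ W)) [DecidableEq L.Point] :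
    L.nextPerm W k = L.nextPerm V k * Equiv.swap (L.bl t h) (L.tr t h) := by
  have hk' : ¬ Even ((L.slice t).pos + 1 + k) := by
    rw [Nat.even_iff] at *; omega
  ext1 p
  apply Next.eq
  rw [Equiv.Perm.mul_apply]
  by_cases h1 : p = L.bl t h
  · rw [h1, Equiv.swap_apply_left]
    have : L.Next V k (L.tr t h) (L.br t h) :=
      ⟨t, .top ((L.slice t).pos + 1), hk', isEnd_tr h, by rw [hV]; exact isEnd_br h⟩
    rw [this.eq]
    exact ⟨t, .bot (L.slice t).pos, hk, isEnd_bl h, by rw [hW]; simpa [Shape.inv] using isEnd_br h⟩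
  by_cases h2 : p = L.tr t h
  · rw [h2, Equiv.swap_apply_right]
    have : L.Next V k (L.bl t h) (L.tl t h) :=
      ⟨t, .bot (L.slice t).pos, hk, isEnd_bl h, by rw [hV]; exact isEnd_tl h⟩
    rw [this.eq]
    exact ⟨t, .top ((L.slice t).pos + 1), hk', isEnd_tr h, by rw [hW]; simpa [Shape.inv] using isEnd_tl h⟩
  rw [Equiv.swap_apply_of_ne_of_ne h1 h2]
  obtain ⟨s, e, he, hp, hq⟩ := L.next_nextPerm V k p
  refine ⟨s, e, he, hp, ?_⟩
  by_cases hst : s = t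
  · subst hst
    rw [hV] at hq
    rw [hW]
    cases e with
    | bot j =>
      have ha : j ≠ (L.slice s).pos := by
        rintro rfl; exact h1 (hp.unique (isEnd_bl h))
      have hb : j ≠ (L.slice s).pos + 1 := by
        rintro rfl; exact hk' he
      simpa [Shape.inv, ha, hb] using hq
    | top j =>
      have ha : j ≠ (L.slice s).pos + 1 := by
        rintro rfl; exact h2 (hp.unique (isEnd_tr h))
      have hb : j ≠ (L.slice s).pos := by
        rintro rfl; exact he hk
      simpa [Shape.inv, ha, hb] using hq
  · rwa [← shapeAt_congr (hoff s hst)]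

/-- The two permutations differ by the transposition of `bl` and `tr`, so one of them has these
points on one cycle and the other on two. Thus an edge of the cube always merges two circles or
splits one. Planarity enters through the alternating directions. -/
theorem circle_flip_iff (v v' : L.Vertex) (hv : t ∉ v.1) (hv' : t ∈ v'.1)
    (hoff : ∀ s ≠ t, (s ∈ v.1 ↔ s ∈ v'.1)) :
    L.circle v' (L.bl t h) = L.circle v' (L.tr t h) ↔
      L.circle v (L.bl t h) ≠ L.circle v (L.tr t h) := by
  classical
  obtain ⟨k, hk⟩ : ∃ k, Even ((L.slice t).pos + k) := ⟨(L.slice t).pos, ⟨_, rfl⟩⟩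
  rcases shapeAt_flip h hv hv' with ⟨h1, h2⟩ | ⟨h1, h2⟩
  · rw [← sameCycle_iff v' k, Ne, ← sameCycle_iff v k, nextPerm_turn h hk h1 h2 hoff]
    exact sameCycle_mul_swap _ (bl_ne_tr h)
  · have := sameCycle_mul_swap (L.nextPerm v'.1 k) (bl_ne_tr h)
    rw [← nextPerm_turn h hk h2 h1 fun s hs => (hoff s hs).symm, sameCycle_iff v k,
      sameCycle_iff v' k] at this
    tauto

end Corners

end Diagram

end LeeKh

/-! ### Merges and splittings in terms of the two characters of `V` -/

namespace LeeKh

theorem Shape.ok_id {x y : ℕ → Bool} : Shape.id.Ok x y ↔ ∀ j, x j = y j := by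
  constructor
  · exact fun h j => h _ _ (.id j)
  · rintro h e f ⟨⟩
    exact h _

theorem Shape.ok_turn {i : ℕ} {x y : ℕ → Bool} : (Shape.turn i).Ok x y ↔
    x i = x (i + 1) ∧ y i = y (i + 1) ∧ ∀ j, j ≠ i → j ≠ i + 1 → x j = y j := by
  constructor
  · exact fun h => ⟨h _ _ (.turn_cap i), h _ _ (.turn_cup i),
      fun j h1 h2 => h _ _ (.turn_off i j h1 h2)⟩
  · rintro ⟨h1, h2, h3⟩ e f ⟨⟩
    exacts [h3 _ ‹_› ‹_›, h1, h2]

theorem Shape.ok_cap {i : ℕ} {x y : ℕ → Bool} : (Shape.cap i).Ok x y ↔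
    x i = x (i + 1) ∧ (∀ j < i, x j = y j) ∧ ∀ j, i ≤ j → x (j + 2) = y j := by
  constructor
  · exact fun h => ⟨h _ _ (.cap_arc i), fun j h1 => h _ _ (.cap_left i j h1),
      fun j h1 => h _ _ (.cap_right i j h1)⟩
  · rintro ⟨h1, h2, h3⟩ e f ⟨⟩
    exacts [h2 _ ‹_›, h3 _ ‹_›, h1]

/-- Each resolution joins `bl` and `tr` to the two remaining corners. If `bl` and `tr` have the same
colour, then both conditions say that all four corners have it. -/
theorem Shape.ok_id_iff_turn {i : ℕ} {x y : ℕ → Bool} (h : x i = y (i + 1)) :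
    Shape.id.Ok x y ↔ (Shape.turn i).Ok x y := by
  rw [ok_id, ok_turn]
  constructor
  · intro h'
    have := h' i
    have := h' (i + 1)
    exact ⟨by simp_all, by simp_all, fun j _ _ => h' j⟩
  · rintro ⟨h1, h2, h3⟩ j
    by_cases hj : j = i
    · subst hj; simp_all
    by_cases hj' : j = i + 1
    · subst hj'; simp_all
    exact h3 j hj hj'

namespace Diagram

variable {N : ℕ}

/-- The crossing in slice `t` has corners of a single colour. -/
def Mono (L : Diagram N) (c : Coloring) (t : Fin N) : Prop :=
  c t (L.slice t).pos = c (t + 1) ((L.slice t).pos + 1)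

/-- A monochromatic crossing can be resolved in either way without changing the colouring.
Conversely, a colouring which fits both resolutions is monochromatic there (`Comp.mono_iff`): the
vertical and the turned arcs together connect all four corners. -/
theorem Comp.flip {L : Diagram N} {V W : Finset (Fin N)} {c : Coloring} {t : Fin N}
    (hc : L.Comp V c) (ht : (L.slice t).IsCross) (hm : L.Mono c t)
    (hoff : ∀ s ≠ t, (s ∈ V ↔ s ∈ W)) : L.Comp W c where
  cross s hs := by
    by_cases hst : s = t
    · rwa [hst]
    · exact hc.cross s ((hoff s hst).2 hs)
  supp := hc.supp
  ok s := by
    by_cases hst : s = t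
    · subst hst
      have h1 := hc.ok s
      rcases shapeAt_cases ht V with hV | hV <;> rcases shapeAt_cases ht W with hW | hW <;>
        rw [hV] at h1 <;> rw [hW]
      · exact h1
      · exact (Shape.ok_id_iff_turn hm).1 h1
      · exact (Shape.ok_id_iff_turn hm).2 h1
      · exact h1
    · rw [← shapeAt_congr (hoff s hst)]
      exact hc.ok s

theorem Comp.mono_iff {L : Diagram N} {V W : Finset (Fin N)} {c : Coloring} {t : Fin N}
    (hc : L.Comp V c) (ht : (L.slice t).IsCross) (htV : t ∈ V) (htW : t ∉ W)
    (hoff : ∀ s ≠ t, (s ∈ V ↔ s ∈ W)) : L.Comp W c ↔ L.Mono c t := by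
  constructor
  · intro hW
    have h1 := hc.ok t
    have h2 := hW.ok t
    unfold Mono
    rcases shapeAt_flip ht htW htV with ⟨h3, h4⟩ | ⟨h3, h4⟩ <;> rw [h4] at h1 <;> rw [h3] at h2
    · rw [Shape.ok_turn] at h1
      rw [h1.1]
      exact Shape.ok_id.1 h2 _
    · rw [Shape.ok_turn] at h2
      rw [h2.1]
      exact Shape.ok_id.1 h1 _
  · exact fun h => hc.flip ht h hoff

/-! ## Coordinates with respect to colourings -/

/-- The value of `v_x` at `a` (`k = true`) or `b` (`k = false`), where `v₊` is the unit. -/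
def ev (k x : Bool) : ℚ := if k = false ∧ x = false then -1 else 1

open scoped Classical in
/-- The value of a state at a colouring of the circles of the resolution `V`. -/
noncomputable def weight (L : Diagram N) (V : Finset (Fin N)) (c : Coloring) (s : L.State) : ℚ :=
  if s.1.1 = V then ∏ C, ev (colorOf c C) (s.2 C) else 0

/-- The value of an element of `CKh'` at a colouring of the circles of the resolution `V`. -/
noncomputable def pair (L : Diagram N) (V : Finset (Fin N)) (c : Coloring) : L.CKh →ₗ[ℚ] ℚ :=
  Finsupp.linearCombination ℚ (L.weight V c)

theorem pair_single (L : Diagram N) (V : Finset (Fin N)) (c : Coloring) (s : L.State) (q : ℚ) :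
    L.pair V c (Finsupp.single s q) = q * L.weight V c s := by
  simp [pair]

theorem pair_ofCoeff_single {L L' : Diagram N} (k : L.State → L'.State → ℚ) (V : Finset (Fin N))
    (c : Coloring) (s : L.State) :
    L'.pair V c (ofCoeff k (Finsupp.single s 1)) = ∑ s', k s s' * L'.weight V c s' := by
  simp [ofCoeff, pair_single, map_sum]

open scoped Classical in
theorem sum_weight {L : Diagram N} (v : L.Vertex) (c : Coloring) (k : L.State → ℚ) :
    ∑ s, k s * L.weight v.1 c s =
      ∑ x : L.Circle v → Bool, k ⟨v, x⟩ * ∏ C, ev (colorOf c C) (x C) := by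
  have h1 : ∑ s, k s * L.weight v.1 c s =
      ∑ v' : L.Vertex, ∑ x : L.Circle v' → Bool, k ⟨v', x⟩ * L.weight v.1 c ⟨v', x⟩ := by
    rw [← Fintype.sum_sigma']
    convert rfl
  rw [h1, Finset.sum_eq_single v]
  · apply Finset.sum_congr rfl
    intro x _
    simp [weight]
  · intro v' _ hv'
    apply Finset.sum_eq_zero
    intro x _
    rw [weight, if_neg (fun h => hv' (Subtype.ext h)), mul_zero]
  · simp

/-- The factor by which an edge of the cube multiplies: merging preserves idempotents, splitting
multiplies by `2` or `-2` according to the colour. -/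
noncomputable def kap (L : Diagram N) (V : Finset (Fin N)) (t : Fin N) (c : Coloring) : ℚ :=
  open scoped Classical in
  if L.Same V t (L.slice t).pos (t + 1) ((L.slice t).pos + 1) then
    (if c t (L.slice t).pos = true then 2 else -2) else 1

theorem kap_ne_zero (L : Diagram N) (V : Finset (Fin N)) (t : Fin N) (c : Coloring) :
    L.kap V t c ≠ 0 := by
  unfold kap
  split_ifs <;> norm_num

/-- Two points are the ends of an arc in the resolution `v`. -/
def Arc (L : Diagram N) (v : L.Vertex) (p q : L.Point) : Prop :=
  L.Adj (fun t => (L.slice t).resolve (decide (t ∈ v.1))) p q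

noncomputable instance (L : Diagram N) (v : L.Vertex) : Fintype (Quot (L.Arc v)) :=
  inferInstanceAs (Fintype (L.Circle v))

section Saddle

variable {L : Diagram N} {t : Fin N} (h : (L.slice t).IsCross)

theorem same_corner_iff (v : L.Vertex) :
    L.Same v.1 t (L.slice t).pos (t + 1) ((L.slice t).pos + 1) ↔
      L.circle v (L.bl t h) = L.circle v (L.tr t h) := by
  rw [circle_eq_iff_same]
  simp [bl, tr]

theorem color_bl (c : Coloring) :
    c (L.bl t h).1 (L.bl t h).2 = c t (L.slice t).pos := rfl

theorem color_tr (c : Coloring) :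
    c (L.tr t h).1 (L.tr t h).2 = c (t + 1) ((L.slice t).pos + 1) := by
  simp [tr]

open scoped Classical in
/-- The matrix coefficient of a saddle. -/
noncomputable def saddleCoeff (L : Diagram N) (t : Fin N) (h : (L.slice t).IsCross)
    (s s' : L.State) : ℚ :=
  if t ∉ s.1.1 ∧ s'.1.1 = insert t s.1.1 ∧
      ∀ p, L.circle s.1 p ≠ L.circle s.1 (L.bl t h) → L.circle s.1 p ≠ L.circle s.1 (L.tr t h) →
        s'.label p = s.label p then
    if L.circle s.1 (L.bl t h) ≠ L.circle s.1 (L.tr t h) then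
      mulCoeff (s.label (L.bl t h)) (s.label (L.tr t h)) (s'.label (L.bl t h))
    else
      comulCoeff (s.label (L.bl t h)) (s'.label (L.bl t h)) (s'.label (L.tr t h))
  else 0

theorem saddle_eq : L.saddle t h = ofCoeff (L.saddleCoeff t h) := rfl

theorem exists_circle_merge (v w : L.Vertex) (hoff : ∀ s ≠ t, (s ∈ v.1 ↔ s ∈ w.1))
    (hw : L.circle w (L.bl t h) = L.circle w (L.tr t h))
    (hv : L.circle v (L.bl t h) ≠ L.circle v (L.tr t h)) :
    ∃ g : L.Circle w → L.Circle v,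
      (∀ p, L.circle v p ≠ L.circle v (L.tr t h) → g (L.circle w p) = L.circle v p) ∧
      (∀ p q, L.circle v p = L.circle v q → L.circle w p = L.circle w q) ∧
      ∀ F : L.Circle v → ℚ, ∏ C, F C = F (L.circle v (L.tr t h)) * ∏ C', F (g C') := by
  obtain ⟨g, h1, -, h2, h3⟩ := exists_merge (M := ℚ) (L.Arc v) (L.Arc w) (L.bl t h) (L.tr t h)
    (fun p q hpq => by
      rcases circle_flip h v w hoff hpq with h1 | ⟨h1, h2⟩
      · exact h1
      · change L.circle w p = L.circle w q
        rw [hw] at h1 h2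
        rw [or_self] at h1 h2
        rw [h1, h2])
    (fun p q hpq => circle_flip h w v (fun s hs => (hoff s hs).symm) hpq) hw hv
  exact ⟨g, h1, h2, h3⟩

open scoped Classical in
-- Merging is the multiplication of `V`, and `ev` is multiplicative. So the value of the product at
-- a colour is the product of the values of the two factors at this colour.
theorem sum_merge (v v' : L.Vertex) (hv : t ∉ v.1) (hv' : v'.1 = insert t v.1) {c : Coloring}
    (hc : L.Comp v'.1 c) (x : L.Circle v → Bool)
    (hne : L.circle v (L.bl t h) ≠ L.circle v (L.tr t h)) :
    ∑ x' : L.Circle v' → Bool, L.saddleCoeff t h ⟨v, x⟩ ⟨v', x'⟩ * ∏ C, ev (colorOf c C) (x' C) =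
      ∏ C, ev (colorOf c C) (x C) := by
  have hoff : ∀ s ≠ t, (s ∈ v.1 ↔ s ∈ v'.1) := by
    intro s hs
    rw [hv']
    simp [hs]
  have hblr := (circle_flip_iff h v v' hv (by simp [hv']) hoff).2 hne
  obtain ⟨g, hg1, hcoarse, hprod⟩ := exists_circle_merge h v v' hoff hblr hne
  have hm : L.Mono c t := by
    have := hc.circle_eq hblr
    rwa [color_bl h c, color_tr h c] at this
  have hcv : L.Comp v.1 c := hc.flip h hm fun s hs => (hoff s hs).symm
  -- The only labelling with a nonzero coefficient. Because `v₊` is the unit and `v₋² = v₊`, the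
  -- product of labels is given by the Boolean equality `==`.
  let x₀ : L.Circle v' → Bool := fun C' => if C' = L.circle v' (L.bl t h) then
    (x (L.circle v (L.bl t h)) == x (L.circle v (L.tr t h))) else x (g C')
  have hgoff : ∀ p, L.circle v p ≠ L.circle v (L.bl t h) → L.circle v p ≠ L.circle v (L.tr t h) →
      L.circle v' p ≠ L.circle v' (L.bl t h) := by
    intro p h1 h2 h3
    have := congrArg g h3
    rw [hg1 p h2, hg1 _ hne] at this
    exact h1 this
  rw [Fintype.sum_eq_single x₀]
  · have hco : L.saddleCoeff t h ⟨v, x⟩ ⟨v', x₀⟩ = 1 := by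
      have hcond : ∀ p, L.circle v p ≠ L.circle v (L.bl t h) →
          L.circle v p ≠ L.circle v (L.tr t h) → x₀ (L.circle v' p) = x (L.circle v p) := by
        intro p h1 h2
        simp only [x₀]
        rw [if_neg (hgoff p h1 h2), hg1 p h2]
      unfold saddleCoeff
      rw [if_pos ⟨hv, hv', hcond⟩, if_pos hne]
      simp only [State.label, x₀, if_pos]
      generalize x (L.circle v (L.bl t h)) = a
      generalize x (L.circle v (L.tr t h)) = b
      cases a <;> cases b <;> rfl
    rw [hco, one_mul, hprod, ← Finset.mul_prod_erase Finset.univ _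
      (Finset.mem_univ (L.circle v' (L.bl t h))), ← Finset.mul_prod_erase Finset.univ
      (fun C' => ev (colorOf c (g C')) (x (g C'))) (Finset.mem_univ (L.circle v' (L.bl t h))),
      ← mul_assoc]
    congr 1
    · simp only [x₀, if_pos, hg1 _ hne, hc.colorOf_circle, hcv.colorOf_circle]
      rw [color_bl h c, color_tr h c]
      unfold Mono at hm
      rw [← hm]
      generalize x (L.circle v (L.bl t h)) = a
      generalize x (L.circle v (L.tr t h)) = b
      generalize c t (L.slice t).pos = k
      cases a <;> cases b <;> cases k <;> simp [ev]
    · apply Finset.prod_congr rfl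
      intro C' hC'
      simp only [x₀]
      rw [if_neg (Finset.ne_of_mem_erase hC')]
      congr 1
      obtain ⟨p, rfl⟩ := Quot.exists_rep C'
      change colorOf c (L.circle v' p) = colorOf c (g (L.circle v' p))
      have h1 : L.circle v p ≠ L.circle v (L.tr t h) := by
        intro h1
        have := hcoarse _ _ h1
        rw [← hblr] at this
        exact Finset.ne_of_mem_erase hC' this
      rw [hg1 p h1, hc.colorOf_circle, hcv.colorOf_circle]
  · intro x' hx'
    rw [mul_eq_zero]
    left
    by_contra h0
    apply hx'
    unfold saddleCoeff at h0
    split_ifs at h0 with h1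
    · obtain ⟨-, -, h1⟩ := h1
      simp only [State.label] at h0 h1
      funext C'
      obtain ⟨p, rfl⟩ := Quot.exists_rep C'
      change x' (L.circle v' p) = x₀ (L.circle v' p)
      simp only [x₀]
      split_ifs with h2
      · rw [h2]
        revert h0
        generalize x (L.circle v (L.bl t h)) = a
        generalize x (L.circle v (L.tr t h)) = b
        generalize x' (L.circle v' (L.bl t h)) = z
        cases a <;> cases b <;> cases z <;> simp [mulCoeff]
      · have h3 : L.circle v p ≠ L.circle v (L.tr t h) := by
          intro h3
          have := hcoarse _ _ h3
          rw [← hblr] at this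
          exact h2 this
        have h4 : L.circle v p ≠ L.circle v (L.bl t h) := fun h4 => h2 (hcoarse _ _ h4)
        rw [h1 p h4 h3, hg1 p h3]
    · exact absurd rfl h0

open scoped Classical in
-- This is dual to `Δ'(a) = a ⊗ a` and `Δ'(b) = b ⊗ b`: after a splitting the two new circles can
-- only be seen with equal colours, and then the value is multiplied by `2` for `a` and by `-2` for
-- `b`.
theorem sum_split (v v' : L.Vertex) (hv : t ∉ v.1) (hv' : v'.1 = insert t v.1) {c : Coloring}
    (hc : L.Comp v'.1 c) (x : L.Circle v → Bool)
    (heq : L.circle v (L.bl t h) = L.circle v (L.tr t h)) :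
    ∑ x' : L.Circle v' → Bool, L.saddleCoeff t h ⟨v, x⟩ ⟨v', x'⟩ * ∏ C, ev (colorOf c C) (x' C) =
      if L.Mono c t then (if c t (L.slice t).pos = true then 2 else -2) *
        ∏ C, ev (colorOf c C) (x C) else 0 := by
  have hoff : ∀ s ≠ t, (s ∈ v.1 ↔ s ∈ v'.1) := by
    intro s hs
    rw [hv']
    simp [hs]
  have hne : L.circle v' (L.bl t h) ≠ L.circle v' (L.tr t h) := by
    intro h1
    exact (circle_flip_iff h v v' hv (by simp [hv']) hoff).1 h1 heq
  obtain ⟨g, hg1, hcoarse, hprod⟩ :=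
    exists_circle_merge h v' v (fun s hs => (hoff s hs).symm) heq hne
  -- `Δ'` of a basis vector has two summands. They are numbered by the label `b` of the circle
  -- through `bl`, and the label of the circle through `tr` is then determined.
  let X : Bool → L.Circle v' → Bool := fun b C' =>
    if C' = L.circle v' (L.bl t h) then b
    else if C' = L.circle v' (L.tr t h) then (b == !(x (L.circle v (L.bl t h))))
    else x (L.circle v (Quot.out C'))
  have hXoff : ∀ b p, L.circle v p ≠ L.circle v (L.bl t h) →
      X b (L.circle v' p) = x (L.circle v p) := by
    intro b p h1
    simp only [X]
    rw [if_neg fun h2 => h1 (hcoarse _ _ h2),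
      if_neg fun h2 => h1 ((hcoarse _ _ h2).trans heq.symm), hcoarse _ p (circle_out _)]
  have hXbl : ∀ b, X b (L.circle v' (L.bl t h)) = b := by
    intro b; simp [X]
  have hXtr : ∀ b, X b (L.circle v' (L.tr t h)) = (b == !(x (L.circle v (L.bl t h)))) := by
    intro b; simp [X, hne.symm]
  have hco : ∀ b, L.saddleCoeff t h ⟨v, x⟩ ⟨v', X b⟩ = 1 := by
    intro b
    unfold saddleCoeff
    rw [if_pos ⟨hv, hv', fun p h1 _ => hXoff b p h1⟩, if_neg (not_not.2 heq)]
    simp only [State.label, hXbl, hXtr]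
    generalize x (L.circle v (L.bl t h)) = a
    cases a <;> cases b <;> rfl
  have hpr : ∀ b, ∏ C, ev (colorOf c C) (X b C) =
      (ev (c (t + 1) ((L.slice t).pos + 1)) (b == !(x (L.circle v (L.bl t h)))) *
        ev (c t (L.slice t).pos) b) *
        ∏ C ∈ Finset.univ.erase (L.circle v (L.bl t h)), ev (colorOf c C) (x C) := by
    intro b
    rw [hprod, ← Finset.mul_prod_erase Finset.univ
      (fun C' => ev (colorOf c (g C')) (X b (g C'))) (Finset.mem_univ (L.circle v (L.bl t h))),
      ← mul_assoc]
    congr 1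
    · rw [hg1 _ hne, hXtr, hXbl, hc.colorOf_circle, hc.colorOf_circle, color_bl h c, color_tr h c]
    · apply Finset.prod_congr rfl
      intro C hC
      have hC' := Finset.ne_of_mem_erase hC
      have h1 : g C = L.circle v' (Quot.out C) := by
        rw [← hg1 _ fun h2 => hC' _, circle_out]
        intro h2
        rw [← circle_out C, hcoarse _ _ h2, heq]
      rw [h1, hc.colorOf_circle, hXoff b _ (by rw [circle_out]; exact hC'), circle_out]
      rfl
  rw [Fintype.sum_eq_add (X true) (X false)]
  · rw [hco, hco, hpr, hpr, one_mul, one_mul, ← add_mul,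
      ← Finset.mul_prod_erase Finset.univ (fun C => ev (colorOf c C) (x C))
        (Finset.mem_univ (L.circle v (L.bl t h)))]
    by_cases hm : L.Mono c t
    · have hcv : L.Comp v.1 c := hc.flip h hm fun s hs => (hoff s hs).symm
      rw [if_pos hm, hcv.colorOf_circle, color_bl h c, ← mul_assoc]
      congr 1
      unfold Mono at hm
      rw [← hm]
      generalize x (L.circle v (L.bl t h)) = a
      generalize c t (L.slice t).pos = k
      cases a <;> cases k <;> norm_num [ev]
    · rw [if_neg hm, mul_eq_zero]
      left
      unfold Mono at hm
      revert hm
      generalize x (L.circle v (L.bl t h)) = a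
      generalize c t (L.slice t).pos = k
      generalize c (t + 1) ((L.slice t).pos + 1) = k'
      cases a <;> cases k <;> cases k' <;> norm_num [ev]
  · intro hX
    have := congrFun hX (L.circle v' (L.bl t h))
    rw [hXbl, hXbl] at this
    exact absurd this (by simp)
  · rintro x' ⟨hx1, hx2⟩
    rw [mul_eq_zero]
    left
    by_contra h0
    have hx' : x' = X (x' (L.circle v' (L.bl t h))) := by
      unfold saddleCoeff at h0
      split_ifs at h0 with h1 h2
      · exact absurd heq h2
      · obtain ⟨-, -, h1⟩ := h1
        simp only [State.label] at h0 h1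
        funext C'
        obtain ⟨p, rfl⟩ := Quot.exists_rep C'
        change x' (L.circle v' p) = X _ (L.circle v' p)
        by_cases h3 : L.circle v' p = L.circle v' (L.bl t h)
        · rw [h3, hXbl]
        by_cases h4 : L.circle v' p = L.circle v' (L.tr t h)
        · rw [h4, hXtr]
          revert h0
          generalize x (L.circle v (L.bl t h)) = a
          generalize x' (L.circle v' (L.bl t h)) = z
          generalize x' (L.circle v' (L.tr t h)) = z'
          cases a <;> cases z <;> cases z' <;> simp [comulCoeff]
        have h5 : L.circle v p ≠ L.circle v (L.bl t h) := by
          intro h5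
          have h6 := hg1 _ hne
          rw [← h5, hg1 _ h4] at h6
          exact h3 h6
        rw [hXoff _ p h5, h1 p h5 (by rwa [← heq])]
      · exact absurd rfl h0
    cases hb : x' (L.circle v' (L.bl t h)) <;> rw [hb] at hx'
    · exact hx2 hx'
    · exact hx1 hx'

end Saddle

end Diagram

end LeeKh

/-! ### The differential in the coordinates given by colourings -/

namespace LeeKh

namespace Diagram

variable {N : ℕ}

theorem pair_ofCoeff {L L' : Diagram N} {k : L.State → L'.State → ℚ} {V W : Finset (Fin N)}
    {c d : Coloring} {q : ℚ} (hk : ∀ s, ∑ s', k s s' * L'.weight V c s' = q * L.weight W d s)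
    (f : L.CKh) : L'.pair V c (ofCoeff k f) = q * L.pair W d f := by
  have : L'.pair V c ∘ₗ ofCoeff k = q • L.pair W d := by
    apply Finsupp.lhom_ext
    intro s b
    have hs : Finsupp.single s b = b • (Finsupp.single s 1 : L.CKh) := by simp
    rw [hs, map_smul, map_smul, LinearMap.comp_apply, pair_ofCoeff_single, hk,
      LinearMap.smul_apply, pair_single, one_mul, smul_eq_mul, smul_eq_mul, smul_eq_mul]
  exact LinearMap.congr_fun this f

theorem pair_scale {L : Diagram N} {g : L.State → ℚ} {V : Finset (Fin N)} {q : ℚ}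
    (hg : ∀ s, s.1.1 = V → g s = q) (c : Coloring) (f : L.CKh) :
    L.pair V c (scale g f) = q * L.pair V c f := by
  have : L.pair V c ∘ₗ scale g = q • L.pair V c := by
    apply Finsupp.lhom_ext
    intro s b
    rw [LinearMap.comp_apply, LinearMap.smul_apply, pair_single, scale,
      Finsupp.linearCombination_single, map_smul, pair_single, smul_eq_mul, smul_eq_mul]
    by_cases hs : s.1.1 = V
    · rw [hg s hs]; ring
    · simp [weight, hs]
  exact LinearMap.congr_fun this f

theorem Comp.erase_iff {L : Diagram N} {V : Finset (Fin N)} {c : Coloring} {t : Fin N}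
    (hc : L.Comp V c) (ht : t ∈ V) : L.Comp (V.erase t) c ↔ L.Mono c t :=
  hc.mono_iff (hc.cross t ht) ht (by simp) (by intro s hs; simp [hs])

theorem Comp.insert_iff {L : Diagram N} {V : Finset (Fin N)} {c : Coloring} {t : Fin N}
    (hc : L.Comp V c) (ht : (L.slice t).IsCross) (htV : t ∉ V) :
    L.Comp (insert t V) c ↔ L.Mono c t := by
  constructor
  · intro h
    have h2 := (h.erase_iff (Finset.mem_insert_self t V)).1
    rw [Finset.erase_insert htV] at h2
    exact h2 hc
  · exact fun h => hc.flip ht h (by intro s hs; simp [hs])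

open scoped Classical in
-- The complex is diagonalised here: an edge relates only coordinates at the same colouring, since a
-- colouring of both resolutions is the same as a colouring with a monochromatic crossing. For a
-- merge the crossing is automatically monochromatic after the edge, for a splitting this is the
-- condition that the value is not zero.
theorem pair_saddle {L : Diagram N} {t : Fin N} (h : (L.slice t).IsCross) {V : Finset (Fin N)}
    {c : Coloring} (hc : L.Comp V c) (f : L.CKh) :
    L.pair V c (L.saddle t h f) =
      if t ∈ V ∧ L.Mono c t then L.kap (V.erase t) t c * L.pair (V.erase t) c f else 0 := by
  rw [saddle_eq]
  have hq : (if t ∈ V ∧ L.Mono c t then L.kap (V.erase t) t c * L.pair (V.erase t) c f else 0) =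
      (if t ∈ V ∧ L.Mono c t then L.kap (V.erase t) t c else 0) * L.pair (V.erase t) c f := by
    split_ifs <;> simp
  rw [hq]
  apply pair_ofCoeff
  rintro ⟨v, x⟩
  have hsum := sum_weight (L := L) ⟨V, hc.cross⟩ c (L.saddleCoeff t h ⟨v, x⟩)
  rw [hsum]
  by_cases hv : t ∉ v.1 ∧ V = insert t v.1
  · obtain ⟨htv, rfl⟩ := hv
    have hw : L.weight ((insert t v.1).erase t) c ⟨v, x⟩ = ∏ C, ev (colorOf c C) (x C) := by
      rw [Finset.erase_insert htv]; simp [weight]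
    rw [hw]
    have hsame := same_corner_iff h v
    by_cases heq : L.circle v (L.bl t h) = L.circle v (L.tr t h)
    · rw [sum_split h v ⟨_, hc.cross⟩ htv rfl hc x heq]
      rw [Finset.erase_insert htv, kap, if_pos (hsame.2 heq)]
      simp
    · rw [sum_merge h v ⟨_, hc.cross⟩ htv rfl hc x heq]
      have hm : L.Mono c t := by
        have h1 := (circle_flip_iff h v ⟨_, hc.cross⟩ htv (by simp) (by
          intro s hs; simp [hs])).2 heq
        have h2 := Comp.circle_eq (v := ⟨_, hc.cross⟩) hc h1
        rwa [color_bl h c, color_tr h c] at h2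
      rw [Finset.erase_insert htv, kap, if_neg (fun h => heq (hsame.1 h)), if_pos ⟨by simp, hm⟩,
        one_mul]
  · have h1 : (if t ∈ V ∧ L.Mono c t then L.kap (V.erase t) t c else 0) *
        L.weight (V.erase t) c ⟨v, x⟩ = 0 := by
      rw [mul_eq_zero]
      by_cases ht : t ∈ V
      · right
        rw [weight, if_neg]
        rintro h1
        change v.1 = V.erase t at h1
        apply hv
        rw [h1]
        simp [ht]
      · left
        rw [if_neg (fun h => ht h.1)]
    rw [h1]
    apply Finset.sum_eq_zero
    intro x' _
    rw [mul_eq_zero]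
    left
    rw [saddleCoeff, if_neg]
    rintro ⟨h2, h3, -⟩
    exact hv ⟨h2, h3⟩

/-- The sign of the edge in direction `t` at `V`. -/
def sgn (r : Fin N → ℕ) (V : Finset (Fin N)) (t : Fin N) : ℚ :=
  (-1) ^ (V.filter fun k => r k < r t).card

theorem sgn_ne_zero (r : Fin N → ℕ) (V : Finset (Fin N)) (t : Fin N) : sgn r V t ≠ 0 := by
  unfold sgn
  positivity

theorem sgn_erase (r : Fin N → ℕ) (V : Finset (Fin N)) (t : Fin N) :
    sgn r (V.erase t) t = sgn r V t := by
  unfold sgn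
  congr 2
  ext k
  simp only [Finset.mem_filter, Finset.mem_erase]
  constructor
  · rintro ⟨⟨-, h⟩, h'⟩; exact ⟨h, h'⟩
  · rintro ⟨h, h'⟩
    refine ⟨⟨?_, h⟩, h'⟩
    rintro rfl; omega

theorem sgn_insert (r : Fin N → ℕ) {V : Finset (Fin N)} {s : Fin N} (hs : s ∉ V) (t : Fin N) :
    sgn r (insert s V) t = if r s < r t then - sgn r V t else sgn r V t := by
  unfold sgn
  rw [Finset.filter_insert]
  split_ifs with h
  · rw [Finset.card_insert_of_notMem (by simp [hs]), pow_succ]; ring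
  · rfl

open scoped Classical in
/-- The contribution of the edges in direction `t` to the differential. -/
noncomputable def term (L : Diagram N) (r : Fin N → ℕ) (V : Finset (Fin N)) (c : Coloring)
    (f : L.CKh) (t : Fin N) : ℚ :=
  if t ∈ V ∧ L.Mono c t then sgn r V t * L.kap (V.erase t) t c * L.pair (V.erase t) c f else 0

theorem pair_dLee {L : Diagram N} (r : Fin N → ℕ) {V : Finset (Fin N)} {c : Coloring}
    (hc : L.Comp V c) (f : L.CKh) : L.pair V c (L.dLee r f) = ∑ t, L.term r V c f t := by
  classical
  unfold dLee
  rw [LinearMap.sum_apply, map_sum]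
  apply Finset.sum_congr rfl
  intro t _
  unfold term
  by_cases h : (L.slice t).IsCross
  · rw [dif_pos h, LinearMap.comp_apply, pair_saddle h hc,
      pair_scale (q := sgn r (V.erase t) t) (by intro s hs; rw [edgeSign, sgn, hs])]
    split_ifs
    · rw [sgn_erase]; ring
    · rfl
  · rw [dif_neg h, LinearMap.zero_apply, map_zero, if_neg]
    exact fun h' => h (hc.cross t h'.1)

/-! ### The idempotent basis -/

open scoped Classical in
/-- The tensor product of labels `a` (`true`) and `b` (`false`). -/
noncomputable def abElem (L : Diagram N) (v : L.Vertex) (y : L.Circle v → Bool) : L.CKh :=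
  ∑ x : L.Circle v → Bool, Finsupp.single ⟨v, x⟩ (∏ C, abCoeff (y C = true) (x C))

theorem ab_ev (y k : Bool) : ∑ b : Bool, abCoeff (y = true) b * ev k b =
    if y = k then (if k = true then 2 else -2) else 0 := by
  cases y <;> cases k <;> norm_num [abCoeff, ev]

open scoped Classical in
theorem pair_abElem {L : Diagram N} (v : L.Vertex) (y : L.Circle v → Bool) (c : Coloring) :
    L.pair v.1 c (L.abElem v y) =
      ∏ C : L.Circle v, if y C = colorOf c C then (if colorOf c C = true then 2 else -2) else 0 := by
  unfold abElem
  rw [map_sum]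
  simp only [pair_single, weight, if_pos, ← Finset.prod_mul_distrib]
  rw [← Fintype.piFinset_univ, ← Finset.prod_univ_sum (fun _ => Finset.univ)
    (fun C b => abCoeff (y C = true) b * ev (colorOf c C) b)]
  exact Finset.prod_congr rfl fun C _ => ab_ev _ _

theorem pair_abElem_of_ne {L : Diagram N} (v : L.Vertex) (y : L.Circle v → Bool)
    {V : Finset (Fin N)} (hV : v.1 ≠ V) (c : Coloring) : L.pair V c (L.abElem v y) = 0 := by
  unfold abElem
  rw [map_sum]
  apply Finset.sum_eq_zero
  intro x _
  rw [pair_single, weight, if_neg hV, mul_zero]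

theorem pair_abElem_ne_zero {L : Diagram N} (v : L.Vertex) (y : L.Circle v → Bool) :
    L.pair v.1 (ofCircle y) (L.abElem v y) ≠ 0 := by
  rw [pair_abElem, Finset.prod_ne_zero_iff]
  intro C _
  rw [colorOf_ofCircle, if_pos rfl]
  split_ifs <;> norm_num

theorem pair_abElem_eq_zero {L : Diagram N} (v : L.Vertex) (y : L.Circle v → Bool)
    {V : Finset (Fin N)} {c : Coloring} (hc : L.Comp V c) (h : ¬ (V = v.1 ∧ c = ofCircle y)) :
    L.pair V c (L.abElem v y) = 0 := by
  by_cases hV : v.1 = V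
  · subst hV
    rw [pair_abElem, Finset.prod_eq_zero_iff]
    by_contra hcon
    apply h
    refine ⟨rfl, ?_⟩
    rw [← hc.ofCircle_colorOf]
    congr 1
    funext C
    by_contra hC
    exact hcon ⟨C, Finset.mem_univ _, if_neg fun h => hC h.symm⟩
  · exact pair_abElem_of_ne v y hV c

/-- The tensor products of `a` and `b` form a dual basis up to the nonzero factors `±2` of the
circles, so they can be rescaled and combined at will. -/
theorem exists_pair_eq (L : Diagram N) (F : Finset (Fin N) → Coloring → ℚ) :
    ∃ f : L.CKh, ∀ V c, L.Comp V c → L.pair V c f = F V c := by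
  classical
  refine ⟨∑ s : L.State, (F s.1.1 (ofCircle s.2) / L.pair s.1.1 (ofCircle s.2)
    (L.abElem s.1 s.2)) • L.abElem s.1 s.2, ?_⟩
  intro V c hc
  rw [map_sum, Finset.sum_eq_single (⟨⟨V, hc.cross⟩, fun C => colorOf c C⟩ : L.State)]
  · have h1 : ofCircle (fun C : L.Circle ⟨V, hc.cross⟩ => colorOf c C) = c :=
      Comp.ofCircle_colorOf (v := ⟨V, hc.cross⟩) hc
    have h2 := pair_abElem_ne_zero ⟨V, hc.cross⟩ (fun C : L.Circle ⟨V, hc.cross⟩ => colorOf c C)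
    simp only [h1, map_smul, smul_eq_mul] at h2 ⊢
    exact div_mul_cancel₀ _ h2
  · rintro ⟨v, y⟩ _ hs
    rw [map_smul, pair_abElem_eq_zero v y hc, smul_zero]
    rintro ⟨rfl, rfl⟩
    apply hs
    congr 1
    funext C
    exact (colorOf_ofCircle y C).symm
  · simp

/-- All values are attained by `exists_pair_eq`, and there are as many coordinates as states. Hence
a surjective linear map between spaces of the same dimension is injective. -/
theorem pair_inj {L : Diagram N} {f g : L.CKh} (h : ∀ V c, L.Comp V c → L.pair V c f = L.pair V c g) :
    f = g := by
  let Ψ : L.CKh →ₗ[ℚ] (L.State → ℚ) := LinearMap.pi fun s => L.pair s.1.1 (ofCircle s.2)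
  have hsurj : Function.Surjective Ψ := by
    intro F
    classical
    obtain ⟨f, hf⟩ := L.exists_pair_eq fun V c =>
      if h : L.Comp V c then F ⟨⟨V, h.cross⟩, fun C => colorOf c C⟩ else 0
    refine ⟨f, ?_⟩
    funext ⟨v, y⟩
    change L.pair v.1 (ofCircle y) f = _
    rw [hf _ _ (comp_ofCircle y), dif_pos (comp_ofCircle y)]
    congr 2
    funext C
    exact colorOf_ofCircle y C
  have hinj : Function.Injective Ψ := by
    apply (LinearMap.injective_iff_surjective_of_finrank_eq_finrank ?_).2 hsurj
    rw [Module.finrank_finsupp_self, Module.finrank_fintype_fun_eq_card]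
  apply hinj
  funext ⟨v, y⟩
  exact h _ _ (comp_ofCircle y)

end Diagram

end LeeKh

namespace LeeKh

/-! ## Rays -/

/-- The parity of the number of `true` values before `j`. -/
def par (x : ℕ → Bool) : ℕ → Bool
  | 0 => false
  | j + 1 => par x j ^^ x j

theorem par_congr {x y : ℕ → Bool} {j : ℕ} (h : ∀ k < j, x k = y k) : par x j = par y j := by
  induction j with
  | zero => rfl
  | succ j ih => rw [par, par, ih fun k hk => h k (by omega), h j (by omega)]

theorem par_shift {x y : ℕ → Bool} {i : ℕ} (h1 : ∀ j < i, x j = y j)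
    (h2 : ∀ j, i ≤ j → x (j + 2) = y j) (h3 : x i = x (i + 1)) {j : ℕ} (hj : i ≤ j) :
    par x (j + 2) = par y j := by
  induction j, hj using Nat.le_induction with
  | base => simp [par, par_congr h1, ← h3]
  | succ j hj ih =>
    rw [par, show j + 1 + 1 = j + 2 from rfl, ih, par]
    rw [h2 j hj]

theorem par_turn {x y : ℕ → Bool} {i : ℕ} (h1 : ∀ j, j ≠ i → j ≠ i + 1 → x j = y j)
    (h2 : x i = x (i + 1)) (h3 : y i = y (i + 1)) {j : ℕ} (hj : j ≠ i + 1) :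
    par x j = par y j := by
  rcases Nat.lt_or_ge j (i + 2) with h | h
  · exact par_congr fun k hk => h1 k (by omega) (by omega)
  · induction j, h using Nat.le_induction with
    | base =>
      have := par_congr (x := x) (y := y) (j := i) fun k hk => h1 k (by omega) (by omega)
      simp [par, ← h2, ← h3, this]
    | succ j hj ih =>
      rw [par, par, ih (by omega), h1 j (by omega) (by omega)]

/-- The parity of the number of `true` points to the left of an end. -/
def SliceEnd.par (x y : ℕ → Bool) : SliceEnd → Bool
  | .bot j => LeeKh.par x j
  | .top j => LeeKh.par y j

/-- This is the Jordan curve argument modulo `2`. Moving an end of an arc past a cap or a cup of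
another arc adds or removes two neighbouring points of equal colour, and the two ends of a cap or
cup of colour `false` have no `true` point between them. -/
theorem Shape.Ok.par_eq {S : Shape} (hS : ∀ i, S ≠ .swap i) {x y : ℕ → Bool} (h : S.Ok x y)
    {e f : SliceEnd} (hj : S.Joins e f) (he : e.val x y = false) : e.par x y = f.par x y := by
  cases hj with
  | id j =>
    have h := Shape.ok_id.1 h
    exact par_congr fun k _ => h k
  | cup_left i j hji => exact par_congr fun k hk => h _ _ (.cup_left i k (by omega))
  | cup_right i j hji =>
    exact (par_shift (fun k hk => (h _ _ (.cup_left i k hk)).symm)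
      (fun k hk => (h _ _ (.cup_right i k hk)).symm) (h _ _ (.cup_arc i)) hji).symm
  | cup_arc i =>
    simp only [SliceEnd.val] at he
    simp [SliceEnd.par, LeeKh.par, he]
  | cap_left i j hji => exact par_congr fun k hk => h _ _ (.cap_left i k (by omega))
  | cap_right i j hji =>
    exact par_shift (fun k hk => h _ _ (.cap_left i k hk))
      (fun k hk => h _ _ (.cap_right i k hk)) (h _ _ (.cap_arc i)) hji
  | cap_arc i =>
    simp only [SliceEnd.val] at he
    simp [SliceEnd.par, LeeKh.par, he]
  | swap_off i => exact absurd rfl (hS i)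
  | swap_right i => exact absurd rfl (hS i)
  | swap_left i => exact absurd rfl (hS i)
  | turn_off i j h1 h2 =>
    exact par_turn (fun k h1 h2 => h _ _ (.turn_off i k h1 h2)) (h _ _ (.turn_cap i))
      (h _ _ (.turn_cup i)) h2
  | turn_cap i =>
    simp only [SliceEnd.val] at he
    simp [SliceEnd.par, LeeKh.par, he]
  | turn_cup i =>
    simp only [SliceEnd.val] at he
    simp [SliceEnd.par, LeeKh.par, he]

theorem Slice.resolve_ne_swap (σ : Slice) (u : Bool) (i : ℕ) : σ.resolve u ≠ .swap i := by
  cases σ with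
  | cross j p => cases p <;> cases u <;> simp [Slice.resolve]
  | _ => simp [Slice.resolve]

theorem decide_even_succ (n : ℕ) : decide (Even (n + 1)) = !decide (Even n) := by
  by_cases h : Even n <;> simp only [Nat.even_add_one, h] <;> rfl

theorem par_eq_card (x : ℕ → Bool) (j : ℕ) :
    par x j = decide (¬ Even ((Finset.range j).filter fun k => x k = true).card) := by
  induction j with
  | zero => simp [par]
  | succ j ih =>
    rw [par, ih, Finset.range_add_one, Finset.filter_insert]
    cases hx : x j
    · simp
    · rw [if_pos rfl, Finset.card_insert_of_notMem (by simp)]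
      simp only [Nat.even_add_one]
      by_cases h : Even ((Finset.range j).filter fun k => x k = true).card <;> simp [h]

namespace Diagram

variable {N : ℕ} {L : Diagram N}

theorem IsEnd.par {t : Fin N} {e : SliceEnd} {p : L.Point} (h : L.IsEnd t e p) (c : Coloring) :
    e.par (c t) (c (t + 1)) = LeeKh.par (c p.1) p.2 := by
  cases e <;> obtain ⟨h1, h2⟩ := h <;> simp [SliceEnd.par, h1, h2]

open scoped Classical in
theorem even_rayCount (v : L.Vertex) (p : L.Point) :
    Even (L.rayCount v p) ↔ LeeKh.par
      (ofCircle (fun C : L.Circle v => decide (C ≠ L.circle v p)) p.1) p.2 = false := by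
  rw [par_eq_card]
  have : L.rayCount v p = ((Finset.range p.2).filter fun k =>
      ofCircle (fun C : L.Circle v => decide (C ≠ L.circle v p)) p.1 k = true).card := by
    unfold rayCount
    refine Finset.card_bij (fun j _ => (j : ℕ)) ?_ ?_ ?_
    · intro j hj
      simp only [Finset.mem_filter, Finset.mem_univ, true_and, Finset.mem_range] at hj ⊢
      refine ⟨hj.1, ?_⟩
      have := ofCircle_point (fun C : L.Circle v => decide (C ≠ L.circle v p)) ⟨p.1, j⟩
      rw [this]
      simpa using hj.2
    · intro j _ k _ h
      exact Fin.ext h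
    · intro k hk
      simp only [Finset.mem_filter, Finset.mem_range] at hk
      refine ⟨⟨k, hk.1.trans p.2.2⟩, ?_, rfl⟩
      simp only [Finset.mem_filter, Finset.mem_univ, true_and]
      refine ⟨hk.1, ?_⟩
      have := (ofCircle_point (fun C : L.Circle v => decide (C ≠ L.circle v p))
        ⟨p.1, ⟨k, hk.1.trans p.2.2⟩⟩).symm.trans hk.2
      simpa using this
  rw [this]
  simp

/-- All circles but the one under consideration get the colour `true`; by `Shape.Ok.par_eq` the
parity to the left is constant along the circle of colour `false`. -/
theorem even_rayCount_congr (v : L.Vertex) {p q : L.Point} (h : L.circle v p = L.circle v q) :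
    Even (L.rayCount v p) ↔ Even (L.rayCount v q) := by
  classical
  rw [even_rayCount, even_rayCount, ← h]
  set c := ofCircle (fun C : L.Circle v => decide (C ≠ L.circle v p)) with hc
  have hcomp : L.Comp v.1 c := comp_ofCircle _
  -- The alternative `c = true` makes the predicate constant along all arcs, so that it descends to
  -- the circles, although the parity is controlled only on the circle of `p`.
  let F : L.Circle v → Prop := Quot.lift (fun q => c q.1 q.2 = true ∨ LeeKh.par (c q.1) q.2 = false)
    (by
      rintro a b ⟨t, e, f, hj, ha, hb⟩
      have h1 := hcomp.ok t e f hj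
      by_cases he : e.val (c t) (c (t + 1)) = false
      · have h2 := Shape.Ok.par_eq (Slice.resolve_ne_swap _ _) (hcomp.ok t) hj he
        rw [ha.val, hb.val] at h1
        rw [ha.par, hb.par] at h2
        rw [h1, h2]
      · rw [ha.val] at he h1
        rw [hb.val] at h1
        rw [← h1]
        simp [he])
  have h1 : F (L.circle v p) = F (L.circle v q) := by rw [h]
  have hp : c p.1 p.2 = false := by rw [hc, ofCircle_point]; simp
  have hq : c q.1 q.2 = false := by rw [hc, ofCircle_point]; simp [h]
  have h2 : (c p.1 p.2 = true ∨ LeeKh.par (c p.1) p.2 = false) =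
    (c q.1 q.2 = true ∨ LeeKh.par (c q.1) q.2 = false) := h1
  rw [hp, hq] at h2
  simpa using h2

theorem rayCount_of_leftmost (v : L.Vertex) (p : L.Point)
    (h : ∀ j : Fin (L.width p.1), j < p.2 → L.circle v ⟨p.1, j⟩ ≠ L.circle v p) :
    L.rayCount v p = p.2 := by
  classical
  unfold rayCount
  have : (Finset.univ.filter fun j : Fin (L.width p.1) =>
      j < p.2 ∧ L.circle v ⟨p.1, j⟩ ≠ L.circle v p) = Finset.Iio p.2 := by
    ext j
    simp only [Finset.mem_filter, Finset.mem_univ, true_and, Finset.mem_Iio]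
    exact ⟨fun h => h.1, fun hj => ⟨hj, h j hj⟩⟩
  rw [← Fin.card_Iio p.2, ← this]

theorem exists_leftmost (v : L.Vertex) (p : L.Point) : ∃ q : L.Point, L.circle v q = L.circle v p ∧
    ∀ j : Fin (L.width q.1), j < q.2 → L.circle v ⟨q.1, j⟩ ≠ L.circle v q := by
  classical
  obtain ⟨n, j⟩ := p
  obtain ⟨k, hk, hmin⟩ := Finset.exists_min_image
    (Finset.univ.filter fun k : Fin (L.width n) => L.circle v ⟨n, k⟩ = L.circle v ⟨n, j⟩) id
    ⟨j, by simp⟩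
  simp only [Finset.mem_filter, Finset.mem_univ, true_and, id] at hk hmin
  refine ⟨⟨n, k⟩, hk, ?_⟩
  intro m hm h
  have := hmin m (h.trans hk)
  exact absurd hm (not_lt.2 this)

/-! ## Orientations as colourings -/

namespace Orientation

open scoped Classical in
/-- The colouring of the points by `a` and `b` in the canonical generator. -/
noncomputable def col (o : L.Orientation) : Coloring := fun n j =>
  if h : ∃ p : L.Point, (p.1 : ℕ) = n ∧ (p.2 : ℕ) = j then (decide (Even j) == o.up h.choose)
    else false

theorem col_point (o : L.Orientation) (p : L.Point) :
    o.col p.1 p.2 = (decide (Even (p.2 : ℕ)) == o.up p) := by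
  have h : ∃ q : L.Point, (q.1 : ℕ) = p.1 ∧ (q.2 : ℕ) = p.2 := ⟨p, rfl, rfl⟩
  rw [col, dif_pos h]
  congr 2
  exact Point.ext' h.choose_spec.1 h.choose_spec.2

theorem col_of_not (o : L.Orientation) {n j : ℕ} (h : ¬ j < L.wd n) : o.col n j = false := by
  rw [col, dif_neg]
  rintro ⟨p, rfl, rfl⟩
  exact h p.lt_wd

theorem up_eq (o : L.Orientation) (p : L.Point) :
    o.up p = (decide (Even (p.2 : ℕ)) == o.col p.1 p.2) := by
  rw [col_point]
  cases decide (Even (p.2 : ℕ)) <;> cases o.up p <;> rfl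

theorem ext_col {o o' : L.Orientation} (h : o.col = o'.col) : o = o' := by
  ext p
  rw [up_eq, up_eq, h]

theorem coherent_joins (o : L.Orientation) {t : Fin N} {e f : SliceEnd}
    (h : (L.slice t).shape.Joins e f) {p q : L.Point} (hp : L.IsEnd t e p) (hq : L.IsEnd t f q) :
    o.up p = o.up q ↔ p.1 ≠ q.1 :=
  o.coherent p q ⟨t, e, f, h, hp, hq⟩

theorem bl_tr (o : L.Orientation) {t : Fin N} (h : (L.slice t).IsCross) :
    o.up (L.bl t h) = o.up (L.tr t h) := by
  apply (o.coherent_joins _ (isEnd_bl h) (isEnd_tr h)).2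
  · simp only [bl, tr]; exact (Fin.castSucc_lt_succ).ne
  · obtain ⟨i, p, hip⟩ := h
    rw [hip]
    exact .swap_right i

theorem br_tl (o : L.Orientation) {t : Fin N} (h : (L.slice t).IsCross) :
    o.up (L.br t h) = o.up (L.tl t h) := by
  apply (o.coherent_joins _ (isEnd_br h) (isEnd_tl h)).2
  · simp only [br, tl]; exact (Fin.castSucc_lt_succ).ne
  · obtain ⟨i, p, hip⟩ := h
    rw [hip]
    exact .swap_left i

theorem shapeAt_vertex (o : L.Orientation) {t : Fin N} (h : (L.slice t).IsCross) :
    L.shapeAt o.vertex.1 t =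
      if o.up (L.bl t h) = o.up (L.br t h) then .id else .turn (L.slice t).pos := by
  have hmem : t ∈ o.vertex.1 ↔ o.IsNegative t h := by
    simp only [vertex, Finset.mem_filter, Finset.mem_univ, true_and]
    exact ⟨fun ⟨_, h⟩ => h, fun h' => ⟨h, h'⟩⟩
  unfold IsNegative at hmem
  obtain ⟨i, p, hip⟩ := id h
  unfold shapeAt
  generalize o.up (L.bl t h) = x at *
  generalize o.up (L.br t h) = y at *
  simp only [hmem, hip, Slice.isPos, Slice.pos]
  cases p <;> cases x <;> cases y <;> rfl

/-- Where the oriented resolution joins different levels, both the parity of the position and the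
direction are preserved; where it joins neighbours at one level, both are reversed. In either case
the colour does not change. -/
theorem comp (o : L.Orientation) : L.Comp o.vertex.1 o.col := by
  have key : ∀ p q, L.Arc o.vertex p q → o.col p.1 p.2 = o.col q.1 q.2 := by
    rintro p q hpq
    obtain ⟨t, e, f, hj, hp, hq⟩ := (Vertex.adj_iff o.vertex).1 hpq
    have hlev : t.castSucc ≠ t.succ := (Fin.castSucc_lt_succ).ne
    have hlev' := hlev.symm
    by_cases hcr : (L.slice t).IsCross
    · have h1 := o.bl_tr hcr
      have h2 := o.br_tl hcr
      have hoff : ∀ j, j ≠ (L.slice t).pos → j ≠ (L.slice t).pos + 1 → e = .bot j → f = .top j →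
          o.col p.1 p.2 = o.col q.1 q.2 := by
        rintro j h3 h4 rfl rfl
        have hs : (L.slice t).shape.Joins (.bot j) (.top j) := by
          obtain ⟨i, b, hip⟩ := hcr
          rw [hip] at h3 h4 ⊢
          exact .swap_off i j h3 h4
        have := (o.coherent_joins hs hp hq).2 (by rw [hp.1, hq.1]; exact hlev)
        rw [col_point, col_point, this, hp.2, hq.2]
      rw [o.shapeAt_vertex hcr] at hj
      have hpos := decide_even_succ (L.slice t).pos
      split_ifs at hj with hud
      · cases hj
        rename_i j
        by_cases h3 : j = (L.slice t).pos
        · subst h3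
          obtain rfl := hp.unique (isEnd_bl hcr)
          obtain rfl := hq.unique (isEnd_tl hcr)
          rw [col_point, col_point, hud, h2]
          rfl
        by_cases h4 : j = (L.slice t).pos + 1
        · subst h4
          obtain rfl := hp.unique (isEnd_br hcr)
          obtain rfl := hq.unique (isEnd_tr hcr)
          rw [col_point, col_point, ← hud, h1]
          rfl
        exact hoff j h3 h4 rfl rfl
      · cases hj
        · exact hoff _ ‹_› ‹_› rfl rfl
        · obtain rfl := hp.unique (isEnd_bl hcr)
          obtain rfl := hq.unique (isEnd_br hcr)
          rw [col_point, col_point]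
          change (decide (Even (L.slice t).pos) == _) = (decide (Even ((L.slice t).pos + 1)) == _)
          rw [hpos]
          revert hud
          cases o.up (L.bl t hcr) <;> cases o.up (L.br t hcr) <;>
            cases decide (Even (L.slice t).pos) <;> simp
        · obtain rfl := hp.unique (isEnd_tl hcr)
          obtain rfl := hq.unique (isEnd_tr hcr)
          rw [col_point, col_point, ← h1, ← h2]
          change (decide (Even (L.slice t).pos) == _) = (decide (Even ((L.slice t).pos + 1)) == _)
          rw [hpos]
          revert hud
          cases o.up (L.bl t hcr) <;> cases o.up (L.br t hcr) <;>
            cases decide (Even (L.slice t).pos) <;> simp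
    · have hs : L.shapeAt o.vertex.1 t = (L.slice t).shape := by
        unfold shapeAt
        cases hsl : L.slice t with
        | cross i b => exact absurd ⟨i, b, hsl⟩ hcr
        | _ => rfl
      rw [hs] at hj
      have hco := o.coherent_joins hj hp hq
      have hns : ∀ i, (L.slice t).shape ≠ .swap i ∧ (L.slice t).shape ≠ .turn i := by
        intro i
        cases hsl : L.slice t with
        | cross i b => exact absurd ⟨i, b, hsl⟩ hcr
        | _ => simp [Slice.shape]
      rw [col_point, col_point]
      generalize (L.slice t).shape = S at *
      cases hj with
      | swap_off i => exact absurd rfl (hns i).1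
      | swap_right i => exact absurd rfl (hns i).1
      | swap_left i => exact absurd rfl (hns i).1
      | turn_off i => exact absurd rfl (hns i).2
      | turn_cap i => exact absurd rfl (hns i).2
      | turn_cup i => exact absurd rfl (hns i).2
      | cup_arc i =>
        rw [hp.1, hq.1] at hco
        rw [hp.2, hq.2, decide_even_succ]
        simp only [ne_eq, not_true, iff_false] at hco
        generalize decide (Even i) = z
        revert hco
        cases o.up p <;> cases o.up q <;> cases z <;> simp
      | cap_arc i =>
        rw [hp.1, hq.1] at hco
        rw [hp.2, hq.2, decide_even_succ]
        simp only [ne_eq, not_true, iff_false] at hco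
        generalize decide (Even i) = z
        revert hco
        cases o.up p <;> cases o.up q <;> cases z <;> simp
      | _ =>
        rw [hp.1, hq.1] at hco
        rw [hp.2, hq.2, hco.2 hlev]
        try simp [Nat.even_add]
  let y : L.Circle o.vertex → Bool := Quot.lift (fun p => o.col p.1 p.2) key
  have hy : ofCircle y = o.col := by
    funext n j
    by_cases hj : j < L.wd n
    · obtain ⟨p, rfl, rfl⟩ := L.exists_point hj
      rw [ofCircle_point]
      rfl
    · rw [ofCircle_of_not y hj, o.col_of_not hj]
  rw [← hy]
  exact comp_ofCircle y

/-- The corners `bl` and `tr` belong to one strand of the link, with a single direction, but their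
positions have different parities. -/
theorem not_mono (o : L.Orientation) {t : Fin N} (h : (L.slice t).IsCross) :
    ¬ L.Mono o.col t := by
  unfold Mono
  rw [← color_bl h o.col, ← color_tr h o.col, col_point, col_point, o.bl_tr h]
  change ¬ (decide (Even (L.slice t).pos) == _) = (decide (Even ((L.slice t).pos + 1)) == _)
  rw [decide_even_succ]
  cases decide (Even (L.slice t).pos) <;> cases o.up (L.tr t h) <;> simp

/-- At the leftmost point of the circle on some level all points to the left belong to other
circles, so the ray count is the position itself and the rule for the label becomes a comparison of
parity and direction. The parity of the ray count may then be carried along the circle. -/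
theorem isA_iff (o : L.Orientation) (p : L.Point) :
    o.IsA (L.circle o.vertex p) ↔ o.col p.1 p.2 = true := by
  classical
  have hleft : ∀ q : L.Point,
      (∀ j : Fin (L.width q.1), j < q.2 → L.circle o.vertex ⟨q.1, j⟩ ≠ L.circle o.vertex q) →
      (o.col q.1 q.2 = true ↔ (Even (L.rayCount o.vertex q) ↔ o.up q = true)) := by
    intro q hq
    rw [rayCount_of_leftmost _ q hq, col_point]
    by_cases hi : Even (q.2 : ℕ) <;> cases o.up q <;> simp [hi]
  obtain ⟨q, hq1, hq2⟩ := exists_leftmost o.vertex p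
  -- Counterclockwise means that some leftmost point is directed downwards. All leftmost points
  -- agree on this, since both the colour and the parity of the ray count are constant on the circle
  -- and together determine the direction.
  have hccw : o.IsCCW (L.circle o.vertex p) ↔ o.up q = false := by
    constructor
    · rintro ⟨q', h1, h2, h3⟩
      have h4 := hleft q' (by rwa [h1])
      have h5 := hleft q hq2
      have h6 := even_rayCount_congr o.vertex (h1.trans hq1.symm)
      have h7 := o.comp.circle_eq (h1.trans hq1.symm)
      rw [h7, h3] at h4
      by_contra h8
      rw [Bool.not_eq_false] at h8
      rw [h8, h4, h6] at h5
      simp only [Bool.false_eq_true, iff_false, iff_true] at h5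
      tauto
    · intro h
      exact ⟨q, hq1, by rwa [hq1] at hq2, h⟩
  unfold IsA
  have h1 : Even (L.rayCount o.vertex (Quot.out (L.circle o.vertex p))) ↔
      Even (L.rayCount o.vertex q) :=
    even_rayCount_congr o.vertex ((circle_out _).trans hq1.symm)
  rw [← o.comp.circle_eq hq1, hleft q hq2]
  by_cases hup : o.up q = false
  · rw [if_pos (hccw.2 hup), Nat.even_add_one, h1, hup]
    simp only [Bool.false_eq_true, iff_false]
  · rw [if_neg (fun h => hup (hccw.1 h)), add_zero, h1]
    rw [Bool.not_eq_false] at hup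
    simp only [hup, iff_true]

theorem canonical_eq (o : L.Orientation) :
    L.canonical o = L.abElem o.vertex (fun C => colorOf o.col C) := by
  classical
  unfold canonical abElem
  apply Finset.sum_congr rfl
  intro x _
  congr 1
  apply Finset.prod_congr rfl
  intro C _
  have h := o.isA_iff (Quot.out C)
  rw [circle_out] at h
  unfold abCoeff
  simp only [h]
  rfl

theorem pair_canonical_ne_zero (o : L.Orientation) :
    L.pair o.vertex.1 o.col (L.canonical o) ≠ 0 := by
  have := pair_abElem_ne_zero o.vertex (fun C => colorOf o.col C)
  rwa [o.comp.ofCircle_colorOf, ← canonical_eq] at this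

theorem pair_canonical_eq_zero (o : L.Orientation) {V : Finset (Fin N)} {c : Coloring}
    (hc : L.Comp V c) (h : ¬ (V = o.vertex.1 ∧ c = o.col)) :
    L.pair V c (L.canonical o) = 0 := by
  rw [canonical_eq]
  apply pair_abElem_eq_zero _ _ hc
  rwa [o.comp.ofCircle_colorOf]

end Orientation

/-- The effect of a crossing at position `i` on the colours that belong to an orientation. -/
def _root_.LeeKh.crossFlip (i : ℕ) (x : ℕ → Bool) : ℕ → Bool := fun j =>
  if j = i then !x (i + 1) else if j = i + 1 then !x i else x j

/-- The condition for the colours below and above a slice to come from an orientation. -/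
def _root_.LeeKh.Slice.Flow : Slice → (ℕ → Bool) → (ℕ → Bool) → Prop
  | .cross i _, x, y => y = crossFlip i x
  | .id, x, y => Shape.id.Ok x y
  | .cup i, x, y => (Shape.cup i).Ok x y
  | .cap i, x, y => (Shape.cap i).Ok x y

/-- The colouring comes from an orientation. -/
structure Flow (L : Diagram N) (c : Coloring) : Prop where
  supp : ∀ n j, c n j = true → j < L.wd n
  flow : ∀ t : Fin N, (L.slice t).Flow (c t) (c (t + 1))

theorem _root_.LeeKh.Slice.flow_of_not_isCross {σ : Slice} (h : ¬ σ.IsCross) (x y : ℕ → Bool) :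
    σ.Flow x y ↔ σ.shape.Ok x y := by
  cases σ with
  | cross i p => exact absurd ⟨i, p, rfl⟩ h
  | _ => rfl

theorem _root_.LeeKh.Slice.flow_of_isCross {σ : Slice} (h : σ.IsCross) (x y : ℕ → Bool) :
    σ.Flow x y ↔ y = crossFlip σ.pos x := by
  obtain ⟨i, p, rfl⟩ := h
  rfl

theorem _root_.LeeKh.Slice.IsCross.shape {σ : Slice} (h : σ.IsCross) :
    σ.shape = .swap σ.pos := by
  obtain ⟨i, p, rfl⟩ := h
  rfl

theorem _root_.LeeKh.Slice.shape_ne_of_not_isCross {σ : Slice} (h : ¬ σ.IsCross) (i : ℕ) :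
    σ.shape ≠ .swap i ∧ σ.shape ≠ .turn i := by
  cases σ with
  | cross i p => exact absurd ⟨i, p, rfl⟩ h
  | _ => simp [Slice.shape]

theorem Flow.exists_orientation {c : Coloring} (hc : L.Flow c) :
    ∃ o : L.Orientation, o.col = c := by
  let o : L.Orientation :=
    { up := fun p => decide (Even (p.2 : ℕ)) == c p.1 p.2
      coherent := by
        rintro p q ⟨t, e, f, hj, hp, hq⟩
        have hlev : t.castSucc ≠ t.succ := (Fin.castSucc_lt_succ).ne
        have hfl := hc.flow t
        rw [← hp.val c, ← hq.val c]
        by_cases h : (L.slice t).IsCross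
        · rw [Slice.flow_of_isCross h] at hfl
          simp only at hj
          rw [h.shape] at hj
          cases hj with
          | swap_off i j ha hb =>
            refine iff_of_true ?_ (by rw [hp.1, hq.1]; exact hlev)
            rw [hp.2, hq.2, SliceEnd.val, SliceEnd.val, hfl, crossFlip, if_neg ha, if_neg hb]
          | swap_right i =>
            refine iff_of_true ?_ (by rw [hp.1, hq.1]; exact hlev)
            rw [hp.2, hq.2, SliceEnd.val, SliceEnd.val, hfl, crossFlip, if_neg (by omega), if_pos rfl,
              decide_even_succ]
            cases decide (Even (L.slice t).pos) <;> cases c t (L.slice t).pos <;> rfl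
          | swap_left i =>
            refine iff_of_true ?_ (by rw [hp.1, hq.1]; exact hlev)
            rw [hp.2, hq.2, SliceEnd.val, SliceEnd.val, hfl, crossFlip, if_pos rfl, decide_even_succ]
            cases decide (Even (L.slice t).pos) <;> cases c t ((L.slice t).pos + 1) <;> rfl
        · rw [Slice.flow_of_not_isCross h] at hfl
          have hns := Slice.shape_ne_of_not_isCross h
          have hcol := hfl e f hj
          rw [hcol]
          simp only at hj
          generalize (L.slice t).shape = S at *
          cases hj with
          | swap_off i => exact absurd rfl (hns i).1
          | swap_right i => exact absurd rfl (hns i).1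
          | swap_left i => exact absurd rfl (hns i).1
          | turn_off i => exact absurd rfl (hns i).2
          | turn_cap i => exact absurd rfl (hns i).2
          | turn_cup i => exact absurd rfl (hns i).2
          | cup_arc i =>
            refine iff_of_false ?_ (by rw [hp.1, hq.1]; simp)
            rw [hp.2, hq.2, decide_even_succ]
            cases decide (Even i) <;> cases SliceEnd.val (c t) (c (t + 1)) (.top (i + 1)) <;> simp
          | cap_arc i =>
            refine iff_of_false ?_ (by rw [hp.1, hq.1]; simp)
            rw [hp.2, hq.2, decide_even_succ]
            cases decide (Even i) <;> cases SliceEnd.val (c t) (c (t + 1)) (.bot (i + 1)) <;> simp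
          | _ =>
            refine iff_of_true ?_ (by rw [hp.1, hq.1]; exact hlev)
            rw [hp.2, hq.2]
            try simp [Nat.even_add] }
  refine ⟨o, ?_⟩
  funext n j
  by_cases hj : j < L.wd n
  · obtain ⟨p, rfl, rfl⟩ := L.exists_point hj
    rw [Orientation.col_point]
    change (_ == (_ == _)) = _
    cases decide (Even (p.2 : ℕ)) <;> cases c p.1 p.2 <;> rfl
  · rw [o.col_of_not hj]
    cases h : c n j
    · rfl
    · exact absurd (hc.supp n j h) hj

/-- If `bl` and `tr` have different colours, both resolutions lead to the same rule: the colours of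
the two strands are exchanged and negated, as it happens to a strand that keeps its direction and
changes the parity of its position. -/
theorem Comp.flow {V : Finset (Fin N)} {c : Coloring} (hc : L.Comp V c)
    (hm : ∀ t, (L.slice t).IsCross → ¬ L.Mono c t) : L.Flow c where
  supp := hc.supp
  flow t := by
    have h2 := hc.ok t
    by_cases h : (L.slice t).IsCross
    · rw [Slice.flow_of_isCross h]
      have h1 := hm t h
      unfold Mono at h1
      funext j
      unfold crossFlip
      rcases shapeAt_cases h V with hs | hs <;> rw [hs] at h2
      · rw [Shape.ok_id] at h2
        rw [← h2] at h1
        split_ifs with h3 h4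
        · rw [h3, ← h2]
          exact Bool.eq_not_of_ne h1
        · rw [h4, ← h2]
          exact Bool.eq_not_of_ne (Ne.symm h1)
        · exact (h2 j).symm
      · rw [Shape.ok_turn] at h2
        split_ifs with h3 h4
        · rw [h3, h2.2.1, ← h2.1]
          exact Bool.eq_not_of_ne (Ne.symm h1)
        · rw [h4]
          exact Bool.eq_not_of_ne (Ne.symm h1)
        · exact (h2.2.2 j h3 h4).symm
    · rw [Slice.flow_of_not_isCross h]
      have hs : L.shapeAt V t = (L.slice t).shape := by
        unfold shapeAt
        cases hsl : L.slice t with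
        | cross i b => exact absurd ⟨i, b, hsl⟩ h
        | _ => rfl
      rwa [hs] at h2

theorem Orientation.flow (o : L.Orientation) : L.Flow o.col :=
  o.comp.flow fun _ h => o.not_mono h

theorem Comp.shapeAt_eq {V : Finset (Fin N)} {c : Coloring} (hc : L.Comp V c) {t : Fin N}
    (h : (L.slice t).IsCross) (hm : ¬ L.Mono c t) : L.shapeAt V t =
      if c t (L.slice t).pos = c t ((L.slice t).pos + 1) then .turn (L.slice t).pos else .id := by
  have h2 := hc.ok t
  unfold Mono at hm
  rcases shapeAt_cases h V with hs | hs <;> rw [hs] at h2 <;> rw [hs]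
  · rw [Shape.ok_id] at h2
    rw [← h2] at hm
    rw [if_neg hm]
  · rw [Shape.ok_turn] at h2
    rw [if_pos h2.1]

/-- At a crossing with two colours the arcs are turned if the two lower corners agree, and vertical
if not. Which of these is the `1`-resolution depends on the over-strand. -/
theorem Comp.mem_iff {V : Finset (Fin N)} {c : Coloring} (hc : L.Comp V c) {t : Fin N} {i : ℕ}
    {b : Bool} (h : L.slice t = .cross i b) (hm : ¬ L.Mono c t) :
    t ∈ V ↔ (c t i = c t (i + 1) ↔ b = true) := by
  have h1 := hc.shapeAt_eq ⟨i, b, h⟩ hm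
  unfold shapeAt at h1
  rw [h] at h1
  simp only [Slice.pos] at h1
  by_cases hV : t ∈ V <;> by_cases hcc : c t i = c t (i + 1) <;> cases b <;>
    simp [hV, hcc, Slice.resolve] at h1 ⊢

/-- The colours force the resolution of each crossing that is not monochromatic. So an orientation
contributes a single coordinate, at its oriented resolution. -/
theorem Comp.vertex_unique {V W : Finset (Fin N)} {c : Coloring} (hc : L.Comp V c)
    (hW : L.Comp W c) (hm : ∀ t, (L.slice t).IsCross → ¬ L.Mono c t) : V = W := by
  ext t
  by_cases h : (L.slice t).IsCross
  · obtain ⟨i, b, hib⟩ := id h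
    rw [hc.mem_iff hib (hm t h), hW.mem_iff hib (hm t h)]
  · exact iff_of_false (fun h' => h (hc.cross t h')) fun h' => h (hW.cross t h')

/-- Every colouring without monochromatic crossings belongs to an orientation. -/
theorem Comp.exists_orientation {V : Finset (Fin N)} {c : Coloring} (hc : L.Comp V c)
    (hm : ∀ t, (L.slice t).IsCross → ¬ L.Mono c t) :
    ∃ o : L.Orientation, o.vertex.1 = V ∧ o.col = c := by
  obtain ⟨o, rfl⟩ := (hc.flow hm).exists_orientation
  exact ⟨o, o.comp.vertex_unique hc hm, rfl⟩

end Diagram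

end LeeKh

namespace LeeKh

namespace Diagram

variable {N : ℕ} {L : Diagram N}

/-! ## The square relation for the coefficients of the cube -/

open scoped Classical in
/-- Two to the number of circles of colour `k`. -/
noncomputable def colorCount (L : Diagram N) (V : Finset (Fin N)) (c : Coloring) (k : Bool) : ℚ :=
  if h : ∀ t ∈ V, (L.slice t).IsCross then
    ∏ C : L.Circle ⟨V, h⟩, if colorOf c C = k then 2 else 1
  else 1

theorem colorCount_pos (V : Finset (Fin N)) (c : Coloring) (k : Bool) :
    0 < L.colorCount V c k := by
  unfold colorCount
  split_ifs
  · apply Finset.prod_pos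
    intro C _
    split_ifs <;> norm_num
  · norm_num

theorem colorCount_merge {t : Fin N} (h : (L.slice t).IsCross) (v w : L.Vertex)
    (hoff : ∀ s ≠ t, (s ∈ v.1 ↔ s ∈ w.1))
    (hw : L.circle w (L.bl t h) = L.circle w (L.tr t h))
    (hv : L.circle v (L.bl t h) ≠ L.circle v (L.tr t h)) {c : Coloring}
    (hcv : L.Comp v.1 c) (hcw : L.Comp w.1 c) (k : Bool) :
    L.colorCount v.1 c k =
      (if c t (L.slice t).pos = k then 2 else 1) * L.colorCount w.1 c k := by
  obtain ⟨g, hg, hcoarse, hprod⟩ := exists_circle_merge h v w hoff hw hv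
  unfold colorCount
  rw [dif_pos v.2, dif_pos w.2]
  refine (hprod _).trans ?_
  have hcol := hcw.circle_eq hw
  congr 1
  · rw [hcv.colorOf_circle, ← hcol, color_bl h c]
  · apply Finset.prod_congr rfl
    intro C _
    have : colorOf c (g C) = colorOf c C := by
      obtain ⟨p, rfl⟩ := Quot.exists_rep C
      change colorOf c (g (L.circle w p)) = colorOf c (L.circle w p)
      by_cases hp : L.circle v p = L.circle v (L.tr t h)
      · have h1 : L.circle w p = L.circle w (L.bl t h) := (hcoarse _ _ hp).trans hw.symm
        rw [h1, hg _ hv, hcv.colorOf_circle, hcw.colorOf_circle]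
      · rw [hg p hp, hcv.colorOf_circle, hcw.colorOf_circle]
    rw [this]

theorem colorCount_insert {V : Finset (Fin N)} {c : Coloring} {t : Fin N} (hc : L.Comp V c)
    (h : (L.slice t).IsCross) (ht : t ∉ V) (hm : L.Mono c t) (k : Bool) :
    (L.Same V t (L.slice t).pos (t + 1) ((L.slice t).pos + 1) → L.colorCount (insert t V) c k =
      (if c t (L.slice t).pos = k then 2 else 1) * L.colorCount V c k) ∧
    (¬ L.Same V t (L.slice t).pos (t + 1) ((L.slice t).pos + 1) → L.colorCount V c k =
      (if c t (L.slice t).pos = k then 2 else 1) * L.colorCount (insert t V) c k) := by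
  have hc' : L.Comp (insert t V) c := (hc.insert_iff h ht).2 hm
  have hoff : ∀ s ≠ t, (s ∈ V ↔ s ∈ insert t V) := by
    intro s hs; simp [hs]
  have hiff := circle_flip_iff h ⟨V, hc.cross⟩ ⟨_, hc'.cross⟩ ht (Finset.mem_insert_self t V) hoff
  have hsame := same_corner_iff h ⟨V, hc.cross⟩
  constructor
  · intro hs
    have h1 := hsame.1 hs
    exact colorCount_merge h ⟨_, hc'.cross⟩ ⟨V, hc.cross⟩ (fun s hs => (hoff s hs).symm) h1
      (fun h2 => hiff.1 h2 h1) hc' hc k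
  · intro hs
    have h1 : ¬ _ := fun h => hs (hsame.2 h)
    exact colorCount_merge h ⟨V, hc.cross⟩ ⟨_, hc'.cross⟩ hoff (hiff.2 h1) h1 hc hc' k

/-- No case distinction on the positions of the circles is needed. A splitting of colour `k` doubles
`colorCount` at `k` and a merge halves it, while the other colour is not affected; both ways around
the square have the same initial and final counts. -/
theorem Comp.kap_square {V : Finset (Fin N)} {c : Coloring} (hc : L.Comp V c) {t s : Fin N}
    (ht : (L.slice t).IsCross) (hs : (L.slice s).IsCross) (hts : t ≠ s) (htV : t ∉ V)
    (hsV : s ∉ V) (hmt : L.Mono c t) (hms : L.Mono c s) :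
    L.kap V t c * L.kap (insert t V) s c = L.kap V s c * L.kap (insert s V) t c := by
  have hct := (hc.insert_iff ht htV).2 hmt
  have hcs := (hc.insert_iff hs hsV).2 hms
  have hst' : s ∉ insert t V := by simp [hts.symm, hsV]
  have hts' : t ∉ insert s V := by simp [hts, htV]
  have e1 := fun k => colorCount_insert hc ht htV hmt k
  have e2 := fun k => colorCount_insert hc hs hsV hms k
  have e3 := fun k => colorCount_insert hct hs hst' hms k
  have e4 := fun k => colorCount_insert hcs ht hts' hmt k
  rw [Finset.insert_comm] at e3
  have p1 := fun k => L.colorCount_pos V c k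
  have p2 := fun k => L.colorCount_pos (insert t V) c k
  have p3 := fun k => L.colorCount_pos (insert s V) c k
  have p4 := fun k => L.colorCount_pos (insert t (insert s V)) c k
  unfold kap
  generalize L.colorCount (insert t (insert s V)) c = a11 at *
  generalize L.colorCount (insert t V) c = a10 at *
  generalize L.colorCount (insert s V) c = a01 at *
  generalize L.colorCount V c = a00 at *
  generalize c t (L.slice t).pos = kt at *
  generalize c s (L.slice s).pos = ks at *
  generalize L.Same V t (L.slice t).pos (t + 1) ((L.slice t).pos + 1) = S1 at *
  generalize L.Same V s (L.slice s).pos (s + 1) ((L.slice s).pos + 1) = S2 at *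
  generalize L.Same (insert t V) s (L.slice s).pos (s + 1) ((L.slice s).pos + 1) = S3 at *
  generalize L.Same (insert s V) t (L.slice t).pos (t + 1) ((L.slice t).pos + 1) = S4 at *
  clear hc hct hcs
  -- If the crossings have the same colour, the quotient of the final and the initial count
  -- determines how many of two steps are splittings, and each splitting has the same factor.
  by_cases hk : kt = ks
  · subst hk
    have p1 := p1 kt
    have p2 := p2 kt
    have p3 := p3 kt
    have p4 := p4 kt
    have e1 := e1 kt
    have e2 := e2 kt
    have e3 := e3 kt
    have e4 := e4 kt
    simp only [if_true] at e1 e2 e3 e4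
    by_cases h1 : S1 <;> by_cases h2 : S2 <;> by_cases h3 : S3 <;> by_cases h4 : S4 <;>
      simp only [h1, h2, h3, h4, not_true, not_false_eq_true, true_implies, false_implies,
        and_true, true_and, if_true, if_false] at e1 e2 e3 e4 ⊢ <;>
      first | ring1 | (exfalso; linarith)
  -- If the colours are different, the count of the colour of `t` is changed by the step `t` only.
  -- So `t` splits before `s` is changed if and only if it does so afterwards, and likewise for `s`.
  · have hk' : ks ≠ kt := fun h => hk h.symm
    have h14 : S1 ↔ S4 := by
      have p1 := p1 kt
      have p2 := p2 kt
      have p3 := p3 kt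
      have p4 := p4 kt
      have e1 := e1 kt
      have e2 := e2 kt
      have e3 := e3 kt
      have e4 := e4 kt
      simp only [if_true, if_neg hk', one_mul] at e1 e2 e3 e4
      by_cases h1 : S1 <;> by_cases h2 : S2 <;> by_cases h3 : S3 <;> by_cases h4 : S4 <;>
        simp only [h1, h2, h3, h4, not_true, not_false_eq_true, true_implies, false_implies,
          and_true, true_and, true_iff, false_iff] at e1 e2 e3 e4 ⊢ <;> linarith
    have h23 : S2 ↔ S3 := by
      have p1 := p1 ks
      have p2 := p2 ks
      have p3 := p3 ks
      have p4 := p4 ks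
      have e1 := e1 ks
      have e2 := e2 ks
      have e3 := e3 ks
      have e4 := e4 ks
      simp only [if_true, if_neg hk, one_mul] at e1 e2 e3 e4
      by_cases h1 : S1 <;> by_cases h2 : S2 <;> by_cases h3 : S3 <;> by_cases h4 : S4 <;>
        simp only [h1, h2, h3, h4, not_true, not_false_eq_true, true_implies, false_implies,
          and_true, true_and, true_iff, false_iff] at e1 e2 e3 e4 ⊢ <;> linarith
    obtain rfl := propext h14
    obtain rfl := propext h23
    ring

/-! ## The homology -/

theorem sgn_mul_self (r : Fin N → ℕ) (V : Finset (Fin N)) (t : Fin N) :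
    sgn r V t * sgn r V t = 1 := by
  unfold sgn
  rw [← mul_pow]
  norm_num

theorem sgn_eq_erase (r : Fin N → ℕ) {V : Finset (Fin N)} {s : Fin N} (hs : s ∈ V) (t : Fin N) :
    sgn r V t = if r s < r t then - sgn r (V.erase s) t else sgn r (V.erase s) t := by
  conv_lhs => rw [← Finset.insert_erase hs]
  exact sgn_insert r (by simp) t

theorem sgn_square {r : Fin N → ℕ} (hr : Function.Injective r) {V : Finset (Fin N)} {t s : Fin N}
    (hts : t ≠ s) (ht : t ∈ V) (hs : s ∈ V) :
    sgn r V t * sgn r (V.erase t) s = - (sgn r V s * sgn r (V.erase s) t) := by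
  rw [sgn_eq_erase r hs t, sgn_eq_erase r ht s]
  have := hr.ne hts
  rcases lt_or_gt_of_ne this with h | h
  · rw [if_neg (by omega), if_pos h]; ring
  · rw [if_pos h, if_neg (by omega)]; ring

theorem dLee_dLee {r : Fin N → ℕ} (hr : Function.Injective r) (f : L.CKh) :
    L.dLee r (L.dLee r f) = 0 := by
  classical
  apply pair_inj
  intro V c hc
  rw [pair_dLee r hc, map_zero]
  -- The contribution of the path that changes `s` and then `t`. The signs of the two paths around a
  -- square are opposite and the factors agree by `Comp.kap_square`, so `g` is antisymmetric.
  let g : Fin N → Fin N → ℚ := fun t s =>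
    if t ∈ V ∧ L.Mono c t ∧ s ∈ V.erase t ∧ L.Mono c s then
      sgn r V t * L.kap (V.erase t) t c * (sgn r (V.erase t) s * L.kap ((V.erase t).erase s) s c *
        L.pair ((V.erase t).erase s) c f) else 0
  have hg : ∀ t, L.term r V c (L.dLee r f) t = ∑ s, g t s := by
    intro t
    unfold term
    by_cases h : t ∈ V ∧ L.Mono c t
    · rw [if_pos h, pair_dLee r ((hc.erase_iff h.1).2 h.2), Finset.mul_sum]
      apply Finset.sum_congr rfl
      intro s _
      simp only [g, term, h.1, h.2, true_and]
      split_ifs <;> ring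
    · rw [if_neg h, eq_comm]
      apply Finset.sum_eq_zero
      intro s _
      exact if_neg fun h' => h ⟨h'.1, h'.2.1⟩
  have hanti : ∀ t s, g t s + g s t = 0 := by
    intro t s
    simp only [g]
    by_cases h : t ∈ V ∧ L.Mono c t ∧ s ∈ V.erase t ∧ L.Mono c s
    · obtain ⟨h1, h2, h3, h4⟩ := h
      have h5 := Finset.mem_of_mem_erase h3
      have hst := Finset.ne_of_mem_erase h3
      rw [if_pos ⟨h1, h2, h3, h4⟩, if_pos ⟨h5, h4, Finset.mem_erase.2 ⟨hst.symm, h1⟩, h2⟩,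
        Finset.erase_right_comm (a := s)]
      have hU : L.Comp ((V.erase t).erase s) c :=
        (((hc.erase_iff h1).2 h2).erase_iff h3).2 h4
      have hsq := hU.kap_square (hc.cross t h1) (hc.cross s h5) hst.symm (by simp) (by simp) h2 h4
      rw [Finset.insert_erase h3, Finset.erase_right_comm, Finset.insert_erase
        (Finset.mem_erase.2 ⟨hst.symm, h1⟩)] at hsq
      have hsg := sgn_square hr hst.symm h1 h5
      rw [Finset.erase_right_comm (a := t)]
      linear_combination (L.kap (V.erase t) t c * L.kap ((V.erase s).erase t) s c *
        L.pair ((V.erase s).erase t) c f) * hsg + (- sgn r V s * sgn r (V.erase s) t *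
        L.pair ((V.erase s).erase t) c f) * (-hsq)
    · rw [if_neg h, if_neg, add_zero]
      rintro ⟨h1, h2, h3, h4⟩
      exact h ⟨Finset.mem_of_mem_erase h3, h4,
        Finset.mem_erase.2 ⟨(Finset.ne_of_mem_erase h3).symm, h1⟩, h2⟩
  simp only [hg]
  have h1 : ∑ t, ∑ s, g t s = ∑ t, ∑ s, g s t := Finset.sum_comm
  have h2 : ∑ t, ∑ s, g t s + ∑ t, ∑ s, g s t = 0 := by
    rw [← Finset.sum_add_distrib]
    apply Finset.sum_eq_zero
    intro t _
    rw [← Finset.sum_add_distrib]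
    exact Finset.sum_eq_zero fun s _ => hanti t s
  linarith

/-- A cycle is a boundary if its coordinates vanish at all colourings that come from
orientations. -/
theorem exists_boundary {r : Fin N → ℕ} (hr : Function.Injective r) {z : L.CKh}
    (hz : L.dLee r z = 0)
    (h : ∀ o : L.Orientation, L.pair o.vertex.1 o.col z = 0) : ∃ y, L.dLee r y = z := by
  classical
  -- A contracting homotopy of the cube of `c`: one monochromatic crossing is chosen and its edge is
  -- inverted. The choice is made from a statement in which only `c` occurs, so it is the same at
  -- all resolutions `V`.
  obtain ⟨y, hy⟩ := L.exists_pair_eq fun V c =>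
    if h : ∃ t, (L.slice t).IsCross ∧ L.Mono c t then
      if h.choose ∈ V then 0 else
        sgn r (insert h.choose V) h.choose / L.kap V h.choose c *
          L.pair (insert h.choose V) c z
    else 0
  refine ⟨y, pair_inj fun V c hc => ?_⟩
  rw [pair_dLee r hc]
  by_cases hex : ∃ t, (L.slice t).IsCross ∧ L.Mono c t
  · obtain ⟨ht, hm⟩ := hex.choose_spec
    have hyV : ∀ V, L.Comp V c → L.pair V c y = if hex.choose ∈ V then 0 else
        sgn r (insert hex.choose V) hex.choose / L.kap V hex.choose c *
          L.pair (insert hex.choose V) c z := by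
      intro V hV
      rw [hy V c hV, dif_pos hex]
    generalize hex.choose = t₀ at *
    -- If `t₀` is in `V`, the edges in other directions start where `y` vanishes, and the edge of
    -- `t₀` returns the coordinate of `z`.
    by_cases h0 : t₀ ∈ V
    · rw [Finset.sum_eq_single t₀]
      · have hk := L.kap_ne_zero (V.erase t₀) t₀ c
        rw [term, if_pos ⟨h0, hm⟩, hyV _ ((hc.erase_iff h0).2 hm), if_neg (by simp),
          Finset.insert_erase h0]
        have := sgn_mul_self r V t₀
        field_simp
        linear_combination (L.pair V c z) * this
      · intro t _ hne
        unfold term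
        split_ifs with h1
        · rw [hyV _ ((hc.erase_iff h1.1).2 h1.2), if_pos (Finset.mem_erase.2 ⟨hne.symm, h0⟩),
            mul_zero]
        · rfl
      · simp
    -- If `t₀` is not in `V`, the equation `d z = 0` at `insert t₀ V` expresses the coordinate of
    -- `z` at `V` by terms in the other directions. By the square relations these are the terms of
    -- `d y` at `V`, up to the common factor `-a`.
    · have hc' : L.Comp (insert t₀ V) c := (hc.insert_iff ht h0).2 hm
      have hz' := pair_dLee r hc' z
      rw [hz, map_zero] at hz'
      have hk := L.kap_ne_zero V t₀ c
      set a := sgn r (insert t₀ V) t₀ / L.kap V t₀ c with ha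
      have hterm : ∀ t, t ≠ t₀ → L.term r V c y t = - a * L.term r (insert t₀ V) c z t := by
        intro t hne
        unfold term
        by_cases h1 : t ∈ V ∧ L.Mono c t
        · have hct := (hc.erase_iff h1.1).2 h1.2
          have h2 : t₀ ∉ V.erase t := fun h => h0 (Finset.mem_of_mem_erase h)
          rw [if_pos h1, if_pos ⟨Finset.mem_insert_of_mem h1.1, h1.2⟩, hyV _ hct, if_neg h2]
          have h3 : (insert t₀ V).erase t = insert t₀ (V.erase t) :=
            Finset.erase_insert_of_ne hne.symm
          rw [h3, ha]
          have hsq := hct.kap_square (hc.cross t h1.1) ht hne (by simp) h2 h1.2 hm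
          rw [Finset.insert_erase h1.1] at hsq
          have hsg := sgn_square hr hne (Finset.mem_insert_of_mem h1.1)
            (Finset.mem_insert_self t₀ V)
          rw [h3, Finset.erase_insert h0] at hsg
          have hk2 := L.kap_ne_zero (V.erase t) t₀ c
          have s1 := sgn_mul_self r (insert t₀ V) t₀
          have s2 := sgn_mul_self r (insert t₀ V) t
          have s3 := sgn_mul_self r V t
          have hsg' : sgn r V t * sgn r (insert t₀ (V.erase t)) t₀ =
              - (sgn r (insert t₀ V) t₀ * sgn r (insert t₀ V) t) := by
            linear_combination (sgn r (insert t₀ V) t * sgn r V t) * hsg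
              - (sgn r V t * sgn r (insert t₀ (V.erase t)) t₀) * s2
              - (sgn r (insert t₀ V) t₀ * sgn r (insert t₀ V) t) * s3
          field_simp
          linear_combination L.pair (insert t₀ (V.erase t)) c z *
            ((L.kap (V.erase t) t c * L.kap V t₀ c) * hsg' -
              (sgn r (insert t₀ V) t₀ * sgn r (insert t₀ V) t) * hsq)
        · rw [if_neg h1, if_neg, mul_zero]
          rintro ⟨h2, h3⟩
          exact h1 ⟨(Finset.mem_insert.1 h2).resolve_left hne, h3⟩
      have ht0 : L.term r V c y t₀ = 0 := if_neg fun h => h0 h.1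
      rw [← Finset.add_sum_erase _ _ (Finset.mem_univ t₀), ht0, zero_add,
        Finset.sum_congr rfl fun t ht => hterm t (Finset.ne_of_mem_erase ht), ← Finset.mul_sum]
      rw [← Finset.add_sum_erase _ _ (Finset.mem_univ t₀)] at hz'
      have ht0' : L.term r (insert t₀ V) c z t₀ =
          sgn r (insert t₀ V) t₀ * L.kap V t₀ c * L.pair V c z := by
        rw [term, if_pos ⟨Finset.mem_insert_self t₀ V, hm⟩, Finset.erase_insert h0]
      rw [ht0'] at hz'
      have h5 : a * (sgn r (insert t₀ V) t₀ * L.kap V t₀ c) = 1 := by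
        rw [ha]
        field_simp
        rw [pow_two]
        exact sgn_mul_self _ _ _
      linear_combination a * hz' + (L.pair V c z) * h5
  -- Without a monochromatic crossing the coordinate is that of an orientation. There `z` vanishes
  -- by assumption, and no edge ends.
  · obtain ⟨o, rfl, rfl⟩ := hc.exists_orientation fun t h1 h2 => hex ⟨t, h1, h2⟩
    rw [h o]
    apply Finset.sum_eq_zero
    intro t _
    exact if_neg fun h' => hex ⟨t, hc.cross t h'.1, h'.2⟩

/-- An edge contributes only at a monochromatic crossing, and an orientation has none. Hence the
orientation coordinates are well defined on homology classes. -/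
theorem pair_dLee_orientation (r : Fin N → ℕ) (o : L.Orientation) (f : L.CKh) :
    L.pair o.vertex.1 o.col (L.dLee r f) = 0 := by
  rw [pair_dLee r o.comp]
  apply Finset.sum_eq_zero
  intro t _
  exact if_neg fun h' => o.not_mono (o.vertex.2 t h'.1) h'.2

theorem dLee_canonical (r : Fin N → ℕ) (o : L.Orientation) : L.dLee r (L.canonical o) = 0 := by
  apply pair_inj
  intro V c hc
  rw [pair_dLee r hc, map_zero]
  apply Finset.sum_eq_zero
  intro t _
  unfold term
  split_ifs with h
  · rw [o.pair_canonical_eq_zero ((hc.erase_iff h.1).2 h.2), mul_zero]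
    rintro ⟨-, rfl⟩
    exact o.not_mono (hc.cross t h.1) h.2
  · rfl

end Diagram

end LeeKh

namespace LeeKh

namespace Diagram

variable {N : ℕ} {L L' : Diagram N}

/-! ## Diagrams that differ at some levels -/

/-- The colourings agree at all levels not in `J`. -/
def EqOff (J : Set ℕ) (c d : Coloring) : Prop := ∀ n ∉ J, c n = d n

theorem EqOff.symm {J : Set ℕ} {c d : Coloring} (h : EqOff J c d) : EqOff J d c :=
  fun n hn => (h n hn).symm

theorem EqOff.trans {J : Set ℕ} {c d e : Coloring} (h : EqOff J c d) (h' : EqOff J d e) :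
    EqOff J c e := fun n hn => (h n hn).trans (h' n hn)

/-- Only the slices that touch a level in `J` have to be checked when colours are changed at these
levels. -/
theorem Comp.replace {V V' : Finset (Fin N)} {J : Set ℕ} {c c' : Coloring} (hc : L.Comp V c)
    (hw : L.wd = L'.wd) (hcross : ∀ t ∈ V', (L'.slice t).IsCross) (h : EqOff J c c')
    (hsupp : ∀ n ∈ J, ∀ j, c' n j = true → j < L.wd n)
    (hoff : ∀ t : Fin N, (t : ℕ) ∉ J → (t + 1 : ℕ) ∉ J → L'.shapeAt V' t = L.shapeAt V t)
    (hok : ∀ t : Fin N, ((t : ℕ) ∈ J ∨ (t + 1 : ℕ) ∈ J) →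
      (L'.shapeAt V' t).Ok (c' t) (c' (t + 1))) : L'.Comp V' c' where
  cross := hcross
  supp n j hj := by
    rw [← hw]
    by_cases hn : n ∈ J
    · exact hsupp n hn j hj
    · rw [← h n hn] at hj
      exact hc.supp n j hj
  ok t := by
    by_cases ht : (t : ℕ) ∈ J ∨ (t + 1 : ℕ) ∈ J
    · exact hok t ht
    · rw [not_or] at ht
      rw [hoff t ht.1 ht.2, ← h _ ht.1, ← h _ ht.2]
      exact hc.ok t

/-- The resolution `V'` of `L'` is obtained from the resolution `V` of `L` by a planar isotopy that
moves only the levels in `J`, and by adding a small circle at these levels, which contains the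
points in `Z`. -/
structure Refill (L L' : Diagram N) (J : Set ℕ) (Z : Set (ℕ × ℕ)) (V V' : Finset (Fin N)) :
    Prop where
  cross : ∀ t ∈ V, (L.slice t).IsCross
  cross' : ∀ t ∈ V', (L'.slice t).IsCross
  wd : L.wd = L'.wd
  ext : ∀ c, L.Comp V c → ∀ β, ∃ c', L'.Comp V' c' ∧ EqOff J c c' ∧ ∀ z ∈ Z, c' z.1 z.2 = β
  res : ∀ c', L'.Comp V' c' → ∃ c, L.Comp V c ∧ EqOff J c c'
  uniq : ∀ c d, L.Comp V c → L.Comp V d → EqOff J c d → c = d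
  uniq' : ∀ c d, L'.Comp V' c → L'.Comp V' d → EqOff J c d → (∀ z ∈ Z, c z.1 z.2 = d z.1 z.2) →
    c = d

namespace Refill

variable {J : Set ℕ} {Z : Set (ℕ × ℕ)} {V V' : Finset (Fin N)}

theorem same_iff (R : Refill L L' J Z V V') {n m : ℕ} (hn : n ∉ J) (hm : m ∉ J) (j k : ℕ) :
    L.Same V n j m k ↔ L'.Same V' n j m k := by
  constructor
  · intro h c' hc'
    obtain ⟨c, hc, he⟩ := R.res c' hc'
    rw [← he n hn, ← he m hm]
    exact h c hc
  · intro h c hc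
    obtain ⟨c', hc', he, -⟩ := R.ext c hc true
    rw [he n hn, he m hm]
    exact h c' hc'

theorem kap_eq (R : Refill L L' J Z V V') {t : Fin N} (h : L.slice t = L'.slice t)
    (h1 : (t : ℕ) ∉ J) (h2 : (t + 1 : ℕ) ∉ J) {c c' : Coloring} (he : EqOff J c c') :
    L.kap V t c = L'.kap V' t c' := by
  unfold kap
  have := R.same_iff h1 h2 (L.slice t).pos ((L.slice t).pos + 1)
  rw [h] at this
  rw [h, he _ h1]
  by_cases hs : L'.Same V' t (L'.slice t).pos (t + 1) ((L'.slice t).pos + 1)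
  · rw [if_pos hs, if_pos (this.2 hs)]
  · rw [if_neg hs, if_neg fun h => hs (this.1 h)]

theorem _root_.LeeKh.Diagram.SamePlace.apply {p : L.Point} {p' : L'.Point} (h : SamePlace p p')
    (c : Coloring) : c p'.1 p'.2 = c p.1 p.2 := by
  obtain ⟨n, j⟩ := p
  obtain ⟨n', j'⟩ := p'
  obtain ⟨h1, h2⟩ := h
  simp only at h1 h2
  subst h1
  simp only [h2]

theorem circle_eq_iff {v : L.Vertex} {v' : L'.Vertex} (R : Refill L L' J Z v.1 v'.1)
    {p q : L.Point} {p' q' : L'.Point} (hp : SamePlace p p') (hq : SamePlace q q')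
    (hpJ : (p.1 : ℕ) ∉ J) (hqJ : (q.1 : ℕ) ∉ J) :
    L.circle v p = L.circle v q ↔ L'.circle v' p' = L'.circle v' q' := by
  rw [circle_eq_iff_same, circle_eq_iff_same, R.same_iff hpJ hqJ]
  unfold Same
  refine forall₂_congr fun c _ => ?_
  rw [hp.apply c, hq.apply c]

theorem exists_same_place (hw : L.wd = L'.wd) (p : L.Point) : ∃ p' : L'.Point, SamePlace p p' := by
  obtain ⟨p', h1, h2⟩ := L'.exists_point (hw ▸ p.lt_wd)
  exact ⟨p', Fin.ext h1.symm, h2.symm⟩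

theorem exists_same_place' (hw : L.wd = L'.wd) (p' : L'.Point) :
    ∃ p : L.Point, SamePlace p p' := by
  obtain ⟨p, h1, h2⟩ := L.exists_point (hw.symm ▸ p'.lt_wd)
  exact ⟨p, Fin.ext h1, h2⟩

theorem comp_false {V : Finset (Fin N)} (h : ∀ t ∈ V, (L.slice t).IsCross) :
    L.Comp V fun _ _ => false where
  cross := h
  supp := by simp
  ok t e f _ := by cases e <;> cases f <;> rfl

open scoped Classical in
-- A circle that stays within the levels `J` could be recoloured without changing anything outside,
-- in contradiction to `uniq`.
theorem exists_outer {v : L.Vertex} (R : Refill L L' J Z v.1 V') (C : L.Circle v) :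
    ∃ p : L.Point, L.circle v p = C ∧ (p.1 : ℕ) ∉ J := by
  by_contra! hcon
  have h1 := comp_ofCircle fun D : L.Circle v => decide (D = C)
  have h2 := R.uniq _ _ h1 (comp_false v.2) (by
    intro n hn
    funext j
    by_cases hj : j < L.wd n
    · obtain ⟨p, rfl, rfl⟩ := L.exists_point hj
      rw [ofCircle_point]
      exact decide_eq_false fun h => hn (hcon p h)
    · exact ofCircle_of_not _ hj)
  have h3 := ofCircle_point (fun D : L.Circle v => decide (D = C)) (Quot.out C)
  rw [h2, circle_out] at h3
  simp at h3

open scoped Classical in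
/-- The circles of the two resolutions correspond to each other, except for the small circle. -/
theorem exists_circle_map {v : L.Vertex} {v' : L'.Vertex} (R : Refill L L' J Z v.1 v'.1) :
    ∃ θ : L.Circle v → L'.Circle v',
      (∀ p p', SamePlace p p' → (p.1 : ℕ) ∉ J → θ (L.circle v p) = L'.circle v' p') ∧
      ∀ F : L'.Circle v' → ℚ, ∏ C', F C' = (∏ C' ∈ Finset.univ.filter fun C' =>
        ∃ p' : L'.Point, L'.circle v' p' = C' ∧ ((p'.1 : ℕ), (p'.2 : ℕ)) ∈ Z, F C') *
        ∏ C, F (θ C) := by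
  choose q hq hqJ using R.exists_outer
  choose q' hq' using fun C => exists_same_place R.wd (q C)
  have hθ : ∀ p p', SamePlace p p' → (p.1 : ℕ) ∉ J →
      L'.circle v' (q' (L.circle v p)) = L'.circle v' p' := by
    intro p p' hp hpJ
    rw [← R.circle_eq_iff (hq' _) hp (hqJ _) hpJ]
    exact hq _
  refine ⟨fun C => L'.circle v' (q' C), hθ, fun F => ?_⟩
  rw [← Finset.prod_mul_prod_compl (Finset.univ.filter fun C' =>
        ∃ p' : L'.Point, L'.circle v' p' = C' ∧ ((p'.1 : ℕ), (p'.2 : ℕ)) ∈ Z) F]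
  congr 1
  symm
  refine Finset.prod_bij (fun C _ => L'.circle v' (q' C)) ?_ ?_ ?_ fun _ _ => rfl
  · intro C _
    simp only [Finset.mem_compl, Finset.mem_filter, Finset.mem_univ, true_and, not_exists, not_and]
    intro p' hp' hZ
    obtain ⟨c', hc', he, hz⟩ := R.ext _ (comp_false v.2) true
    have h1 := hz _ hZ
    rw [hc'.circle_eq hp', (hq' C).apply c', ← he _ (hqJ C)] at h1
    exact absurd h1 (by simp)
  · intro C _ D _ h
    rwa [← R.circle_eq_iff (hq' _) (hq' _) (hqJ _) (hqJ _), hq, hq] at h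
  · intro C' hC'
    simp only [Finset.mem_compl, Finset.mem_filter, Finset.mem_univ, true_and, not_exists,
      not_and] at hC'
    by_contra! hcon
    have h1 := comp_ofCircle fun D : L'.Circle v' => decide (D = C')
    have h2 := R.uniq' _ _ h1 (comp_false v'.2) (by
      intro n hn
      funext j
      by_cases hj : j < L'.wd n
      · obtain ⟨p', rfl, rfl⟩ := L'.exists_point hj
        rw [ofCircle_point]
        refine decide_eq_false fun h => ?_
        obtain ⟨p, hp⟩ := exists_same_place' R.wd p'
        rw [← hp.1] at hn
        exact hcon (L.circle v p) (Finset.mem_univ _) ((hθ p p' hp hn).trans h)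
      · exact ofCircle_of_not _ hj) (by
      rintro ⟨n, j⟩ hz
      by_cases hj : j < L'.wd n
      · obtain ⟨p', rfl, rfl⟩ := L'.exists_point hj
        rw [ofCircle_point]
        exact decide_eq_false fun h => hC' p' h hz
      · exact ofCircle_of_not _ hj)
    have h3 := ofCircle_point (fun D : L'.Circle v' => decide (D = C')) (Quot.out C')
    rw [h2, circle_out] at h3
    simp at h3

/-- The extension of a labelling to the small circle, which gets the label `β`. -/
theorem exists_extension {v : L.Vertex} {v' : L'.Vertex} (R : Refill L L' J Z v.1 v'.1)
    (x : L.Circle v → Bool) (β : Bool) : ∃ x' : L'.Circle v' → Bool,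
      (∀ p p', SamePlace p p' → (p.1 : ℕ) ∉ J → x' (L'.circle v' p') = x (L.circle v p)) ∧
      (∀ p' : L'.Point, ((p'.1 : ℕ), (p'.2 : ℕ)) ∈ Z → x' (L'.circle v' p') = β) ∧
      ∀ c c', L.Comp v.1 c → L'.Comp v'.1 c' → EqOff J c c' →
        ∏ C', ev (colorOf c' C') (x' C') = (open scoped Classical in
          ∏ C' ∈ Finset.univ.filter fun C' => ∃ p' : L'.Point, L'.circle v' p' = C' ∧
            ((p'.1 : ℕ), (p'.2 : ℕ)) ∈ Z, ev (colorOf c' C') β) *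
          ∏ C, ev (colorOf c C) (x C) := by
  classical
  obtain ⟨d, hd, he, hz⟩ := R.ext _ (comp_ofCircle x) β
  obtain ⟨θ, hθ, hprod⟩ := R.exists_circle_map
  have h1 : ∀ p p', SamePlace p p' → (p.1 : ℕ) ∉ J →
      colorOf d (L'.circle v' p') = x (L.circle v p) := by
    intro p p' hp hpJ
    rw [hd.colorOf_circle, hp.apply d, ← he _ hpJ, ofCircle_point]
  have h2 : ∀ p' : L'.Point, ((p'.1 : ℕ), (p'.2 : ℕ)) ∈ Z → colorOf d (L'.circle v' p') = β := by
    intro p' hp'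
    rw [hd.colorOf_circle]
    exact hz _ hp'
  refine ⟨colorOf d, h1, h2, fun c c' hc hc' hcc => ?_⟩
  rw [hprod]
  congr 1
  · apply Finset.prod_congr rfl
    intro C' hC'
    obtain ⟨-, p', rfl, hp'⟩ := Finset.mem_filter.1 hC'
    rw [h2 p' hp']
  · apply Finset.prod_congr rfl
    intro C _
    obtain ⟨p, rfl, hp⟩ := R.exists_outer C
    obtain ⟨p', hp'⟩ := exists_same_place R.wd p
    rw [hθ p p' hp' hp, h1 p p' hp' hp, hc'.colorOf_circle, hc.colorOf_circle, hp'.apply c',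
      hcc _ hp]

theorem extension_unique {v : L.Vertex} {v' : L'.Vertex} (R : Refill L L' J Z v.1 v'.1)
    {x' y' : L'.Circle v' → Bool}
    (h : ∀ p' : L'.Point, (p'.1 : ℕ) ∉ J → x' (L'.circle v' p') = y' (L'.circle v' p'))
    (hz : ∀ p' : L'.Point, ((p'.1 : ℕ), (p'.2 : ℕ)) ∈ Z →
      x' (L'.circle v' p') = y' (L'.circle v' p')) : x' = y' := by
  have h1 := R.uniq' _ _ (comp_ofCircle x') (comp_ofCircle y') (by
    intro n hn
    funext j
    by_cases hj : j < L'.wd n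
    · obtain ⟨p', rfl, rfl⟩ := L'.exists_point hj
      rw [ofCircle_point, ofCircle_point, h p' hn]
    · rw [ofCircle_of_not _ hj, ofCircle_of_not _ hj]) (by
    rintro ⟨n, j⟩ hnj
    by_cases hj : j < L'.wd n
    · obtain ⟨p', rfl, rfl⟩ := L'.exists_point hj
      rw [ofCircle_point, ofCircle_point, hz p' hnj]
    · rw [ofCircle_of_not _ hj, ofCircle_of_not _ hj])
  funext C
  rw [← colorOf_ofCircle x', h1, colorOf_ofCircle]

/-- The characters have the value `1` at `v₊`. So an identification of complexes and the birth of a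
circle with label `v₊` both preserve coordinates, whatever colour the small circle has; for an
identification `Z` is empty. -/
theorem pair_transfer (R : Refill L L' J Z V V') {I : Set (Fin (N + 1))}
    (hI : ∀ n, n ∈ I ↔ (n : ℕ) ∈ J) {P : Finset (Fin N) → Finset (Fin N) → Prop}
    {E : L'.State → Prop} (hP : ∀ W : L.Vertex, P W.1 V' ↔ W.1 = V)
    (hE : ∀ s' : L'.State, s'.1.1 = V' →
      (E s' ↔ ∀ p' : L'.Point, ((p'.1 : ℕ), (p'.2 : ℕ)) ∈ Z → s'.label p' = true))
    {c c' : Coloring} (hc : L.Comp V c) (hc' : L'.Comp V' c') (h : EqOff J c c') (f : L.CKh) :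
    L'.pair V' c' (transfer L L' I P E f) = L.pair V c f := by
  classical
  rw [← one_mul (L.pair V c f)]
  apply pair_ofCoeff
  rintro ⟨v, x⟩
  rw [sum_weight (L := L') ⟨V', hc'.cross⟩ c', one_mul]
  by_cases hv : v.1 = V
  · subst hv
    rw [weight, if_pos rfl]
    obtain ⟨x', h1, h2, h3⟩ := exists_extension (v' := ⟨V', hc'.cross⟩) R x true
    rw [Fintype.sum_eq_single x', if_pos, one_mul, h3 c c' hc hc' h, Finset.prod_eq_one, one_mul]
    · intro C' _
      simp [ev]
    · refine ⟨(hP v).2 rfl, ?_, (hE _ rfl).2 h2⟩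
      intro p p' hp hpI
      rw [hI] at hpI
      exact h1 p p' hp hpI
    · intro y' hy'
      rw [if_neg, zero_mul]
      rintro ⟨-, ha, he⟩
      apply hy'
      apply extension_unique (v' := ⟨V', hc'.cross⟩) R
      · intro p' hp'
        obtain ⟨p, hp⟩ := exists_same_place' R.wd p'
        rw [← hp.1] at hp'
        rw [h1 p p' hp hp']
        exact ha p p' hp (by rwa [hI])
      · intro p' hp'
        rw [h2 p' hp']
        exact (hE _ rfl).1 he p' hp'
  · rw [weight, if_neg (fun h => hv h)]
    apply Finset.sum_eq_zero
    intro x' _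
    rw [if_neg, zero_mul]
    rintro ⟨hp, -⟩
    exact hv ((hP v).1 hp)

end Refill

theorem pair_transfer_eq_zero {V' : Finset (Fin N)} {c' : Coloring} {I : Set (Fin (N + 1))}
    {P : Finset (Fin N) → Finset (Fin N) → Prop} {E : L'.State → Prop}
    (hP : ∀ W : L.Vertex, ¬ P W.1 V') (f : L.CKh) :
    L'.pair V' c' (transfer L L' I P E f) = 0 := by
  classical
  rw [← zero_mul (L.pair V' c' f)]
  apply pair_ofCoeff
  intro s
  rw [zero_mul]
  apply Finset.sum_eq_zero
  intro s' _
  by_cases hs : s'.1.1 = V'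
  · rw [if_neg, zero_mul]
    rintro ⟨h, -⟩
    exact hP s.1 (hs ▸ h)
  · rw [weight, if_neg hs, mul_zero]

/-! ## Induced orientations -/

theorem Orientation.induces_iff (hw : L.wd = L'.wd) {I : Set (Fin (N + 1))} {J : Set ℕ}
    (hI : ∀ n, n ∈ I ↔ (n : ℕ) ∈ J) (o : L.Orientation) (o' : L'.Orientation) :
    o.Induces I o' ↔ EqOff J o.col o'.col := by
  constructor
  · intro h n hn
    funext j
    by_cases hj : j < L.wd n
    · obtain ⟨p, rfl, rfl⟩ := L.exists_point hj
      obtain ⟨p', hp⟩ := Refill.exists_same_place hw p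
      have h1 := h p p' hp (by rwa [hI])
      have h2 := o'.col_point p'
      rw [hp.apply o'.col, h1] at h2
      rw [h2, o.col_point, hp.2]
    · rw [o.col_of_not hj, o'.col_of_not (hw ▸ hj)]
  · intro h p p' hp hpI
    rw [hI] at hpI
    have h1 := congrFun (h _ hpI) p.2
    have h2 := o'.col_point p'
    have h3 := o.col_point p
    rw [hp.apply o'.col, ← h1, h3, ← hp.2] at h2
    revert h2
    cases decide (Even (p.2 : ℕ)) <;> cases o.up p <;> cases o'.up p' <;> simp

end Diagram

end LeeKh

/-! ### Correspondence of orientations, and maps that multiply orientation coordinates -/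

namespace LeeKh

/-- The slice contains no cup and no cap. -/
def Slice.Level (σ : Slice) : Prop := σ = .id ∨ σ.IsCross

theorem Slice.Level.width_eq {σ : Slice} (h : σ.Level) {m n : ℕ} (hf : σ.Fits m n) : n = m := by
  rcases h with rfl | ⟨i, p, rfl⟩
  · exact hf
  · exact hf.2

theorem Slice.Level.flow_unique {σ : Slice} (h : σ.Level) {x y y' : ℕ → Bool} (h1 : σ.Flow x y)
    (h2 : σ.Flow x y') : y = y' := by
  rcases h with rfl | ⟨i, p, rfl⟩
  · funext j
    rw [← Shape.ok_id.1 h1 j, ← Shape.ok_id.1 h2 j]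
  · exact Eq.trans h1 (Eq.symm h2)

theorem Slice.fits_unique {σ : Slice} {m n n' : ℕ} (h : σ.Fits m n) (h' : σ.Fits m n') :
    n = n' := by
  cases σ with
  | id => exact h.trans h'.symm
  | cup i => exact h.2.trans h'.2.symm
  | cap i => exact Nat.add_right_cancel (h.2.symm.trans h'.2)
  | cross i p => exact h.2.trans h'.2.symm

theorem crossFlip_left (i : ℕ) (x : ℕ → Bool) : crossFlip i x i = !x (i + 1) := if_pos rfl

theorem crossFlip_right (i : ℕ) (x : ℕ → Bool) : crossFlip i x (i + 1) = !x i := by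
  rw [crossFlip, if_neg (by omega), if_pos rfl]

theorem crossFlip_of_ne {i j : ℕ} (x : ℕ → Bool) (h : j ≠ i) (h' : j ≠ i + 1) :
    crossFlip i x j = x j := by
  rw [crossFlip, if_neg h, if_neg h']

theorem crossFlip_crossFlip (i : ℕ) (x : ℕ → Bool) : crossFlip i (crossFlip i x) = x := by
  funext j
  unfold crossFlip
  by_cases h : j = i
  · simp [h]
  by_cases h' : j = i + 1
  · simp [h']
  · simp [h, h']

theorem crossFlip_supp {i n : ℕ} {x : ℕ → Bool} (hi : i + 1 < n) (h : ∀ j, x j = true → j < n)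
    (j : ℕ) (hj : crossFlip i x j = true) : j < n := by
  unfold crossFlip at hj
  split_ifs at hj
  · omega
  · omega
  · exact h j hj

namespace Diagram

variable {N : ℕ} {L L' : Diagram N}

theorem wd_zero (L : Diagram N) : L.wd 0 = 0 := by
  have := L.wd_fin 0
  rwa [L.width_first] at this

/-- The width is `0` at the bottom, and each slice determines the width above it. Replacing slices
by others without cups and caps changes no width. -/
theorem wd_eq (h : ∀ t, L'.slice t = L.slice t ∨ (L.slice t).Level ∧ (L'.slice t).Level) :
    L.wd = L'.wd := by
  funext n
  induction n with
  | zero => rw [wd_zero, wd_zero]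
  | succ n ih =>
    by_cases hn : n < N
    · have h1 := L.fits' ⟨n, hn⟩
      have h2 := L'.fits' ⟨n, hn⟩
      simp only [← ih] at h1 h2
      rcases h ⟨n, hn⟩ with h3 | ⟨h3, h4⟩
      · rw [h3] at h2
        exact Slice.fits_unique h1 h2
      · rw [h3.width_eq h1, h4.width_eq h2]
    · unfold wd
      rw [dif_neg (by omega), dif_neg (by omega)]

theorem pos_lt_wd {t : Fin N} {i : ℕ} {p : Bool} (h : L.slice t = .cross i p) :
    i + 1 < L.wd t := by
  have := L.fits' t
  rw [h] at this
  have := this.1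
  omega

theorem Flow.replace {J : Set ℕ} {c c' : Coloring} (hc : L.Flow c)
    (hw : L.wd = L'.wd) (h : EqOff J c c')
    (hsupp : ∀ n ∈ J, ∀ j, c' n j = true → j < L.wd n)
    (hoff : ∀ t : Fin N, (t : ℕ) ∉ J → (t + 1 : ℕ) ∉ J → L'.slice t = L.slice t)
    (hok : ∀ t : Fin N, ((t : ℕ) ∈ J ∨ (t + 1 : ℕ) ∈ J) →
      (L'.slice t).Flow (c' t) (c' (t + 1))) : L'.Flow c' where
  supp n j hj := by
    rw [← hw]
    by_cases hn : n ∈ J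
    · exact hsupp n hn j hj
    · rw [← h n hn] at hj
      exact hc.supp n j hj
  flow t := by
    by_cases ht : (t : ℕ) ∈ J ∨ (t + 1 : ℕ) ∈ J
    · exact hok t ht
    · rw [not_or] at ht
      rw [hoff t ht.1 ht.2, ← h _ ht.1, ← h _ ht.2]
      exact hc.flow t

/-- A slice without cups and caps determines the colours above it from those below. So orientations
are determined outside of a move, and induced orientations are unique. -/
theorem Flow.eq_of_eqOff {J : Set ℕ} {c d : Coloring} (hc : L.Flow c) (hd : L.Flow d)
    (h : EqOff J c d) (hJ : ∀ n ∈ J, ∃ t : Fin N, n = t + 1 ∧ (L.slice t).Level) : c = d := by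
  funext n
  induction n with
  | zero =>
    refine h 0 fun h0 => ?_
    obtain ⟨t, ht, -⟩ := hJ 0 h0
    omega
  | succ n ih =>
    by_cases hn : n + 1 ∈ J
    · obtain ⟨t, ht, hl⟩ := hJ _ hn
      obtain rfl : n = t := by omega
      have h1 := hc.flow t
      have h2 := hd.flow t
      rw [← ih] at h2
      exact hl.flow_unique h1 h2
    · exact h _ hn

/-- The orientations of the two diagrams correspond to each other. -/
structure OrientationCorr (L L' : Diagram N) (J : Set ℕ) : Prop where
  wd : L.wd = L'.wd
  ex : ∀ o : L.Orientation, ∃ o' : L'.Orientation, EqOff J o.col o'.col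
  ex' : ∀ o' : L'.Orientation, ∃ o : L.Orientation, EqOff J o.col o'.col
  uniq : ∀ o₁ o₂ : L.Orientation, EqOff J o₁.col o₂.col → o₁ = o₂
  uniq' : ∀ o₁ o₂ : L'.Orientation, EqOff J o₁.col o₂.col → o₁ = o₂

theorem OrientationCorr.mk' {J : Set ℕ} (hw : L.wd = L'.wd)
    (hJ : ∀ n ∈ J, ∃ t : Fin N, n = t + 1 ∧ (L.slice t).Level ∧ (L'.slice t).Level)
    (ex : ∀ c, L.Flow c → ∃ c', L'.Flow c' ∧ EqOff J c c')
    (ex' : ∀ c', L'.Flow c' → ∃ c, L.Flow c ∧ EqOff J c c') : OrientationCorr L L' J where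
  wd := hw
  ex o := by
    obtain ⟨c', hc', h⟩ := ex _ o.flow
    obtain ⟨o', rfl⟩ := hc'.exists_orientation
    exact ⟨o', h⟩
  ex' o' := by
    obtain ⟨c, hc, h⟩ := ex' _ o'.flow
    obtain ⟨o, rfl⟩ := hc.exists_orientation
    exact ⟨o, h⟩
  uniq o₁ o₂ h := Orientation.ext_col <| o₁.flow.eq_of_eqOff o₂.flow h fun n hn => by
    obtain ⟨t, ht, h, -⟩ := hJ n hn
    exact ⟨t, ht, h⟩
  uniq' o₁ o₂ h := Orientation.ext_col <| o₁.flow.eq_of_eqOff o₂.flow h fun n hn => by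
    obtain ⟨t, ht, -, h⟩ := hJ n hn
    exact ⟨t, ht, h⟩

/-- A cycle whose only nonzero orientation coordinate is that of `o` is homologous to a multiple of
the canonical generator. -/
theorem exists_cls_eq_smul {r : Fin N → ℕ} (hr : Function.Injective r) {z : L.CKh}
    (hz : L.dLee r z = 0) (o : L.Orientation) (h0 : L.pair o.vertex.1 o.col z ≠ 0)
    (h : ∀ o₁, o₁ ≠ o → L.pair o₁.vertex.1 o₁.col z = 0) :
    ∃ q : ℚ, q ≠ 0 ∧ cls _ z hz = q • cls _ _ (L.dLee_canonical r o) := by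
  have hne := o.pair_canonical_ne_zero
  set q := L.pair o.vertex.1 o.col z / L.pair o.vertex.1 o.col (L.canonical o) with hq
  refine ⟨q, div_ne_zero h0 hne, ?_⟩
  obtain ⟨y, hy⟩ := exists_boundary hr (z := z - q • L.canonical o)
    (by rw [map_sub, map_smul, hz, L.dLee_canonical, smul_zero, sub_zero]) (by
      intro o₁
      rw [map_sub, map_smul, smul_eq_mul]
      by_cases ho : o₁ = o
      · subst ho
        rw [hq, div_mul_cancel₀ _ hne, sub_self]
      · rw [h o₁ ho, o.pair_canonical_eq_zero o₁.comp fun h' => ho (Orientation.ext_col h'.2),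
          mul_zero, sub_zero])
  rw [cls, cls, ← Submodule.Quotient.mk_smul, Submodule.Quotient.eq]
  exact ⟨y, hy⟩

/-- The cycle `s_o` has its only orientation coordinate at `o`, so the image has its only one at the
induced orientation; by `exists_cls_eq_smul` this describes its class. The representative `z'` is
left open because a map on homology need not come from a chain map on all of `CKh'(L)`. -/
theorem OrientationCorr.preservesCanonical {J : Set ℕ} (C : OrientationCorr L L' J)
    {I : Set (Fin (N + 1))} (hI : ∀ n, n ∈ I ↔ (n : ℕ) ∈ J) {r r' : Fin N → ℕ}
    (hr' : Function.Injective r') (F : L.Kh r →ₗ[ℚ] L'.Kh r')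
    (h : ∀ o, ∃ z', ∃ hz' : L'.dLee r' z' = 0, F (cls _ _ (L.dLee_canonical r o)) = cls _ z' hz' ∧
      ∀ (o₁ : L.Orientation) (o₁' : L'.Orientation), EqOff J o₁.col o₁'.col → ∃ q : ℚ, q ≠ 0 ∧
        L'.pair o₁'.vertex.1 o₁'.col z' = q * L.pair o₁.vertex.1 o₁.col (L.canonical o)) :
    PreservesCanonical I F := by
  intro o
  obtain ⟨o', ho'⟩ := C.ex o
  refine ⟨o', ⟨(o.induces_iff C.wd hI o').2 ho', fun o'' h'' => ?_⟩, L.dLee_canonical r o,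
    L'.dLee_canonical r' o', ?_⟩
  · rw [o.induces_iff C.wd hI] at h''
    exact C.uniq' _ _ (h''.symm.trans ho')
  · obtain ⟨z', hz', h1, h2⟩ := h o
    rw [h1]
    apply exists_cls_eq_smul hr'
    · obtain ⟨q, hq, h3⟩ := h2 o o' ho'
      rw [h3]
      exact mul_ne_zero hq o.pair_canonical_ne_zero
    · intro o₁' hne
      obtain ⟨o₁, ho₁⟩ := C.ex' o₁'
      obtain ⟨q, hq, h3⟩ := h2 o₁ o₁' ho₁
      rw [h3, o.pair_canonical_eq_zero o₁.comp, mul_zero]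
      rintro ⟨-, h4⟩
      rw [h4] at ho₁
      exact hne (C.uniq' _ _ (ho₁.symm.trans ho'))

theorem eqOff_update (c : Coloring) (n : ℕ) (x : ℕ → Bool) :
    EqOff {n} c (Function.update c n x) := by
  intro m hm
  rw [Function.update_of_ne hm]

theorem mem_singleton_succ (a : Fin N) (n : Fin (N + 1)) :
    n ∈ ({a.succ} : Set (Fin (N + 1))) ↔ (n : ℕ) ∈ ({(a : ℕ) + 1} : Set ℕ) := by
  simp [Fin.ext_iff]

theorem cls_eq_zero_iff {r : Fin N → ℕ} {z : L.CKh} (hz : L.dLee r z = 0) :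
    cls _ z hz = 0 ↔ ∃ y, L.dLee r y = z := by
  rw [cls, Submodule.Quotient.mk_eq_zero]
  rfl

theorem OrientationCorr.preservesCanonical_map {J : Set ℕ} (C : OrientationCorr L L' J)
    {I : Set (Fin (N + 1))} (hI : ∀ n, n ∈ I ↔ (n : ℕ) ∈ J) {r r' : Fin N → ℕ}
    (hr' : Function.Injective r') {f : L.CKh →ₗ[ℚ] L'.CKh}
    (hf : IsChainMap (L.dLee r) (L'.dLee r') f)
    (h : ∀ (o : L.Orientation) (o' : L'.Orientation), EqOff J o.col o'.col → ∃ q : ℚ, q ≠ 0 ∧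
      ∀ x, L'.pair o'.vertex.1 o'.col (f x) = q * L.pair o.vertex.1 o.col x) :
    PreservesCanonical I hf.map := by
  refine C.preservesCanonical hI hr' _ fun o => ⟨_, _, hf.map_cls _ _, fun o₁ o₁' ho => ?_⟩
  obtain ⟨q, hq, h1⟩ := h o₁ o₁' ho
  exact ⟨q, hq, h1 _⟩

open scoped Classical in
/-- There are cycles with given orientation coordinates. -/
theorem exists_cycle (r : Fin N → ℕ) (F : L.Orientation → ℚ) :
    ∃ z : L.CKh, L.dLee r z = 0 ∧ ∀ o, L.pair o.vertex.1 o.col z = F o := by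
  obtain ⟨z, hz⟩ := L.exists_pair_eq fun V c =>
    if h : ∃ o : L.Orientation, o.vertex.1 = V ∧ o.col = c then F h.choose else 0
  refine ⟨z, ?_, fun o => ?_⟩
  · apply pair_inj
    intro V c hc
    rw [pair_dLee r hc, map_zero]
    apply Finset.sum_eq_zero
    intro t _
    unfold term
    split_ifs with ht
    · rw [hz _ _ ((hc.erase_iff ht.1).2 ht.2), dif_neg, mul_zero]
      rintro ⟨o, -, rfl⟩
      exact o.not_mono (hc.cross t ht.1) ht.2
    · rfl
  · have h : ∃ o₁ : L.Orientation, o₁.vertex.1 = o.vertex.1 ∧ o₁.col = o.col := ⟨o, rfl, rfl⟩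
    rw [hz _ _ o.comp, dif_pos h, Orientation.ext_col h.choose_spec.2]

/-- On both sides the orientation coordinates identify the homology with functions on the
orientations, and the map is diagonal with nonzero entries. -/
theorem OrientationCorr.bijective_map {J : Set ℕ} (C : OrientationCorr L L' J)
    {r r' : Fin N → ℕ} (hr : Function.Injective r)
    (hr' : Function.Injective r') {f : L.CKh →ₗ[ℚ] L'.CKh}
    (hf : IsChainMap (L.dLee r) (L'.dLee r') f)
    (h : ∀ (o : L.Orientation) (o' : L'.Orientation), EqOff J o.col o'.col → ∃ q : ℚ, q ≠ 0 ∧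
      ∀ x, L'.pair o'.vertex.1 o'.col (f x) = q * L.pair o.vertex.1 o.col x) :
    Function.Bijective hf.map := by
  constructor
  · rw [injective_iff_map_eq_zero]
    intro ζ hζ
    obtain ⟨⟨z, hz⟩, rfl⟩ := Submodule.Quotient.mk_surjective _ ζ
    rw [LinearMap.mem_ker] at hz
    have hfz : L'.dLee r' (f z) = 0 := by rw [hf z, hz, map_zero]
    obtain ⟨y, hy⟩ := (cls_eq_zero_iff hfz).1 hζ
    refine (cls_eq_zero_iff hz).2 (exists_boundary hr hz fun o => ?_)
    obtain ⟨o', ho'⟩ := C.ex o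
    obtain ⟨q, hq, h1⟩ := h o o' ho'
    have h2 := h1 z
    rw [← hy, pair_dLee_orientation] at h2
    exact (mul_eq_zero.1 h2.symm).resolve_left hq
  · intro η
    obtain ⟨⟨y, hy⟩, rfl⟩ := Submodule.Quotient.mk_surjective _ η
    rw [LinearMap.mem_ker] at hy
    choose g hg using C.ex
    choose q hq hq' using fun o => h o (g o) (hg o)
    -- The coordinates of `y` divided by the diagonal entries are realised by a cycle `z`; then `f z
    -- - y` is a boundary because its orientation coordinates vanish.
    obtain ⟨z, hz, hzF⟩ := exists_cycle r fun o => L'.pair (g o).vertex.1 (g o).col y / q o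
    refine ⟨cls _ z hz, ?_⟩
    rw [hf.map_cls]
    refine (Submodule.Quotient.eq _).2 ?_
    obtain ⟨w, hw⟩ := exists_boundary hr' (z := f z - y)
      (by rw [map_sub, hf z, hz, map_zero, hy, sub_zero]) (by
        intro o'
        obtain ⟨o, ho⟩ := C.ex' o'
        obtain rfl : g o = o' := C.uniq' _ _ ((hg o).symm.trans ho)
        rw [map_sub, hq', hzF, mul_div_cancel₀ _ (hq o), sub_self])
    exact ⟨w, hw⟩

/-! ### The first Reidemeister move -/

namespace IsRI

variable {a b : Fin N} {i : ℕ} (h : IsRI L L' a b i)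

include h

theorem ne : b ≠ a := by
  intro hab
  have := h.next
  rw [hab] at this
  omega

theorem cap' : L'.slice b = .cap i := by rw [h.off b h.ne, h.cap]

theorem wd_eq : L.wd = L'.wd := by
  apply Diagram.wd_eq
  intro t
  by_cases ht : t = a
  · subst ht
    exact .inr ⟨.inl h.before, .inr h.isCross⟩
  · exact .inl (h.off t ht)

theorem wd_succ : L.wd (a + 1) = L.wd a := by
  have := L.fits' a
  rw [h.before] at this
  exact this

theorem lt_wd : i + 1 < L.wd a := by
  rw [h.wd_eq]
  exact pos_lt_wd h.after

theorem not_mem {V : Finset (Fin N)} (hV : ∀ t ∈ V, (L.slice t).IsCross) : a ∉ V := by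
  intro ha
  obtain ⟨j, p, hjp⟩ := hV a ha
  rw [h.before] at hjp
  cases hjp

theorem not_mem_b {V : Finset (Fin N)} (hV : ∀ t ∈ V, (L'.slice t).IsCross) : b ∉ V := by
  intro hb
  obtain ⟨j, p, hjp⟩ := hV b hb
  rw [h.cap'] at hjp
  cases hjp

theorem cases_of_mem {t : Fin N} (ht : (t : ℕ) ∈ ({(a : ℕ) + 1} : Set ℕ) ∨
    (t + 1 : ℕ) ∈ ({(a : ℕ) + 1} : Set ℕ)) : t = a ∨ t = b := by
  have := h.next
  simp only [Set.mem_singleton_iff, Fin.ext_iff] at *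
  omega

theorem shapeAt_a {V : Finset (Fin N)} : L.shapeAt V a = .id := by
  unfold shapeAt
  rw [h.before]
  rfl

theorem shapeAt_a' {V : Finset (Fin N)} (ha : a ∉ V) : L'.shapeAt V a = .turn i := by
  unfold shapeAt
  rw [h.after]
  simp [ha, Slice.resolve]

theorem shapeAt_b {V : Finset (Fin N)} : L.shapeAt V b = .cap i := by
  unfold shapeAt
  rw [h.cap]
  rfl

theorem shapeAt_b' {V : Finset (Fin N)} : L'.shapeAt V b = .cap i := by
  unfold shapeAt
  rw [h.cap']
  rfl

theorem comp_level {V : Finset (Fin N)} {c : Coloring} (hc : L.Comp V c) : c (a + 1) = c a := by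
  have := hc.ok a
  rw [h.shapeAt_a, Shape.ok_id] at this
  funext j
  exact (this j).symm

theorem comp_cap {V : Finset (Fin N)} {c : Coloring} (hc : L.Comp V c) :
    c a i = c a (i + 1) ∧ (∀ j < i, c a j = c (b + 1) j) ∧
      ∀ j, i ≤ j → c a (j + 2) = c (b + 1) j := by
  have := hc.ok b
  rw [h.shapeAt_b, Shape.ok_cap, h.next, h.comp_level hc] at this
  rwa [h.next]

theorem comp_turn' {V : Finset (Fin N)} {c : Coloring} (hc : L'.Comp V c) (ha : a ∉ V) :
    c a i = c a (i + 1) ∧ c (a + 1) i = c (a + 1) (i + 1) ∧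
      ∀ j, j ≠ i → j ≠ i + 1 → c a j = c (a + 1) j := by
  have := hc.ok a
  rwa [h.shapeAt_a' ha, Shape.ok_turn] at this

theorem comp_cap' {V : Finset (Fin N)} {c : Coloring} (hc : L'.Comp V c) :
    c (a + 1) i = c (a + 1) (i + 1) ∧ (∀ j < i, c (a + 1) j = c (b + 1) j) ∧
      ∀ j, i ≤ j → c (a + 1) (j + 2) = c (b + 1) j := by
  have := hc.ok b
  rw [h.shapeAt_b', Shape.ok_cap, h.next] at this
  rwa [h.next]

/-- In the `0`-resolution the strands below the crossing are closed by its cap, and its cup forms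
the small circle with the cap of slice `b`. The small circle meets only the level `a + 1`, at the
positions `i` and `i + 1`. -/
theorem refill {V : Finset (Fin N)} (hV : ∀ t ∈ V, (L.slice t).IsCross) :
    Refill L L' {(a : ℕ) + 1} {((a : ℕ) + 1, i + 1)} V V where
  cross := hV
  cross' t ht := by
    rw [h.off t fun hta => h.not_mem hV (hta ▸ ht)]
    exact hV t ht
  wd := h.wd_eq
  ext c hc β := by
    have h1 := h.comp_cap hc
    refine ⟨Function.update c (a + 1) fun j => if j = i ∨ j = i + 1 then β else c a j, ?_,
      eqOff_update _ _ _, by simp⟩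
    refine hc.replace h.wd_eq ?_ (eqOff_update _ _ _) ?_ ?_ ?_
    · intro t ht
      rw [h.off t fun hta => h.not_mem hV (hta ▸ ht)]
      exact hV t ht
    · rintro n rfl j
      rw [Function.update_self, h.wd_succ]
      have := h.lt_wd
      split_ifs with hj
      · intro _
        omega
      · exact hc.supp _ _
    · intro t ht _
      unfold shapeAt
      by_cases hta : t = a
      · subst hta
        exact absurd rfl ‹¬ _›
      · rw [h.off t hta]
    · intro t ht
      rcases h.cases_of_mem ht with rfl | rfl
      · rw [h.shapeAt_a' (h.not_mem hV), Shape.ok_turn, Function.update_of_ne (by omega),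
          Function.update_self]
        refine ⟨h1.1, by simp, fun j hj hj' => by simp [hj, hj']⟩
      · rw [h.shapeAt_b', Shape.ok_cap, h.next, Function.update_self,
          Function.update_of_ne (by omega)]
        have h2 := h1.2
        rw [h.next] at h2
        refine ⟨by simp, fun j hj => ?_, fun j hj => ?_⟩
        · rw [if_neg (by omega)]
          exact h2.1 j hj
        · rw [if_neg (by omega)]
          exact h2.2 j hj
  res c' hc' := by
    have ha := h.not_mem hV
    have h1 := h.comp_turn' hc' ha
    have h2 := h.comp_cap' hc'
    refine ⟨Function.update c' (a + 1) (c' a), ?_, (eqOff_update _ _ _).symm⟩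
    refine hc'.replace h.wd_eq.symm hV (eqOff_update _ _ _) ?_ ?_ ?_
    · rintro n rfl j
      rw [Function.update_self, ← h.wd_eq, h.wd_succ, h.wd_eq]
      exact hc'.supp _ _
    · intro t ht _
      unfold shapeAt
      by_cases hta : t = a
      · subst hta
        exact absurd rfl ‹¬ _›
      · rw [h.off t hta]
    · intro t ht
      rcases h.cases_of_mem ht with rfl | rfl
      · rw [h.shapeAt_a, Shape.ok_id, Function.update_of_ne (by omega), Function.update_self]
        exact fun j => rfl
      · rw [h.shapeAt_b, Shape.ok_cap, h.next, Function.update_self,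
          Function.update_of_ne (by omega)]
        rw [h.next] at h2
        refine ⟨h1.1, fun j hj => ?_, fun j hj => ?_⟩
        · rw [h1.2.2 j (by omega) (by omega)]
          exact h2.2.1 j hj
        · rw [h1.2.2 _ (by omega) (by omega)]
          exact h2.2.2 j hj
  uniq c d hc hd hcd := by
    funext n
    by_cases hn : n = a + 1
    · rw [hn, h.comp_level hc, h.comp_level hd]
      exact hcd _ (by simp)
    · exact hcd n hn
  uniq' c d hc hd hcd hz := by
    have ha := h.not_mem hV
    funext n
    by_cases hn : n = a + 1
    · have h1 := h.comp_turn' hc ha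
      have h2 := h.comp_turn' hd ha
      have h3 := hz _ rfl
      have h4 := hcd a (by simp)
      funext j
      rw [hn]
      by_cases hj : j = i
      · rw [hj, h1.2.1, h2.2.1]
        exact h3
      by_cases hj' : j = i + 1
      · rw [hj']
        exact h3
      · rw [← h1.2.2 j hj hj', ← h2.2.2 j hj hj', h4]
    · exact hcd n hn

end IsRI

theorem Refill.filter_singleton {v' : L'.Vertex} (p₀ : L'.Point) [DecidablePred fun C' =>
    ∃ p' : L'.Point, L'.circle v' p' = C' ∧
      ((p'.1 : ℕ), (p'.2 : ℕ)) ∈ ({((p₀.1 : ℕ), (p₀.2 : ℕ))} : Set (ℕ × ℕ))] :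
    (Finset.univ.filter fun C' => ∃ p' : L'.Point, L'.circle v' p' = C' ∧
      ((p'.1 : ℕ), (p'.2 : ℕ)) ∈ ({((p₀.1 : ℕ), (p₀.2 : ℕ))} : Set (ℕ × ℕ))) =
      {L'.circle v' p₀} := by
  ext C'
  simp only [Finset.mem_filter, Finset.mem_univ, true_and, Finset.mem_singleton,
    Set.mem_singleton_iff, Prod.mk.injEq]
  constructor
  · rintro ⟨p', rfl, h1, h2⟩
    rw [Point.ext' h1 h2]
  · rintro rfl
    exact ⟨p₀, rfl, rfl, rfl⟩

namespace IsRI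

variable {a b : Fin N} {i : ℕ} (h : IsRI L L' a b i)

/-- The coefficient of `ρ₁'` in the coordinates given by colourings. -/
def factor (_h : IsRI L L' a b i) (c : Coloring) : ℚ :=
  ev (c (a + 1) (i + 1)) false - ev (c a i) false

theorem factor_ne_zero {c : Coloring} (hc : c a i ≠ c (a + 1) (i + 1)) : h.factor c ≠ 0 := by
  unfold factor
  revert hc
  cases c a i <;> cases c (a + 1) (i + 1) <;> norm_num [ev]

theorem factor_eq_zero {c : Coloring} (hc : c a i = c (a + 1) (i + 1)) : h.factor c = 0 := by
  rw [factor, hc, sub_self]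

include h in
theorem not_cross : ¬ (L.slice a).IsCross := by
  rintro ⟨j, p, hjp⟩
  rw [h.before] at hjp
  cases hjp

theorem pair_rhoI_of_mem {V : Finset (Fin N)} (ha : a ∈ V) (c : Coloring) (f : L.CKh) :
    L'.pair V c (rhoI h f) = 0 := by
  classical
  rw [← zero_mul (L.pair V c f)]
  apply pair_ofCoeff
  intro s
  rw [zero_mul]
  apply Finset.sum_eq_zero
  intro s' _
  by_cases hs : s'.1.1 = V
  · rw [if_neg, zero_mul]
    rintro ⟨h1, -⟩
    rw [h1] at hs
    exact h.not_cross (s.1.2 a (hs ▸ ha))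
  · rw [weight, if_neg hs, mul_zero]

/-- The map is `v ↦ v ⊗ v₋ - v₋v ⊗ v₊`. At a colouring its value is therefore the value of `v` times
the difference of the values of `v₋` at the small circle and at the strand, which is `factor`. -/
theorem pair_rhoI {V : Finset (Fin N)} (ha : a ∉ V) {c c' : Coloring} (hc : L.Comp V c)
    (hc' : L'.Comp V c') (he : EqOff {(a : ℕ) + 1} c c') (f : L.CKh) :
    L'.pair V c' (rhoI h f) = h.factor c' * L.pair V c f := by
  classical
  apply pair_ofCoeff
  rintro ⟨v, x⟩
  rw [sum_weight (L := L') ⟨V, hc'.cross⟩ c']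
  by_cases hv : v.1 = V
  swap
  · rw [weight, if_neg hv, mul_zero]
    apply Finset.sum_eq_zero
    intro x' _
    rw [if_neg, zero_mul]
    rintro ⟨h1, -⟩
    exact hv h1.symm
  subst hv
  rw [weight, if_pos rfl]
  let v' : L'.Vertex := ⟨v.1, hc'.cross⟩
  let R := h.refill v.2
  let S : L.Point := ⟨a.castSucc, ⟨i, h.lt⟩⟩
  have hpos : (L'.slice a).pos = i := by rw [h.after]; rfl
  have hS : SamePlace S (L'.bl a h.isCross) := ⟨rfl, hpos.symm⟩
  have hSJ : (S.1 : ℕ) ∉ ({(a : ℕ) + 1} : Set ℕ) := by simp [S]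
  have hZ : (((a : ℕ) + 1, i + 1) : ℕ × ℕ) =
      (((L'.tr a h.isCross).1 : ℕ), ((L'.tr a h.isCross).2 : ℕ)) := by
    simp [tr, hpos]
  -- The two states in the image: `x₁` keeps the label of the strand and puts `v₋` on the small
  -- circle, `x₂` multiplies the label of the strand by `v₋` and puts `v₊` on the small circle.
  obtain ⟨x₁, h1, h2, h3⟩ := R.exists_extension (v' := v') x false
  obtain ⟨x₂, k1, k2, k3⟩ := R.exists_extension (v' := v')
    (fun C => if C = L.circle v S then !x C else x C) true
  have hcond : ∀ x' : L'.Circle v' → Bool, (∀ p p', SamePlace p p' → p.1 ≠ a.succ →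
      L.circle v p ≠ L.circle v S → x' (L'.circle v' p') = x (L.circle v p)) ↔
      ∀ p p', SamePlace p p' → (p.1 : ℕ) ∉ ({(a : ℕ) + 1} : Set ℕ) →
        L.circle v p ≠ L.circle v S → x' (L'.circle v' p') = x (L.circle v p) := by
    intro x'
    refine forall₂_congr fun p p' => ?_
    simp [Fin.ext_iff]
  have hco : ∀ x' : L'.Circle v' → Bool, (if v'.1 = v.1 ∧ ∀ p p', SamePlace p p' →
      p.1 ≠ a.succ → L.circle v p ≠ L.circle v S → x' (L'.circle v' p') = x (L.circle v p) then
        rhoICoeff (x (L.circle v S)) (x' (L'.circle v' (L'.bl a h.isCross)))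
          (x' (L'.circle v' (L'.tr a h.isCross))) else 0) =
      if x' = x₁ then 1 else if x' = x₂ then -1 else (0 : ℚ) := by
    intro x'
    rw [if_congr (and_congr_right' (hcond x')) rfl rfl]
    have htr : ((((L'.tr a h.isCross).1 : ℕ), ((L'.tr a h.isCross).2 : ℕ)) : ℕ × ℕ) ∈
      ({((a : ℕ) + 1, i + 1)} : Set (ℕ × ℕ)) := by rw [hZ]; rfl
    split_ifs with ha1 ha2 ha3 ha2 ha3
    · rw [ha2, h1 _ _ hS hSJ, h2 _ htr]
      cases x (L.circle v S) <;> rfl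
    · rw [ha3, k1 _ _ hS hSJ, k2 _ htr, if_pos rfl]
      cases x (L.circle v S) <;> rfl
    · by_contra hne
      have hcase : (x' (L'.circle v' (L'.tr a h.isCross)) = false ∧
          x' (L'.circle v' (L'.bl a h.isCross)) = x (L.circle v S)) ∨
          (x' (L'.circle v' (L'.tr a h.isCross)) = true ∧
          x' (L'.circle v' (L'.bl a h.isCross)) = !x (L.circle v S)) := by
        revert hne
        generalize x' (L'.circle v' (L'.tr a h.isCross)) = z
        generalize x' (L'.circle v' (L'.bl a h.isCross)) = y
        cases x (L.circle v S) <;> cases y <;> cases z <;> simp [rhoICoeff]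
      have hstr : ∀ p p', SamePlace p p' → (p.1 : ℕ) ∉ ({(a : ℕ) + 1} : Set ℕ) →
          L.circle v p = L.circle v S →
          L'.circle v' p' = L'.circle v' (L'.bl a h.isCross) := by
        intro p p' hp hpJ hpS
        exact (R.circle_eq_iff (v' := v') hp hS hpJ hSJ).1 hpS
      have hz : ∀ p' : L'.Point, ((p'.1 : ℕ), (p'.2 : ℕ)) ∈
          ({((a : ℕ) + 1, i + 1)} : Set (ℕ × ℕ)) → p' = L'.tr a h.isCross := by
        intro p' hp'
        rw [hZ] at hp'
        exact Point.ext' (congrArg Prod.fst hp') (congrArg Prod.snd hp')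
      rcases hcase with ⟨e1, e2⟩ | ⟨e1, e2⟩
      · apply ha2
        apply R.extension_unique (v' := v')
        · intro p' hp'
          obtain ⟨p, hp⟩ := Refill.exists_same_place' R.wd p'
          rw [← hp.1] at hp'
          rw [h1 p p' hp hp']
          by_cases hpS : L.circle v p = L.circle v S
          · rw [hstr p p' hp hp' hpS, e2, hpS]
          · exact ha1.2 p p' hp hp' hpS
        · intro p' hp'
          rw [h2 p' hp', hz p' hp', e1]
      · apply ha3
        apply R.extension_unique (v' := v')
        · intro p' hp'
          obtain ⟨p, hp⟩ := Refill.exists_same_place' R.wd p'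
          rw [← hp.1] at hp'
          rw [k1 p p' hp hp']
          by_cases hpS : L.circle v p = L.circle v S
          · rw [hstr p p' hp hp' hpS, e2, hpS, if_pos rfl]
          · rw [if_neg hpS]
            exact ha1.2 p p' hp hp' hpS
        · intro p' hp'
          rw [k2 p' hp', hz p' hp', e1]
    · exfalso
      apply ha1
      refine ⟨rfl, fun p p' hp hpJ _ => ?_⟩
      rw [ha2, h1 p p' hp hpJ]
    · exfalso
      apply ha1
      refine ⟨rfl, fun p p' hp hpJ hpS => ?_⟩
      rw [ha3, k1 p p' hp hpJ, if_neg hpS]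
    · rfl
  have hne : x₁ ≠ x₂ := by
    intro hx
    have e1 := h2 (L'.tr a h.isCross) (by rw [hZ]; rfl)
    have e2 := k2 (L'.tr a h.isCross) (by rw [hZ]; rfl)
    rw [hx, e2] at e1
    cases e1
  have htr : c' (L'.tr a h.isCross).1 (L'.tr a h.isCross).2 = c' (a + 1) (i + 1) :=
    (congrArg (fun z : ℕ × ℕ => c' z.1 z.2) hZ).symm
  calc _ = ∑ x' : L'.Circle v' → Bool, (if x' = x₁ then 1 else if x' = x₂ then -1 else (0 : ℚ)) *
        ∏ C, ev (colorOf c' C) (x' C) := Finset.sum_congr rfl fun x' _ => by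
          rw [← hco x']
          rfl
    _ = ∏ C, ev (colorOf c' C) (x₁ C) - ∏ C, ev (colorOf c' C) (x₂ C) := by
      rw [Fintype.sum_eq_add x₁ x₂ hne]
      · rw [if_pos rfl, if_neg hne.symm, if_pos rfl]
        ring
      · rintro x' ⟨hx1, hx2⟩
        rw [if_neg hx1, if_neg hx2, zero_mul]
    _ = _ := by
      have e1 := h3 c c' hc hc' he
      have e2 := k3 c c' hc hc' he
      rw [hZ, Refill.filter_singleton, Finset.prod_singleton,
        Comp.colorOf_circle (v := v') hc', htr] at e1 e2
      -- Changing the label of a circle is multiplication by `v₋`, because `v₋² = v₊`; so it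
      -- multiplies the value by that of `v₋`.
      have e3 : ∏ C, ev (colorOf c C) (if C = L.circle v S then !x C else x C) =
          ev (c' a i) false * ∏ C, ev (colorOf c C) (x C) := by
        rw [← Finset.mul_prod_erase Finset.univ _ (Finset.mem_univ (L.circle v S)),
          ← Finset.mul_prod_erase Finset.univ (fun C => ev (colorOf c C) (x C))
            (Finset.mem_univ (L.circle v S)), ← mul_assoc, if_pos rfl, hc.colorOf_circle]
        congr 1
        · have : c S.1 S.2 = c' a i := by rw [he _ hSJ]; rfl
          rw [this]
          cases c' a i <;> cases x (L.circle v S) <;> norm_num [ev]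
        · apply Finset.prod_congr rfl
          intro C hC
          rw [if_neg (Finset.ne_of_mem_erase hC)]
      rw [e1, e2, e3, factor]
      have : ev (c' (a + 1) (i + 1)) true = 1 := by simp [ev]
      rw [this]
      ring

end IsRI

theorem Mono.congr {J : Set ℕ} {c c' : Coloring} (he : EqOff J c c') {t : Fin N}
    (h : L.slice t = L'.slice t) (h1 : (t : ℕ) ∉ J) (h2 : (t + 1 : ℕ) ∉ J) :
    L.Mono c t ↔ L'.Mono c' t := by
  unfold Mono
  rw [h, he _ h1, he _ h2]

namespace IsRI

variable {a b : Fin N} {i : ℕ} (h : IsRI L L' a b i)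

include h in
theorem mono_iff (c : Coloring) : L'.Mono c a ↔ c a i = c (a + 1) (i + 1) := by
  unfold Mono
  rw [h.after]
  rfl

include h

/-- The edge of the new crossing merges the small circle with the strand and so sees only equal
colours, where `factor` vanishes. All other edges have the same signs and the same factors in both
diagrams. -/
theorem isChainMap (r : Fin N → ℕ) : IsChainMap (L.dLee r) (L'.dLee r) (rhoI h) := by
  intro f
  apply pair_inj
  intro V c' hc'
  rw [pair_dLee r hc']
  by_cases ha : a ∈ V
  · rw [h.pair_rhoI_of_mem ha]
    apply Finset.sum_eq_zero
    intro t _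
    unfold term
    split_ifs with ht
    · by_cases hta : t = a
      · subst hta
        have hc1 := (hc'.erase_iff ht.1).2 ht.2
        obtain ⟨c, hc, he⟩ := (h.refill (V := V.erase t) fun s hs => by
          rw [← h.off s (Finset.ne_of_mem_erase hs)]
          exact hc1.cross s hs).res c' hc1
        rw [h.pair_rhoI (by simp) hc hc1 he, h.factor_eq_zero ((h.mono_iff c').1 ht.2), zero_mul,
          mul_zero]
      · rw [h.pair_rhoI_of_mem (Finset.mem_erase.2 ⟨Ne.symm hta, ha⟩), mul_zero]
    · rfl
  · have hV : ∀ t ∈ V, (L.slice t).IsCross := fun t ht => by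
      rw [← h.off t fun hta => ha (hta ▸ ht)]
      exact hc'.cross t ht
    obtain ⟨c, hc, he⟩ := (h.refill hV).res c' hc'
    rw [h.pair_rhoI ha hc hc' he, pair_dLee r hc, Finset.mul_sum]
    apply Finset.sum_congr rfl
    intro t _
    unfold term
    by_cases ht : t ∈ V
    · have hta : t ≠ a := fun hta => ha (hta ▸ ht)
      have htb : t ≠ b := fun htb => h.not_mem_b hc'.cross (htb ▸ ht)
      have h1 : (t : ℕ) ∉ ({(a : ℕ) + 1} : Set ℕ) := by
        rw [Set.mem_singleton_iff, ← h.next]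
        exact Fin.val_ne_of_ne htb
      have h2 : (t + 1 : ℕ) ∉ ({(a : ℕ) + 1} : Set ℕ) := by
        rw [Set.mem_singleton_iff]
        have := Fin.val_ne_of_ne hta
        omega
      have hm := Mono.congr he (h.off t hta).symm h1 h2
      by_cases hmt : L.Mono c t
      · have hcr : ∀ s ∈ V.erase t, (L.slice s).IsCross :=
          fun s hs => hV s (Finset.mem_of_mem_erase hs)
        rw [if_pos ⟨ht, hm.1 hmt⟩, if_pos ⟨ht, hmt⟩, h.pair_rhoI (by simp [ha])
          ((hc.erase_iff ht).2 hmt) ((hc'.erase_iff ht).2 (hm.1 hmt)) he,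
          (h.refill hcr).kap_eq (h.off t hta).symm h1 h2 he]
        ring
      · rw [if_neg fun h => hmt (hm.2 h.2), if_neg fun h => hmt h.2, mul_zero]
    · rw [if_neg fun h => ht h.1, if_neg fun h => ht h.1, mul_zero]

theorem orientationCorr : OrientationCorr L L' {(a : ℕ) + 1} := by
  refine OrientationCorr.mk' h.wd_eq ?_ ?_ ?_
  · rintro n rfl
    exact ⟨a, rfl, .inl h.before, .inr h.isCross⟩
  · intro c hc
    have h1 : c (a + 1) = c a := by
      have := hc.flow a
      rw [h.before] at this
      funext j
      exact (Shape.ok_id.1 this j).symm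
    have h2 := hc.flow b
    rw [h.cap] at h2
    replace h2 := Shape.ok_cap.1 h2
    rw [h.next, h1] at h2
    refine ⟨Function.update c (a + 1) (crossFlip i (c a)), ?_, eqOff_update _ _ _⟩
    refine hc.replace h.wd_eq (eqOff_update _ _ _) ?_ ?_ ?_
    · rintro n rfl
      rw [Function.update_self, h.wd_succ]
      exact crossFlip_supp h.lt_wd (hc.supp _)
    · intro t ht _
      refine h.off t ?_
      rintro rfl
      exact absurd rfl ‹¬ _›
    · intro t ht
      rcases h.cases_of_mem ht with rfl | rfl
      · rw [h.after, Function.update_of_ne (by omega), Function.update_self]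
        rfl
      · rw [h.cap', h.next, Function.update_self, Function.update_of_ne (by omega)]
        refine Shape.ok_cap.2 ⟨?_, fun j hj => ?_, fun j hj => ?_⟩
        · simp [crossFlip, h2.1]
        · rw [← h2.2.1 j hj, crossFlip, if_neg (by omega), if_neg (by omega)]
        · rw [← h2.2.2 j hj, crossFlip, if_neg (by omega), if_neg (by omega)]
  · intro c hc
    have h1 : c (a + 1) = crossFlip i (c a) := by
      have := hc.flow a
      rw [h.after] at this
      exact this
    have h2 := hc.flow b
    rw [h.cap'] at h2
    replace h2 := Shape.ok_cap.1 h2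
    rw [h.next, h1] at h2
    refine ⟨Function.update c (a + 1) (c a), ?_, (eqOff_update _ _ _).symm⟩
    refine hc.replace h.wd_eq.symm (eqOff_update _ _ _) ?_ ?_ ?_
    · rintro n rfl
      rw [Function.update_self, ← h.wd_eq, h.wd_succ, h.wd_eq]
      exact hc.supp _
    · intro t ht _
      refine (h.off t ?_).symm
      rintro rfl
      exact absurd rfl ‹¬ _›
    · intro t ht
      rcases h.cases_of_mem ht with rfl | rfl
      · rw [h.before, Function.update_of_ne (by omega), Function.update_self]
        exact Shape.ok_id.2 fun _ => rfl
      · rw [h.cap, h.next, Function.update_self, Function.update_of_ne (by omega)]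
        refine Shape.ok_cap.2 ⟨?_, fun j hj => ?_, fun j hj => ?_⟩
        · have := h2.1
          simp only [crossFlip, if_pos, if_neg (Nat.succ_ne_self i)] at this
          revert this
          cases c a i <;> cases c a (i + 1) <;> simp
        · rw [← h2.2.1 j hj, crossFlip, if_neg (by omega), if_neg (by omega)]
        · rw [← h2.2.2 j hj, crossFlip, if_neg (by omega), if_neg (by omega)]

/-- The cap makes the colours of the two strands at the new crossing equal, so an orientation
resolves it by `0`. It is not monochromatic, hence the small circle and the strand have different
colours and `factor` is not zero. -/
theorem pair_orientation (o : L.Orientation) (o' : L'.Orientation)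
    (he : EqOff {(a : ℕ) + 1} o.col o'.col) : ∃ q : ℚ, q ≠ 0 ∧
      ∀ x, L'.pair o'.vertex.1 o'.col (rhoI h x) = q * L.pair o.vertex.1 o.col x := by
  have hm := o'.not_mono h.isCross
  have ha : a ∉ o'.vertex.1 := by
    rw [o'.comp.mem_iff h.after hm]
    have h1 := o'.flow.flow a
    rw [h.after] at h1
    have h2 := o'.flow.flow b
    rw [h.cap'] at h2
    replace h2 := (Shape.ok_cap.1 h2).1
    rw [h.next] at h2
    have h3 := congrFun h1 i
    have h4 := congrFun h1 (i + 1)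
    rw [crossFlip, if_pos rfl] at h3
    rw [crossFlip, if_neg (by omega), if_pos rfl] at h4
    rw [h3, h4] at h2
    revert h2
    cases o'.col a i <;> cases o'.col a (i + 1) <;> simp
  have hV : ∀ t ∈ o'.vertex.1, (L.slice t).IsCross := fun t ht => by
    rw [← h.off t fun hta => ha (hta ▸ ht)]
    exact o'.comp.cross t ht
  obtain ⟨c, hc, hcc⟩ := (h.refill hV).res _ o'.comp
  obtain rfl : c = o.col := by
    have hcc' := hcc.trans he.symm
    funext n
    by_cases hn : n = a + 1
    · rw [hn, h.comp_level hc, h.comp_level o.comp]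
      exact hcc' _ (by simp)
    · exact hcc' n hn
  refine ⟨h.factor o'.col, h.factor_ne_zero ((h.mono_iff _).not.1 hm), fun x => ?_⟩
  rw [h.pair_rhoI ha hc o'.comp he, hc.vertex_unique o.comp fun t ht => o.not_mono ht]

theorem preservesCanonical {r : Fin N → ℕ} (hr : Function.Injective r) :
    PreservesCanonical {a.succ} (h.isChainMap r).map :=
  h.orientationCorr.preservesCanonical_map (mem_singleton_succ a) hr _ h.pair_orientation

theorem bijective {r : Fin N → ℕ} (hr : Function.Injective r) :
    Function.Bijective (h.isChainMap r).map :=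
  h.orientationCorr.bijective_map hr hr _ h.pair_orientation

end IsRI

/-! ### The second Reidemeister move -/

namespace IsRII

variable {a b c₀ c₁ : Fin N} {i : ℕ} (h : IsRII L L' a b i c₀ c₁)

include h

theorem ne : c₀ ≠ c₁ := by
  have := h.next
  rcases h.order with ⟨rfl, rfl⟩ | ⟨rfl, rfl⟩ <;> rintro rfl <;> omega

theorem eq_or_iff {t : Fin N} : t = a ∨ t = b ↔ t = c₀ ∨ t = c₁ := by
  rcases h.order with ⟨rfl, rfl⟩ | ⟨rfl, rfl⟩
  · rfl
  · exact or_comm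

theorem off' {t : Fin N} (h0 : t ≠ c₀) (h1 : t ≠ c₁) : L'.slice t = L.slice t := by
  have := h.eq_or_iff (t := t)
  exact h.off t (by tauto) (by tauto)

theorem isCross₁ : (L'.slice c₁).IsCross := ⟨i, false, h.after₁⟩

theorem before {t : Fin N} (ht : t = c₀ ∨ t = c₁) : L.slice t = .id := by
  rw [← h.eq_or_iff] at ht
  rcases ht with rfl | rfl
  exacts [h.before_a, h.before_b]

theorem not_mem {V : Finset (Fin N)} (hV : ∀ t ∈ V, (L.slice t).IsCross) : c₀ ∉ V ∧ c₁ ∉ V := by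
  constructor <;> intro hm <;> obtain ⟨j, p, hjp⟩ := hV _ hm
  · rw [h.before (.inl rfl)] at hjp
    cases hjp
  · rw [h.before (.inr rfl)] at hjp
    cases hjp

theorem wd_eq : L.wd = L'.wd := by
  apply Diagram.wd_eq
  intro t
  by_cases h0 : t = c₀
  · subst h0
    exact .inr ⟨.inl (h.before (.inl rfl)), .inr h.isCross₀⟩
  by_cases h1 : t = c₁
  · subst h1
    exact .inr ⟨.inl (h.before (.inr rfl)), .inr h.isCross₁⟩
  · exact .inl (h.off' h0 h1)

theorem wd_succ : L.wd (a + 1) = L.wd a := by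
  have := L.fits' a
  rw [h.before_a] at this
  exact this

theorem wd_succ_b : L.wd (b + 1) = L.wd a := by
  have := L.fits' b
  rw [h.before_b, h.next, h.wd_succ] at this
  rw [h.next]
  exact this

theorem lt_wd : i + 1 < L.wd a := by
  rcases h.order with ⟨rfl, rfl⟩ | ⟨rfl, rfl⟩
  · rw [h.wd_eq]; exact pos_lt_wd h.after₀
  · rw [h.wd_eq]; exact pos_lt_wd h.after₁

theorem cases_of_mem {t : Fin N} (ht : (t : ℕ) ∈ ({(a : ℕ) + 1} : Set ℕ) ∨
    (t + 1 : ℕ) ∈ ({(a : ℕ) + 1} : Set ℕ)) : t = a ∨ t = b := by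
  have := h.next
  simp only [Set.mem_singleton_iff, Fin.ext_iff] at *
  omega

theorem notMem_level {t : Fin N} (h0 : t ≠ c₀) (h1 : t ≠ c₁) :
    (t : ℕ) ∉ ({(a : ℕ) + 1} : Set ℕ) ∧ (t + 1 : ℕ) ∉ ({(a : ℕ) + 1} : Set ℕ) := by
  rw [← not_or]
  intro ht
  have := (h.eq_or_iff).1 (h.cases_of_mem ht)
  tauto

theorem shapeAt₀ (V : Finset (Fin N)) : L'.shapeAt V c₀ = if c₀ ∈ V then .turn i else .id := by
  unfold shapeAt
  rw [h.after₀]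
  split_ifs with hV <;> simp [hV, Slice.resolve]

theorem shapeAt₁ (V : Finset (Fin N)) : L'.shapeAt V c₁ = if c₁ ∈ V then .id else .turn i := by
  unfold shapeAt
  rw [h.after₁]
  split_ifs with hV <;> simp [hV, Slice.resolve]

theorem shapeAt_before {t : Fin N} (ht : t = c₀ ∨ t = c₁) (V : Finset (Fin N)) :
    L.shapeAt V t = .id := by
  unfold shapeAt
  rw [h.before ht]
  rfl

theorem shapeAt_off {t : Fin N} (h0 : t ≠ c₀) (h1 : t ≠ c₁) {V W : Finset (Fin N)}
    (hVW : t ∈ V ↔ t ∈ W) : L.shapeAt V t = L'.shapeAt W t := by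
  unfold shapeAt
  rw [h.off' h0 h1]
  simp only [hVW]

/-- At the vertices `01`. -/
theorem shapeAt01 {V : Finset (Fin N)} (h0 : c₀ ∉ V) (h1 : c₁ ∈ V) :
    L'.shapeAt V a = .id ∧ L'.shapeAt V b = .id := by
  have e0 := h.shapeAt₀ V
  have e1 := h.shapeAt₁ V
  rw [if_neg h0] at e0
  rw [if_pos h1] at e1
  rcases h.order with ⟨rfl, rfl⟩ | ⟨rfl, rfl⟩
  exacts [⟨e0, e1⟩, ⟨e1, e0⟩]

/-- At the vertices `10`. -/
theorem shapeAt10 {V : Finset (Fin N)} (h0 : c₀ ∈ V) (h1 : c₁ ∉ V) :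
    L'.shapeAt V a = .turn i ∧ L'.shapeAt V b = .turn i := by
  have e0 := h.shapeAt₀ V
  have e1 := h.shapeAt₁ V
  rw [if_pos h0] at e0
  rw [if_neg h1] at e1
  rcases h.order with ⟨rfl, rfl⟩ | ⟨rfl, rfl⟩
  exacts [⟨e0, e1⟩, ⟨e1, e0⟩]

theorem shapeAt_insert {V : Finset (Fin N)} (h0 : c₀ ∉ V) (t : Fin N) :
    L.shapeAt V t = L'.shapeAt (insert c₁ V) t := by
  by_cases ht0 : t = c₀
  · rw [h.shapeAt_before (.inl ht0), ht0, h.shapeAt₀, if_neg (by simp [h0, h.ne])]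
  by_cases ht1 : t = c₁
  · rw [h.shapeAt_before (.inr ht1), ht1, h.shapeAt₁, if_pos (by simp)]
  · exact h.shapeAt_off ht0 ht1 (by simp [ht1])

theorem isCross_insert {V : Finset (Fin N)} (hV : ∀ t ∈ V, (L.slice t).IsCross) :
    ∀ t ∈ insert c₁ V, (L'.slice t).IsCross := by
  intro t ht
  rcases Finset.mem_insert.1 ht with rfl | ht
  · exact h.isCross₁
  · have := h.not_mem hV
    rw [h.off' (fun e => this.1 (e ▸ ht)) (fun e => this.2 (e ▸ ht))]
    exact hV t ht

theorem comp_insert_iff {V : Finset (Fin N)} (hV : ∀ t ∈ V, (L.slice t).IsCross) {c : Coloring} :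
    L.Comp V c ↔ L'.Comp (insert c₁ V) c := by
  have hsh := h.shapeAt_insert (h.not_mem hV).1
  constructor
  · intro hc
    exact ⟨h.isCross_insert hV, by rw [← h.wd_eq]; exact hc.supp, fun t => hsh t ▸ hc.ok t⟩
  · intro hc
    exact ⟨hV, by rw [h.wd_eq]; exact hc.supp, fun t => (hsh t).symm ▸ hc.ok t⟩

theorem comp01 {V : Finset (Fin N)} (h0 : c₀ ∉ V) (h1 : c₁ ∈ V) {c : Coloring}
    (hc : L'.Comp V c) : c (a + 1) = c a ∧ c (b + 1) = c a := by
  have ea := hc.ok a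
  have eb := hc.ok b
  rw [(h.shapeAt01 h0 h1).1, Shape.ok_id] at ea
  rw [(h.shapeAt01 h0 h1).2, Shape.ok_id, h.next] at eb
  have e1 : c (a + 1) = c a := funext fun j => (ea j).symm
  refine ⟨e1, ?_⟩
  rw [h.next, ← e1]
  exact funext fun j => (eb j).symm

theorem comp_level {V : Finset (Fin N)} {c : Coloring} (hc : L.Comp V c) : c (a + 1) = c a :=
  (h.comp01 (by simp [(h.not_mem hc.cross).1, h.ne]) (by simp)
    ((h.comp_insert_iff hc.cross).1 hc)).1

theorem refill01 {V : Finset (Fin N)} (hV : ∀ t ∈ V, (L.slice t).IsCross) :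
    Refill L L' {(a : ℕ) + 1} ∅ V (insert c₁ V) where
  cross := hV
  cross' := h.isCross_insert hV
  wd := h.wd_eq
  ext c hc _ := ⟨c, (h.comp_insert_iff hV).1 hc, fun _ _ => rfl, by simp⟩
  res c hc := ⟨c, (h.comp_insert_iff hV).2 hc, fun _ _ => rfl⟩
  uniq c d hc hd he := by
    funext n
    by_cases hn : n = a + 1
    · rw [hn, h.comp_level hc, h.comp_level hd, he _ (by simp)]
    · exact he n hn
  uniq' c d hc hd he _ := by
    rw [← h.comp_insert_iff hV] at hc hd
    funext n
    by_cases hn : n = a + 1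
    · rw [hn, h.comp_level hc, h.comp_level hd, he _ (by simp)]
    · exact he n hn

/-- The colours at the level between the two crossings at the vertices `11`. -/
def lev (_h : IsRII L L' a b i c₀ c₁) (c : Coloring) : ℕ → Bool :=
  if c₁ = a then c a else c (b + 1)

/-- The colouring at a vertex `11` that belongs to a colouring at the neighbouring vertex `10`. -/
def restrict (c : Coloring) : Coloring := Function.update c (a + 1) (h.lev c)

theorem eqOff_restrict (c : Coloring) : EqOff {(a : ℕ) + 1} c (h.restrict c) :=
  eqOff_update _ _ _

theorem comp10 {V : Finset (Fin N)} (h0 : c₀ ∈ V) (h1 : c₁ ∉ V) {c : Coloring}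
    (hc : L'.Comp V c) : c a i = c a (i + 1) ∧ c (a + 1) i = c (a + 1) (i + 1) ∧
      c (b + 1) i = c (b + 1) (i + 1) ∧ (∀ j, j ≠ i → j ≠ i + 1 → c (a + 1) j = c a j) ∧
      (∀ j, j ≠ i → j ≠ i + 1 → c (b + 1) j = c a j) := by
  have ea := hc.ok a
  have eb := hc.ok b
  rw [(h.shapeAt10 h0 h1).1, Shape.ok_turn] at ea
  rw [(h.shapeAt10 h0 h1).2, Shape.ok_turn, h.next] at eb
  rw [h.next]
  exact ⟨ea.1, ea.2.1, eb.2.1, fun j hj hj' => (ea.2.2 j hj hj').symm, fun j hj hj' => by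
    rw [← eb.2.2 j hj hj', ea.2.2 j hj hj']⟩

theorem comp11 {V : Finset (Fin N)} (h0 : c₀ ∈ V) (h1 : c₁ ∈ V) {c : Coloring}
    (hc : L'.Comp V c) : c a i = c a (i + 1) ∧ c (a + 1) = h.lev c ∧
      c (b + 1) i = c (b + 1) (i + 1) ∧ (∀ j, j ≠ i → j ≠ i + 1 → c (b + 1) j = c a j) := by
  have ea := hc.ok a
  have eb := hc.ok b
  have e0 := h.shapeAt₀ V
  have e1 := h.shapeAt₁ V
  rw [if_pos h0] at e0
  rw [if_pos h1] at e1
  have hne := h.ne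
  have hn := h.next
  unfold lev
  rcases h.order with ⟨rfl, rfl⟩ | ⟨rfl, rfl⟩
  · rw [e0, Shape.ok_turn] at ea
    rw [e1, Shape.ok_id, hn] at eb
    have e : c (c₀ + 1) = c (c₁ + 1) := by rw [hn]; exact funext eb
    rw [if_neg hne.symm, ← e]
    exact ⟨ea.1, rfl, ea.2.1, fun j hj hj' => (ea.2.2 j hj hj').symm⟩
  · rw [e1, Shape.ok_id] at ea
    have e : c (c₁ + 1) = c c₁ := funext fun j => (ea j).symm
    rw [e0, Shape.ok_turn, hn, e] at eb
    rw [if_pos rfl, hn]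
    exact ⟨eb.1, e, eb.2.1, fun j hj hj' => (eb.2.2 j hj hj').symm⟩

theorem restrict_eq {V : Finset (Fin N)} (h0 : c₀ ∈ V) (h1 : c₁ ∈ V) {c : Coloring}
    (hc : L'.Comp V c) : h.restrict c = c := by
  rw [restrict, ← (h.comp11 h0 h1 hc).2.1, Function.update_eq_self]

theorem comp_restrict {V : Finset (Fin N)} (h0 : c₀ ∈ V) (h1 : c₁ ∉ V) {c : Coloring}
    (hc : L'.Comp V c) : L'.Comp (insert c₁ V) (h.restrict c) := by
  obtain ⟨e1, e2, e3, e4, e5⟩ := h.comp10 h0 h1 hc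
  refine hc.replace rfl ?_ (h.eqOff_restrict c) ?_ ?_ ?_
  · intro t ht
    rcases Finset.mem_insert.1 ht with rfl | ht
    exacts [h.isCross₁, hc.cross t ht]
  · rintro n rfl j
    rw [restrict, Function.update_self, ← h.wd_eq, h.wd_succ, lev]
    split_ifs
    · rw [h.wd_eq]; exact hc.supp _ _
    · rw [← h.wd_succ_b, h.wd_eq]; exact hc.supp _ _
  · intro t ht ht'
    refine shapeAt_congr ?_
    have : t ≠ c₁ := by
      rintro rfl
      have := h.eq_or_iff.2 (.inr (Eq.refl t))
      simp only [Set.mem_singleton_iff] at ht ht'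
      have := h.next
      rcases ‹t = a ∨ t = b› with rfl | rfl <;> omega
    simp [this]
  · intro t ht
    have ha : h.restrict c a = c a := (h.eqOff_restrict c a (by simp)).symm
    have hb : h.restrict c (b + 1) = c (b + 1) :=
      (h.eqOff_restrict c _ (by simp [h.next])).symm
    have hl : h.restrict c (a + 1) = h.lev c := by rw [restrict, Function.update_self]
    have hs0 : ∀ s, s = c₀ → L'.shapeAt (insert c₁ V) s = .turn i := by
      rintro _ rfl
      rw [h.shapeAt₀, if_pos (by simp [h0])]
    have hs1 : ∀ s, s = c₁ → L'.shapeAt (insert c₁ V) s = .id := by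
      rintro _ rfl
      rw [h.shapeAt₁, if_pos (by simp)]
    have hne := h.ne
    have hn := h.next
    have htt := h.cases_of_mem ht
    unfold lev at hl
    rcases h.order with ⟨hc0, hc1⟩ | ⟨hc0, hc1⟩
    · rw [if_neg (by rw [hc1]; rintro rfl; omega)] at hl
      rcases htt with rfl | rfl
      · rw [hs0 _ hc0.symm, Shape.ok_turn, ha, hl]
        exact ⟨e1, e3, fun j hj hj' => (e5 j hj hj').symm⟩
      · rw [hs1 _ hc1.symm, Shape.ok_id, hb, hn, hl]
        exact fun _ => by rw [hn]
    · rw [if_pos hc1] at hl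
      rcases htt with rfl | rfl
      · rw [hs1 _ hc1.symm, Shape.ok_id, ha, hl]
        exact fun _ => rfl
      · rw [hs0 _ hc0.symm, Shape.ok_turn, hb, hn, hl]
        rw [hn] at e3 e5
        exact ⟨e1, e3, fun j hj hj' => (e5 j hj hj').symm⟩

/-- At the vertices `11` the vertical crossing `c₁` connects the middle level with an outer one.
Turning it encloses a small circle at the middle level and changes nothing else; `restrict` forgets
the colour of this circle. -/
theorem refill11 {V : Finset (Fin N)} (hV : ∀ t ∈ V, (L'.slice t).IsCross) (h0 : c₀ ∈ V)
    (h1 : c₁ ∉ V) : Refill L' L' {(a : ℕ) + 1} {((a : ℕ) + 1, i + 1)} (insert c₁ V) V where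
  cross t ht := by
    rcases Finset.mem_insert.1 ht with rfl | ht
    exacts [h.isCross₁, hV t ht]
  cross' := hV
  wd := rfl
  ext c hc β := by
    obtain ⟨e1, e2, e3, e4⟩ := h.comp11 (by simp [h0]) (by simp) hc
    refine ⟨Function.update c (a + 1) fun j => if j = i ∨ j = i + 1 then β else c a j, ?_,
      eqOff_update _ _ _, by simp⟩
    refine hc.replace rfl hV (eqOff_update _ _ _) ?_ ?_ ?_
    · rintro n rfl j
      rw [Function.update_self, ← h.wd_eq, h.wd_succ]
      have := h.lt_wd
      split_ifs with hj
      · intro _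
        omega
      · rw [h.wd_eq]
        exact hc.supp _ _
    · intro t ht ht'
      refine shapeAt_congr ?_
      have : t ≠ c₁ := by
        rintro rfl
        have := h.eq_or_iff.2 (.inr (Eq.refl t))
        simp only [Set.mem_singleton_iff] at ht ht'
        have := h.next
        rcases ‹t = a ∨ t = b› with rfl | rfl <;> omega
      simp [this]
    · intro t ht
      rcases h.cases_of_mem ht with rfl | rfl
      · rw [(h.shapeAt10 h0 h1).1, Shape.ok_turn, Function.update_of_ne (by omega),
          Function.update_self]
        exact ⟨e1, by simp, fun j hj hj' => by simp [hj, hj']⟩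
      · rw [(h.shapeAt10 h0 h1).2, Shape.ok_turn, h.next, Function.update_self,
          Function.update_of_ne (by omega)]
        rw [h.next] at e3 e4
        exact ⟨by simp, e3, fun j hj hj' => by simp [hj, hj', e4]⟩
  res c hc := ⟨h.restrict c, h.comp_restrict h0 h1 hc, (h.eqOff_restrict c).symm⟩
  uniq c d hc hd he := by
    funext n
    by_cases hn : n = a + 1
    · rw [hn, (h.comp11 (by simp [h0]) (by simp) hc).2.1,
        (h.comp11 (by simp [h0]) (by simp) hd).2.1, lev, lev, he a (by simp),
        he (b + 1) (by simp [h.next])]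
    · exact he n hn
  uniq' c d hc hd he hz := by
    obtain ⟨-, e2, -, e4, -⟩ := h.comp10 h0 h1 hc
    obtain ⟨-, f2, -, f4, -⟩ := h.comp10 h0 h1 hd
    have h3 := hz _ rfl
    funext n
    by_cases hn : n = a + 1
    · funext j
      rw [hn]
      by_cases hj : j = i
      · rw [hj, e2, f2]
        exact h3
      by_cases hj' : j = i + 1
      · rw [hj']
        exact h3
      · rw [e4 j hj hj', f4 j hj hj', he a (by simp)]
    · exact he n hn

theorem mono_restrict (c : Coloring) :
    L'.Mono (h.restrict c) c₀ ↔ c a i = c (b + 1) (i + 1) := by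
  have ha : h.restrict c a = c a := (h.eqOff_restrict c a (by simp)).symm
  have hb : h.restrict c (b + 1) = c (b + 1) := (h.eqOff_restrict c _ (by simp [h.next])).symm
  have hl : h.restrict c (a + 1) = h.lev c := by rw [restrict, Function.update_self]
  have hne := h.ne
  have hp : (L'.slice c₀).pos = i := by rw [h.after₀]; rfl
  unfold Mono
  rw [hp]
  unfold lev at hl
  rcases h.order with ⟨hc0, hc1⟩ | ⟨hc0, hc1⟩
  · rw [if_neg (by rw [hc1]; rintro rfl; exact hne (hc0.trans hc1.symm))] at hl
    rw [congrArg Fin.val hc0, ha, hl]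
  · rw [if_pos hc1] at hl
    rw [congrArg Fin.val hc0, hb, h.next, hl]

end IsRII

theorem Refill.kap_eq_self {V V' : Finset (Fin N)} {J : Set ℕ} {Z : Set (ℕ × ℕ)}
    (R : Refill L L J Z V V') {t : Fin N} (h1 : (t : ℕ) ∉ J) (h2 : (t + 1 : ℕ) ∉ J)
    {c c' : Coloring} (he : EqOff J c c') : L.kap V t c = L.kap V' t c' :=
  R.kap_eq rfl h1 h2 he

theorem sgn_eq_one {r : Fin N → ℕ} {V : Finset (Fin N)} {t : Fin N}
    (h : ∀ k ∈ V, ¬ r k < r t) : sgn r V t = 1 := by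
  rw [sgn, Finset.filter_false_of_mem h, Finset.card_empty, pow_zero]

theorem term_eq {r : Fin N → ℕ} {V : Finset (Fin N)} {c : Coloring} {f : L.CKh}
    {t : Fin N} (h : t ∈ V) (hm : L.Mono c t) : L.term r V c f t =
      sgn r V t * L.kap (V.erase t) t c * L.pair (V.erase t) c f := if_pos ⟨h, hm⟩

theorem term_of_not_mem {r : Fin N → ℕ} {V : Finset (Fin N)} {c : Coloring} {f : L.CKh}
    {t : Fin N} (h : t ∉ V) : L.term r V c f t = 0 := if_neg fun h' => h h'.1

theorem term_of_not_mono {r : Fin N → ℕ} {V : Finset (Fin N)} {c : Coloring} {f : L.CKh}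
    {t : Fin N} (h : ¬ L.Mono c t) : L.term r V c f t = 0 := if_neg fun h' => h h'.2

theorem term_eq_zero {r : Fin N → ℕ} {V : Finset (Fin N)} {c : Coloring} {f : L.CKh}
    {t : Fin N} (h : t ∈ V → L.Mono c t → L.pair (V.erase t) c f = 0) :
    L.term r V c f t = 0 := by
  unfold term
  split_ifs with h'
  · rw [h h'.1 h'.2, mul_zero]
  · rfl

/-- The value of `(-1)^gr` at a vertex. -/
noncomputable def grSign (w : L.Orientation) (V : Finset (Fin N)) : ℚ :=
  (-1 : ℚ) ^ ((V.card : ℤ) - (w.numNeg : ℤ))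

theorem grSign_ne_zero (w : L.Orientation) (V : Finset (Fin N)) : grSign w V ≠ 0 :=
  zpow_ne_zero _ (by norm_num)

theorem grSign_erase (w : L.Orientation) {V : Finset (Fin N)} {t : Fin N} (ht : t ∈ V) :
    grSign w V = - grSign w (V.erase t) := by
  unfold grSign
  have : ((V.card : ℤ) - (w.numNeg : ℤ)) = (((V.erase t).card : ℤ) - (w.numNeg : ℤ)) + 1 := by
    rw [Finset.card_erase_of_mem ht]
    have := Finset.card_pos.2 ⟨t, ht⟩
    omega
  rw [this, zpow_add_one₀ (by norm_num)]
  ring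

theorem pair_scale_gr (w : L.Orientation) (V : Finset (Fin N)) (c : Coloring) (f : L.CKh) :
    L.pair V c (scale (fun s => (-1 : ℚ) ^ gr w s) f) = grSign w V * L.pair V c f :=
  pair_scale (fun s hs => by rw [gr, hs, grSign]) c f

namespace IsRII

variable {a b c₀ c₁ : Fin N} {i : ℕ} (h : IsRII L L' a b i c₀ c₁)

include h

theorem isCross_of_mem {V : Finset (Fin N)} (hV : ∀ t ∈ V, (L'.slice t).IsCross) :
    ∀ t ∈ (V.erase c₁).erase c₀, (L.slice t).IsCross := by
  intro t ht
  simp only [Finset.mem_erase] at ht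
  rw [← h.off' ht.1 ht.2.1]
  exact hV t ht.2.2

theorem isCross_erase₁ {V : Finset (Fin N)} (hV : ∀ t ∈ V, (L'.slice t).IsCross) (h0 : c₀ ∉ V) :
    ∀ t ∈ V.erase c₁, (L.slice t).IsCross := by
  have := h.isCross_of_mem hV
  rwa [Finset.erase_eq_of_notMem (a := c₀) (by simp [h0])] at this

theorem isCross_erase₀ {V : Finset (Fin N)} (hV : ∀ t ∈ V, (L'.slice t).IsCross) (h1 : c₁ ∉ V) :
    ∀ t ∈ V.erase c₀, (L.slice t).IsCross := by
  have := h.isCross_of_mem hV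
  rwa [Finset.erase_eq_of_notMem h1] at this

theorem comp_erase₁ {V : Finset (Fin N)} {c : Coloring} (hc : L'.Comp V c) (h0 : c₀ ∉ V)
    (h1 : c₁ ∈ V) : L.Comp (V.erase c₁) c := by
  rw [h.comp_insert_iff (h.isCross_erase₁ hc.cross h0), Finset.insert_erase h1]
  exact hc

theorem pair_incl {V : Finset (Fin N)} {c : Coloring} (hc : L'.Comp V c) (h0 : c₀ ∉ V)
    (h1 : c₁ ∈ V) (f : L.CKh) : L'.pair V c (h.incl f) = L.pair (V.erase c₁) c f := by
  have R := h.refill01 (h.isCross_erase₁ hc.cross h0)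
  rw [Finset.insert_erase h1] at R
  refine R.pair_transfer (mem_singleton_succ a) (fun W => ?_) (by simp)
    (h.comp_erase₁ hc h0 h1) hc (fun _ _ => rfl) f
  constructor
  · intro hW
    rw [hW, Finset.erase_insert (h.not_mem W.2).2]
  · intro hW
    rw [hW, Finset.insert_erase h1]

theorem pair_incl_eq_zero {V : Finset (Fin N)} {c : Coloring} (hV : c₀ ∈ V ∨ c₁ ∉ V)
    (f : L.CKh) : L'.pair V c (h.incl f) = 0 := by
  refine pair_transfer_eq_zero (fun W hW => ?_) f
  subst hW
  have := (h.not_mem W.2).1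
  have := h.ne
  simp_all

theorem pair_birth {V : Finset (Fin N)} {c : Coloring} (hc : L'.Comp V c) (h0 : c₀ ∈ V)
    (h1 : c₁ ∉ V) (f : L'.CKh) :
    L'.pair V c (h.birth f) = L'.pair (insert c₁ V) (h.restrict c) f := by
  refine (h.refill11 hc.cross h0 h1).pair_transfer (mem_singleton_succ a) (fun W => ?_) ?_
    (h.comp_restrict h0 h1 hc) hc (h.eqOff_restrict c).symm f
  · constructor
    · rintro ⟨-, h3, h4⟩
      rw [h4, Finset.insert_erase h3]
    · intro hW
      rw [hW]
      exact ⟨by simp [h0], by simp, by simp [h1]⟩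
  · intro s' _
    have hpos : (L'.slice a).pos = i := by
      rcases h.order with ⟨rfl, -⟩ | ⟨-, rfl⟩
      · rw [h.after₀]; rfl
      · rw [h.after₁]; rfl
    constructor
    · intro hs p' hp'
      rw [← hs]
      congr 1
      apply Point.ext'
      · simpa [tr] using congrArg Prod.fst hp'
      · simpa [tr, hpos] using congrArg Prod.snd hp'
    · intro hs
      apply hs
      simp [tr, hpos]

theorem pair_birth_eq_zero {V : Finset (Fin N)} {c : Coloring} (hV : c₀ ∉ V ∨ c₁ ∈ V)
    (f : L'.CKh) : L'.pair V c (h.birth f) = 0 := by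
  refine pair_transfer_eq_zero ?_ f
  rintro W ⟨h2, h3, rfl⟩
  have := h.ne
  simp_all

/-- The map `z ↦ z + ι (d'_{01→11} z)`. -/
noncomputable def core : L.CKh →ₗ[ℚ] L'.CKh :=
  h.incl + h.birth ∘ₗ L'.saddle c₀ h.isCross₀ ∘ₗ h.incl

theorem core_apply (f : L.CKh) :
    h.core f = h.incl f + h.birth (L'.saddle c₀ h.isCross₀ (h.incl f)) := rfl

theorem pair_core01 {V : Finset (Fin N)} {c : Coloring} (hc : L'.Comp V c) (h0 : c₀ ∉ V)
    (h1 : c₁ ∈ V) (f : L.CKh) : L'.pair V c (h.core f) = L.pair (V.erase c₁) c f := by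
  rw [core_apply, map_add, h.pair_incl hc h0 h1, h.pair_birth_eq_zero (.inl h0), add_zero]

open scoped Classical in
-- Since the small circle is labelled by `v₊`, the value does not depend on its colour. It is the
-- coordinate at the vertex `01` times the factor of the edge `01 → 11`.
theorem pair_core10 {V : Finset (Fin N)} {c : Coloring} (hc : L'.Comp V c) (h0 : c₀ ∈ V)
    (h1 : c₁ ∉ V) (f : L.CKh) : L'.pair V c (h.core f) = if L'.Mono (h.restrict c) c₀ then
      L'.kap (insert c₁ (V.erase c₀)) c₀ (h.restrict c) * L.pair (V.erase c₀) (h.restrict c) f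
    else 0 := by
  have e : (insert c₁ V).erase c₀ = insert c₁ (V.erase c₀) :=
    Finset.erase_insert_of_ne h.ne.symm
  have hcr := h.comp_restrict h0 h1 hc
  have h0' : c₀ ∈ insert c₁ V := by simp [h0]
  rw [core_apply, map_add, h.pair_incl_eq_zero (.inl h0), h.pair_birth hc h0 h1, zero_add,
    pair_saddle _ hcr]
  by_cases hm : L'.Mono (h.restrict c) c₀
  · rw [if_pos ⟨h0', hm⟩, if_pos hm, h.pair_incl ((hcr.erase_iff h0').2 hm) (by simp)
      (by simp [h.ne.symm]), e, Finset.erase_insert (by simp [h1])]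
  · rw [if_neg fun h => hm h.2, if_neg hm]

theorem pair_core_eq_zero {V : Finset (Fin N)} {c : Coloring} (hV : c₀ ∈ V ↔ c₁ ∈ V)
    (f : L.CKh) : L'.pair V c (h.core f) = 0 := by
  rw [core_apply, map_add, h.pair_incl_eq_zero (by tauto), h.pair_birth_eq_zero (by tauto),
    add_zero]

theorem rhoII_apply (w : L.Orientation) (f : L.CKh) :
    rhoII h w f = h.core (scale (fun s => (-1 : ℚ) ^ gr w s) f) := rfl

omit h in
theorem sgn_eq_neg_erase {r : Fin N → ℕ} {V : Finset (Fin N)} {s t : Fin N} (hs : s ∈ V)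
    (hst : r s < r t) : sgn r V t = - sgn r (V.erase s) t := by
  rw [sgn_eq_erase r hs, if_pos hst]

/-- The merge with the small circle. -/
theorem kap_small {V : Finset (Fin N)} {c : Coloring} (hc : L'.Comp V c)
    (h0 : c₀ ∈ V) (h1 : c₁ ∉ V) (d : Coloring) : L'.kap V c₁ d = 1 := by
  have R := h.refill11 hc.cross h0 h1
  have hp : (L'.slice c₁).pos = i := by rw [h.after₁]; rfl
  unfold kap
  rw [if_neg]
  rw [hp]
  intro hs
  have hcr := h.comp_restrict h0 h1 hc
  obtain ⟨x, hx, hxe, hxz⟩ := R.ext _ hcr true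
  obtain ⟨y, hy, hye, hyz⟩ := R.ext _ hcr false
  have hs1 := hs x hx
  have hs2 := hs y hy
  have hx2 := (h.comp10 h0 h1 hx).2.1
  have hy2 := (h.comp10 h0 h1 hy).2.1
  have hx3 : x (a + 1) (i + 1) = true := hxz _ rfl
  have hy3 : y (a + 1) (i + 1) = false := hyz _ rfl
  have hn := h.next
  rcases h.order with ⟨-, hc1⟩ | ⟨-, hc1⟩
  · rw [congrArg Fin.val hc1] at hs1 hs2
    have e : x (b + 1) = y (b + 1) := by
      rw [← hxe _ (by simp [hn]), hye _ (by simp [hn])]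
    rw [hn, hx2, hx3, ← hn, e] at hs1
    rw [hn, hy2, hy3, ← hn, ← hs1] at hs2
    cases hs2
  · rw [congrArg Fin.val hc1] at hs1 hs2
    have e : x a = y a := by
      rw [← hxe _ (by simp), hye _ (by simp)]
    rw [hx3, e] at hs1
    rw [hy3, hs1] at hs2
    cases hs2

/-- The turned crossing `c₀` joins two neighbouring corners of `c₁`, and `c₁` itself is vertical, so
all its corners lie on one circle. -/
theorem mono₁ {V : Finset (Fin N)} {c : Coloring} (hc : L'.Comp V c)
    (h0 : c₀ ∈ V) (h1 : c₁ ∈ V) : L'.Mono c c₁ := by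
  have hp : (L'.slice c₁).pos = i := by rw [h.after₁]; rfl
  obtain ⟨e1, e2, e3, -⟩ := h.comp11 h0 h1 hc
  have hn := h.next
  have hne := h.ne
  unfold Mono
  rw [hp]
  unfold lev at e2
  rcases h.order with ⟨hc0, hc1⟩ | ⟨hc0, hc1⟩
  · rw [if_neg (by rw [hc1]; rintro rfl; omega)] at e2
    rw [congrArg Fin.val hc1, hn, e2, ← hn, e3]
  · rw [if_pos hc1] at e2
    rw [congrArg Fin.val hc1, e2, e1]

/-- The two crossings of the move precede all others and exactly one of them is `1`-resolved in the
image. So each of the other edges has the opposite sign in `L'`, and this is compensated by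
`(-1)^gr`. -/
theorem isChainMap {r : Fin N → ℕ} (hr : Function.Injective r)
    (hlt : ∀ t, t ≠ a → t ≠ b → r a < r t ∧ r b < r t) (w : L.Orientation) :
    IsChainMap (L.dLee r) (L'.dLee r) (rhoII h w) := by
  classical
  have hlt' : ∀ t, t ≠ c₀ → t ≠ c₁ → r c₀ < r t ∧ r c₁ < r t := by
    intro t ht0 ht1
    rcases h.order with ⟨rfl, rfl⟩ | ⟨rfl, rfl⟩
    · exact hlt t ht0 ht1
    · exact (hlt t ht1 ht0).symm
  intro f
  apply pair_inj
  intro V c hc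
  rw [pair_dLee r hc, rhoII_apply, rhoII_apply]
  set S := scale (fun s : L.State => (-1 : ℚ) ^ gr w s)
  have hS : ∀ V c f, L.pair V c (S f) = grSign w V * L.pair V c f := pair_scale_gr w
  by_cases h0 : c₀ ∈ V <;> by_cases h1 : c₁ ∈ V
  -- At `11` the image vanishes. The edge from `10` removes the small circle with factor `1`, and
  -- the edge from `01` has the factor that was already inserted in the value at `10`; their signs
  -- are opposite.
  · rw [h.pair_core_eq_zero (iff_of_true h0 h1)]
    rw [Fintype.sum_eq_add c₀ c₁ h.ne]
    · have hm1 := h.mono₁ hc h0 h1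
      have hc1 := (hc.erase_iff h1).2 hm1
      have hrc : h.restrict c = c := h.restrict_eq h0 h1 hc
      have h01 : c₀ ∈ V.erase c₁ := Finset.mem_erase.2 ⟨h.ne, h0⟩
      have h10 : c₁ ∈ V.erase c₀ := Finset.mem_erase.2 ⟨h.ne.symm, h1⟩
      have e : insert c₁ ((V.erase c₁).erase c₀) = V.erase c₀ := by
        rw [Finset.erase_right_comm, Finset.insert_erase h10]
      rw [term_eq h1 hm1, h.pair_core10 hc1 h01 (by simp), hrc, e, h.kap_small hc1 h01 (by simp)]
      by_cases hm0 : L'.Mono c c₀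
      · have hc0 := (hc.erase_iff h0).2 hm0
        rw [term_eq h0 hm0, if_pos hm0, h.pair_core01 hc0 (by simp) h10,
          Finset.erase_right_comm]
        have hsg : sgn r V c₀ = - sgn r V c₁ := by
          have hno : ∀ k ∈ (V.erase c₀).erase c₁, r c₀ < r k ∧ r c₁ < r k := by
            intro k hk
            simp only [Finset.mem_erase] at hk
            exact hlt' k hk.2.1 hk.1
          have hne := hr.ne h.ne
          rw [← sgn_erase r V c₀, ← sgn_erase r V c₁, sgn_eq_erase r h10, sgn_eq_erase r h01,
            Finset.erase_right_comm (a := c₁), sgn_eq_one (t := c₀), sgn_eq_one (t := c₁)]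
          · rcases lt_or_gt_of_ne hne with hl | hl
            · rw [if_neg (by omega), if_pos hl]; ring
            · rw [if_pos hl, if_neg (by omega)]
          · exact fun k hk => by have := hno k hk; omega
          · exact fun k hk => by have := hno k hk; omega
        rw [hsg]
        ring
      · rw [term_of_not_mono hm0, if_neg hm0]
        ring
    · rintro t ⟨ht0, ht1⟩
      refine term_eq_zero fun _ _ => h.pair_core_eq_zero ?_ _
      simp [h0, h1, ht0.symm, ht1.symm]
  -- At `10` the edge from `00` contributes nothing. For the other edges the map is compatible by
  -- the square relation for `c₀` and `t` at the vertices `01` and `11`.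
  · rw [h.pair_core10 hc h0 h1]
    have hcr := h.comp_restrict h0 h1 hc
    have key : ∀ t, L'.term r V c (h.core (S f)) t = if L'.Mono (h.restrict c) c₀ then
        L'.kap (insert c₁ (V.erase c₀)) c₀ (h.restrict c) * grSign w (V.erase c₀) *
          L.term r (V.erase c₀) (h.restrict c) f t else 0 := by
      intro t
      by_cases ht : t ∈ V
      swap
      · rw [term_of_not_mem ht, term_of_not_mem (fun h => ht (Finset.mem_of_mem_erase h)),
          mul_zero, ite_self]
      have ht1 : t ≠ c₁ := fun e => h1 (e ▸ ht)
      by_cases ht0 : t = c₀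
      · rw [ht0, term_of_not_mem (V := V.erase c₀) (by simp), mul_zero, ite_self]
        exact term_eq_zero fun _ _ => h.pair_core_eq_zero (by simp [h1]) _
      obtain ⟨hl1, hl2⟩ := h.notMem_level ht0 ht1
      have hmm : L'.Mono c t ↔ L'.Mono (h.restrict c) t :=
        Mono.congr (h.eqOff_restrict c) rfl hl1 hl2
      have hmm' : L'.Mono (h.restrict c) t ↔ L.Mono (h.restrict c) t := by
        unfold Mono
        rw [h.off' ht0 ht1]
      by_cases hm : L'.Mono c t
      swap
      · rw [term_of_not_mono hm, term_of_not_mono fun h' => hm (hmm.2 (hmm'.2 h')), mul_zero,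
          ite_self]
      have hc2 := (hc.erase_iff ht).2 hm
      have h02 : c₀ ∈ V.erase t := Finset.mem_erase.2 ⟨Ne.symm ht0, h0⟩
      have h12 : c₁ ∉ V.erase t := fun h' => h1 (Finset.mem_of_mem_erase h')
      have htW : t ∈ V.erase c₀ := Finset.mem_erase.2 ⟨ht0, ht⟩
      rw [term_eq ht hm, term_eq htW (hmm'.1 (hmm.1 hm)), h.pair_core10 hc2 h02 h12, hS]
      by_cases hm0 : L'.Mono (h.restrict c) c₀
      swap
      · rw [if_neg hm0, if_neg hm0, mul_zero]
      rw [if_pos hm0, if_pos hm0, sgn_eq_neg_erase h0 (hlt' t ht0 ht1).1, grSign_erase w htW,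
        Finset.erase_right_comm (a := t)]
      have R1 := h.refill11 hc2.cross h02 h12
      have R2 := h.refill01 (V := (V.erase c₀).erase t) fun s hs =>
        h.isCross_erase₀ hc.cross h1 s (Finset.mem_of_mem_erase hs)
      have k1 := R1.kap_eq_self hl1 hl2 (h.eqOff_restrict c).symm
      have k2 := R2.kap_eq (h.off' ht0 ht1).symm hl1 hl2 (c := h.restrict c) fun _ _ => rfl
      have ht' : t ∈ insert c₁ V := by simp [ht]
      have hU := (hcr.erase_iff ht').2 (hmm.1 hm)
      have h0' : c₀ ∈ (insert c₁ V).erase t := by simp [h0, Ne.symm ht0]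
      have hU' := (hU.erase_iff h0').2 hm0
      have eU : ((insert c₁ V).erase t).erase c₀ = insert c₁ ((V.erase c₀).erase t) := by
        rw [Finset.erase_insert_of_ne (Ne.symm ht1), Finset.erase_insert_of_ne h.ne.symm,
          Finset.erase_right_comm]
      rw [eU] at hU'
      have sq := hU'.kap_square h.isCross₀ (hc.cross t ht) (Ne.symm ht0)
        (by simp [h.ne]) (by simp [ht1]) hm0 (hmm.1 hm)
      have e1 : insert c₀ (insert c₁ ((V.erase c₀).erase t)) = insert c₁ (V.erase t) := by
        rw [Finset.insert_comm, Finset.erase_right_comm, Finset.insert_erase h02]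
      have e2 : insert t (insert c₁ ((V.erase c₀).erase t)) = insert c₁ (V.erase c₀) := by
        rw [Finset.insert_comm, Finset.insert_erase htW]
      rw [e1, e2] at sq
      rw [← k1, k2]
      linear_combination (- sgn r (V.erase c₀) t * grSign w ((V.erase c₀).erase t) *
        L.pair ((V.erase c₀).erase t) (h.restrict c) f) * sq
    rw [Finset.sum_congr rfl fun t _ => key t]
    by_cases hm0 : L'.Mono (h.restrict c) c₀
    · have hcW := (hcr.erase_iff (t := c₀) (by simp [h0])).2 hm0
      have hcW' := h.comp_erase₁ hcW (by simp) (by simp [h.ne.symm])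
      have e : ((insert c₁ V).erase c₀).erase c₁ = V.erase c₀ := by
        rw [Finset.erase_right_comm, Finset.erase_insert h1]
      rw [e] at hcW'
      simp only [if_pos hm0]
      rw [← Finset.mul_sum, hS, pair_dLee r hcW', mul_assoc]
    · simp only [if_neg hm0, Finset.sum_const_zero]
  -- At `01` the resolutions of both diagrams coincide, and only signs have to be compared.
  · rw [h.pair_core01 hc h0 h1, hS, pair_dLee r (h.comp_erase₁ hc h0 h1), Finset.mul_sum]
    apply Finset.sum_congr rfl
    intro t _
    by_cases ht : t ∈ V
    swap
    · rw [term_of_not_mem ht, term_of_not_mem (fun h => ht (Finset.mem_of_mem_erase h)), mul_zero]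
    have ht0 : t ≠ c₀ := fun e => h0 (e ▸ ht)
    by_cases ht1 : t = c₁
    · rw [ht1, term_of_not_mem (V := V.erase c₁) (by simp), mul_zero]
      exact term_eq_zero fun _ _ => h.pair_core_eq_zero (by simp [h0]) _
    obtain ⟨hl1, hl2⟩ := h.notMem_level ht0 ht1
    have hmm : L'.Mono c t ↔ L.Mono c t := by
      unfold Mono
      rw [h.off' ht0 ht1]
    by_cases hm : L'.Mono c t
    swap
    · rw [term_of_not_mono hm, term_of_not_mono fun h' => hm (hmm.2 h'), mul_zero]
    have htW : t ∈ V.erase c₁ := Finset.mem_erase.2 ⟨ht1, ht⟩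
    have hc2 := (hc.erase_iff ht).2 hm
    have h12 : c₁ ∈ V.erase t := Finset.mem_erase.2 ⟨Ne.symm ht1, h1⟩
    have R2 := h.refill01 (V := (V.erase c₁).erase t) fun s hs =>
        h.isCross_erase₁ hc.cross h0 s (Finset.mem_of_mem_erase hs)
    have k2 := R2.kap_eq (h.off' ht0 ht1).symm hl1 hl2 (c := c) fun _ _ => rfl
    rw [Finset.erase_right_comm, Finset.insert_erase h12] at k2
    rw [term_eq ht hm, term_eq htW (hmm.1 hm), h.pair_core01 hc2 (by simp [h0]) h12, hS,
      sgn_eq_neg_erase h1 (hlt' t ht0 ht1).2, grSign_erase w htW,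
      Finset.erase_right_comm (a := t), Finset.erase_right_comm (a := c₁), k2]
    rw [Finset.erase_right_comm (a := t)]
    ring
  · rw [h.pair_core_eq_zero (iff_of_false h0 h1)]
    apply Finset.sum_eq_zero
    intro t _
    exact term_eq_zero fun _ _ => h.pair_core_eq_zero (by simp [h0, h1]) _

theorem off_of_notMem {t : Fin N} (ht : (t : ℕ) ∉ ({(a : ℕ) + 1} : Set ℕ))
    (ht' : (t + 1 : ℕ) ∉ ({(a : ℕ) + 1} : Set ℕ)) : L'.slice t = L.slice t :=
  h.off t (by rintro rfl; exact ht' rfl) (by rintro rfl; exact ht h.next)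

/-- Passing both crossings applies `crossFlip` twice, which is the identity. So only the colours at
the middle level have to be changed. -/
theorem orientationCorr : OrientationCorr L L' {(a : ℕ) + 1} := by
  have hflow : ∀ x y, (L'.slice a).Flow x y ↔ y = crossFlip i x := by
    intro x y
    rcases h.order with ⟨rfl, -⟩ | ⟨-, rfl⟩
    · rw [h.after₀]; rfl
    · rw [h.after₁]; rfl
  have hflow' : ∀ x y, (L'.slice b).Flow x y ↔ y = crossFlip i x := by
    intro x y
    rcases h.order with ⟨-, rfl⟩ | ⟨rfl, -⟩
    · rw [h.after₁]; rfl
    · rw [h.after₀]; rfl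
  have hn := h.next
  refine OrientationCorr.mk' h.wd_eq ?_ ?_ ?_
  · rintro n rfl
    exact ⟨a, rfl, .inl h.before_a, .inr h.isCross_a⟩
  · intro c hc
    have h1 : c (a + 1) = c a := by
      have := hc.flow a
      rw [h.before_a] at this
      funext j
      exact (Shape.ok_id.1 this j).symm
    have h2 : c (b + 1) = c a := by
      have := hc.flow b
      rw [h.before_b, hn, h1] at this
      funext j
      rw [hn]
      exact (Shape.ok_id.1 this j).symm
    refine ⟨Function.update c (a + 1) (crossFlip i (c a)), ?_, eqOff_update _ _ _⟩
    refine hc.replace h.wd_eq (eqOff_update _ _ _) ?_ ?_ ?_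
    · rintro n rfl
      rw [Function.update_self, h.wd_succ]
      exact crossFlip_supp h.lt_wd (hc.supp _)
    · exact fun t ht ht' => h.off_of_notMem ht ht'
    · intro t ht
      rcases h.cases_of_mem ht with rfl | rfl
      · rw [hflow, Function.update_self, Function.update_of_ne (by omega)]
      · rw [hflow', hn, Function.update_self, Function.update_of_ne (by omega),
          crossFlip_crossFlip, ← h2, hn]
  · intro c hc
    have h1 := (hflow _ _).1 (hc.flow a)
    have h2 := (hflow' _ _).1 (hc.flow b)
    rw [hn, h1, crossFlip_crossFlip] at h2
    refine ⟨Function.update c (a + 1) (c a), ?_, (eqOff_update _ _ _).symm⟩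
    refine hc.replace h.wd_eq.symm (eqOff_update _ _ _) ?_ ?_ ?_
    · rintro n rfl
      rw [Function.update_self, ← h.wd_eq, h.wd_succ, h.wd_eq]
      exact hc.supp _
    · exact fun t ht ht' => (h.off_of_notMem ht ht').symm
    · intro t ht
      rcases h.cases_of_mem ht with rfl | rfl
      · rw [h.before_a, Function.update_of_ne (by omega), Function.update_self]
        exact Shape.ok_id.2 fun _ => rfl
      · rw [h.before_b, hn, Function.update_self, Function.update_of_ne (by omega), h2]
        exact Shape.ok_id.2 fun _ => rfl

end IsRII

namespace IsRII

variable {a b c₀ c₁ : Fin N} {i : ℕ} (h : IsRII L L' a b i c₀ c₁)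

include h

theorem col_level {c : Coloring} (hc : L'.Flow c) :
    c (a + 1) = crossFlip i (c a) ∧ c (b + 1) = c a := by
  have hflow : c (a + 1) = crossFlip i (c a) := by
    have := hc.flow a
    rcases h.order with ⟨h1, -⟩ | ⟨-, h1⟩
    · rw [← h1, h.after₀] at this
      rw [← h1]
      exact this
    · rw [← h1, h.after₁] at this
      rw [← h1]
      exact this
  have hflow' : c (b + 1) = crossFlip i (c b) := by
    have := hc.flow b
    rcases h.order with ⟨-, h1⟩ | ⟨h1, -⟩
    · rw [← h1, h.after₁] at this
      rw [← h1]
      exact this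
    · rw [← h1, h.after₀] at this
      rw [← h1]
      exact this
  refine ⟨hflow, ?_⟩
  rw [hflow', h.next, hflow, crossFlip_crossFlip]

/-- If the two strands are antiparallel, their colours are equal and the oriented vertex of `L'` is
of type `10`; the coordinate is then obtained through the edge `01 → 11`, which is monochromatic. If
they are parallel, the vertex is of type `01` and the coordinate is carried over directly. -/
theorem pair_orientation (w : L.Orientation) (o : L.Orientation) (o' : L'.Orientation)
    (he : EqOff {(a : ℕ) + 1} o.col o'.col) : ∃ q : ℚ, q ≠ 0 ∧
      ∀ x, L'.pair o'.vertex.1 o'.col (rhoII h w x) = q * L.pair o.vertex.1 o.col x := by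
  obtain ⟨e1, e2⟩ := h.col_level o'.flow
  have hx : ∀ t, t = a ∨ t = b → (o'.col t i = o'.col t (i + 1) ↔
      o'.col a i = o'.col a (i + 1)) := by
    rintro t (rfl | rfl)
    · rfl
    · rw [h.next, e1, crossFlip_left, crossFlip_right]
      cases o'.col a i <;> cases o'.col a (i + 1) <;> simp
  have m0 := o'.comp.mem_iff h.after₀ (o'.not_mono h.isCross₀)
  have m1 := o'.comp.mem_iff h.after₁ (o'.not_mono h.isCross₁)
  rw [hx _ (h.eq_or_iff.2 (.inl rfl))] at m0
  rw [hx _ (h.eq_or_iff.2 (.inr rfl))] at m1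
  have hcol : ∀ {V c}, L.Comp V c → EqOff {(a : ℕ) + 1} c o'.col → V = o.vertex.1 ∧ c = o.col := by
    intro V c hc hcc
    have hcc' := hcc.trans he.symm
    obtain rfl : c = o.col := by
      funext n
      by_cases hn : n = a + 1
      · rw [hn, h.comp_level hc, h.comp_level o.comp]
        exact hcc' _ (by simp)
      · exact hcc' n hn
    exact ⟨hc.vertex_unique o.comp fun t ht => o.not_mono ht, rfl⟩
  by_cases hxx : o'.col a i = o'.col a (i + 1)
  · have h0 : c₀ ∈ o'.vertex.1 := m0.2 (iff_of_true hxx rfl)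
    have h1 : c₁ ∉ o'.vertex.1 := fun h' => by simpa using (m1.1 h').1 hxx
    have hm : L'.Mono (h.restrict o'.col) c₀ := by rw [h.mono_restrict, e2, hxx]
    have hc1 := h.comp_restrict h0 h1 o'.comp
    have hc2 := (hc1.erase_iff (t := c₀) (by simp [h0])).2 hm
    have hc3 := h.comp_erase₁ hc2 (by simp) (by simp [h.ne.symm])
    rw [Finset.erase_right_comm, Finset.erase_insert h1] at hc3
    obtain ⟨hV, hc⟩ := hcol hc3 (h.eqOff_restrict _).symm
    refine ⟨L'.kap (insert c₁ (o'.vertex.1.erase c₀)) c₀ (h.restrict o'.col) *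
      grSign w o.vertex.1, mul_ne_zero (L'.kap_ne_zero _ _ _) (grSign_ne_zero _ _), fun x => ?_⟩
    rw [rhoII_apply, h.pair_core10 o'.comp h0 h1, if_pos hm, hV, hc, pair_scale_gr, mul_assoc]
  · have h0 : c₀ ∉ o'.vertex.1 := fun h' => hxx ((m0.1 h').2 rfl)
    have h1 : c₁ ∈ o'.vertex.1 := m1.2 (iff_of_false hxx (by simp))
    obtain ⟨hV, hc⟩ := hcol (h.comp_erase₁ o'.comp h0 h1) fun _ _ => rfl
    refine ⟨grSign w o.vertex.1, grSign_ne_zero _ _, fun x => ?_⟩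
    rw [rhoII_apply, h.pair_core01 o'.comp h0 h1, hV, hc, pair_scale_gr]

theorem preservesCanonical {r : Fin N → ℕ} (hr : Function.Injective r)
    (hlt : ∀ t, t ≠ a → t ≠ b → r a < r t ∧ r b < r t) (w : L.Orientation) :
    PreservesCanonical {a.succ} (h.isChainMap hr hlt w).map :=
  h.orientationCorr.preservesCanonical_map (mem_singleton_succ a) hr _ (h.pair_orientation w)

end IsRII

/-- The right-hand curl. -/
theorem preservesCanonical_symm_comp {M : Diagram N} {a b c : Fin N} {i : ℕ} {r : Fin N → ℕ}
    (hr : Function.Injective r) (w : L.Orientation)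
    (h₂ : IsRII L M a b i a b) (h₁ : IsRI L' M b c i)
    (hlt : ∀ t, t ≠ a → t ≠ b → r a < r t ∧ r b < r t) :
    PreservesCanonical {a.succ, b.succ}
      ((LinearEquiv.ofBijective (h₁.isChainMap r).map (h₁.bijective hr)).symm.toLinearMap ∘ₗ
        (h₂.isChainMap hr hlt w).map) := by
  intro o
  have hI : ∀ n : Fin (N + 1), n ∈ ({a.succ, b.succ} : Set (Fin (N + 1))) ↔
      (n : ℕ) ∈ ({(a : ℕ) + 1, (b : ℕ) + 1} : Set ℕ) := by simp [Fin.ext_iff]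
  have hw : L.wd = L'.wd := h₂.wd_eq.trans h₁.wd_eq.symm
  obtain ⟨oM, ⟨ho, -⟩, hz, hzM, q, hq, hqe⟩ := h₂.preservesCanonical hr hlt w o
  rw [Orientation.induces_iff h₂.wd_eq (mem_singleton_succ a)] at ho
  obtain ⟨o', ho'⟩ := h₁.orientationCorr.ex' oM
  obtain ⟨oM', ⟨hoM', -⟩, hz', hzM', q', hq', hqe'⟩ := h₁.preservesCanonical hr o'
  rw [Orientation.induces_iff h₁.wd_eq (mem_singleton_succ b)] at hoM'
  -- Both moves lead to the same orientation of `M`, so the inverse of the second map can be applied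
  -- to the canonical class of `M`.
  obtain rfl : oM' = oM := h₁.orientationCorr.uniq' _ _ (hoM'.symm.trans ho')
  have hoo : EqOff {(a : ℕ) + 1, (b : ℕ) + 1} o.col o'.col := by
    intro n hn
    simp only [Set.mem_insert_iff, Set.mem_singleton_iff, not_or] at hn
    rw [ho n hn.1, ho' n hn.2]
  refine ⟨o', ⟨(o.induces_iff hw hI o').2 hoo, fun o'' h'' => ?_⟩, hz, hz', q'⁻¹ * q,
    mul_ne_zero (inv_ne_zero hq') hq, ?_⟩
  · rw [o.induces_iff hw hI] at h''
    refine Orientation.ext_col (o''.flow.eq_of_eqOff o'.flow (h''.symm.trans hoo) ?_)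
    rintro n (rfl | rfl)
    · refine ⟨a, rfl, .inr ?_⟩
      rw [← h₁.off a (by rintro rfl; have := h₂.next; omega)]
      exact h₂.isCross_a
    · exact ⟨b, rfl, .inl h₁.before⟩
  · rw [LinearMap.comp_apply, hqe, map_smul, mul_comm, mul_smul]
    congr 1
    rw [LinearEquiv.coe_coe, LinearEquiv.symm_apply_eq, map_smul, LinearEquiv.ofBijective_apply,
      hqe', smul_smul, inv_mul_cancel₀ hq', one_smul]

/-! ### The third Reidemeister move: three crossings and the small circle between them -/

/-- Three consecutive crossings at positions `p`, `q`, `p` whose `1`-resolutions are vertical. -/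
structure Triple (L : Diagram N) (a b c : Fin N) (p q : ℕ) : Prop where
  next_a : (b : ℕ) = a + 1
  next_b : (c : ℕ) = b + 1
  at_a : L.slice a = .cross p false
  at_b : L.slice b = .cross q false
  at_c : L.slice c = .cross p false

namespace Triple

variable {a b c : Fin N} {p q : ℕ} (T : Triple L a b c p q)

include T

theorem val_c : (c : ℕ) = a + 2 := by rw [T.next_b, T.next_a]

theorem ne_ab : a ≠ b := by rintro rfl; have := T.next_a; omega
theorem ne_bc : b ≠ c := by rintro rfl; have := T.next_b; omega
theorem ne_ac : a ≠ c := by rintro rfl; have := T.val_c; omega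

theorem isCross_a : (L.slice a).IsCross := ⟨_, _, T.at_a⟩
theorem isCross_b : (L.slice b).IsCross := ⟨_, _, T.at_b⟩
theorem isCross_c : (L.slice c).IsCross := ⟨_, _, T.at_c⟩

theorem lt_p : p + 1 < L.wd a := pos_lt_wd T.at_a

theorem wd_one : L.wd (a + 1) = L.wd a := by
  have := L.fits' a
  rw [T.at_a] at this
  exact this.2

theorem wd_two : L.wd (a + 2) = L.wd a := by
  have := L.fits' b
  rw [T.at_b, T.next_a, T.wd_one] at this
  exact this.2

theorem wd_three : L.wd (a + 3) = L.wd a := by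
  have := L.fits' c
  rw [T.at_c, T.val_c, T.wd_two] at this
  exact this.2

theorem cases_of_mem {t : Fin N} (ht : (t : ℕ) ∈ ({(a : ℕ) + 1, (a : ℕ) + 2} : Set ℕ) ∨
    (t + 1 : ℕ) ∈ ({(a : ℕ) + 1, (a : ℕ) + 2} : Set ℕ)) : t = a ∨ t = b ∨ t = c := by
  have := T.next_a
  have := T.val_c
  simp only [Set.mem_insert_iff, Set.mem_singleton_iff, Fin.ext_iff] at *
  omega

theorem notMem_level {t : Fin N} (ha : t ≠ a) (hb : t ≠ b) (hc : t ≠ c) :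
    (t : ℕ) ∉ ({(a : ℕ) + 1, (a : ℕ) + 2} : Set ℕ) ∧
      (t + 1 : ℕ) ∉ ({(a : ℕ) + 1, (a : ℕ) + 2} : Set ℕ) := by
  rw [← not_or]
  intro ht
  have := T.cases_of_mem ht
  tauto

theorem ne_of_notMem {t : Fin N} (h1 : (t : ℕ) ∉ ({(a : ℕ) + 1, (a : ℕ) + 2} : Set ℕ))
    (h2 : (t + 1 : ℕ) ∉ ({(a : ℕ) + 1, (a : ℕ) + 2} : Set ℕ)) : t ≠ a ∧ t ≠ b ∧ t ≠ c := by
  have := T.next_a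
  have := T.val_c
  simp only [Set.mem_insert_iff, Set.mem_singleton_iff, ne_eq, Fin.ext_iff] at *
  omega

theorem shape_a (V : Finset (Fin N)) : L.shapeAt V a = if a ∈ V then .id else .turn p := by
  unfold shapeAt
  rw [T.at_a]
  split_ifs with h <;> simp [h, Slice.resolve]

theorem shape_b (V : Finset (Fin N)) : L.shapeAt V b = if b ∈ V then .id else .turn q := by
  unfold shapeAt
  rw [T.at_b]
  split_ifs with h <;> simp [h, Slice.resolve]

theorem shape_c (V : Finset (Fin N)) : L.shapeAt V c = if c ∈ V then .id else .turn p := by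
  unfold shapeAt
  rw [T.at_c]
  split_ifs with h <;> simp [h, Slice.resolve]

section Comp

variable {V : Finset (Fin N)} {k : Coloring} (hk : L.Comp V k)

include hk

theorem id_a (ha : a ∈ V) : k (a + 1) = k a := by
  have := hk.ok a
  rw [T.shape_a, if_pos ha, Shape.ok_id] at this
  exact (funext this).symm

theorem id_b (hb : b ∈ V) : k (a + 2) = k (a + 1) := by
  have := hk.ok b
  rw [T.shape_b, if_pos hb, Shape.ok_id, T.next_a] at this
  exact (funext this).symm

theorem id_c (hc : c ∈ V) : k (a + 3) = k (a + 2) := by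
  have := hk.ok c
  rw [T.shape_c, if_pos hc, Shape.ok_id, T.val_c] at this
  exact (funext this).symm

theorem turn_a (ha : a ∉ V) : k a p = k a (p + 1) ∧ k (a + 1) p = k (a + 1) (p + 1) ∧
    ∀ j, j ≠ p → j ≠ p + 1 → k a j = k (a + 1) j := by
  have := hk.ok a
  rwa [T.shape_a, if_neg ha, Shape.ok_turn] at this

theorem turn_b (hb : b ∉ V) : k (a + 1) q = k (a + 1) (q + 1) ∧ k (a + 2) q = k (a + 2) (q + 1) ∧
    ∀ j, j ≠ q → j ≠ q + 1 → k (a + 1) j = k (a + 2) j := by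
  have := hk.ok b
  rwa [T.shape_b, if_neg hb, Shape.ok_turn, T.next_a] at this

theorem turn_c (hc : c ∉ V) : k (a + 2) p = k (a + 2) (p + 1) ∧ k (a + 3) p = k (a + 3) (p + 1) ∧
    ∀ j, j ≠ p → j ≠ p + 1 → k (a + 2) j = k (a + 3) j := by
  have := hk.ok c
  rwa [T.shape_c, if_neg hc, Shape.ok_turn, T.val_c] at this

end Comp

omit T

/-- The colouring `k` with new colours at the levels `n + 1` and `n + 2`. -/
def _root_.LeeKh.setTwo (k : Coloring) (n : ℕ) (x y : ℕ → Bool) : Coloring :=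
  Function.update (Function.update k (n + 1) x) (n + 2) y

theorem _root_.LeeKh.setTwo_one (k : Coloring) (n : ℕ) (x y : ℕ → Bool) :
    setTwo k n x y (n + 1) = x := by
  rw [setTwo, Function.update_of_ne (by omega), Function.update_self]

theorem _root_.LeeKh.setTwo_two (k : Coloring) (n : ℕ) (x y : ℕ → Bool) :
    setTwo k n x y (n + 2) = y := by
  rw [setTwo, Function.update_self]

theorem eqOff_setTwo (k : Coloring) (n : ℕ) (x y : ℕ → Bool) :
    EqOff {n + 1, n + 2} k (setTwo k n x y) := by
  intro m hm
  simp only [Set.mem_insert_iff, Set.mem_singleton_iff, not_or] at hm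
  rw [setTwo, Function.update_of_ne hm.2, Function.update_of_ne hm.1]

theorem _root_.LeeKh.setTwo_zero (k : Coloring) (n : ℕ) (x y : ℕ → Bool) :
    setTwo k n x y n = k n := (eqOff_setTwo k n x y n (by simp)).symm

theorem _root_.LeeKh.setTwo_three (k : Coloring) (n : ℕ) (x y : ℕ → Bool) :
    setTwo k n x y (n + 3) = k (n + 3) := (eqOff_setTwo k n x y _ (by simp)).symm

theorem setTwo_eq {k d : Coloring} {n : ℕ} {x y : ℕ → Bool} (he : EqOff {n + 1, n + 2} k d)
    (h1 : x = d (n + 1)) (h2 : y = d (n + 2)) : setTwo k n x y = d := by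
  subst h1 h2
  funext m
  by_cases hm1 : m = n + 1
  · rw [hm1, setTwo_one]
  by_cases hm2 : m = n + 2
  · rw [hm2, setTwo_two]
  · rw [← eqOff_setTwo k n _ _ m (by simp [hm1, hm2]), he m (by simp [hm1, hm2])]

include T

/-- All modifications in the third move concern the two levels between the crossings, so three
conditions, one for each slice, have to be checked. Two diagrams are admitted in order to pass from
one side of the move to the other. -/
theorem comp_setTwo {V V' : Finset (Fin N)} {p' q' : ℕ} (T' : Triple L' a b c p' q')
    (hw : L.wd = L'.wd) (hoff : ∀ t, t ≠ a → t ≠ b → t ≠ c → L'.slice t = L.slice t)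
    (hV : ∀ t, t ≠ a → t ≠ b → t ≠ c → (t ∈ V ↔ t ∈ V')) {k : Coloring} (hk : L.Comp V k)
    {x y : ℕ → Bool} (hx : ∀ j, x j = true → j < L.wd a) (hy : ∀ j, y j = true → j < L.wd a)
    (ha : (L'.shapeAt V' a).Ok (k a) x) (hb : (L'.shapeAt V' b).Ok x y)
    (hc : (L'.shapeAt V' c).Ok y (k (a + 3))) : L'.Comp V' (setTwo k a x y) := by
  refine hk.replace hw ?_ (eqOff_setTwo k a x y) ?_ ?_ ?_
  · intro t ht
    by_cases h1 : t = a
    · exact h1 ▸ T'.isCross_a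
    by_cases h2 : t = b
    · exact h2 ▸ T'.isCross_b
    by_cases h3 : t = c
    · exact h3 ▸ T'.isCross_c
    · rw [hoff t h1 h2 h3]
      exact hk.cross t ((hV t h1 h2 h3).2 ht)
  · rintro n (rfl | rfl) j
    · rw [setTwo_one, T.wd_one]; exact hx j
    · rw [setTwo_two, T.wd_two]; exact hy j
  · intro t h1 h2
    obtain ⟨h1, h2, h3⟩ := T.ne_of_notMem h1 h2
    unfold shapeAt
    rw [hoff t h1 h2 h3]
    simp only [hV t h1 h2 h3]
  · intro t ht
    rcases T.cases_of_mem ht with rfl | rfl | rfl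
    · rw [setTwo_one, setTwo_zero]; exact ha
    · rw [T.next_a, setTwo_one, setTwo_two]; exact hb
    · rw [T.val_c, setTwo_two, setTwo_three]; exact hc

omit T in
theorem supp_level {V : Finset (Fin N)} {k : Coloring} (hk : L.Comp V k) {n m : ℕ}
    (h : L.wd m = L.wd n) : ∀ j, k m j = true → j < L.wd n := by
  rw [← h]; exact hk.supp m

/-! ### Resolutions with a small circle -/

/-- The colouring in which the strands `p`, `p + 1` between the crossings have colour `s`, and the
others have the same colours as below the crossings. -/
def _root_.LeeKh.fill (a p : ℕ) (s : Bool) (k : Coloring) : Coloring :=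
  setTwo k a (fun j => if j = p ∨ j = p + 1 then s else k a j)
    (fun j => if j = p ∨ j = p + 1 then s else k a j)

/-- Outside of the levels between the crossings, `k` is a colouring of a resolution which consists
of a cap, a cup and vertical strands. -/
def _root_.LeeKh.Outer (a p : ℕ) (k : Coloring) : Prop :=
  k a p = k a (p + 1) ∧ k (a + 3) p = k (a + 3) (p + 1) ∧
    ∀ j, j ≠ p → j ≠ p + 1 → k a j = k (a + 3) j

omit T in
theorem eqOff_fill (a p : ℕ) (s : Bool) (k : Coloring) : EqOff {a + 1, a + 2} k (fill a p s k) :=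
  eqOff_setTwo _ _ _ _

omit T in
theorem fill_zero (a p : ℕ) (s : Bool) (k : Coloring) : fill a p s k a = k a :=
  setTwo_zero _ _ _ _

omit T in
theorem fill_three (a p : ℕ) (s : Bool) (k : Coloring) : fill a p s k (a + 3) = k (a + 3) :=
  setTwo_three _ _ _ _

omit T in
theorem fill_one (a p : ℕ) (s : Bool) (k : Coloring) (j : ℕ) :
    fill a p s k (a + 1) j = if j = p ∨ j = p + 1 then s else k a j := by
  rw [fill, setTwo_one]

omit T in
theorem fill_two (a p : ℕ) (s : Bool) (k : Coloring) (j : ℕ) :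
    fill a p s k (a + 2) j = if j = p ∨ j = p + 1 then s else k a j := by
  rw [fill, setTwo_two]

omit T in
theorem fill_congr {a p : ℕ} {s : Bool} {k d : Coloring} (h : EqOff {a + 1, a + 2} k d) :
    fill a p s k = fill a p s d := by
  refine setTwo_eq (h.trans (eqOff_fill a p s d)) ?_ ?_
  · funext j
    rw [fill_one, h a (by simp)]
  · funext j
    rw [fill_two, h a (by simp)]

omit T in
theorem fill_fill (a p : ℕ) (s s' : Bool) (k : Coloring) :
    fill a p s (fill a p s' k) = fill a p s k := fill_congr (eqOff_fill a p s' k).symm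

omit T in
theorem fill_self {a p : ℕ} {s : Bool} {k : Coloring} (h1 : k (a + 1) p = s)
    (h1' : k (a + 1) (p + 1) = s) (h2 : ∀ j, j ≠ p → j ≠ p + 1 → k a j = k (a + 1) j)
    (h3 : k (a + 2) = k (a + 1)) : fill a p s k = k := by
  have h4 : ∀ j, (if j = p ∨ j = p + 1 then s else k a j) = k (a + 1) j := by
    intro j
    by_cases hj : j = p
    · rw [hj, if_pos (.inl rfl), h1]
    by_cases hj' : j = p + 1
    · rw [hj', if_pos (.inr rfl), h1']
    · rw [if_neg (by tauto), h2 j hj hj']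
  refine setTwo_eq (fun _ _ => rfl) (funext h4) ?_
  rw [h3]
  exact funext h4

section Comp

variable {V : Finset (Fin N)} {k : Coloring} (hk : L.Comp V k)

include hk

/-- Only the middle crossing is resolved vertically. -/
theorem outer_b (ha : a ∉ V) (hb : b ∈ V) (hc : c ∉ V) :
    Outer a p k ∧ fill a p (k (a + 1) p) k = k := by
  obtain ⟨e1, e2, e3⟩ := T.turn_a hk ha
  obtain ⟨f1, f2, f3⟩ := T.turn_c hk hc
  have e := T.id_b hk hb
  refine ⟨⟨e1, f2, fun j hj hj' => ?_⟩, fill_self rfl e2.symm e3 e⟩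
  rw [e3 j hj hj', ← e, f3 j hj hj']

theorem outer_ab (ha : a ∈ V) (hb : b ∈ V) (hc : c ∉ V) :
    Outer a p k ∧ fill a p (k a p) k = k := by
  obtain ⟨f1, f2, f3⟩ := T.turn_c hk hc
  have e := T.id_b hk hb
  have e' := T.id_a hk ha
  rw [e, e'] at f1 f3
  refine ⟨⟨f1, f2, f3⟩, fill_self (by rw [e']) (by rw [e', f1]) (fun j _ _ => by rw [e']) e⟩

theorem outer_bc (ha : a ∉ V) (hb : b ∈ V) (hc : c ∈ V) :
    Outer a p k ∧ fill a p (k (a + 3) p) k = k := by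
  obtain ⟨f1, f2, f3⟩ := T.turn_a hk ha
  have e := T.id_b hk hb
  have e' := T.id_c hk hc
  refine ⟨⟨f1, ?_, fun j hj hj' => ?_⟩, fill_self (by rw [e', e]) (by rw [e', e, f2]) f3 e⟩
  · rw [e', e, f2]
  · rw [e', e, f3 j hj hj']

theorem supp_fill (s : Bool) (j : ℕ)
    (hj : (if j = p ∨ j = p + 1 then s else k a j) = true) : j < L.wd a := by
  have := T.lt_p
  split_ifs at hj
  · omega
  · exact hk.supp _ _ hj

variable {V' : Finset (Fin N)} (hV : ∀ t, t ≠ a → t ≠ b → t ≠ c → (t ∈ V ↔ t ∈ V'))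
  (ho : Outer a p k)

include hV ho

theorem comp_fill_b (ha : a ∉ V') (hb : b ∈ V') (hc : c ∉ V') (s : Bool) :
    L.Comp V' (fill a p s k) := by
  refine T.comp_setTwo T rfl (fun _ _ _ _ => rfl) hV hk (T.supp_fill hk s) (T.supp_fill hk s)
    ?_ ?_ ?_
  · rw [T.shape_a, if_neg ha, Shape.ok_turn]
    exact ⟨ho.1, by simp, fun j hj hj' => by simp [hj, hj']⟩
  · rw [T.shape_b, if_pos hb, Shape.ok_id]
    exact fun _ => rfl
  · rw [T.shape_c, if_neg hc, Shape.ok_turn]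
    exact ⟨by simp, ho.2.1, fun j hj hj' => by simp [hj, hj', ho.2.2 j hj hj']⟩

theorem comp_fill_ab (ha : a ∈ V') (hb : b ∈ V') (hc : c ∉ V') :
    L.Comp V' (fill a p (k a p) k) := by
  refine T.comp_setTwo T rfl (fun _ _ _ _ => rfl) hV hk (T.supp_fill hk _) (T.supp_fill hk _)
    ?_ ?_ ?_
  · rw [T.shape_a, if_pos ha, Shape.ok_id]
    intro j
    split_ifs with h
    · rcases h with rfl | rfl
      · rfl
      · exact ho.1.symm
    · rfl
  · rw [T.shape_b, if_pos hb, Shape.ok_id]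
    exact fun _ => rfl
  · rw [T.shape_c, if_neg hc, Shape.ok_turn]
    exact ⟨by simp, ho.2.1, fun j hj hj' => by simp [hj, hj', ho.2.2 j hj hj']⟩

theorem comp_fill_bc (ha : a ∉ V') (hb : b ∈ V') (hc : c ∈ V') :
    L.Comp V' (fill a p (k (a + 3) p) k) := by
  refine T.comp_setTwo T rfl (fun _ _ _ _ => rfl) hV hk (T.supp_fill hk _) (T.supp_fill hk _)
    ?_ ?_ ?_
  · rw [T.shape_a, if_neg ha, Shape.ok_turn]
    exact ⟨ho.1, by simp, fun j hj hj' => by simp [hj, hj']⟩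
  · rw [T.shape_b, if_pos hb, Shape.ok_id]
    exact fun _ => rfl
  · rw [T.shape_c, if_pos hc, Shape.ok_id]
    intro j
    split_ifs with h
    · rcases h with rfl | rfl
      · rfl
      · exact ho.2.1
    · exact ho.2.2 j (by tauto) (by tauto)

end Comp

section Refill

variable {V : Finset (Fin N)} (hV : ∀ t ∈ V, (L.slice t).IsCross)

include hV

omit T in
theorem isCross_insert {e : Fin N} (he : (L.slice e).IsCross) :
    ∀ t ∈ insert e V, (L.slice t).IsCross := by
  intro t ht
  rcases Finset.mem_insert.1 ht with rfl | ht
  exacts [he, hV t ht]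

omit hV in
theorem fill_unique (ha : a ∉ V) (hb : b ∈ V) (hc : c ∉ V) {j : ℕ} (hj : j = p ∨ j = p + 1)
    {x y : Coloring} (hx : L.Comp V x) (hy : L.Comp V y) (he : EqOff {(a : ℕ) + 1, (a : ℕ) + 2} x y)
    (hz : x (a + 1) j = y (a + 1) j) : x = y := by
  rw [← (T.outer_b hx ha hb hc).2, ← (T.outer_b hy ha hb hc).2, fill_congr he]
  have h1 := (T.turn_a hx ha).2.1
  have h2 := (T.turn_a hy ha).2.1
  rcases hj with rfl | rfl
  · rw [hz]
  · rw [h1, h2, hz]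

/-- If only the middle crossing is vertical, the cup of `a` and the cap of `c` form a small circle.
Making `a` vertical opens it towards the strands below. Either of the points `p`, `p + 1` may
represent the circle. -/
theorem refill_a (ha : a ∉ V) (hb : b ∈ V) (hc : c ∉ V) {j : ℕ} (hj : j = p ∨ j = p + 1) :
    Refill L L {(a : ℕ) + 1, (a : ℕ) + 2} {((a : ℕ) + 1, j)} (insert a V) V where
  cross := isCross_insert hV T.isCross_a
  cross' := hV
  wd := rfl
  ext k hk β := by
    have ho := (T.outer_ab hk (by simp) (by simp [hb]) (by simp [hc, T.ne_ac.symm])).1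
    refine ⟨fill a p β k, T.comp_fill_b hk (by simp +contextual) ho ha hb hc β, eqOff_fill _ _ _ _,
      ?_⟩
    rintro _ rfl
    simp only [fill_one, if_pos hj]
  res k hk := by
    have ho := (T.outer_b hk ha hb hc).1
    exact ⟨_, T.comp_fill_ab hk (by simp +contextual) ho (by simp) (by simp [hb])
      (by simp [hc, T.ne_ac.symm]), (eqOff_fill _ _ _ _).symm⟩
  uniq x y hx hy he := by
    rw [← (T.outer_ab hx (by simp) (by simp [hb]) (by simp [hc, T.ne_ac.symm])).2,
      ← (T.outer_ab hy (by simp) (by simp [hb]) (by simp [hc, T.ne_ac.symm])).2, fill_congr he,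
      he a (by simp)]
  uniq' x y hx hy he hz := T.fill_unique ha hb hc hj hx hy he (hz _ rfl)

theorem refill_c (ha : a ∉ V) (hb : b ∈ V) (hc : c ∉ V) {j : ℕ} (hj : j = p ∨ j = p + 1) :
    Refill L L {(a : ℕ) + 1, (a : ℕ) + 2} {((a : ℕ) + 1, j)} (insert c V) V where
  cross := isCross_insert hV T.isCross_c
  cross' := hV
  wd := rfl
  ext k hk β := by
    have ho := (T.outer_bc hk (by simp [ha, T.ne_ac]) (by simp [hb]) (by simp)).1
    refine ⟨fill a p β k, T.comp_fill_b hk (by simp +contextual) ho ha hb hc β, eqOff_fill _ _ _ _,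
      ?_⟩
    rintro _ rfl
    simp only [fill_one, if_pos hj]
  res k hk := by
    have ho := (T.outer_b hk ha hb hc).1
    exact ⟨_, T.comp_fill_bc hk (by simp +contextual) ho (by simp [ha, T.ne_ac]) (by simp [hb])
      (by simp), (eqOff_fill _ _ _ _).symm⟩
  uniq x y hx hy he := by
    rw [← (T.outer_bc hx (by simp [ha, T.ne_ac]) (by simp [hb]) (by simp)).2,
      ← (T.outer_bc hy (by simp [ha, T.ne_ac]) (by simp [hb]) (by simp)).2, fill_congr he,
      he (a + 3) (by simp)]
  uniq' x y hx hy he hz := T.fill_unique ha hb hc hj hx hy he (hz _ rfl)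

end Refill

/-! ### Merging with the small circle -/

omit T in
theorem mono_a_iff (T : Triple L a b c p q) (k : Coloring) :
    L.Mono k a ↔ k a p = k (a + 1) (p + 1) := by
  unfold Mono
  rw [T.at_a]
  rfl

omit T in
theorem mono_b_iff (T : Triple L a b c p q) (k : Coloring) :
    L.Mono k b ↔ k (a + 1) q = k (a + 2) (q + 1) := by
  unfold Mono
  rw [T.at_b, T.next_a]
  rfl

omit T in
theorem mono_c_iff (T : Triple L a b c p q) (k : Coloring) :
    L.Mono k c ↔ k (a + 2) p = k (a + 3) (p + 1) := by
  unfold Mono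
  rw [T.at_c, T.val_c]
  rfl

/-- The small circle may be given the colour opposite to that of the corner outside of it. So the
corners lie on different circles and the edge is a merge. -/
theorem kap_small_a {V : Finset (Fin N)} {d : Coloring} (hd : L.Comp V d) (ha : a ∉ V) (hb : b ∈ V)
    (hc : c ∉ V) (k : Coloring) : L.kap V a k = 1 := by
  have ho := (T.outer_b hd ha hb hc).1
  unfold kap
  rw [if_neg]
  rw [T.at_a]
  intro hs
  have h1 := hs _ (T.comp_fill_b hd (fun _ _ _ _ => Iff.rfl) ho ha hb hc (!d a p))
  simp only [Slice.pos] at h1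
  rw [fill_zero, fill_one, if_pos (.inr rfl)] at h1
  simp at h1

theorem kap_small_c {V : Finset (Fin N)} {d : Coloring} (hd : L.Comp V d) (ha : a ∉ V) (hb : b ∈ V)
    (hc : c ∉ V) (k : Coloring) : L.kap V c k = 1 := by
  have ho := (T.outer_b hd ha hb hc).1
  unfold kap
  rw [if_neg]
  rw [T.at_c, T.val_c]
  intro hs
  have h1 := hs _ (T.comp_fill_b hd (fun _ _ _ _ => Iff.rfl) ho ha hb hc (!d (a + 3) (p + 1)))
  simp only [Slice.pos] at h1
  rw [show (a : ℕ) + 2 + 1 = a + 3 from rfl, fill_three, fill_two, if_pos (.inl rfl)] at h1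
  simp at h1

end Triple

/-- The slices other than `a`, `b`, `c`. -/
def rest (a b c : Fin N) : Finset (Fin N) :=
  Finset.univ.filter fun t => t ≠ a ∧ t ≠ b ∧ t ≠ c

theorem mem_rest {a b c t : Fin N} : t ∈ rest a b c ↔ t ≠ a ∧ t ≠ b ∧ t ≠ c := by
  simp [rest]

/-- The value at the resolution `V`, for the colouring `k`, of the map which goes to the resolution
without `1` at `e` after changing the crossing `b`, and adds a small circle with label `v₊`.  Here
`m` is the level outside of the small circle next to the crossing `e`. -/
noncomputable def bet (L : Diagram N) (a b e : Fin N) (p m : ℕ) (V : Finset (Fin N)) (k : Coloring)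
    (f : L.CKh) : ℚ := open scoped Classical in
  if L.Mono (fill a p (k m p) k) b then
    L.kap ((insert e V).erase b) b (fill a p (k m p) k) *
      L.pair ((insert e V).erase b) (fill a p (k m p) k) f
  else 0

namespace Triple

variable {a b c : Fin N} {p q : ℕ} (T : Triple L a b c p q)

include T

theorem sum_eq (g : Fin N → ℚ) : ∑ t, g t = g a + g b + g c + ∑ t ∈ rest a b c, g t := by
  have h1 : (Finset.univ : Finset (Fin N)) = insert a (insert b (insert c (rest a b c))) := by
    ext t
    simp only [Finset.mem_univ, Finset.mem_insert, mem_rest, true_iff]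
    tauto
  rw [h1, Finset.sum_insert, Finset.sum_insert, Finset.sum_insert]
  · ring
  all_goals simp [mem_rest, T.ne_ab, T.ne_bc, T.ne_ac]

theorem mem_levels (n : Fin (N + 1)) : n ∈ ({a.succ, b.succ} : Set (Fin (N + 1))) ↔
    (n : ℕ) ∈ ({(a : ℕ) + 1, (a : ℕ) + 2} : Set ℕ) := by
  simp [Fin.ext_iff, T.next_a]

section Birth

variable {e f : Fin N} {m : ℕ} (hef : (e = a ∧ f = c ∧ m = a) ∨ (e = c ∧ f = a ∧ m = a + 3))

include hef

theorem ne_eb : e ≠ b := by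
  rcases hef with ⟨rfl, -⟩ | ⟨rfl, -⟩
  exacts [T.ne_ab, T.ne_bc.symm]

theorem ne_ef : e ≠ f := by
  rcases hef with ⟨rfl, rfl, -⟩ | ⟨rfl, rfl, -⟩
  exacts [T.ne_ac, T.ne_ac.symm]

theorem ne_of_rest {t : Fin N} (ht : t ∈ rest a b c) : t ≠ e ∧ t ≠ f ∧ t ≠ b := by
  rw [mem_rest] at ht
  rcases hef with ⟨rfl, rfl, -⟩ | ⟨rfl, rfl, -⟩ <;> tauto

variable {V : Finset (Fin N)} (he : e ∉ V) (hb : b ∈ V) (hf : f ∉ V)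

include he hb hf

theorem refill_e (hV : ∀ t ∈ V, (L.slice t).IsCross) :
    Refill L L {(a : ℕ) + 1, (a : ℕ) + 2} {((a : ℕ) + 1, p + 1)} (insert e V) V := by
  rcases hef with ⟨rfl, rfl, -⟩ | ⟨rfl, rfl, -⟩
  · exact T.refill_a hV he hb hf (.inr rfl)
  · exact T.refill_c hV hf hb he (.inr rfl)

theorem outer_e {k : Coloring} (hk : L.Comp V k) : Outer a p k := by
  rcases hef with ⟨rfl, rfl, -⟩ | ⟨rfl, rfl, -⟩
  exacts [(T.outer_b hk he hb hf).1, (T.outer_b hk hf hb he).1]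

theorem comp_e {k : Coloring} (hk : L.Comp V k) : L.Comp (insert e V) (fill a p (k m p) k) := by
  have ho := T.outer_e hef he hb hf hk
  have hne := T.ne_ef hef
  rcases hef with ⟨rfl, rfl, rfl⟩ | ⟨rfl, rfl, rfl⟩
  · exact T.comp_fill_ab hk (by simp +contextual) ho (by simp) (by simp [hb]) (by simp [hf, hne.symm])
  · exact T.comp_fill_bc hk (by simp +contextual) ho (by simp [hf, hne.symm]) (by simp [hb])
      (by simp)

/-- The case `e = a` of `hef` serves for `beta` on `L`, the case `e = c` for `beta'` on `L'`. In
both of them the crossing `e` is turned after the edge of `b`, which creates the small circle. -/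
theorem pair_birth {P : Finset (Fin N) → Finset (Fin N) → Prop} {E : L.State → Prop}
    (hP : ∀ v v', P v v' ↔ e ∈ v ∧ b ∈ v ∧ f ∉ v ∧ v' = v.erase e)
    (hE : ∀ s, E s ↔ s.label (L.tr a T.isCross_a) = true) {k : Coloring} (hk : L.Comp V k)
    (x : L.CKh) : L.pair V k (transfer L L {a.succ, b.succ} P E (L.saddle b T.isCross_b x)) =
      L.bet a b e p m V k x := by
  have hne := T.ne_ef hef
  have hk' := T.comp_e hef he hb hf hk
  rw [(T.refill_e hef he hb hf hk.cross).pair_transfer T.mem_levels ?_ ?_ hk' hk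
    (eqOff_fill _ _ _ _).symm, pair_saddle _ hk', bet]
  · congr 1
    simp [hb]
  · intro W
    rw [hP]
    constructor
    · rintro ⟨h1, h2, h3, rfl⟩
      rw [Finset.insert_erase h1]
    · intro hW
      rw [hW]
      simp [hb, he, hf, hne.symm]
  · intro s _
    have hpos : (L.slice a).pos = p := by rw [T.at_a]; rfl
    rw [hE]
    constructor
    · intro hs p' hp'
      rw [← hs]
      congr 1
      apply Point.ext'
      · simpa [tr] using congrArg Prod.fst hp'
      · simpa [tr, hpos] using congrArg Prod.snd hp'
    · intro hs
      apply hs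
      simp [tr, hpos]

/-- The edge of `t` is carried past the birth by the comparison of resolutions, and past the edge of
`b` by the square relation. -/
theorem term_bet {k : Coloring} (hk : L.Comp V k) {r : Fin N → ℕ}
    (hlt : ∀ t ∈ rest a b c, r a < r t ∧ r b < r t ∧ r c < r t) (x : L.CKh) {t : Fin N}
    (ht : t ∈ rest a b c) (htV : t ∈ V) (hm : L.Mono k t) :
    sgn r V t * L.kap (V.erase t) t k * L.bet a b e p m (V.erase t) k x =
      open scoped Classical in if L.Mono (fill a p (k m p) k) b then
        L.kap ((insert e V).erase b) b (fill a p (k m p) k) *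
          L.term r ((insert e V).erase b) (fill a p (k m p) k) x t else 0 := by
  obtain ⟨h1, h2, h3⟩ := mem_rest.1 ht
  obtain ⟨hte, htf, -⟩ := T.ne_of_rest hef ht
  obtain ⟨hl1, hl2⟩ := T.notMem_level h1 h2 h3
  have hbe := T.ne_eb hef
  set k' := fill a p (k m p) k with hk'
  unfold bet
  rw [← hk']
  by_cases hmb : L.Mono k' b
  swap
  · rw [if_neg hmb, if_neg hmb, mul_zero]
  rw [if_pos hmb, if_pos hmb]
  have hmt : L.Mono k' t := (Mono.congr (eqOff_fill _ _ _ _) rfl hl1 hl2).1 hm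
  have htU : t ∈ (insert e V).erase b := by simp [htV, h2]
  have hce := T.comp_e hef he hb hf hk
  rw [← hk'] at hce
  rw [term_eq htU hmt]
  have hV' := (hk.erase_iff htV).2 hm
  have R := T.refill_e hef (V := V.erase t) (by simp [he]) (by simp [hb, h2.symm]) (by simp [hf])
    hV'.cross
  have k1 := R.kap_eq_self hl1 hl2 (eqOff_fill a p (k m p) k).symm
  rw [← hk'] at k1
  have eU : (insert e (V.erase t)).erase b = ((insert e V).erase b).erase t := by
    rw [← Finset.erase_insert_of_ne hte.symm, Finset.erase_right_comm]
  have hbW : b ∈ insert e V := by simp [hb]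
  have hU := (hce.erase_iff hbW).2 hmb
  have hU' := (hU.erase_iff htU).2 hmt
  have sq := hU'.kap_square T.isCross_b (hk.cross t htV) h2.symm (by simp) (by simp) hmb hmt
  have e1 : insert b (((insert e V).erase b).erase t) = insert e (V.erase t) := by
    rw [← eU, Finset.insert_erase (by simp [hb, h2.symm])]
  have e2 : insert t (((insert e V).erase b).erase t) = (insert e V).erase b :=
    Finset.insert_erase htU
  rw [e1, e2] at sq
  -- Passing from `V` to the source removes `b` and adds `e`. Both precede `t`, so the two changes
  -- of sign cancel.
  have hsg : sgn r V t = sgn r ((insert e V).erase b) t := by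
    have hl := hlt t ht
    have hle : r e < r t := by
      rcases hef with ⟨rfl, -⟩ | ⟨rfl, -⟩ <;> tauto
    have s1 := sgn_eq_erase r hbW t
    have s2 := sgn_insert r he t
    rw [if_pos hl.2.1] at s1
    rw [if_pos hle] at s2
    linear_combination s2 - s1
  rw [← k1, eU, hsg]
  linear_combination (sgn r ((insert e V).erase b) t *
    L.pair (((insert e V).erase b).erase t) k' x) * sq

/-- The map is compatible with the changes of the other crossings. -/
theorem sum_bet {k : Coloring} (hk : L.Comp V k) {r : Fin N → ℕ}
    (hlt : ∀ t ∈ rest a b c, r a < r t ∧ r b < r t ∧ r c < r t) (x : L.CKh) :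
    (∑ t ∈ rest a b c, open scoped Classical in if t ∈ V ∧ L.Mono k t then
      sgn r V t * L.kap (V.erase t) t k * L.bet a b e p m (V.erase t) k x else 0) =
      open scoped Classical in if L.Mono (fill a p (k m p) k) b then
        L.kap ((insert e V).erase b) b (fill a p (k m p) k) *
          ∑ t ∈ rest a b c, L.term r ((insert e V).erase b) (fill a p (k m p) k) x t else 0 := by
  classical
  have key : ∀ t ∈ rest a b c, (if t ∈ V ∧ L.Mono k t then
      sgn r V t * L.kap (V.erase t) t k * L.bet a b e p m (V.erase t) k x else 0) =
      if L.Mono (fill a p (k m p) k) b then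
        L.kap ((insert e V).erase b) b (fill a p (k m p) k) *
          L.term r ((insert e V).erase b) (fill a p (k m p) k) x t else 0 := by
    intro t ht
    by_cases htV : t ∈ V ∧ L.Mono k t
    · rw [if_pos htV, T.term_bet hef he hb hf hk hlt x ht htV.1 htV.2]
    · rw [if_neg htV]
      obtain ⟨h1, h2, h3⟩ := mem_rest.1 ht
      obtain ⟨hl1, hl2⟩ := T.notMem_level h1 h2 h3
      have hte := (T.ne_of_rest hef ht).1
      have hmt := Mono.congr (L := L) (L' := L) (t := t) (eqOff_fill a p (k m p) k) rfl hl1 hl2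
      have h0 : L.term r ((insert e V).erase b) (fill a p (k m p) k) x t = 0 := by
        refine if_neg fun h => htV ⟨?_, hmt.2 h.2⟩
        simpa [h2, hte] using h.1
      rw [h0, mul_zero, ite_self]
  rw [Finset.sum_congr rfl key]
  split_ifs
  · rw [Finset.mul_sum]
  · exact Finset.sum_const_zero

/-- The value of the map at a boundary. -/
theorem bet_dLee {k : Coloring} (hk : L.Comp V k) (r : Fin N → ℕ) (x : L.CKh) :
    L.bet a b e p m V k (L.dLee r x) =
      open scoped Classical in if L.Mono (fill a p (k m p) k) b then
        L.kap ((insert e V).erase b) b (fill a p (k m p) k) *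
          (L.term r ((insert e V).erase b) (fill a p (k m p) k) x e +
            ∑ t ∈ rest a b c, L.term r ((insert e V).erase b) (fill a p (k m p) k) x t) else 0 := by
  unfold bet
  split_ifs with hm
  · have hU := ((T.comp_e hef he hb hf hk).erase_iff (by simp [hb])).2 hm
    have hne := T.ne_ef hef
    rw [pair_dLee r hU, T.sum_eq]
    rcases hef with ⟨rfl, rfl, -⟩ | ⟨rfl, rfl, -⟩
    · rw [term_of_not_mem (t := b) (by simp), term_of_not_mem (t := f) (by simp [hf, hne.symm])]
      ring
    · rw [term_of_not_mem (t := b) (by simp), term_of_not_mem (t := f) (by simp [hf, hne.symm])]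
      ring
  · rfl

end Birth

end Triple

theorem bet_sub {a b e : Fin N} {p m : ℕ} {V : Finset (Fin N)} {k : Coloring} (f g : L.CKh) :
    L.bet a b e p m V k (f - g) = L.bet a b e p m V k f - L.bet a b e p m V k g := by
  unfold bet
  split_ifs
  · rw [map_sub, mul_sub]
  · rw [sub_zero]

theorem bet_add {a b e : Fin N} {p m : ℕ} {V : Finset (Fin N)} {k : Coloring} (f g : L.CKh) :
    L.bet a b e p m V k (f + g) = L.bet a b e p m V k f + L.bet a b e p m V k g := by
  unfold bet
  split_ifs
  · rw [map_add, mul_add]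
  · rw [add_zero]

theorem Triple.bet_eq_zero {a b c e f : Fin N} {p q m : ℕ} (T : Triple L a b c p q)
    (hef : (e = a ∧ f = c ∧ m = a) ∨ (e = c ∧ f = a ∧ m = a + 3)) {V : Finset (Fin N)}
    (he : e ∉ V) (hb : b ∈ V) (hf : f ∉ V) {k : Coloring} (hk : L.Comp V k) {x : L.CKh}
    (h : ∀ k', L.Comp ((insert e V).erase b) k' → L.pair ((insert e V).erase b) k' x = 0) :
    L.bet a b e p m V k x = 0 := by
  unfold bet
  split_ifs with hm
  · rw [h _ (((T.comp_e hef he hb hf hk).erase_iff (by simp [hb])).2 hm), mul_zero]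
  · rfl

open scoped Classical in
theorem scale_mem_supported (S : Finset (Fin N) → Prop) (f : L.CKh) :
    scale (fun s : L.State => if S s.1.1 then 1 else 0) f ∈
      Finsupp.supported ℚ ℚ {s : L.State | S s.1.1} := by
  rw [scale, Finsupp.linearCombination_apply]
  refine Submodule.sum_mem _ fun s _ => Submodule.smul_mem _ _ ?_
  by_cases hs : S s.1.1
  · exact Finsupp.single_mem_supported _ _ hs
  · rw [if_neg hs, Finsupp.single_zero]
    exact Submodule.zero_mem _

open scoped Classical in
theorem pair_scale_ite (S : Finset (Fin N) → Prop) (V : Finset (Fin N)) (k : Coloring) (f : L.CKh) :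
    L.pair V k (scale (fun s : L.State => if S s.1.1 then 1 else 0) f) =
      if S V then L.pair V k f else 0 := by
  rw [pair_scale (q := if S V then 1 else 0) (fun s hs => by rw [hs])]
  split_ifs <;> ring

theorem pair_of_mem_supported (S : Finset (Fin N) → Prop) {f : L.CKh}
    (hf : f ∈ Finsupp.supported ℚ ℚ {s : L.State | S s.1.1}) {V : Finset (Fin N)} (hV : ¬ S V)
    (k : Coloring) : L.pair V k f = 0 := by
  rw [pair, Finsupp.linearCombination_apply]
  refine Finset.sum_eq_zero fun s hs => ?_
  have h1 : S s.1.1 := hf hs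
  have h2 : s.1.1 ≠ V := fun e => hV (e ▸ h1)
  simp [weight, h2]

namespace IsRIII

variable {a b c : Fin N} {i : ℕ} (h : IsRIII L L' a b c i)

include h

theorem triple : Triple L a b c i (i + 1) :=
  ⟨h.next_a, h.next_b, h.before_a, h.before_b, h.before_c⟩

theorem triple' : Triple L' a b c (i + 1) i :=
  ⟨h.next_a, h.next_b, h.after_a, h.after_b, h.after_c⟩

theorem pair_beta {V : Finset (Fin N)} (ha : a ∉ V) (hb : b ∈ V) (hc : c ∉ V) {k : Coloring}
    (hk : L.Comp V k) (f : L.CKh) : L.pair V k (h.beta f) = L.bet a b a i a V k f := by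
  rw [beta, LinearMap.comp_apply]
  exact h.triple.pair_birth (.inl ⟨rfl, rfl, rfl⟩) ha hb hc (fun _ _ => Iff.rfl) (fun _ => Iff.rfl) hk f

theorem pair_beta_eq_zero {V : Finset (Fin N)} (hV : ¬ (a ∉ V ∧ b ∈ V ∧ c ∉ V)) (k : Coloring)
    (f : L.CKh) : L.pair V k (h.beta f) = 0 := by
  rw [beta, LinearMap.comp_apply]
  refine pair_transfer_eq_zero ?_ _
  rintro W ⟨h1, h2, h3, rfl⟩
  have := h.triple.ne_ab
  simp_all

theorem pair_beta' {V : Finset (Fin N)} (ha : a ∉ V) (hb : b ∈ V) (hc : c ∉ V) {k : Coloring}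
    (hk : L'.Comp V k) (f : L'.CKh) :
    L'.pair V k (h.beta' f) = L'.bet a b c (i + 1) (a + 3) V k f := by
  rw [beta', LinearMap.comp_apply]
  exact h.triple'.pair_birth (.inr ⟨rfl, rfl, rfl⟩) hc hb ha (fun v v' => by tauto) (fun _ => Iff.rfl) hk f

theorem pair_beta'_eq_zero {V : Finset (Fin N)} (hV : ¬ (a ∉ V ∧ b ∈ V ∧ c ∉ V)) (k : Coloring)
    (f : L'.CKh) : L'.pair V k (h.beta' f) = 0 := by
  rw [beta', LinearMap.comp_apply]
  refine pair_transfer_eq_zero ?_ _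
  rintro W ⟨h1, h2, h3, rfl⟩
  have := h.triple.ne_bc
  simp_all

omit h in
/-- This vanishes on `X₁` at the vertices `010`. -/
noncomputable def defect (L : Diagram N) (a b : Fin N) (i : ℕ) (V : Finset (Fin N)) (k : Coloring)
    (f : L.CKh) : ℚ := L.pair V k f - L.bet a b a i a V k f

omit h in
theorem defect_sub {V : Finset (Fin N)} {k : Coloring} (f g : L.CKh) :
    defect L a b i V k (f - g) = defect L a b i V k f - defect L a b i V k g := by
  unfold defect
  rw [map_sub, bet_sub]
  ring

theorem defect_eq_zero {V : Finset (Fin N)} (ha : a ∉ V) (hb : b ∈ V) (hc : c ∉ V) {k : Coloring}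
    (hk : L.Comp V k) {x : L.CKh} (h0 : L.pair V k x = 0)
    (h1 : ∀ k', L.Comp ((insert a V).erase b) k' → L.pair ((insert a V).erase b) k' x = 0) :
    defect L a b i V k x = 0 := by
  rw [defect, h0, h.triple.bet_eq_zero (.inl ⟨rfl, rfl, rfl⟩) ha hb hc hk h1, sub_zero]

/-- Among the vertices without crossing number `3`, an element of `X₁` vanishes at `000` and `110`
and is determined at `010` by its part at `100`. Conversely, the parts of such an element at `100`
and at `*1` serve as `x` and `y`. -/
theorem mem_X₁_iff {f : L.CKh} : f ∈ h.X₁ ↔ ∀ V k, L.Comp V k → c ∉ V →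
    ((a ∈ V ↔ b ∈ V) → L.pair V k f = 0) ∧ (a ∉ V → b ∈ V → defect L a b i V k f = 0) := by
  classical
  have T := h.triple
  have hab := T.ne_ab
  have hbc := T.ne_bc
  have hac := T.ne_ac
  constructor
  · intro hf V k hk hc
    obtain ⟨x', hx', y, hy, rfl⟩ := Submodule.mem_sup.1 hf
    obtain ⟨x, hx, rfl⟩ := hx'
    have hy0 : ∀ U k', c ∉ U → L.pair U k' y = 0 := fun U k' hU =>
      pair_of_mem_supported (fun v => c ∈ v) hy hU k'
    have hx0 : ∀ U k', ¬ (a ∈ U ∧ b ∉ U ∧ c ∉ U) → L.pair U k' x = 0 :=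
      fun U k' hU => pair_of_mem_supported (fun v => a ∈ v ∧ b ∉ v ∧ c ∉ v) hx hU k'
    simp only [LinearMap.add_apply, LinearMap.id_coe, id_eq]
    constructor
    · intro hV
      rw [map_add, map_add, hy0 V k hc, hx0 V k (by tauto), h.pair_beta_eq_zero (by tauto)]
      ring
    · intro ha hb
      have h1 : L.bet a b a i a V k (h.beta x + y) = 0 := by
        refine T.bet_eq_zero (.inl ⟨rfl, rfl, rfl⟩) ha hb hc hk fun k' _ => ?_
        rw [map_add, hy0 _ _ (by simp [hc, hac.symm]), h.pair_beta_eq_zero (by simp), add_zero]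
      rw [defect, add_assoc, bet_add, h1, map_add, map_add, hy0 V k hc, hx0 V k (by tauto),
        h.pair_beta ha hb hc hk]
      ring
  · intro H
    have hx := scale_mem_supported (fun v => a ∈ v ∧ b ∉ v ∧ c ∉ v) f
    have hx' := pair_scale_ite (fun v => a ∈ v ∧ b ∉ v ∧ c ∉ v) (f := f)
    have hy := scale_mem_supported (fun v => c ∈ v) f
    have hy' := pair_scale_ite (fun v => c ∈ v) (f := f)
    refine Submodule.mem_sup.2 ⟨_, ⟨_, hx, rfl⟩, _, hy, pair_inj fun V k hk => ?_⟩
    rw [LinearMap.add_apply, LinearMap.id_coe, id_eq, map_add, map_add, hx', hy']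
    by_cases hc : c ∈ V
    · rw [if_neg (by tauto), if_pos hc, h.pair_beta_eq_zero (by tauto)]
      ring
    obtain ⟨H1, H2⟩ := H V k hk hc
    rw [if_neg hc, add_zero]
    by_cases hV : a ∈ V ↔ b ∈ V
    · rw [if_neg (by tauto), h.pair_beta_eq_zero (by tauto), H1 hV, add_zero]
    by_cases ha : a ∈ V
    · rw [if_pos (by tauto), h.pair_beta_eq_zero (by tauto), add_zero]
    · have hb : b ∈ V := by tauto
      have h3 := H2 ha hb
      rw [defect, sub_eq_zero] at h3
      rw [if_neg (by tauto), h.pair_beta ha hb hc hk, h3, zero_add]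
      unfold bet
      split_ifs with hm
      · rw [hx', if_pos]
        simp [hab, hc, hac.symm]
      · rfl

end IsRIII

/-- The two crossings precede all others of `V`. Exactly one of them precedes the other, and nothing
else comes before them. -/
theorem sgn_eq_neg {r : Fin N → ℕ} (hr : Function.Injective r) {V : Finset (Fin N)} {s t : Fin N}
    (hs : s ∈ V) (ht : t ∈ V) (hst : s ≠ t)
    (hlt : ∀ k ∈ V, k ≠ s → k ≠ t → r s < r k ∧ r t < r k) : sgn r V s = - sgn r V t := by
  have hno : ∀ k ∈ (V.erase s).erase t, r s < r k ∧ r t < r k := by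
    intro k hk
    simp only [Finset.mem_erase] at hk
    exact hlt k hk.2.2 hk.2.1 hk.1
  have hne := hr.ne hst
  have hs' : s ∈ V.erase t := Finset.mem_erase.2 ⟨hst, hs⟩
  have ht' : t ∈ V.erase s := Finset.mem_erase.2 ⟨hst.symm, ht⟩
  rw [← sgn_erase r V s, ← sgn_erase r V t, sgn_eq_erase r ht', sgn_eq_erase r hs',
    Finset.erase_right_comm (a := t), sgn_eq_one (t := s), sgn_eq_one (t := t)]
  · rcases lt_or_gt_of_ne hne with hl | hl
    · rw [if_neg (by omega), if_pos hl]; ring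
    · rw [if_pos hl, if_neg (by omega)]
  · exact fun k hk => by have := hno k hk; omega
  · exact fun k hk => by have := hno k hk; omega

namespace IsRIII

variable {a b c : Fin N} {i : ℕ} (h : IsRIII L L' a b c i)

include h

/-- The value of the defect at a boundary: the contributions of the crossings that are not involved
in the move, and those of `000`. -/
theorem defect_dLee {r : Fin N → ℕ}
    (hlt : ∀ t ∈ rest a b c, r a < r t ∧ r b < r t ∧ r c < r t) {V : Finset (Fin N)}
    (ha : a ∉ V) (hb : b ∈ V) (hc : c ∉ V) {k : Coloring} (hk : L.Comp V k) (f : L.CKh) :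
    defect L a b i V k (L.dLee r f) = (∑ t ∈ rest a b c, open scoped Classical in
      if t ∈ V ∧ L.Mono k t then
        sgn r V t * L.kap (V.erase t) t k * defect L a b i (V.erase t) k f else 0) +
      (L.term r V k f b - open scoped Classical in if L.Mono (fill a i (k a i) k) b then
        L.kap ((insert a V).erase b) b (fill a i (k a i) k) *
          L.term r ((insert a V).erase b) (fill a i (k a i) k) f a else 0) := by
  classical
  have T := h.triple
  have h1 := T.sum_bet (.inl ⟨rfl, rfl, rfl⟩) ha hb hc hk hlt f
  have h2 := T.bet_dLee (.inl ⟨rfl, rfl, rfl⟩) ha hb hc hk r f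
  have h3 : ∀ t ∈ rest a b c, (if t ∈ V ∧ L.Mono k t then
        sgn r V t * L.kap (V.erase t) t k * defect L a b i (V.erase t) k f else 0) =
      L.term r V k f t - if t ∈ V ∧ L.Mono k t then
        sgn r V t * L.kap (V.erase t) t k * L.bet a b a i a (V.erase t) k f else 0 := by
    intro t _
    unfold defect term
    split_ifs <;> ring
  rw [Finset.sum_congr rfl h3, Finset.sum_sub_distrib, h1, defect, pair_dLee r hk, T.sum_eq, h2,
    term_of_not_mem ha, term_of_not_mem hc]
  split_ifs <;> ring

/-- Two edges of the move end at `110`. The one of `a` merges the small circle with factor `1`, the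
one of `b` comes from `100`, and their signs are opposite; together they give the defect at `010`.
-/
theorem pair_dLee_110 {r : Fin N → ℕ} (hr : Function.Injective r)
    (hlt : ∀ t ∈ rest a b c, r a < r t ∧ r b < r t ∧ r c < r t) {V : Finset (Fin N)}
    (ha : a ∈ V) (hb : b ∈ V) (hc : c ∉ V) {k : Coloring} (hk : L.Comp V k) (f : L.CKh) :
    L.pair V k (L.dLee r f) =
      sgn r V a * defect L a b i (V.erase a) k f + ∑ t ∈ rest a b c, L.term r V k f t := by
  have T := h.triple
  obtain ⟨ho, hfill⟩ := T.outer_ab hk ha hb hc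
  have hma : L.Mono k a := by
    rw [T.mono_a_iff, T.id_a hk ha]
    exact ho.1
  have hca := (hk.erase_iff ha).2 hma
  have hba : b ∈ V.erase a := by simp [hb, T.ne_ab.symm]
  have hk1 : L.kap (V.erase a) a k = 1 := T.kap_small_a hca (by simp) hba (by simp [hc]) k
  have hsg : sgn r V a = - sgn r V b := by
    refine sgn_eq_neg hr ha hb T.ne_ab fun t ht h1 h2 => ?_
    have := hlt t (mem_rest.2 ⟨h1, h2, fun e => hc (e ▸ ht)⟩)
    exact ⟨this.1, this.2.1⟩
  rw [pair_dLee r hk, T.sum_eq, term_of_not_mem hc, term_eq ha hma, hk1, defect, bet, hfill,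
    Finset.insert_erase ha, add_left_inj]
  by_cases hmb : L.Mono k b
  · rw [term_eq hb hmb, if_pos hmb, hsg]
    ring
  · rw [term_of_not_mono hmb, if_neg hmb]
    ring

/-- At `110` the edges from `100` and `010` cancel because the defect is zero. At `010` the defect
is compatible with the other crossings, and the remaining contributions come from `000`, where the
element vanishes. -/
theorem dLee_mem_X₁ {r : Fin N → ℕ} (hr : Function.Injective r)
    (hlt : ∀ t ∈ rest a b c, r a < r t ∧ r b < r t ∧ r c < r t) {x : L.CKh} (hx : x ∈ h.X₁) :
    L.dLee r x ∈ h.X₁ := by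
  have T := h.triple
  have hab := T.ne_ab
  have hac := T.ne_ac
  rw [h.mem_X₁_iff] at hx ⊢
  intro V k hk hc
  have hrest : (a ∈ V ↔ b ∈ V) → ∑ t ∈ rest a b c, L.term r V k x t = 0 := by
    intro hV
    refine Finset.sum_eq_zero fun t ht => term_eq_zero fun htV hm => ?_
    obtain ⟨h1, h2, h3⟩ := mem_rest.1 ht
    exact (hx (V.erase t) k ((hk.erase_iff htV).2 hm) (by simp [hc])).1
      (by simp [hV, h1.symm, h2.symm])
  refine ⟨fun hV => ?_, fun ha hb => ?_⟩
  · by_cases ha : a ∈ V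
    · have hb := hV.1 ha
      have ho := (T.outer_ab hk ha hb hc).1
      have hma : L.Mono k a := by
        rw [T.mono_a_iff, T.id_a hk ha]
        exact ho.1
      have hca := (hk.erase_iff ha).2 hma
      rw [h.pair_dLee_110 hr hlt ha hb hc hk, hrest hV,
        (hx _ _ hca (by simp [hc])).2 (by simp) (by simp [hb, hab.symm])]
      ring
    · rw [pair_dLee r hk, T.sum_eq, hrest hV, term_of_not_mem ha,
        term_of_not_mem fun hb => ha (hV.2 hb), term_of_not_mem hc]
      ring
  · rw [h.defect_dLee hlt ha hb hc hk, Finset.sum_eq_zero, term_eq_zero]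
    · split_ifs with hm
      · have hU := ((T.comp_e (.inl ⟨rfl, rfl, rfl⟩) ha hb hc hk).erase_iff (by simp [hb])).2 hm
        rw [term_eq_zero]
        · ring
        · intro haU hma
          refine (hx _ _ ((hU.erase_iff haU).2 hma) (by simp [hc, hac.symm])).1 (by simp)
      · ring
    · intro hbV hmb
      exact (hx _ _ ((hk.erase_iff hbV).2 hmb) (by simp [hc])).1 (by simp [ha])
    · intro t ht
      obtain ⟨h1, h2, h3⟩ := mem_rest.1 ht
      split_ifs with hm
      · rw [(hx _ _ ((hk.erase_iff hm.1).2 hm.2) (by simp [hc])).2 (by simp [ha])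
          (by simp [hb, h2.symm]), mul_zero]
      · rfl

end IsRIII

/-- The three strands outside of a small circle. -/
theorem Triple.fill_mid {a b c : Fin N} {p : ℕ} (T : Triple L a b c p (p + 1))
    {V : Finset (Fin N)} {k : Coloring} (hk : L.Comp V k) (ha : a ∉ V) (hb : b ∉ V) (hc : c ∉ V) :
    Outer a p k ∧ fill a p (k a (p + 2)) k = k := by
  obtain ⟨a1, a2, a3⟩ := T.turn_a hk ha
  obtain ⟨b1, b2, b3⟩ := T.turn_b hk hb
  obtain ⟨c1, c2, c3⟩ := T.turn_c hk hc
  have e1 := a3 (p + 2) (by omega) (by omega)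
  have e2 := b3 p (by omega) (by omega)
  have e3 := c3 (p + 2) (by omega) (by omega)
  rw [show p + 1 + 1 = p + 2 from rfl] at b1 b2
  have h1 : k (a + 2) = k (a + 1) := by
    funext j
    by_cases h1 : j = p + 1
    · rw [h1, ← c1, ← e2, a2]
    by_cases h2 : j = p + 2
    · rw [h2, ← b2, ← c1, ← e2, a2, b1]
    · exact (b3 j h1 h2).symm
  refine ⟨⟨a1, c2, fun j hj hj' => ?_⟩, fill_self ?_ ?_ a3 h1⟩
  · rw [a3 j hj hj', ← c3 j hj hj', h1]
  · rw [a2, b1, e1]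
  · rw [b1, e1]

namespace IsRIII

variable {a b c : Fin N} {i : ℕ} (h : IsRIII L L' a b c i)

/-- The factor at the vertices `000` in the formula for the defect of a boundary. -/
noncomputable def defectCoeff (L : Diagram N) (a b : Fin N) (i : ℕ) (r : Fin N → ℕ)
    (V : Finset (Fin N)) (k : Coloring) : ℚ :=
  if k (a + 1) i = k a (i + 2) then sgn r V b * L.kap (V.erase b) b k
  else - (L.kap ((insert a V).erase b) b (fill a i (k a i) k) *
    (sgn r ((insert a V).erase b) a * L.kap (V.erase b) a (fill a i (k a i) k)))

theorem defectCoeff_ne_zero (L : Diagram N) (a b : Fin N) (i : ℕ) (r : Fin N → ℕ)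
    (V : Finset (Fin N)) (k : Coloring) : defectCoeff L a b i r V k ≠ 0 := by
  unfold defectCoeff
  split_ifs
  · exact mul_ne_zero (sgn_ne_zero _ _ _) (kap_ne_zero _ _ _ _)
  · exact neg_ne_zero.2 (mul_ne_zero (kap_ne_zero _ _ _ _)
      (mul_ne_zero (sgn_ne_zero _ _ _) (kap_ne_zero _ _ _ _)))

include h

/-- If the small circle and the strands at `i` have different colours, the third strand has the
colour of exactly one of them. So just one of the two paths from `000` contributes, the direct edge
or the path over `100`, and in both cases it starts at the colouring in which the middle has the
colour of the third strand. -/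
theorem term_sub_eq {r : Fin N → ℕ} {V : Finset (Fin N)}
    (ha : a ∉ V) (hb : b ∈ V) (hc : c ∉ V) {k : Coloring} (hk : L.Comp V k)
    (hs : k (a + 1) i ≠ k a i) (f : L.CKh) :
    (L.term r V k f b - open scoped Classical in if L.Mono (fill a i (k a i) k) b then
        L.kap ((insert a V).erase b) b (fill a i (k a i) k) *
          L.term r ((insert a V).erase b) (fill a i (k a i) k) f a else 0) =
      defectCoeff L a b i r V k * L.pair (V.erase b) (fill a i (k a (i + 2)) k) f ∧
      L.Comp (V.erase b) (fill a i (k a (i + 2)) k) := by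
  classical
  have T := h.triple
  have hab := T.ne_ab
  obtain ⟨ho, hfill⟩ := T.outer_b hk ha hb hc
  set k' := fill a i (k a i) k with hk'
  have hmk : ∀ s, L.Mono (fill a i s k) b ↔ s = k a (i + 2) := by
    intro s
    rw [T.mono_b_iff, Triple.fill_one, Triple.fill_two, if_pos (.inr rfl), if_neg (by omega)]
  have hcomp : L.Comp (V.erase b) (fill a i (k a (i + 2)) k) :=
    ((T.comp_fill_b hk (fun _ _ _ _ => Iff.rfl) ho ha hb hc _).erase_iff hb).2 ((hmk _).2 rfl)
  refine ⟨?_, hcomp⟩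
  have hmb := hmk (k (a + 1) i)
  rw [hfill] at hmb
  have hmb' := hmk (k a i)
  rw [← hk'] at hmb'
  unfold defectCoeff
  by_cases hA : k (a + 1) i = k a (i + 2)
  · rw [if_neg fun h => hs (hA.trans (hmb'.1 h).symm), if_pos hA, term_eq hb (hmb.2 hA), ← hA,
      hfill, sub_zero]
  · have hA' : k a i = k a (i + 2) := by
      revert hA hs
      cases k (a + 1) i <;> cases k a i <;> cases k a (i + 2) <;> simp
    have hma : L.Mono k' a := by
      rw [T.mono_a_iff, hk', Triple.fill_zero, Triple.fill_one, if_pos (.inr rfl)]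
    have e : ((insert a V).erase b).erase a = V.erase b := by
      rw [Finset.erase_right_comm, Finset.erase_insert ha]
    rw [term_of_not_mono fun h => hA (hmb.1 h), if_pos (hmb'.2 hA'), if_neg hA,
      term_eq (by simp [hab]) hma, e, ← hA', ← hk']
    ring

/-- Every element with boundary in `X₁` can be changed by a boundary such that it lies in `X₁`. -/
theorem exists_sub_mem_X₁ {r : Fin N → ℕ} (hr : Function.Injective r)
    (hlt : ∀ t ∈ rest a b c, r a < r t ∧ r b < r t ∧ r c < r t) {w : L.CKh}
    (hw : L.dLee r w ∈ h.X₁) : ∃ u, w - L.dLee r u ∈ h.X₁ := by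
  classical
  have T := h.triple
  have hab := T.ne_ab
  have hac := T.ne_ac
  have hbc := T.ne_bc
  -- The merge `010 → 110` with the small circle is onto. Here `u₁` is a preimage of the part of `w`
  -- at `110` that is independent of the colour of the small circle.
  obtain ⟨u₁, hu₁⟩ := L.exists_pair_eq fun W k => if a ∉ W ∧ b ∈ W ∧ c ∉ W then
    sgn r (insert a W) a * L.pair (insert a W) (fill a i (k a i) k) w else 0
  have h1 : ∀ V k, L.Comp V k → a ∈ V → b ∈ V → c ∉ V →
      L.pair V k (w - L.dLee r u₁) = 0 := by
    intro V k hk ha hb hc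
    obtain ⟨ho, hfill⟩ := T.outer_ab hk ha hb hc
    have hma : L.Mono k a := by
      rw [T.mono_a_iff, T.id_a hk ha]
      exact ho.1
    have hca := (hk.erase_iff ha).2 hma
    have hba : b ∈ V.erase a := by simp [hb, hab.symm]
    have e1 : L.pair (V.erase a) k u₁ = sgn r V a * L.pair V k w := by
      rw [hu₁ _ _ hca, if_pos ⟨by simp, hba, by simp [hc]⟩, Finset.insert_erase ha, hfill]
    have e2 : defect L a b i (V.erase a) k u₁ = sgn r V a * L.pair V k w := by
      rw [defect, e1, T.bet_eq_zero (.inl ⟨rfl, rfl, rfl⟩) (by simp) hba (by simp [hc]) hca, sub_zero]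
      intro k' hk'
      rw [hu₁ _ _ hk', if_neg (by simp)]
    rw [map_sub, h.pair_dLee_110 hr hlt ha hb hc hk, e2, Finset.sum_eq_zero, ← mul_assoc,
      sgn_mul_self]
    · ring
    · intro t ht
      obtain ⟨h1, h2, h3⟩ := mem_rest.1 ht
      refine term_eq_zero fun htV hm => ?_
      rw [hu₁ _ _ ((hk.erase_iff htV).2 hm), if_neg (by simp [ha, h1.symm])]
  set w₁ := w - L.dLee r u₁ with hw₁
  -- The edges from `000` are used to remove the defect at `010` for those colourings in which the
  -- small circle and the strands at `i` have different colours; there `defectCoeff` can be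
  -- inverted. The parts at `110` are not changed, since no edge leads from `000` to `110`.
  obtain ⟨u₂, hu₂⟩ := L.exists_pair_eq fun W d => if a ∉ W ∧ b ∉ W ∧ c ∉ W then
    defect L a b i (insert b W) (fill a i (!d a i) d) w₁ /
      defectCoeff L a b i r (insert b W) (fill a i (!d a i) d) else 0
  refine ⟨u₁ + u₂, ?_⟩
  have hdw : L.dLee r (w₁ - L.dLee r u₂) = L.dLee r w := by
    rw [hw₁, map_sub, map_sub, dLee_dLee hr, dLee_dLee hr, sub_zero, sub_zero]
  have h110 : ∀ V k, L.Comp V k → a ∈ V → b ∈ V → c ∉ V →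
      L.pair V k (w₁ - L.dLee r u₂) = 0 := by
    intro V k hk ha hb hc
    rw [map_sub, h1 V k hk ha hb hc, pair_dLee r hk, Finset.sum_eq_zero, sub_zero]
    intro t _
    refine term_eq_zero fun htV hm => ?_
    rw [hu₂ _ _ ((hk.erase_iff htV).2 hm), if_neg]
    rintro ⟨h1, h2, -⟩
    simp only [Finset.mem_erase, ha, hb, and_true, not_not] at h1 h2
    exact hab (h1.trans h2.symm)
  have h010 : ∀ V k, L.Comp V k → a ∉ V → b ∈ V → c ∉ V → k (a + 1) i ≠ k a i →
      defect L a b i V k (w₁ - L.dLee r u₂) = 0 := by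
    intro V k hk ha hb hc hs
    obtain ⟨hK, hcomp⟩ := h.term_sub_eq (r := r) ha hb hc hk hs u₂
    have hfill := (T.outer_b hk ha hb hc).2
    have hns : (!k a i) = k (a + 1) i := by
      revert hs
      cases k (a + 1) i <;> cases k a i <;> simp
    rw [defect_sub, h.defect_dLee hlt ha hb hc hk, hK, hu₂ _ _ hcomp,
      if_pos ⟨by simp [ha], by simp, by simp [hc]⟩, Finset.insert_erase hb, Triple.fill_zero, Triple.fill_fill,
      hns, hfill, mul_div_cancel₀ _ (defectCoeff_ne_zero _ _ _ _ _ _ _), Finset.sum_eq_zero]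
    · ring
    · intro t ht
      obtain ⟨h1, h2, h3⟩ := mem_rest.1 ht
      split_ifs with hm
      · have hk' := (hk.erase_iff hm.1).2 hm.2
        rw [h.defect_eq_zero (by simp [ha]) (by simp [hb, h2.symm]) (by simp [hc]) hk', mul_zero]
        · rw [hu₂ _ _ hk', if_neg (by simp [hb, h2.symm])]
        · intro k' hk'
          rw [hu₂ _ _ hk', if_neg (by simp [hab])]
      · rfl
  have h010' : ∀ V k, L.Comp V k → a ∉ V → b ∈ V → c ∉ V →
      defect L a b i V k (w₁ - L.dLee r u₂) = 0 := by
    intro V k hk ha hb hc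
    by_cases hs : k (a + 1) i = k a i
    swap
    · exact h010 V k hk ha hb hc hs
    -- If the colours are equal, no further correction is needed: the boundary vanishes at `110`,
    -- and there it is the defect up to sign, as all parts at `110` have been removed.
    have hce := T.comp_e (.inl ⟨rfl, rfl, rfl⟩) ha hb hc hk
    have hfill := (T.outer_b hk ha hb hc).2
    rw [← hs, hfill] at hce
    have h2 := ((h.mem_X₁_iff).1 hw _ _ hce (by simp [hc, hac.symm])).1 (by simp [hb])
    rw [← hdw, h.pair_dLee_110 hr hlt (by simp) (by simp [hb]) (by simp [hc, hac.symm]) hce,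
      Finset.erase_insert ha, Finset.sum_eq_zero, add_zero] at h2
    · exact (mul_eq_zero.1 h2).resolve_left (sgn_ne_zero _ _ _)
    · intro t ht
      obtain ⟨h1, h2, h3⟩ := mem_rest.1 ht
      refine term_eq_zero fun htV hm => ?_
      exact h110 _ _ ((hce.erase_iff htV).2 hm) (by simp [h1.symm]) (by simp [hb, h2.symm])
        (by simp [hc, hac.symm])
  rw [map_add, ← sub_sub, ← hw₁, h.mem_X₁_iff]
  intro V k hk hc
  refine ⟨fun hV => ?_, fun ha hb => h010' V k hk ha hb hc⟩
  by_cases ha : a ∈ V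
  · exact h110 V k hk ha (hV.1 ha) hc
  have hb : b ∉ V := fun hb => ha (hV.2 hb)
  -- At `000` the boundary is tested at `010`, with a small circle of the opposite colour. Its
  -- defect vanishes, and it is an invertible multiple of the coordinate at `000`.
  obtain ⟨ho, hfill⟩ := T.fill_mid hk ha hb hc
  have hV' : ∀ t, t ≠ a → t ≠ b → t ≠ c → (t ∈ V ↔ t ∈ insert b V) := by
    intro t _ h2 _
    simp [h2]
  have ha' : a ∉ insert b V := by simp [ha, hab]
  have hc' : c ∉ insert b V := by simp [hc, hbc.symm]
  have hd := T.comp_fill_b hk hV' ho ha' (by simp) hc' (!k a i)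
  have hs : fill a i (!k a i) k (a + 1) i ≠ fill a i (!k a i) k a i := by
    rw [Triple.fill_one, if_pos (.inl rfl), Triple.fill_zero]
    cases k a i <;> simp
  have h2 := ((h.mem_X₁_iff).1 hw _ _ hd hc').2 ha' (by simp)
  rw [← hdw, h.defect_dLee hlt ha' (by simp) hc' hd, (h.term_sub_eq ha' (by simp) hc' hd hs _).1,
    Finset.sum_eq_zero, zero_add, Triple.fill_fill, Triple.fill_zero, hfill, Finset.erase_insert hb] at h2
  · exact (mul_eq_zero.1 h2).resolve_left (defectCoeff_ne_zero _ _ _ _ _ _ _)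
  · intro t ht
    obtain ⟨h1, h2, h3⟩ := mem_rest.1 ht
    split_ifs with hm
    · rw [h010' _ _ ((hd.erase_iff hm.1).2 hm.2) (by simp [ha, hab]) (by simp [h2.symm])
        (by simp [hc, hbc.symm]), mul_zero]
    · rfl

theorem isChainMap_subtype {r : Fin N → ℕ} (hX : ∀ x ∈ h.X₁, L.dLee r x ∈ h.X₁) :
    IsChainMap ((L.dLee r).restrict hX) (L.dLee r) h.X₁.subtype := fun _ => rfl

/-- The inclusion of `X₁` induces a bijection on homology. -/
theorem bijective {r : Fin N → ℕ} (hr : Function.Injective r)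
    (hlt : ∀ t ∈ rest a b c, r a < r t ∧ r b < r t ∧ r c < r t)
    (hX : ∀ x ∈ h.X₁, L.dLee r x ∈ h.X₁)
    (hι : IsChainMap ((L.dLee r).restrict hX) (L.dLee r) h.X₁.subtype) :
    Function.Bijective hι.map := by
  constructor
  · rw [← LinearMap.ker_eq_bot, LinearMap.ker_eq_bot']
    intro q hq
    obtain ⟨⟨x, hx⟩, rfl⟩ := Submodule.Quotient.mk_surjective _ q
    rw [LinearMap.mem_ker] at hx
    change hι.map (cls _ x hx) = 0 at hq
    change cls _ x hx = 0
    rw [hι.map_cls, cls_eq_zero_iff] at hq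
    obtain ⟨y, hy⟩ := hq
    -- If `x` in `X₁` is the boundary of `y`, then `y` can be replaced by an element of `X₁` with
    -- the same boundary. Surjectivity follows in the same way, from cycles in place of `y`.
    obtain ⟨u, hu⟩ := h.exists_sub_mem_X₁ hr hlt (w := y) (by rw [hy]; exact x.2)
    rw [cls, Submodule.Quotient.mk_eq_zero]
    refine ⟨⟨_, hu⟩, Subtype.ext ?_⟩
    change L.dLee r (y - L.dLee r u) = x
    rw [map_sub, dLee_dLee hr, sub_zero, hy]
    rfl
  · intro q
    obtain ⟨⟨z, hz⟩, rfl⟩ := Submodule.Quotient.mk_surjective _ q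
    rw [LinearMap.mem_ker] at hz
    obtain ⟨u, hu⟩ := h.exists_sub_mem_X₁ hr hlt (w := z) (by rw [hz]; exact Submodule.zero_mem _)
    have hd : L.dLee r (z - L.dLee r u) = 0 := by rw [map_sub, hz, dLee_dLee hr, sub_zero]
    refine ⟨cls _ ⟨_, hu⟩ (Subtype.ext hd), ?_⟩
    rw [hι.map_cls, cls]
    rw [Submodule.Quotient.eq]
    refine ⟨-u, ?_⟩
    change L.dLee r (-u) = (z - L.dLee r u) - z
    rw [map_neg]
    abel

end IsRIII

end Diagram

end LeeKh

/-! ### The third Reidemeister move: sliding resolutions from one side to the other -/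

namespace LeeKh

/-- The colours between the crossings move up by one level. -/
def slideUp (a : ℕ) (k : Coloring) : Coloring := setTwo k a (k a) (k (a + 1))

/-- The colours between the crossings move down by one level. -/
def slideDown (a : ℕ) (k : Coloring) : Coloring := setTwo k a (k (a + 2)) (k (a + 3))

theorem slideUp_one (a : ℕ) (k : Coloring) : slideUp a k (a + 1) = k a := setTwo_one _ _ _ _
theorem slideUp_two (a : ℕ) (k : Coloring) : slideUp a k (a + 2) = k (a + 1) := setTwo_two _ _ _ _
theorem slideUp_three (a : ℕ) (k : Coloring) : slideUp a k (a + 3) = k (a + 3) :=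
  setTwo_three _ _ _ _
theorem slideDown_zero (a : ℕ) (k : Coloring) : slideDown a k a = k a := setTwo_zero _ _ _ _
theorem slideDown_one (a : ℕ) (k : Coloring) : slideDown a k (a + 1) = k (a + 2) :=
  setTwo_one _ _ _ _
theorem slideDown_two (a : ℕ) (k : Coloring) : slideDown a k (a + 2) = k (a + 3) :=
  setTwo_two _ _ _ _
namespace Diagram

variable {N : ℕ} {L L' : Diagram N}

theorem eqOff_slideUp (a : ℕ) (k : Coloring) : EqOff {a + 1, a + 2} k (slideUp a k) :=
  Triple.eqOff_setTwo _ _ _ _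

theorem eqOff_slideDown (a : ℕ) (k : Coloring) : EqOff {a + 1, a + 2} k (slideDown a k) :=
  Triple.eqOff_setTwo _ _ _ _

theorem slideUp_slideDown {a : ℕ} {k : Coloring} (h : k (a + 1) = k a) :
    slideUp a (slideDown a k) = k := by
  refine Triple.setTwo_eq (eqOff_slideDown a k).symm ?_ ?_
  · rw [slideDown_zero, h]
  · rw [slideDown_one]

theorem Refill.symm {J : Set ℕ} {V V' : Finset (Fin N)} (R : Refill L L' J ∅ V V') :
    Refill L' L J ∅ V' V where
  cross := R.cross'
  cross' := R.cross
  wd := R.wd.symm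
  ext k hk _ := by
    obtain ⟨d, hd, he⟩ := R.res k hk
    exact ⟨d, hd, he.symm, by simp⟩
  res k hk := by
    obtain ⟨d, hd, he, -⟩ := R.ext k hk true
    exact ⟨d, hd, he.symm⟩
  uniq x y hx hy he := R.uniq' x y hx hy he (by simp)
  uniq' x y hx hy he _ := R.uniq x y hx hy he

/-- The crossings `a`, `b` of one diagram are resolved as the crossings `b`, `c` of the other one,
and the crossing `c`, respectively `a`, is resolved vertically. -/
structure Slide (a b c : Fin N) (V V' : Finset (Fin N)) : Prop where
  mem_c : c ∈ V
  mem_a : a ∈ V'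
  iff_b : b ∈ V' ↔ a ∈ V
  iff_c : c ∈ V' ↔ b ∈ V
  off : ∀ t, t ≠ a → t ≠ b → t ≠ c → (t ∈ V' ↔ t ∈ V)

namespace Triple

variable {a b c : Fin N} {p q : ℕ} (T : Triple L a b c p q)

include T

/-- If one of the outer crossings is vertical, no circle is enclosed between the crossings, and the
colours at the middle levels are determined by the outer ones. -/
theorem unique_of_mem (hpq : q = p + 1 ∨ p = q + 1) {V : Finset (Fin N)} (hV : a ∈ V ∨ c ∈ V)
    {x y : Coloring} (hx : L.Comp V x) (hy : L.Comp V y)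
    (he : EqOff {(a : ℕ) + 1, (a : ℕ) + 2} x y) : x = y := by
  have e0 := he a (by simp)
  have e3 := he (a + 3) (by simp)
  suffices h : x (a + 1) = y (a + 1) ∧ x (a + 2) = y (a + 2) by
    funext n
    by_cases h1 : n = a + 1
    · rw [h1, h.1]
    by_cases h2 : n = a + 2
    · rw [h2, h.2]
    exact he n (by simp [h1, h2])
  by_cases hb : b ∈ V
  · rw [T.id_b hx hb, T.id_b hy hb, and_self]
    rcases hV with h | h
    · rw [T.id_a hx h, T.id_a hy h, e0]
    · rw [← T.id_b hx hb, ← T.id_b hy hb, ← T.id_c hx h, ← T.id_c hy h, e3]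
  obtain ⟨b1, b2, b3⟩ := T.turn_b hx hb
  obtain ⟨b1', b2', b3'⟩ := T.turn_b hy hb
  by_cases ha : a ∈ V
  · have h1 : x (a + 1) = y (a + 1) := by rw [T.id_a hx ha, T.id_a hy ha, e0]
    refine ⟨h1, ?_⟩
    by_cases hc : c ∈ V
    · rw [← T.id_c hx hc, ← T.id_c hy hc, e3]
    obtain ⟨c1, c2, c3⟩ := T.turn_c hx hc
    obtain ⟨c1', c2', c3'⟩ := T.turn_c hy hc
    -- The level is known off `p`, `p + 1` from one side and off `q`, `q + 1` from the other. The
    -- one position left over has the colour of its neighbour.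
    have key : ∀ j, j ≠ p → j ≠ p + 1 → x (a + 2) j = y (a + 2) j := fun j h2 h3 => by
      rw [c3 j h2 h3, c3' j h2 h3, e3]
    have key' : ∀ j, j ≠ q → j ≠ q + 1 → x (a + 2) j = y (a + 2) j := fun j h2 h3 => by
      rw [← b3 j h2 h3, ← b3' j h2 h3, h1]
    funext j
    by_cases h2 : j = p
    · subst h2
      rcases hpq with rfl | rfl
      · exact key' _ (by omega) (by omega)
      · rw [c1, c1']
        exact key' _ (by omega) (by omega)
    by_cases h3 : j = p + 1
    · subst h3
      rcases hpq with rfl | rfl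
      · rw [← c1, ← c1']
        exact key' _ (by omega) (by omega)
      · exact key' _ (by omega) (by omega)
    exact key j h2 h3
  · have hc := hV.resolve_left ha
    have h1 : x (a + 2) = y (a + 2) := by rw [← T.id_c hx hc, ← T.id_c hy hc, e3]
    refine ⟨?_, h1⟩
    obtain ⟨c1, c2, c3⟩ := T.turn_a hx ha
    obtain ⟨c1', c2', c3'⟩ := T.turn_a hy ha
    have key : ∀ j, j ≠ p → j ≠ p + 1 → x (a + 1) j = y (a + 1) j := fun j h2 h3 => by
      rw [← c3 j h2 h3, ← c3' j h2 h3, e0]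
    have key' : ∀ j, j ≠ q → j ≠ q + 1 → x (a + 1) j = y (a + 1) j := fun j h2 h3 => by
      rw [b3 j h2 h3, b3' j h2 h3, h1]
    funext j
    by_cases h2 : j = p
    · subst h2
      rcases hpq with rfl | rfl
      · exact key' _ (by omega) (by omega)
      · rw [c2, c2']
        exact key' _ (by omega) (by omega)
    by_cases h3 : j = p + 1
    · subst h3
      rcases hpq with rfl | rfl
      · rw [← c2, ← c2']
        exact key' _ (by omega) (by omega)
      · exact key' _ (by omega) (by omega)
    exact key j h2 h3

section Slide

variable (T' : Triple L' a b c q p) (hw : L.wd = L'.wd)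
  (hoff : ∀ t, t ≠ a → t ≠ b → t ≠ c → L'.slice t = L.slice t)

include T' hw hoff

variable {V V' : Finset (Fin N)}

theorem comp_slideUp (S : Slide a b c V V') {k : Coloring} (hk : L.Comp V k) :
    L'.Comp V' (slideUp a k) := by
  refine T.comp_setTwo T' hw hoff (fun t h1 h2 h3 => (S.off t h1 h2 h3).symm) hk
    (supp_level hk rfl) (supp_level hk T.wd_one) ?_ ?_ ?_
  · rw [T'.shape_a, if_pos S.mem_a, Shape.ok_id]
    exact fun _ => rfl
  · have := hk.ok a
    rw [T.shape_a] at this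
    rw [T'.shape_b]
    simpa only [S.iff_b] using this
  · have := hk.ok b
    rw [T.shape_b, T.next_a] at this
    rw [T'.shape_c, T.id_c hk S.mem_c]
    simpa only [S.iff_c] using this

theorem comp_slideDown (S : Slide a b c V' V) {k : Coloring} (hk : L.Comp V k) :
    L'.Comp V' (slideDown a k) := by
  refine T.comp_setTwo T' hw hoff S.off hk
    (supp_level hk T.wd_two) (supp_level hk T.wd_three) ?_ ?_ ?_
  · have := hk.ok b
    rw [T.shape_b, T.next_a] at this
    rw [T'.shape_a, ← T.id_a hk S.mem_a]
    simpa only [S.iff_b] using this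
  · have := hk.ok c
    rw [T.shape_c, T.val_c] at this
    rw [T'.shape_b]
    simpa only [S.iff_c] using this
  · rw [T'.shape_c, if_pos S.mem_c, Shape.ok_id]
    exact fun _ => rfl

/-- When crossing number `3` is vertical, the remaining two slices are the same in both diagrams,
only one level higher in `L'`. Neither resolution has a small circle of its own. -/
theorem refill_slide (hpq : q = p + 1 ∨ p = q + 1) (S : Slide a b c V V')
    (hV : ∀ t ∈ V, (L.slice t).IsCross) :
    Refill L L' {(a : ℕ) + 1, (a : ℕ) + 2} ∅ V V' where
  cross := hV
  cross' := by
    intro t ht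
    by_cases h1 : t = a
    · exact h1 ▸ T'.isCross_a
    by_cases h2 : t = b
    · exact h2 ▸ T'.isCross_b
    by_cases h3 : t = c
    · exact h3 ▸ T'.isCross_c
    · rw [hoff t h1 h2 h3]
      exact hV t ((S.off t h1 h2 h3).1 ht)
  wd := hw
  ext k hk _ := ⟨_, T.comp_slideUp T' hw hoff S hk, eqOff_slideUp _ _, by simp⟩
  res k hk := ⟨_, T'.comp_slideDown T hw.symm (fun t h1 h2 h3 => (hoff t h1 h2 h3).symm) S hk,
    (eqOff_slideDown _ _).symm⟩
  uniq x y hx hy he := T.unique_of_mem hpq (.inr S.mem_c) hx hy he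
  uniq' x y hx hy he _ := T'.unique_of_mem hpq.symm (.inl S.mem_a) hx hy he

/-- The two crossings have the same corners after the slide, and `slideUp` and `slideDown` transport
all colourings, hence also the relation that corners lie on one circle. -/
theorem kap_slide_b (S : Slide a b c V V') (k : Coloring) :
    L'.kap V' b (slideUp a k) = L.kap V a k := by
  have h : L'.Same V' (a + 1) p (a + 2) (p + 1) ↔ L.Same V a p (a + 1) (p + 1) := by
    constructor
    · intro h d hd
      have := h _ (T.comp_slideUp T' hw hoff S hd)
      rwa [slideUp_one, slideUp_two] at this
    · intro h d hd
      have := h _ (T'.comp_slideDown T hw.symm (fun t h1 h2 h3 => (hoff t h1 h2 h3).symm) S hd)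
      rwa [slideDown_zero, slideDown_one, ← T'.id_a hd S.mem_a] at this
  have h1 : (L'.slice b).pos = p := by rw [T'.at_b]; rfl
  have h2 : (L.slice a).pos = p := by rw [T.at_a]; rfl
  unfold kap
  rw [h1, h2, T.next_a, slideUp_one]
  by_cases hs : L.Same V a p (a + 1) (p + 1)
  · rw [if_pos hs, if_pos (h.2 hs)]
  · rw [if_neg hs, if_neg fun h' => hs (h.1 h')]

theorem kap_slide_c (S : Slide a b c V V') (k : Coloring) :
    L'.kap V' c (slideUp a k) = L.kap V b k := by
  have h : L'.Same V' (a + 2) q (a + 3) (q + 1) ↔ L.Same V (a + 1) q (a + 2) (q + 1) := by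
    constructor
    · intro h d hd
      have := h _ (T.comp_slideUp T' hw hoff S hd)
      rwa [slideUp_two, slideUp_three, T.id_c hd S.mem_c] at this
    · intro h d hd
      have := h _ (T'.comp_slideDown T hw.symm (fun t h1 h2 h3 => (hoff t h1 h2 h3).symm) S hd)
      rwa [slideDown_one, slideDown_two] at this
  have h1 : (L'.slice c).pos = q := by rw [T'.at_c]; rfl
  have h2 : (L.slice b).pos = q := by rw [T.at_b]; rfl
  unfold kap
  rw [h1, h2, T.val_c, T.next_a, slideUp_two]
  by_cases hs : L.Same V (a + 1) q (a + 2) (q + 1)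
  · rw [if_pos hs, if_pos (h.2 hs)]
  · rw [if_neg hs, if_neg fun h' => hs (h.1 h')]

omit hw hoff in
theorem mono_slide_b (k : Coloring) : L'.Mono (slideUp a k) b ↔ L.Mono k a := by
  rw [T'.mono_b_iff, T.mono_a_iff, slideUp_one, slideUp_two]

omit hw hoff in
theorem mono_slide_c {k : Coloring} (hk : k (a + 3) = k (a + 2)) :
    L'.Mono (slideUp a k) c ↔ L.Mono k b := by
  rw [T'.mono_c_iff, T.mono_b_iff, slideUp_two, slideUp_three, hk]

end Slide

end Triple

/-! ### Places in the enumeration -/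

/-- The cyclic permutation of the three crossings. -/
def slidePerm (a b c : Fin N) : Equiv.Perm (Fin N) := Equiv.swap a b * Equiv.swap b c

namespace Triple

variable {a b c : Fin N} {p q : ℕ} (T : Triple L a b c p q)

include T

theorem slidePerm_a : slidePerm a b c a = b := by
  rw [slidePerm, Equiv.Perm.mul_apply, Equiv.swap_apply_of_ne_of_ne T.ne_ab T.ne_ac,
    Equiv.swap_apply_left]

theorem slidePerm_b : slidePerm a b c b = c := by
  rw [slidePerm, Equiv.Perm.mul_apply, Equiv.swap_apply_left,
    Equiv.swap_apply_of_ne_of_ne T.ne_ac.symm T.ne_bc.symm]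

omit T in
theorem slidePerm_c : slidePerm a b c c = a := by
  rw [slidePerm, Equiv.Perm.mul_apply, Equiv.swap_apply_right, Equiv.swap_apply_right]

omit T in
theorem slidePerm_of_ne {t : Fin N} (ha : t ≠ a) (hb : t ≠ b) (hc : t ≠ c) :
    slidePerm a b c t = t := by
  rw [slidePerm, Equiv.Perm.mul_apply, Equiv.swap_apply_of_ne_of_ne hb hc,
    Equiv.swap_apply_of_ne_of_ne ha hb]

theorem slide_mem_iff {V V' : Finset (Fin N)} (S : Slide a b c V V') (t : Fin N) :
    t ∈ V ↔ slidePerm a b c t ∈ V' := by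
  by_cases ha : t = a
  · rw [ha, T.slidePerm_a, S.iff_b]
  by_cases hb : t = b
  · rw [hb, T.slidePerm_b, S.iff_c]
  by_cases hc : t = c
  · rw [hc, slidePerm_c]
    exact iff_of_true S.mem_c S.mem_a
  · rw [slidePerm_of_ne ha hb hc, S.off t ha hb hc]

theorem exists_slide {V' : Finset (Fin N)} (ha : a ∈ V') : ∃ V, Slide a b c V V' := by
  refine ⟨Finset.univ.filter fun t => slidePerm a b c t ∈ V', ?_, ha, ?_, ?_, fun t h1 h2 h3 => ?_⟩
  · simp [slidePerm_c, ha]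
  · simp [T.slidePerm_a]
  · simp [T.slidePerm_b]
  · simp [slidePerm_of_ne h1 h2 h3]

omit T in
theorem slidePerm_ne_iff {s s' t : Fin N} (hs : slidePerm a b c s = s') :
    s' ≠ slidePerm a b c t ↔ s ≠ t := by
  rw [← hs, (slidePerm a b c).injective.ne_iff]

theorem slide_erase {V V' : Finset (Fin N)} (S : Slide a b c V V') {t : Fin N} (ht : t ≠ c) :
    Slide a b c (V.erase t) (V'.erase (slidePerm a b c t)) where
  mem_c := by simp [S.mem_c, ht.symm]
  mem_a := by
    rw [Finset.mem_erase]
    refine ⟨fun e => ht ?_, S.mem_a⟩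
    apply (slidePerm a b c).injective
    rw [← e, slidePerm_c]
  iff_b := by
    rw [Finset.mem_erase, Finset.mem_erase, S.iff_b, ← slidePerm_ne_iff T.slidePerm_a]
  iff_c := by
    rw [Finset.mem_erase, Finset.mem_erase, S.iff_c, ← slidePerm_ne_iff T.slidePerm_b]
  off s h1 h2 h3 := by
    rw [Finset.mem_erase, Finset.mem_erase, S.off s h1 h2 h3,
      slidePerm_ne_iff (slidePerm_of_ne h1 h2 h3)]

/-- The cyclic permutation preserves both the places in the enumerations and the set of `1`-resolved
crossings. -/
theorem sgn_slide {V V' : Finset (Fin N)} (S : Slide a b c V V') {r r' : Fin N → ℕ}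
    (hr : ∀ t, r' (slidePerm a b c t) = r t) (t : Fin N) :
    sgn r' V' (slidePerm a b c t) = sgn r V t := by
  unfold sgn
  congr 1
  symm
  apply Finset.card_equiv (slidePerm a b c)
  intro s
  rw [Finset.mem_filter, Finset.mem_filter, hr, hr, T.slide_mem_iff S]

end Triple

namespace IsRIII

variable {a b c : Fin N} {i : ℕ} (h : IsRIII L L' a b c i)

include h

theorem wd_eq : L.wd = L'.wd := by
  refine Diagram.wd_eq fun t => ?_
  by_cases h1 : t = a
  · exact .inr ⟨.inr (h1 ▸ h.triple.isCross_a), .inr (h1 ▸ h.triple'.isCross_a)⟩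
  by_cases h2 : t = b
  · exact .inr ⟨.inr (h2 ▸ h.triple.isCross_b), .inr (h2 ▸ h.triple'.isCross_b)⟩
  by_cases h3 : t = c
  · exact .inr ⟨.inr (h3 ▸ h.triple.isCross_c), .inr (h3 ▸ h.triple'.isCross_c)⟩
  · exact .inl (h.off t h1 h2 h3)

theorem off' (t : Fin N) (h1 : t ≠ a) (h2 : t ≠ b) (h3 : t ≠ c) : L.slice t = L'.slice t :=
  (h.off t h1 h2 h3).symm

theorem comp_up {V V' : Finset (Fin N)} (S : Slide a b c V' V) {k : Coloring} (hk : L'.Comp V' k) :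
    L.Comp V (slideUp a k) :=
  h.triple'.comp_slideUp h.triple h.wd_eq.symm h.off' S hk

theorem comp_down {V V' : Finset (Fin N)} (S : Slide a b c V V') {k : Coloring}
    (hk : L'.Comp V' k) : L.Comp V (slideDown a k) :=
  h.triple'.comp_slideDown h.triple h.wd_eq.symm h.off' S hk

theorem refill_down {V V' : Finset (Fin N)} (S : Slide a b c V V')
    (hV : ∀ t ∈ V, (L.slice t).IsCross) : Refill L L' {(a : ℕ) + 1, (a : ℕ) + 2} ∅ V V' :=
  h.triple.refill_slide h.triple' h.wd_eq h.off (.inl rfl) S hV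

theorem refill_up {V V' : Finset (Fin N)} (S : Slide a b c V' V)
    (hV : ∀ t ∈ V', (L'.slice t).IsCross) : Refill L L' {(a : ℕ) + 1, (a : ℕ) + 2} ∅ V V' :=
  (h.triple'.refill_slide h.triple h.wd_eq.symm h.off' (.inr rfl) S hV).symm

/-- The vertices `010` of `L'` correspond to the vertices `100` of `L`. -/
theorem slide_insert {V' : Finset (Fin N)} (ha : a ∉ V') (hb : b ∉ V') (hc : c ∈ V') :
    Slide a b c V' (insert a (V'.erase c)) where
  mem_c := hc
  mem_a := by simp
  iff_b := by simp [ha, hb, h.triple.ne_ab.symm]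
  iff_c := by simp [hb, h.triple.ne_ac.symm]
  off t h1 h2 h3 := by simp [h1, h3]

theorem pair_ident1 {V V' : Finset (Fin N)} (S : Slide a b c V V') {k : Coloring}
    (hk : L'.Comp V' k) (f : L.CKh) :
    L'.pair V' k (h.ident1 f) = L.pair V (slideDown a k) f := by
  have hk' := h.comp_down S hk
  rw [ident1]
  refine (h.refill_down S hk'.cross).pair_transfer h.triple.mem_levels (fun W => ?_) (by simp)
    hk' hk (eqOff_slideDown a k).symm f
  constructor
  · rintro ⟨h1, h2, h3, h4, h5⟩
    ext t
    by_cases ha : t = a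
    · rw [ha, ← S.iff_b, h3]
    by_cases hb : t = b
    · rw [hb, ← S.iff_c, h4]
    by_cases hc : t = c
    · rw [hc]
      exact iff_of_true h1 S.mem_c
    · rw [← S.off t ha hb hc, h5 t ha hb hc]
  · intro hW
    rw [hW]
    exact ⟨S.mem_c, S.mem_a, S.iff_b, S.iff_c, S.off⟩

theorem pair_ident1_eq_zero {V' : Finset (Fin N)} (ha : a ∉ V') (k : Coloring) (f : L.CKh) :
    L'.pair V' k (h.ident1 f) = 0 := by
  rw [ident1]
  exact pair_transfer_eq_zero (fun W hW => ha hW.2.1) f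

theorem pair_ident100 {V' : Finset (Fin N)} (ha : a ∉ V') (hb : b ∉ V') (hc : c ∈ V')
    {k : Coloring} (hk : L'.Comp V' k) (f : L.CKh) :
    L'.pair V' k (h.ident100 f) = L.pair (insert a (V'.erase c)) (slideUp a k) f := by
  have S := h.slide_insert ha hb hc
  have hab := h.triple.ne_ab
  have hac := h.triple.ne_ac
  rw [ident100]
  refine (h.refill_up S hk.cross).pair_transfer h.triple.mem_levels (fun W => ?_) (by simp)
    (h.comp_up S hk) hk (eqOff_slideUp a k).symm f
  constructor
  · rintro ⟨h1, h2, h3, h4⟩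
    rw [h4, Finset.erase_insert (by simp [h3]), Finset.insert_erase h1]
  · intro hW
    rw [hW]
    refine ⟨by simp, by simp [hb, hab.symm], by simp [hac.symm], ?_⟩
    rw [Finset.erase_insert (by simp [ha]), Finset.insert_erase hc]

theorem pair_ident100_eq_zero {V' : Finset (Fin N)} (hV : ¬ (a ∉ V' ∧ b ∉ V' ∧ c ∈ V'))
    (k : Coloring) (f : L.CKh) : L'.pair V' k (h.ident100 f) = 0 := by
  rw [ident100]
  refine pair_transfer_eq_zero ?_ f
  rintro W ⟨h1, h2, h3, rfl⟩
  have := h.triple.ne_bc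
  have := h.triple.ne_ac
  simp_all

/-- The map `ρ₃'`, extended to `CKh'(L)`. -/
noncomputable def core : L.CKh →ₗ[ℚ] L'.CKh :=
  (LinearMap.id + h.beta') ∘ₗ h.ident100 + h.ident1

theorem core_apply (f : L.CKh) :
    h.core f = h.ident100 f + h.beta' (h.ident100 f) + h.ident1 f := rfl

/-- The crossings number `1`, `2`, `3` of `L'` are the slices `b`, `c`, `a`. So membership of `a`
means crossing number `3` is `1`-resolved, and among the others the vertices `100` contain `b` and
the vertices `010` contain `c`. -/
theorem pair_core1 {V V' : Finset (Fin N)} (S : Slide a b c V V') {k : Coloring}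
    (hk : L'.Comp V' k) (f : L.CKh) :
    L'.pair V' k (h.core f) = L.pair V (slideDown a k) f := by
  rw [core_apply, map_add, map_add, h.pair_ident1 S hk,
    h.pair_ident100_eq_zero fun h' => h'.1 S.mem_a, h.pair_beta'_eq_zero fun h' => h'.1 S.mem_a]
  ring

theorem pair_core010 {V' : Finset (Fin N)} (ha : a ∉ V') (hb : b ∉ V') (hc : c ∈ V')
    {k : Coloring} (hk : L'.Comp V' k) (f : L.CKh) :
    L'.pair V' k (h.core f) = L.pair (insert a (V'.erase c)) (slideUp a k) f := by
  rw [core_apply, map_add, map_add, h.pair_ident1_eq_zero ha, h.pair_ident100 ha hb hc hk,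
    h.pair_beta'_eq_zero fun h' => h'.2.2 hc]
  ring

theorem pair_core100 {V' : Finset (Fin N)} (ha : a ∉ V') (hb : b ∈ V') (hc : c ∉ V')
    {k : Coloring} (hk : L'.Comp V' k) (f : L.CKh) :
    L'.pair V' k (h.core f) = L'.bet a b c (i + 1) (a + 3) V' k (h.ident100 f) := by
  rw [core_apply, map_add, map_add, h.pair_ident1_eq_zero ha,
    h.pair_ident100_eq_zero fun h' => hc h'.2.2, h.pair_beta' ha hb hc hk]
  ring

theorem pair_core_eq_zero {V' : Finset (Fin N)} (ha : a ∉ V') (hbc : b ∈ V' ↔ c ∈ V')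
    (k : Coloring) (f : L.CKh) : L'.pair V' k (h.core f) = 0 := by
  rw [core_apply, map_add, map_add, h.pair_ident1_eq_zero ha,
    h.pair_ident100_eq_zero (by tauto), h.pair_beta'_eq_zero (by tauto)]
  ring

theorem reorder_slidePerm (r : Fin N → ℕ) (t : Fin N) :
    h.reorder r (slidePerm a b c t) = r t := by
  have T := h.triple
  have hab := T.ne_ab
  have hbc := T.ne_bc
  have hac := T.ne_ac
  unfold reorder
  by_cases h1 : t = a
  · rw [h1, T.slidePerm_a, if_neg hab.symm, if_pos rfl]
  by_cases h2 : t = b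
  · rw [h2, T.slidePerm_b, if_neg hac.symm, if_neg hbc.symm, if_pos rfl]
  by_cases h3 : t = c
  · rw [h3, Triple.slidePerm_c, if_pos rfl]
  · rw [Triple.slidePerm_of_ne h1 h2 h3, if_neg h1, if_neg h2, if_neg h3]

theorem reorder_injective {r : Fin N → ℕ} (hr : Function.Injective r) :
    Function.Injective (h.reorder r) := by
  intro s t hst
  obtain ⟨s, rfl⟩ := (slidePerm a b c).surjective s
  obtain ⟨t, rfl⟩ := (slidePerm a b c).surjective t
  rw [h.reorder_slidePerm, h.reorder_slidePerm] at hst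
  rw [hr hst]

theorem reorder_of_rest (r : Fin N → ℕ) {t : Fin N} (ht : t ∈ rest a b c) :
    h.reorder r t = r t := by
  obtain ⟨h1, h2, h3⟩ := mem_rest.1 ht
  have := h.reorder_slidePerm r t
  rwa [Triple.slidePerm_of_ne h1 h2 h3] at this

theorem reorder_lt {r : Fin N → ℕ} (hlt : ∀ t ∈ rest a b c, r a < r t ∧ r b < r t ∧ r c < r t) :
    ∀ t ∈ rest a b c, h.reorder r a < h.reorder r t ∧ h.reorder r b < h.reorder r t ∧
      h.reorder r c < h.reorder r t := by
  intro t ht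
  have T := h.triple
  have h1 := h.reorder_slidePerm r a
  have h2 := h.reorder_slidePerm r b
  have h3 := h.reorder_slidePerm r c
  rw [T.slidePerm_a] at h1
  rw [T.slidePerm_b] at h2
  rw [Triple.slidePerm_c] at h3
  rw [h1, h2, h3, h.reorder_of_rest r ht]
  have := hlt t ht
  tauto

/-- Under the identification of `010` with `100` the crossing `c` is replaced by `a`. In its
enumeration each precedes all crossings outside of the move. -/
theorem sgn_reorder_of_rest {r : Fin N → ℕ}
    (hlt : ∀ t ∈ rest a b c, r a < r t ∧ r b < r t ∧ r c < r t) {V' : Finset (Fin N)}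
    (ha : a ∉ V') (hb : b ∉ V') (hc : c ∈ V') {t : Fin N} (ht : t ∈ rest a b c) :
    sgn (h.reorder r) V' t = sgn r (insert a (V'.erase c)) t := by
  have h1 := sgn_eq_erase (h.reorder r) hc t
  have h2 := sgn_insert r (V := V'.erase c) (s := a) (by simp [ha]) t
  rw [if_pos (h.reorder_lt hlt t ht).2.2] at h1
  rw [if_pos (hlt t ht).1] at h2
  have h3 : ((V'.erase c).filter fun s => h.reorder r s < h.reorder r t) =
      (V'.erase c).filter fun s => r s < r t := by
    refine Finset.filter_congr fun s hs => ?_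
    rw [h.reorder_of_rest r ht, h.reorder_of_rest r]
    rw [mem_rest]
    refine ⟨?_, ?_, ?_⟩ <;> rintro rfl <;> simp_all
  rw [h1, h2, sgn, sgn, h3]

/-- The sign and the coordinate slide along with the resolution; what depends on the crossing is the
condition on its corners and its factor. -/
theorem term_slide {r : Fin N → ℕ} {V V' : Finset (Fin N)} (S : Slide a b c V V')
    {k : Coloring} (hk : L'.Comp V' k) (f : L.CKh) {s t : Fin N} (hs : slidePerm a b c t = s)
    (htc : t ≠ c) (hm : L'.Mono k s ↔ L.Mono (slideDown a k) t)
    (hκ : t ∈ V → L.Mono (slideDown a k) t → Slide a b c (V.erase t) (V'.erase s) →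
      L'.kap (V'.erase s) s k = L.kap (V.erase t) t (slideDown a k)) :
    L'.term (h.reorder r) V' k (h.core f) s = L.term r V (slideDown a k) f t := by
  have hV : t ∈ V ↔ s ∈ V' := hs ▸ h.triple.slide_mem_iff S t
  by_cases htV : t ∈ V
  swap
  · rw [term_of_not_mem htV, term_of_not_mem (fun h' => htV (hV.2 h'))]
  by_cases hmt : L.Mono (slideDown a k) t
  swap
  · rw [term_of_not_mono hmt, term_of_not_mono (fun h' => hmt (hm.1 h'))]
  have S' := h.triple.slide_erase S htc
  rw [hs] at S'
  have hsg := h.triple.sgn_slide S (h.reorder_slidePerm r) t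
  rw [hs] at hsg
  rw [term_eq htV hmt, term_eq (hV.1 htV) (hm.2 hmt), hsg, hκ htV hmt S',
    h.pair_core1 S' ((hk.erase_iff (hV.1 htV)).2 (hm.2 hmt))]

theorem term_up {r : Fin N → ℕ} (hlt : ∀ t ∈ rest a b c, r a < r t ∧ r b < r t ∧ r c < r t)
    {V' : Finset (Fin N)} (ha : a ∉ V') (hb : b ∉ V') (hc : c ∈ V')
    {k : Coloring} (hk : L'.Comp V' k) (f : L.CKh) {g : L'.CKh} {t : Fin N} (ht : t ∈ rest a b c)
    (hg : L'.Comp (V'.erase t) k → a ∉ V'.erase t → b ∉ V'.erase t → c ∈ V'.erase t →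
      L'.pair (V'.erase t) k g =
        L.pair (insert a ((V'.erase t).erase c)) (slideUp a k) f) :
    L'.term (h.reorder r) V' k g t = L.term r (insert a (V'.erase c)) (slideUp a k) f t := by
  obtain ⟨h1, h2, h3⟩ := mem_rest.1 ht
  obtain ⟨hl1, hl2⟩ := h.triple.notMem_level h1 h2 h3
  have hV : t ∈ insert a (V'.erase c) ↔ t ∈ V' := by simp [h1, h3]
  have hm : L'.Mono k t ↔ L.Mono (slideUp a k) t :=
    Mono.congr (eqOff_slideUp a k) (h.off t h1 h2 h3) hl1 hl2
  by_cases htV : t ∈ V'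
  swap
  · rw [term_of_not_mem htV, term_of_not_mem (fun h' => htV (hV.1 h'))]
  by_cases hmt : L'.Mono k t
  swap
  · rw [term_of_not_mono hmt, term_of_not_mono (fun h' => hmt (hm.2 h'))]
  have ha' : a ∉ V'.erase t := by simp [ha]
  have hb' : b ∉ V'.erase t := by simp [hb]
  have hc' : c ∈ V'.erase t := by simp [hc, h3.symm]
  have hk' := (hk.erase_iff htV).2 hmt
  have e : insert a ((V'.erase t).erase c) = (insert a (V'.erase c)).erase t := by
    rw [Finset.erase_insert_of_ne h1.symm, Finset.erase_right_comm]
  have R := h.refill_up (h.slide_insert ha' hb' hc') hk'.cross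
  have hκ := R.kap_eq (h.off' t h1 h2 h3) hl1 hl2 (eqOff_slideUp a k).symm
  rw [term_eq htV hmt, term_eq (hV.2 htV) (hm.1 hmt), h.sgn_reorder_of_rest hlt ha hb hc ht,
    hg hk' ha' hb' hc', ← e, hκ]

end IsRIII

/-! ### The third Reidemeister move: the chain map on `X₁` -/

namespace IsRIII

variable {a b c : Fin N} {i : ℕ} (h : IsRIII L L' a b c i)

include h

theorem slideUp_down {V' : Finset (Fin N)} {k : Coloring} (hk : L'.Comp V' k) (ha : a ∈ V') :
    slideUp a (slideDown a k) = k :=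
  slideUp_slideDown (h.triple'.id_a hk ha)

/-- The edges `011 → 111` of type `3` of `L'`, and those of `L`. -/
theorem term_a_of_011 {r : Fin N → ℕ} {V V' : Finset (Fin N)} (S : Slide a b c V V')
    (hb : b ∉ V') (hc : c ∈ V') {k : Coloring} (hk : L'.Comp V' k) {f : L.CKh}
    (hf : f ∈ h.X₁) :
    L'.term (h.reorder r) V' k (h.core f) a = L.term r V (slideDown a k) f c := by
  have T := h.triple
  have T' := h.triple'
  have hab := T.ne_ab
  have hac := T.ne_ac
  have hbc := T.ne_bc
  have haV : a ∉ V := fun h' => hb (S.iff_b.2 h')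
  have hbV : b ∈ V := S.iff_c.1 hc
  have haV' := S.mem_a
  have hsg := T.sgn_slide S (h.reorder_slidePerm r) c
  rw [Triple.slidePerm_c] at hsg
  have hkd := h.comp_down S hk
  have hup : slideDown a k a = k a := slideDown_zero _ _
  set d := slideDown a k with hd
  obtain ⟨t1, t2, t3⟩ := T.turn_a hkd haV
  have hmc : L.Mono d c := by
    rw [T.mono_c_iff, T.id_c hkd S.mem_c, T.id_b hkd hbV]
    exact t2
  have hcc := (hkd.erase_iff S.mem_c).2 hmc
  -- The edge of `c` in `L` starts at `010`. For elements of `X₁` the value there comes from `100`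
  -- through the edge of `b`, whose factor slides to that of the edge of `a` in `L'`.
  have hX := ((h.mem_X₁_iff.1 hf) _ _ hcc (by simp)).2 (by simp [haV]) (by simp [hbV, hbc])
  rw [defect, sub_eq_zero] at hX
  rw [term_eq S.mem_c hmc, hX, T.kap_small_c hcc (by simp [haV]) (by simp [hbV, hbc]) (by simp),
    mul_one, bet]
  have efill : fill a i (d a i) d = slideUp a k := by
    have hcap : ∀ j, (if j = i ∨ j = i + 1 then d a i else d a j) = k a j := by
      intro j
      rw [← hup]
      split_ifs with hj
      · rcases hj with rfl | rfl
        exacts [rfl, t1]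
      · rfl
    refine Triple.setTwo_eq ((eqOff_slideDown a k).symm.trans (eqOff_slideUp a k)) ?_ ?_
    · rw [slideUp_one]
      exact funext hcap
    · rw [slideUp_two, T'.id_a hk haV']
      exact funext hcap
  have hmb : L.Mono (slideUp a k) b ↔ L'.Mono k a := T'.mono_slide_b T k
  rw [efill]
  by_cases hm : L'.Mono k a
  · have hk' := (hk.erase_iff haV').2 hm
    have hb' : b ∉ V'.erase a := by simp [hb]
    have hc' : c ∈ V'.erase a := by simp [hc, hac.symm]
    have S0 := h.slide_insert (V' := V'.erase a) (by simp) hb' hc'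
    have e : insert a ((V'.erase a).erase c) = (insert a (V.erase c)).erase b := by
      ext t
      by_cases h1 : t = a
      · simp [h1, hab]
      by_cases h2 : t = b
      · simp [h2, hb, hab.symm]
      by_cases h3 : t = c
      · simp [h3, hac.symm]
      · simp [h1, h2, h3, S.off t h1 h2 h3]
    have hκ := T'.kap_slide_b T h.wd_eq.symm h.off' S0 k
    rw [term_eq haV' hm, if_pos (hmb.2 hm), h.pair_core010 (by simp) hb' hc' hk', hsg, ← e, hκ]
    ring
  · rw [term_of_not_mono hm, if_neg fun h' => hm (hmb.1 h'), mul_zero]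

/-- In `L'` the edge starts at `100`, where the value of `core` is that of `beta'`. The merge with
the small circle has factor `1`, and the factor contained in `beta'` slides to that of the edge of
`c` in `L`. -/
theorem term_a_of_101 {r : Fin N → ℕ} {V V' : Finset (Fin N)} (S : Slide a b c V V')
    (hb : b ∈ V') (hc : c ∉ V') {k : Coloring} (hk : L'.Comp V' k) (f : L.CKh) :
    L'.term (h.reorder r) V' k (h.core f) a = L.term r V (slideDown a k) f c := by
  have T := h.triple
  have T' := h.triple'
  have hab := T.ne_ab
  have hac := T.ne_ac
  have hbc := T.ne_bc
  have haV : a ∈ V := S.iff_b.1 hb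
  have hbV : b ∉ V := fun h' => hc (S.iff_c.2 h')
  have haV' := S.mem_a
  have hsg := T.sgn_slide S (h.reorder_slidePerm r) c
  rw [Triple.slidePerm_c] at hsg
  have ho := (T'.outer_ab hk haV' hb hc).1
  have hma : L'.Mono k a := by
    rw [T'.mono_a_iff, T'.id_a hk haV']
    exact ho.1
  have hk' := (hk.erase_iff haV').2 hma
  have hb' : b ∈ V'.erase a := by simp [hb, hab.symm]
  have hc' : c ∉ V'.erase a := by simp [hc]
  rw [term_eq haV' hma, T'.kap_small_a hk' (by simp) hb' hc', hsg, mul_one,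
    h.pair_core100 (by simp) hb' hc' hk', bet]
  set d := fill a (i + 1) (k (a + 3) (i + 1)) k with hd
  have hcap : ∀ j, (if j = i + 1 ∨ j = i + 1 + 1 then k (a + 3) (i + 1) else k a j) =
      k (a + 3) j := by
    intro j
    split_ifs with hj
    · rcases hj with rfl | rfl
      exacts [rfl, ho.2.1]
    · exact ho.2.2 j (by tauto) (by tauto)
  have hd1 : d (a + 1) = k (a + 3) := by
    funext j
    rw [hd, Triple.fill_one, hcap]
  have hd2 : d (a + 2) = k (a + 3) := by
    funext j
    rw [hd, Triple.fill_two, hcap]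
  have hd3 : d (a + 3) = k (a + 3) := Triple.fill_three _ _ _ _
  have hd0 : d a = k a := Triple.fill_zero _ _ _ _
  have eup : slideUp a d = slideDown a k := by
    refine Triple.setTwo_eq ((Triple.eqOff_fill _ _ _ _).symm.trans (eqOff_slideDown a k)) ?_ ?_
    · rw [slideDown_one, hd0, T'.id_b hk hb, T'.id_a hk haV']
    · rw [slideDown_two, hd1]
  have hmb : L.Mono (slideUp a d) c ↔ L'.Mono d b := T'.mono_slide_c T (by rw [hd3, hd2])
  rw [eup] at hmb
  by_cases hm : L'.Mono d b
  · have hdc : L'.Comp ((insert c (V'.erase a)).erase b) d :=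
      ((T'.comp_e (.inr ⟨rfl, rfl, rfl⟩) hc' hb' (by simp) hk').erase_iff (by simp [hb'])).2 hm
    have ha'' : a ∉ (insert c (V'.erase a)).erase b := by simp [hac]
    have hc'' : c ∈ (insert c (V'.erase a)).erase b := by simp [hbc.symm]
    have S0 := h.slide_insert ha'' (by simp) hc''
    have e : insert a (((insert c (V'.erase a)).erase b).erase c) = V.erase c := by
      ext t
      by_cases h1 : t = a
      · simp [h1, hac, haV]
      by_cases h2 : t = b
      · simp [h2, hbV, hab.symm]
      by_cases h3 : t = c
      · simp [h3, hac.symm]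
      · simp [h1, h2, h3, S.off t h1 h2 h3]
    have hκ := T'.kap_slide_c T h.wd_eq.symm h.off' S0 d
    rw [e, eup] at hκ
    rw [if_pos hm, term_eq S.mem_c (hmb.2 hm), h.pair_ident100 ha'' (by simp) hc'' hdc, e, eup, hκ]
    ring
  · rw [if_neg hm, term_of_not_mono fun h' => hm (hmb.1 h'), mul_zero]

/-- The values of the boundary at the vertices with a `1`-resolution of the crossing number `3`. -/
theorem pair_core_dLee1 {r : Fin N → ℕ} {V V' : Finset (Fin N)} (S : Slide a b c V V')
    {k : Coloring} (hk : L'.Comp V' k) {f : L.CKh} (hf : f ∈ h.X₁) :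
    L'.pair V' k (L'.dLee (h.reorder r) (h.core f)) = L.pair V (slideDown a k) (L.dLee r f) := by
  have T := h.triple
  have T' := h.triple'
  have hab := T.ne_ab
  have hac := T.ne_ac
  have hbc := T.ne_bc
  have hkd := h.comp_down S hk
  have hud := h.slideUp_down hk S.mem_a
  rw [pair_dLee _ hk, pair_dLee r hkd, T.sum_eq, T.sum_eq]
  have h1 : L'.term (h.reorder r) V' k (h.core f) b = L.term r V (slideDown a k) f a := by
    refine h.term_slide S hk f T.slidePerm_a hac ?_ fun _ _ S' => ?_
    · rw [← T.mono_slide_b T', hud]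
    · rw [← T.kap_slide_b T' h.wd_eq h.off S', hud]
  have h2 : L'.term (h.reorder r) V' k (h.core f) c = L.term r V (slideDown a k) f b := by
    refine h.term_slide S hk f T.slidePerm_b hbc ?_ fun _ _ S' => ?_
    · rw [← T.mono_slide_c T' (T.id_c hkd S.mem_c), hud]
    · rw [← T.kap_slide_c T' h.wd_eq h.off S', hud]
  have h3 : L'.term (h.reorder r) V' k (h.core f) a = L.term r V (slideDown a k) f c := by
    -- If the two agree, the edge starts at `000` or `110`, where both `core` and the elements of
    -- `X₁` vanish. Otherwise it starts at `100` or `010` and involves a small circle on one side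
    -- only.
    by_cases hbc' : b ∈ V' ↔ c ∈ V'
    · rw [term_eq_zero fun _ _ => h.pair_core_eq_zero (by simp)
        (by simp [hab.symm, hac.symm, hbc']) k f]
      rw [term_eq_zero fun hc hm => ?_]
      have := hbc'
      rw [S.iff_b, S.iff_c] at this
      exact (h.mem_X₁_iff.1 hf _ _ ((hkd.erase_iff hc).2 hm) (by simp)).1
        (by simp [hac, hbc, this])
    · by_cases hb : b ∈ V'
      · exact h.term_a_of_101 S hb (by tauto) hk f
      · exact h.term_a_of_011 S hb (by tauto) hk hf
  have h4 : ∀ t ∈ rest a b c, L'.term (h.reorder r) V' k (h.core f) t =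
      L.term r V (slideDown a k) f t := by
    intro t ht
    obtain ⟨h1, h2, h3⟩ := mem_rest.1 ht
    obtain ⟨hl1, hl2⟩ := h.triple.notMem_level h1 h2 h3
    refine h.term_slide S hk f (Triple.slidePerm_of_ne h1 h2 h3) h3
      (Mono.congr (eqOff_slideDown a k) (h.off t h1 h2 h3) hl1 hl2) fun htV hm S' => ?_
    exact ((h.refill_down S' ((hkd.erase_iff htV).2 hm).cross).kap_eq (h.off' t h1 h2 h3) hl1 hl2
      (eqOff_slideDown a k).symm).symm
  rw [h1, h2, h3, Finset.sum_congr rfl h4]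
  ring

/-- The contribution of the other crossings at the vertices `100`. -/
theorem pair_dLee_up {r : Fin N → ℕ} {V' : Finset (Fin N)} (ha : a ∉ V') (hb : b ∉ V')
    (hc : c ∈ V') {k : Coloring} (hk : L'.Comp V' k) {f : L.CKh} (hf : f ∈ h.X₁) :
    L.pair (insert a (V'.erase c)) (slideUp a k) (L.dLee r f) =
      ∑ t ∈ rest a b c, L.term r (insert a (V'.erase c)) (slideUp a k) f t := by
  have T := h.triple
  have hkd := h.comp_up (h.slide_insert ha hb hc) hk
  rw [pair_dLee r hkd, T.sum_eq, term_of_not_mem (t := b) (by simp [hb, T.ne_ab.symm]),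
    term_of_not_mem (t := c) (by simp [T.ne_ac.symm]), term_eq_zero fun ha' hm => ?_]
  · ring
  · exact (h.mem_X₁_iff.1 hf _ _ ((hkd.erase_iff ha').2 hm) (by simp [T.ne_ac.symm])).1
      (by simp [hb])

theorem pair_core_dLee010 {r : Fin N → ℕ}
    (hlt : ∀ t ∈ rest a b c, r a < r t ∧ r b < r t ∧ r c < r t) {V' : Finset (Fin N)}
    (ha : a ∉ V') (hb : b ∉ V') (hc : c ∈ V') {k : Coloring} (hk : L'.Comp V' k) {f : L.CKh}
    (hf : f ∈ h.X₁) : L'.pair V' k (L'.dLee (h.reorder r) (h.core f)) =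
      L.pair (insert a (V'.erase c)) (slideUp a k) (L.dLee r f) := by
  have h4 : ∀ t ∈ rest a b c, L'.term (h.reorder r) V' k (h.core f) t =
      L.term r (insert a (V'.erase c)) (slideUp a k) f t := fun t ht =>
    h.term_up hlt ha hb hc hk f ht fun hk' ha' hb' hc' => h.pair_core010 ha' hb' hc' hk' f
  rw [h.pair_dLee_up ha hb hc hk hf, pair_dLee _ hk, h.triple.sum_eq, term_of_not_mem ha,
    term_of_not_mem hb, term_eq_zero fun _ _ => h.pair_core_eq_zero (by simp [ha])
      (by simp [hb]) k f, Finset.sum_congr rfl h4]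
  ring

/-- The edges from `000` contribute nothing on either side, and the other edges commute with `beta'`
by `Triple.sum_bet`. -/
theorem pair_core_dLee100 {r : Fin N → ℕ}
    (hlt : ∀ t ∈ rest a b c, r a < r t ∧ r b < r t ∧ r c < r t) {V' : Finset (Fin N)}
    (ha : a ∉ V') (hb : b ∈ V') (hc : c ∉ V') {k : Coloring} (hk : L'.Comp V' k) {f : L.CKh}
    (hf : f ∈ h.X₁) : L'.pair V' k (L'.dLee (h.reorder r) (h.core f)) =
      L'.bet a b c (i + 1) (a + 3) V' k (h.ident100 (L.dLee r f)) := by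
  classical
  have T := h.triple
  have T' := h.triple'
  have h1 := T'.sum_bet (.inr ⟨rfl, rfl, rfl⟩) hc hb ha hk (h.reorder_lt hlt) (h.ident100 f)
  have h2 : ∀ t ∈ rest a b c, L'.term (h.reorder r) V' k (h.core f) t =
      if t ∈ V' ∧ L'.Mono k t then sgn (h.reorder r) V' t * L'.kap (V'.erase t) t k *
        L'.bet a b c (i + 1) (a + 3) (V'.erase t) k (h.ident100 f) else 0 := by
    intro t ht
    obtain ⟨e1, e2, e3⟩ := mem_rest.1 ht
    unfold term
    split_ifs with hm
    · rw [h.pair_core100 (by simp [ha]) (by simp [hb, e2.symm]) (by simp [hc])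
        ((hk.erase_iff hm.1).2 hm.2)]
    · rfl
  rw [pair_dLee _ hk, T.sum_eq, term_of_not_mem ha, term_of_not_mem hc,
    term_eq_zero fun _ _ => h.pair_core_eq_zero (by simp [ha]) (by simp [hc]) k f,
    Finset.sum_congr rfl h2, h1, bet]
  set d := fill a (i + 1) (k (a + 3) (i + 1)) k with hd
  by_cases hm : L'.Mono d b
  swap
  · rw [if_neg hm, if_neg hm]
    ring
  have hdc : L'.Comp ((insert c V').erase b) d :=
    ((T'.comp_e (.inr ⟨rfl, rfl, rfl⟩) hc hb ha hk).erase_iff (by simp [hb])).2 hm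
  have ha'' : a ∉ (insert c V').erase b := by simp [ha, T.ne_ac]
  have hc'' : c ∈ (insert c V').erase b := by simp [T.ne_bc.symm]
  rw [if_pos hm, if_pos hm, h.pair_ident100 ha'' (by simp) hc'' hdc,
    h.pair_dLee_up ha'' (by simp) hc'' hdc hf, Finset.sum_congr rfl fun t ht =>
      h.term_up hlt ha'' (by simp) hc'' hdc f ht fun hk' ha' hb' hc' =>
        h.pair_ident100 ha' hb' hc' hk' f]
  ring

/-- The edges from `100` and `010` cancel: the first has factor `1` and its value already contains
the factor of the second, and their signs are opposite. -/
theorem pair_core_dLee110 {r : Fin N → ℕ} (hr : Function.Injective r)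
    (hlt : ∀ t ∈ rest a b c, r a < r t ∧ r b < r t ∧ r c < r t) {V' : Finset (Fin N)}
    (ha : a ∉ V') (hb : b ∈ V') (hc : c ∈ V') {k : Coloring} (hk : L'.Comp V' k) (f : L.CKh) :
    L'.pair V' k (L'.dLee (h.reorder r) (h.core f)) = 0 := by
  have T := h.triple
  have T' := h.triple'
  have hbc := T.ne_bc
  obtain ⟨ho, hfill⟩ := T'.outer_bc hk ha hb hc
  have hmc : L'.Mono k c := by
    rw [T'.mono_c_iff, ← T'.id_c hk hc]
    exact ho.2.1
  have hkc := (hk.erase_iff hc).2 hmc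
  have hbc' : b ∈ V'.erase c := by simp [hb, hbc]
  have hsg : sgn (h.reorder r) V' b = - sgn (h.reorder r) V' c := by
    refine sgn_eq_neg (h.reorder_injective hr) hb hc hbc fun t ht h1 h2 => ?_
    have := h.reorder_lt hlt t (mem_rest.2 ⟨fun e => ha (e ▸ ht), h1, h2⟩)
    tauto
  rw [pair_dLee _ hk, T.sum_eq, term_of_not_mem ha, term_eq hc hmc,
    T'.kap_small_c hkc (by simp [ha]) hbc' (by simp), h.pair_core100 (by simp [ha]) hbc' (by simp)
    hkc, bet, hfill, Finset.insert_erase hc, Finset.sum_eq_zero]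
  · by_cases hm : L'.Mono k b
    · have hkb := (hk.erase_iff hb).2 hm
      have ha' : a ∉ V'.erase b := by simp [ha]
      have hc' : c ∈ V'.erase b := by simp [hc, hbc.symm]
      rw [term_eq hb hm, if_pos hm, h.pair_core010 ha' (by simp) hc' hkb,
        h.pair_ident100 ha' (by simp) hc' hkb, hsg]
      ring
    · rw [term_of_not_mono hm, if_neg hm]
      ring
  · intro t ht
    obtain ⟨e1, e2, e3⟩ := mem_rest.1 ht
    exact term_eq_zero fun _ _ => h.pair_core_eq_zero (by simp [ha])
      (by simp [hb, hc, e2.symm, e3.symm]) k f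

theorem core_dLee {r : Fin N → ℕ} (hr : Function.Injective r)
    (hlt : ∀ t ∈ rest a b c, r a < r t ∧ r b < r t ∧ r c < r t) {f : L.CKh} (hf : f ∈ h.X₁) :
    L'.dLee (h.reorder r) (h.core f) = h.core (L.dLee r f) := by
  apply pair_inj
  intro V' k hk
  by_cases ha : a ∈ V'
  · obtain ⟨V, S⟩ := h.triple.exists_slide ha
    rw [h.pair_core1 S hk, h.pair_core_dLee1 S hk hf]
  by_cases hb : b ∈ V' <;> by_cases hc : c ∈ V'
  · rw [h.pair_core_dLee110 hr hlt ha hb hc hk, h.pair_core_eq_zero ha (iff_of_true hb hc)]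
  · rw [h.pair_core_dLee100 hlt ha hb hc hk hf, h.pair_core100 ha hb hc hk]
  · rw [h.pair_core_dLee010 hlt ha hb hc hk hf, h.pair_core010 ha hb hc hk]
  · rw [h.pair_core_eq_zero ha (iff_of_false hb hc), pair_dLee _ hk]
    refine Finset.sum_eq_zero fun t _ => term_eq_zero fun _ _ =>
      h.pair_core_eq_zero (by simp [ha]) (by simp [hb, hc]) k f

theorem isChainMap {r : Fin N → ℕ} (hr : Function.Injective r)
    (hlt : ∀ t ∈ rest a b c, r a < r t ∧ r b < r t ∧ r c < r t)
    (hX : ∀ x ∈ h.X₁, L.dLee r x ∈ h.X₁) :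
    IsChainMap ((L.dLee r).restrict hX) (L'.dLee (h.reorder r)) h.rhoIII :=
  fun x => h.core_dLee hr hlt x.2

end IsRIII

/-- Up to negation at every other position, `crossFlip` is a transposition of neighbours, so it
satisfies the braid relation. Consequently the colours above the three crossings agree for both
diagrams. -/
theorem crossFlip_braid (i : ℕ) (x : ℕ → Bool) :
    crossFlip i (crossFlip (i + 1) (crossFlip i x)) =
      crossFlip (i + 1) (crossFlip i (crossFlip (i + 1) x)) := by
  funext j
  have e1 : i + 1 + 1 ≠ i := by omega
  have e2 : i ≠ i + 1 + 1 := by omega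
  unfold crossFlip
  by_cases h1 : j = i
  · simp [h1, e1, e2]
  by_cases h2 : j = i + 1
  · simp [h2, e1, e2]
  by_cases h3 : j = i + 1 + 1
  · simp [h3, e1, e2]
  · simp [h1, h2, h3]

theorem Triple.exists_flow {a b c : Fin N} {p q : ℕ} (T : Triple L a b c p q)
    (T' : Triple L' a b c q p) (hw : L.wd = L'.wd)
    (hoff : ∀ t, t ≠ a → t ≠ b → t ≠ c → L'.slice t = L.slice t)
    (hpq : ∀ x, crossFlip p (crossFlip q (crossFlip p x)) =
      crossFlip q (crossFlip p (crossFlip q x))) {k : Coloring} (hk : L.Flow k) :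
    ∃ k', L'.Flow k' ∧ EqOff {(a : ℕ) + 1, (a : ℕ) + 2} k k' := by
  have f1 := hk.flow a
  have f2 := hk.flow b
  have f3 := hk.flow c
  rw [T.at_a] at f1
  rw [T.at_b, T.next_a] at f2
  rw [T.at_c, T.val_c] at f3
  have g1 : k (a + 1) = crossFlip p (k a) := f1
  have g2 : k (a + 2) = crossFlip q (k (a + 1)) := f2
  have g3 : k (a + 3) = crossFlip p (k (a + 2)) := f3
  have s1 : ∀ j, crossFlip q (k a) j = true → j < L.wd a :=
    crossFlip_supp (hw ▸ T'.lt_p) (hk.supp _)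
  have s2 : ∀ j, crossFlip p (crossFlip q (k a)) j = true → j < L.wd a :=
    crossFlip_supp T.lt_p s1
  refine ⟨setTwo k a (crossFlip q (k a)) (crossFlip p (crossFlip q (k a))),
    hk.replace hw (eqOff_setTwo _ _ _ _) ?_ ?_ ?_, eqOff_setTwo _ _ _ _⟩
  · rintro n (rfl | rfl) j
    · rw [setTwo_one, T.wd_one]; exact s1 j
    · rw [setTwo_two, T.wd_two]; exact s2 j
  · intro t h1 h2
    obtain ⟨h1, h2, h3⟩ := T.ne_of_notMem h1 h2
    exact hoff t h1 h2 h3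
  · intro t ht
    rcases T.cases_of_mem ht with rfl | rfl | rfl
    · rw [T'.at_a, setTwo_one, setTwo_zero]
      rfl
    · rw [T'.at_b, T.next_a, setTwo_one, setTwo_two]
      rfl
    · rw [T'.at_c, T.val_c, setTwo_two, setTwo_three, g3, g2, g1, hpq]
      rfl

/-! ### The third Reidemeister move: orientation coordinates -/

namespace IsRIII

variable {a b c : Fin N} {i : ℕ} (h : IsRIII L L' a b c i)

include h

theorem orientationCorr : OrientationCorr L L' {(a : ℕ) + 1, (a : ℕ) + 2} := by
  have T := h.triple
  have T' := h.triple'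
  refine OrientationCorr.mk' h.wd_eq ?_ ?_ ?_
  · rintro n (rfl | rfl)
    · exact ⟨a, rfl, .inr T.isCross_a, .inr T'.isCross_a⟩
    · exact ⟨b, by rw [T.next_a], .inr T.isCross_b, .inr T'.isCross_b⟩
  · intro k hk
    exact T.exists_flow T' h.wd_eq h.off (crossFlip_braid i) hk
  · intro k hk
    obtain ⟨k', h1, h2⟩ := T'.exists_flow T h.wd_eq.symm h.off'
      (fun x => (crossFlip_braid i x).symm) hk
    exact ⟨k', h1, h2.symm⟩

omit h in
-- All resolutions are read off from the colours below the crossings. A strand changes its colour at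
-- each crossing; at `b` just one of the two strands has been crossed before, at `c` both have been
-- crossed once, which accounts for the equality in the second condition.
theorem mem_vertex_iff (T : Triple L a b c i (i + 1)) (o : L.Orientation) :
    (a ∈ o.vertex.1 ↔ o.col a i ≠ o.col a (i + 1)) ∧
    (b ∈ o.vertex.1 ↔ o.col a i = o.col a (i + 2)) ∧
    (c ∈ o.vertex.1 ↔ o.col a (i + 1) ≠ o.col a (i + 2)) := by
  have f1 := o.flow.flow a
  have f2 := o.flow.flow b
  rw [T.at_a] at f1
  rw [T.at_b, T.next_a] at f2
  have g1 : o.col (a + 1) = crossFlip i (o.col a) := f1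
  have g2 : o.col (a + 2) = crossFlip (i + 1) (o.col (a + 1)) := f2
  rw [o.comp.mem_iff T.at_a (o.not_mono T.isCross_a), o.comp.mem_iff T.at_b (o.not_mono T.isCross_b),
    o.comp.mem_iff T.at_c (o.not_mono T.isCross_c), T.val_c, T.next_a, g2, g1]
  simp only [crossFlip_left, crossFlip_right, crossFlip_of_ne _ (show i + 1 + 1 ≠ i by omega)
    (show i + 1 + 1 ≠ i + 1 by omega), crossFlip_of_ne _ (show i ≠ i + 1 by omega)
    (show i ≠ i + 1 + 1 by omega)]
  change (_ ↔ _) ∧ (_ ↔ _) ∧ (_ ↔ o.col a (i + 1) ≠ o.col a (i + 1 + 1))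
  rw [show i + 2 = i + 1 + 1 from rfl]
  cases o.col a i <;> cases o.col a (i + 1) <;> cases o.col a (i + 1 + 1) <;> simp

omit h in
theorem mem_vertex_iff' (T : Triple L' a b c (i + 1) i) (o : L'.Orientation) :
    (a ∈ o.vertex.1 ↔ o.col a (i + 1) ≠ o.col a (i + 2)) ∧
    (b ∈ o.vertex.1 ↔ o.col a i = o.col a (i + 2)) ∧
    (c ∈ o.vertex.1 ↔ o.col a i ≠ o.col a (i + 1)) := by
  have f1 := o.flow.flow a
  have f2 := o.flow.flow b
  rw [T.at_a] at f1
  rw [T.at_b, T.next_a] at f2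
  have g1 : o.col (a + 1) = crossFlip (i + 1) (o.col a) := f1
  have g2 : o.col (a + 2) = crossFlip i (o.col (a + 1)) := f2
  rw [o.comp.mem_iff T.at_a (o.not_mono T.isCross_a), o.comp.mem_iff T.at_b (o.not_mono T.isCross_b),
    o.comp.mem_iff T.at_c (o.not_mono T.isCross_c), T.val_c, T.next_a, g2, g1]
  simp only [crossFlip_left, crossFlip_right, crossFlip_of_ne _ (show i + 1 + 1 ≠ i by omega)
    (show i + 1 + 1 ≠ i + 1 by omega), crossFlip_of_ne _ (show i ≠ i + 1 by omega)
    (show i ≠ i + 1 + 1 by omega)]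
  rw [show i + 2 = i + 1 + 1 from rfl]
  cases o.col a i <;> cases o.col a (i + 1) <;> cases o.col a (i + 1 + 1) <;> simp

theorem mem_vertex_of_rest {o : L.Orientation} {o' : L'.Orientation}
    (ho : EqOff {(a : ℕ) + 1, (a : ℕ) + 2} o.col o'.col) {t : Fin N} (h1 : t ≠ a) (h2 : t ≠ b)
    (h3 : t ≠ c) : t ∈ o'.vertex.1 ↔ t ∈ o.vertex.1 := by
  have hl := (h.triple.notMem_level h1 h2 h3).1
  have hs := h.off t h1 h2 h3
  by_cases hc : (L.slice t).IsCross
  · obtain ⟨j, e, hj⟩ := id hc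
    rw [o.comp.mem_iff hj (o.not_mono hc), o'.comp.mem_iff (hs.trans hj) (o'.not_mono (hs ▸ hc)),
      ho _ hl]
  · exact iff_of_false (fun h' => hc (hs ▸ o'.comp.cross t h')) fun h' => hc (o.comp.cross t h')

/-- The orientation coordinates of an element of `X₁` and of its image. -/
theorem pair_core_orientation {o : L.Orientation} {o' : L'.Orientation}
    (ho : EqOff {(a : ℕ) + 1, (a : ℕ) + 2} o.col o'.col) :
    ∃ q : ℚ, q ≠ 0 ∧ ∀ x ∈ h.X₁, L'.pair o'.vertex.1 o'.col (h.core x) =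
      q * L.pair o.vertex.1 o.col x := by
  have T := h.triple
  have T' := h.triple'
  have hab := T.ne_ab
  have hac := T.ne_ac
  have hbc := T.ne_bc
  obtain ⟨ma, mb, mc⟩ := mem_vertex_iff T o
  obtain ⟨ma', mb', mc'⟩ := mem_vertex_iff' T' o'
  have hoff := fun t h1 h2 h3 => h.mem_vertex_of_rest ho (t := t) h1 h2 h3
  have hk := o.comp
  have hk' := o'.comp
  have e0 := ho a (by simp)
  rw [← e0] at ma' mb' mc'
  set V := o.vertex.1
  set V' := o'.vertex.1
  set k := o.col
  set k' := o'.col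
  -- The colours of the three strands leave three possibilities: crossing number `3` is
  -- `1`-resolved; the vertices are `100` and `010`; or all colours are equal and the vertices are
  -- `010` and `100`, with small circles. Orientations never lead to `000` or `110`.
  have hcase : (a ∈ V' ∧ c ∈ V ∧ (b ∈ V' ↔ a ∈ V) ∧ (c ∈ V' ↔ b ∈ V)) ∨
      (a ∉ V' ∧ b ∉ V' ∧ c ∈ V' ∧ a ∈ V ∧ b ∉ V ∧ c ∉ V) ∨
      (a ∉ V' ∧ b ∈ V' ∧ c ∉ V' ∧ a ∉ V ∧ b ∈ V ∧ c ∉ V ∧ k a i = k a (i + 1) ∧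
        k a (i + 1) = k a (i + 2)) := by
    rw [ma, mb, mc, ma', mb', mc']
    cases k a i <;> cases k a (i + 1) <;> cases k a (i + 2) <;> simp
  rcases hcase with ⟨c1, c2, c3, c4⟩ | ⟨a1, b1, c1, a2, b2, c2⟩ | ⟨a1, b1, c1, a2, b2, c2, x1, x2⟩
  · have S : Slide a b c V V' := ⟨c2, c1, c3, c4, hoff⟩
    refine ⟨1, one_ne_zero, fun x _ => ?_⟩
    rw [h.pair_core1 S hk', one_mul, T.unique_of_mem (.inl rfl) (.inr c2) (h.comp_down S hk') hk
      ((eqOff_slideDown _ _).symm.trans ho.symm)]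
  · have e : insert a (V'.erase c) = V := by
      ext t
      by_cases h1 : t = a
      · simp [h1, a2]
      by_cases h2 : t = b
      · simp [h2, b1, b2, hab.symm]
      by_cases h3 : t = c
      · simp [h3, c2, hac.symm]
      · simp [h1, h3, hoff t h1 h2 h3]
    have hu := h.comp_up (h.slide_insert a1 b1 c1) hk'
    rw [e] at hu
    refine ⟨1, one_ne_zero, fun x _ => ?_⟩
    rw [h.pair_core010 a1 b1 c1 hk', one_mul, e, T.unique_of_mem (.inl rfl) (.inl a2) hu hk
      ((eqOff_slideUp _ _).symm.trans ho.symm)]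
  -- With three equal colours both coordinates come from the same coordinate at `100` of `L`,
  -- through `beta` in `L` and through `beta'` in `L'`. The multiple is the quotient of the two
  -- factors.
  · have f1 := o'.flow.flow a
    have f2 := o'.flow.flow b
    have f3 := o'.flow.flow c
    rw [T'.at_a] at f1
    rw [T'.at_b, T.next_a] at f2
    rw [T'.at_c, T.val_c] at f3
    have g1 : k' (a + 1) = crossFlip (i + 1) (k' a) := f1
    have g2 : k' (a + 2) = crossFlip i (k' (a + 1)) := f2
    have g3 : k' (a + 3) = crossFlip (i + 1) (k' (a + 2)) := f3
    have hm : L.Mono (fill a i (k a i) k) b := by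
      rw [T.mono_b_iff, Triple.fill_one, Triple.fill_two, if_pos (.inr rfl), if_neg (by omega), x1,
        x2]
    have hm' : L'.Mono (fill a (i + 1) (k' (a + 3) (i + 1)) k') b := by
      rw [T'.mono_b_iff, Triple.fill_one, Triple.fill_two, if_neg (by omega), if_pos (.inl rfl),
        g3, crossFlip_left, g2, crossFlip_of_ne _ (by omega) (by omega), g1, crossFlip_right,
        ← e0, x1]
      exact (Bool.not_not _).symm
    have hd : L'.Comp ((insert c V').erase b) (fill a (i + 1) (k' (a + 3) (i + 1)) k') :=
      ((T'.comp_e (.inr ⟨rfl, rfl, rfl⟩) c1 b1 a1 hk').erase_iff (by simp [b1])).2 hm'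
    have hd2 : L.Comp ((insert a V).erase b) (fill a i (k a i) k) :=
      ((T.comp_e (.inl ⟨rfl, rfl, rfl⟩) a2 b2 c2 hk).erase_iff (by simp [b2])).2 hm
    have ha'' : a ∉ (insert c V').erase b := by simp [a1, hac]
    have hc'' : c ∈ (insert c V').erase b := by simp [hbc.symm]
    have e : insert a (((insert c V').erase b).erase c) = (insert a V).erase b := by
      ext t
      by_cases h1 : t = a
      · simp [h1, hab]
      by_cases h2 : t = b
      · simp [h2, hab.symm]
      by_cases h3 : t = c
      · simp [h3, c2, hac.symm]
      · simp [h1, h2, h3, hoff t h1 h2 h3]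
    have hu := h.comp_up (h.slide_insert ha'' (by simp) hc'') hd
    rw [e] at hu
    have hcol := T.unique_of_mem (.inl rfl) (.inl (by simp [hab])) hu hd2
      ((eqOff_slideUp _ _).symm.trans ((Triple.eqOff_fill _ _ _ _).symm.trans
        (ho.symm.trans (Triple.eqOff_fill _ _ _ _))))
    set κ := L.kap ((insert a V).erase b) b (fill a i (k a i) k) with hκ
    have hκ0 : κ ≠ 0 := L.kap_ne_zero _ _ _
    refine ⟨L'.kap ((insert c V').erase b) b (fill a (i + 1) (k' (a + 3) (i + 1)) k') / κ,
      div_ne_zero (L'.kap_ne_zero _ _ _) hκ0, fun x hx => ?_⟩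
    have hX := (h.mem_X₁_iff.1 hx V k hk c2).2 a2 b2
    rw [defect, sub_eq_zero] at hX
    rw [h.pair_core100 a1 b1 c1 hk', bet, if_pos hm', h.pair_ident100 ha'' (by simp) hc'' hd, e,
      hcol, hX, bet, if_pos hm, ← hκ, ← mul_assoc, div_mul_cancel₀ _ hκ0]

theorem preservesCanonical {r : Fin N → ℕ} (hr : Function.Injective r)
    (hX : ∀ x ∈ h.X₁, L.dLee r x ∈ h.X₁)
    (hι : IsChainMap ((L.dLee r).restrict hX) (L.dLee r) h.X₁.subtype)
    (hρ : IsChainMap ((L.dLee r).restrict hX) (L'.dLee (h.reorder r)) h.rhoIII)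
    (hbij : Function.Bijective hι.map) : PreservesCanonical {a.succ, b.succ}
      (hρ.map ∘ₗ (LinearEquiv.ofBijective hι.map hbij).symm.toLinearMap) := by
  refine h.orientationCorr.preservesCanonical h.triple.mem_levels (h.reorder_injective hr) _
    fun o => ?_
  obtain ⟨q, hq⟩ := hbij.2 (cls _ _ (L.dLee_canonical r o))
  obtain ⟨⟨x, hx⟩, rfl⟩ := Submodule.Quotient.mk_surjective _ q
  rw [LinearMap.mem_ker] at hx
  change hι.map (cls _ x hx) = _ at hq
  have hdx : L'.dLee (h.reorder r) (h.rhoIII x) = 0 := by rw [hρ x, hx, map_zero]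
  refine ⟨h.rhoIII x, hdx, ?_, fun o₁ o₁' ho => ?_⟩
  · rw [LinearMap.comp_apply, ← hq]
    change hρ.map ((LinearEquiv.ofBijective hι.map hbij).symm
      (LinearEquiv.ofBijective hι.map hbij (cls _ x hx))) = _
    rw [LinearEquiv.symm_apply_apply, hρ.map_cls]
  · obtain ⟨q', hq', he⟩ := h.pair_core_orientation ho
    refine ⟨q', hq', ?_⟩
    have h1 := he x x.2
    -- The cycle `x` in `X₁` differs from `s_o` by a boundary in `CKh'(L)`, so it has the same
    -- orientation coordinates.
    rw [hι.map_cls, cls, cls, Submodule.Quotient.eq] at hq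
    obtain ⟨y, hy⟩ := hq
    have h2 := pair_dLee_orientation r o₁ y
    rw [hy] at h2
    change L.pair _ _ ((x : L.CKh) - L.canonical o) = 0 at h2
    rw [map_sub, sub_eq_zero] at h2
    rw [← h2]
    exact h1

end IsRIII

end Diagram

end LeeKh

theorem mainTheorem12 {N : ℕ} (r : Fin N → ℕ) (hr : Function.Injective r) :
    -- Reidemeister I, left-hand curl
    (∀ (L L' : LeeKh.Diagram N) (a b : Fin N) (i : ℕ) (h : LeeKh.Diagram.IsRI L L' a b i),
      ∃ hρ : LeeKh.IsChainMap (L.dLee r) (L'.dLee r) (LeeKh.Diagram.rhoI h),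
        LeeKh.Diagram.PreservesCanonical {a.succ} hρ.map) ∧
    -- Reidemeister I, right-hand curl: a second move followed by the inverse of a first move
    (∀ (L L' M : LeeKh.Diagram N) (w : L.Orientation) (a b c : Fin N) (i : ℕ)
      (h₂ : LeeKh.Diagram.IsRII L M a b i a b) (h₁ : LeeKh.Diagram.IsRI L' M b c i),
      (∀ t, t ≠ a → t ≠ b → r a < r t ∧ r b < r t) →
      ∃ (hρ₂ : LeeKh.IsChainMap (L.dLee r) (M.dLee r) (LeeKh.Diagram.rhoII h₂ w))
        (hρ₁ : LeeKh.IsChainMap (L'.dLee r) (M.dLee r) (LeeKh.Diagram.rhoI h₁))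
        (hbij : Function.Bijective hρ₁.map),
        LeeKh.Diagram.PreservesCanonical {a.succ, b.succ}
          ((LinearEquiv.ofBijective hρ₁.map hbij).symm.toLinearMap ∘ₗ hρ₂.map)) ∧
    -- Reidemeister II
    (∀ (L L' : LeeKh.Diagram N) (w : L.Orientation) (a b : Fin N) (i : ℕ) (c₀ c₁ : Fin N)
      (h : LeeKh.Diagram.IsRII L L' a b i c₀ c₁),
      (∀ t, t ≠ a → t ≠ b → r a < r t ∧ r b < r t) →
      ∃ hρ : LeeKh.IsChainMap (L.dLee r) (L'.dLee r) (LeeKh.Diagram.rhoII h w),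
        LeeKh.Diagram.PreservesCanonical {a.succ} hρ.map) ∧
    -- Reidemeister III
    (∀ (L L' : LeeKh.Diagram N) (a b c : Fin N) (i : ℕ)
      (h : LeeKh.Diagram.IsRIII L L' a b c i),
      (∀ t, t ≠ a → t ≠ b → t ≠ c → r a < r t ∧ r b < r t ∧ r c < r t) →
      ∃ (hX : ∀ x ∈ h.X₁, L.dLee r x ∈ h.X₁)
        (hι : LeeKh.IsChainMap ((L.dLee r).restrict hX) (L.dLee r) h.X₁.subtype)
        (hρ : LeeKh.IsChainMap ((L.dLee r).restrict hX) (L'.dLee (h.reorder r)) h.rhoIII)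
        (hbij : Function.Bijective hι.map),
        LeeKh.Diagram.PreservesCanonical {a.succ, b.succ}
          (hρ.map ∘ₗ (LinearEquiv.ofBijective hι.map hbij).symm.toLinearMap)) := by
  refine ⟨fun L L' a b i h => ⟨h.isChainMap r, h.preservesCanonical hr⟩,
    fun L L' M w a b c i h₂ h₁ hlt => ⟨h₂.isChainMap hr hlt w, h₁.isChainMap r, h₁.bijective hr,
      LeeKh.Diagram.preservesCanonical_symm_comp hr w h₂ h₁ hlt⟩,
    fun L L' w a b i c₀ c₁ h hlt => ⟨h.isChainMap hr hlt w, h.preservesCanonical hr hlt w⟩,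
    fun L L' a b c i h hlt => ?_⟩
  have hlt' : ∀ t ∈ LeeKh.Diagram.rest a b c, r a < r t ∧ r b < r t ∧ r c < r t := fun t ht => by
    obtain ⟨h1, h2, h3⟩ := LeeKh.Diagram.mem_rest.1 ht
    exact hlt t h1 h2 h3
  have hX : ∀ x ∈ h.X₁, L.dLee r x ∈ h.X₁ := fun x hx => h.dLee_mem_X₁ hr hlt' hx
  exact ⟨hX, h.isChainMap_subtype hX, h.isChainMap hr hlt' hX,
    h.bijective hr hlt' hX (h.isChainMap_subtype hX), h.preservesCanonical hr hX _ _ _⟩
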